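/- **Setting.** Let $\Omega\subset\mathbb R^2$ be open and connected, with a finite quadrilateral mesh $\mathcal M=(\mathcal Q,\mathcal E,\mathcal V)$: the elements $Q\in\mathcal Q$ are open, strictly convex quadrilaterals contained in $\Omega$, the edges are the open sides and the vertices the corners of the elements, $\overline\Omega=\bigcup_{Q}\overline Q$, and distinct members of $\mathcal Q\cup\mathcal E\cup\mathcal V$ are disjoint (no hanging vertices). For $Q$ with corners $v_1,\dots,v_4$ (counter-clockwise) let $F_Q:[0,1]^2\to\overline Q$ be the bilinear map that sends the corners $(0,0),(1,0),(1,1),(0,1)$ to $v_1,\dots,v_4$, let $h_Q$ be the longest side length, and let $\rho_Q$ be the smallest angle of the four triangles formed by the sides and diagonals. Put $h=\max_Q h_Q$, $\rho=\min_Q\rho_Q$, and suppose $\rho>0$. A unit normal $n_e$ is fixed on each edge $e$. **Space.** Let $p\ge3$ and $k=\max(1,6-p)$, and split $[0,1]^2$ into $k\times k$ equal closed squares $\hat q$. The local Brenner–Sung space $P^p_Q$ consists of the $u:\overline Q\to\mathbb R$ such that $u\in C^{p-2}(Q)$, $u\circ F_Q$ is a polynomial of bi-degree $(p,p)$ on each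 $\hat q$, and on each open side $e$ of $Q$ the trace $u\circ F_Q$ is $C^{p-1}$ and the normal derivative $(\partial_n u)\circ F_Q$ is, on the part of the side in each $\hat q$, a polynomial of degree at most $p-1$. (For $p\ge5$ there is a single $\hat q$ and the two smoothness conditions are automatic.) The global degrees of freedom $\Lambda^p$ are: the derivatives of order $\le 2$ at each vertex; on each edge $e$ with end points $a,b$, for $p\le5$ the normal derivative at the midpoint, and for $p\ge 6$ the values at $a+\frac jp(b-a)$, $3\le j\le p-3$, and the normal derivatives at $a+\frac j{p-1}(b-a)$, $2\le j\le p-3$; and for each $Q$ the values at $F_Q(\eta_1,\eta_2)$, where $\eta_1,\eta_2$ range over $\{\frac29,\frac49,\frac59,\frac79\}$ if $p=3$, $\{\frac14,\frac24,\frac34\}$ if $p=4$, and $\{\frac2p,\dots,\frac{p-2}p\}$ if $p\ge5$. The global space $S^p(\mathcal M)$ consists of the functions on $\overline\Omega$ whose restriction to each $\overline Q$ is in $P^p_Q$ and whose degrees of freedom take the same value from all adjacent elements. $C^2(\overline\Omega)$ denotes the functions that are $C^2$ in $\Omega$ and extend continuously to $\overline\Omega$ with all derivatives of order $\le2$. **Statement.**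 There are functions $\beta_\lambda\in S^p(\mathcal M)$, $\lambda\in\Lambda^p$, with $\lambda(\beta_\lambda)=1$ and $\lambda'(\beta_\lambda)=0$ for $\lambda'\ne\lambda$. Let $\Pi\varphi=\sum_{\lambda\in\Lambda^p}\lambda(\varphi)\beta_\lambda$ for $\varphi\in C^2(\overline\Omega)$. There is a constant $C>0$ that depends only on $\rho$ and $p$ (indeed only on $p$ and on a positive lower bound for $\rho$) such that: 1. for $0\le\ell\le2$, $4\le m\le p+1$, and every $\varphi\in H^m(\Omega)$ with a representative in $C^2(\overline\Omega)$ (to which $\Pi$ is applied), $\varphi-\Pi\varphi\in H^\ell(\Omega)$ and $$|\varphi-\Pi\varphi|_{H^\ell(\Omega)}\le C\,h^{m-\ell}\,|\varphi|_{H^m(\Omega)};$$ 2. for $3\le m\le p+1$ and every $\varphi\in W^m_\infty(\Omega)$ with a representative in $C^2(\overline\Omega)$, $\varphi-\Pi\varphi\in L^\infty(\Omega)$ and $$\|\varphi-\Pi\varphi\|_{L^\infty(\Omega)}\le C\,h^{m}\,|\varphi|_{W^m_\infty(\Omega)}.$$ If every boundary point of $\Omega$ has arbitrarily small neighbourhoods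 $V$ with $V\cap\Omega$ connected (in particular if $\Omega$ is a Lipschitz domain), then every $\varphi\in H^m(\Omega)$ with $4\le m\le p+1$ and every $\varphi\in W^m_\infty(\Omega)$ with $3\le m\le p+1$ has such a representative, so that the estimates hold for all of them. -/

import Mathlib

open Set Filter Topology MeasureTheory
open scoped ENNReal ContDiff

namespace BSQuad

noncomputable section

/-- The Euclidean plane. -/
abbrev Plane : Type := EuclideanSpace ℝ (Fin 2)

/-! ### Derivatives and Sobolev spaces on an open set of the plane -/

/-- The classical partial derivative `∂ᵢ u` (with `i = 0, 1`). -/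
def partialD (i : Fin 2) (u : Plane → ℝ) : Plane → ℝ :=
  fun x => fderiv ℝ u x (EuclideanSpace.single i 1)

/-- The classical derivative `∂₁ᵃ ∂₂ᵇ u`. -/
def mixedD (a b : ℕ) (u : Plane → ℝ) : Plane → ℝ :=
  (partialD 0)^[a] ((partialD 1)^[b] u)

/-- `g` is the weak derivative of `u` on `Ω` for the multi-index `(a, b)`. -/
def IsWeakDeriv (Ω : Set Plane) (a b : ℕ) (u g : Plane → ℝ) : Prop :=
  LocallyIntegrableOn u Ω ∧ LocallyIntegrableOn g Ω ∧
    ∀ ψ : Plane → ℝ, ContDiff ℝ ∞ ψ → HasCompactSupport ψ → tsupport ψ ⊆ Ω →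
      ∫ x in Ω, u x * mixedD a b ψ x = (-1) ^ (a + b) * ∫ x in Ω, g x * ψ x

/-- The Sobolev space `W^k_q(Ω)`; `H^k(Ω)` is the case `q = 2`. -/
def MemSobolev (Ω : Set Plane) (k : ℕ) (q : ℝ≥0∞) (u : Plane → ℝ) : Prop :=
  ∀ a b : ℕ, a + b ≤ k → ∃ g, IsWeakDeriv Ω a b u g ∧ MemLp g q (volume.restrict Ω)

open Classical in
/-- A weak derivative of `u` on `Ω` (unique almost everywhere when it exists). -/
def weakDeriv (Ω : Set Plane) (a b : ℕ) (u : Plane → ℝ) : Plane → ℝ :=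
  if h : ∃ g, IsWeakDeriv Ω a b u g then h.choose else 0

/-- The seminorm `|u|_{H^k(Ω)} = (∑_{|α| = k} ‖D^α u‖²_{L²(Ω)})^{1/2}`. -/
def hSeminorm (Ω : Set Plane) (k : ℕ) (u : Plane → ℝ) : ℝ :=
  √(∑ α ∈ Finset.HasAntidiagonal.antidiagonal k,
    (eLpNorm (weakDeriv Ω α.1 α.2 u) 2 (volume.restrict Ω)).toReal ^ 2)

/-- The seminorm `|u|_{W^k_∞(Ω)} = max_{|α| = k} ‖D^α u‖_{L^∞(Ω)}`. -/
def wInftySeminorm (Ω : Set Plane) (k : ℕ) (u : Plane → ℝ) : ℝ :=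
  ((Finset.HasAntidiagonal.antidiagonal k).sup
    fun α => eLpNorm (weakDeriv Ω α.1 α.2 u) ∞ (volume.restrict Ω)).toReal

/-- The norm of `L^∞(Ω)`. -/
def lInftyNorm (Ω : Set Plane) (u : Plane → ℝ) : ℝ :=
  (eLpNorm u ∞ (volume.restrict Ω)).toReal

/-- `u ∈ C²(closure Ω)`: `u` is `C²` on the open set `Ω`, continuous on `closure Ω`, and its
derivatives up to order two extend continuously to `closure Ω`. -/
def MemC2Closure (Ω : Set Plane) (u : Plane → ℝ) : Prop :=
  ContDiffOn ℝ 2 u Ω ∧ ContinuousOn u (closure Ω) ∧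
    ∀ a b : ℕ, a + b ≤ 2 →
      ∃ g : Plane → ℝ, ContinuousOn g (closure Ω) ∧ EqOn g (mixedD a b u) Ω

/-- `v` is a representative in `C²(closure Ω)` of the almost-everywhere class of `u`. -/
def IsC2Representative (Ω : Set Plane) (u v : Plane → ℝ) : Prop :=
  MemC2Closure Ω v ∧ v =ᵐ[volume.restrict Ω] u

/-- `Ω` is locally connected at its boundary: every boundary point has arbitrarily small
neighbourhoods whose intersection with `Ω` is connected.  Every Lipschitz domain has this property;
it fails for a domain that lies on both sides of a slit, or that touches itself at a point. -/
def LocallyConnectedAtBoundary (Ω : Set Plane) : Prop :=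
  ∀ x ∈ frontier Ω, ∀ U ∈ 𝓝 x, ∃ V ∈ 𝓝 x, V ⊆ U ∧ IsPreconnected (V ∩ Ω)

/-! ### Quadrilaterals -/

/-- The determinant `det (v, w)`. -/
def cross (v w : Plane) : ℝ := v 0 * w 1 - v 1 * w 0

/-- A unit normal of the segment from `x` to `y`. -/
def unitNormal (x y : Plane) : Plane :=
  (dist x y)⁻¹ • !₂[-((y - x) 1), (y - x) 0]

/-- The closed quadrilateral with the vertices `K 0, K 1, K 2, K 3`. -/
def closedCell (K : Fin 4 → Plane) : Set Plane := convexHull ℝ (range K)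

/-- The open quadrilateral with the vertices `K 0, K 1, K 2, K 3`. -/
def cell (K : Fin 4 → Plane) : Set Plane := interior (closedCell K)

/-- The bilinear parametrization of a quadrilateral over `[0,1]²`. -/
def param (K : Fin 4 → Plane) (s t : ℝ) : Plane :=
  ((1 - s) * (1 - t)) • K 0 + (s * (1 - t)) • K 1 + (s * t) • K 2 + ((1 - s) * t) • K 3

/-- The length `h_Q` of the longest side. -/
def longestSide (K : Fin 4 → Plane) : ℝ := ⨆ i : Fin 4, dist (K i) (K (i + 1))

/-- The smallest angle of the triangle `x y z`. -/
def triangleMinAngle (x y z : Plane) : ℝ :=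
  min (EuclideanGeometry.angle x y z)
    (min (EuclideanGeometry.angle y z x) (EuclideanGeometry.angle z x y))

/-- The minimum angle `ρ_Q`: the smallest angle of the four triangles that are formed by two
consecutive sides and a diagonal. -/
def minAngle (K : Fin 4 → Plane) : ℝ :=
  ⨅ i : Fin 4, triangleMinAngle (K i) (K (i + 1)) (K (i + 2))

/-! ### Quadrilateral meshes -/

/-- A quadrilateral mesh of `Ω`.  An element is stored as the tuple of its four corners in
counter-clockwise order, an edge as the pair of its end points; the order of the pair fixes the
direction of the normal of the edge. -/
structure QuadMesh (Ω : Set Plane) where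
  vertices : Finset Plane
  edges : Finset (Plane × Plane)
  quads : Finset (Fin 4 → Plane)
  edge_ends : ∀ e ∈ edges, e.1 ∈ vertices ∧ e.2 ∈ vertices ∧ e.1 ≠ e.2
  quad_corners : ∀ K ∈ quads, ∀ i, K i ∈ vertices
  quad_sides : ∀ K ∈ quads, ∀ i, (K i, K (i + 1)) ∈ edges ∨ (K (i + 1), K i) ∈ edges
  /-- Each element is a strictly convex quadrilateral, with its corners in counter-clockwise
  order. -/
  quad_convex : ∀ K ∈ quads, ∀ i, 0 < cross (K (i + 1) - K i) (K (i + 2) - K (i + 1))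
  vertex_used : ∀ v ∈ vertices, ∃ K ∈ quads, ∃ i, K i = v
  edge_used : ∀ e ∈ edges, ∃ K ∈ quads, ∃ i,
    (K i, K (i + 1)) = e ∨ (K (i + 1), K i) = e
  closure_eq : closure Ω = ⋃ K ∈ quads, closedCell K
  cell_subset : ∀ K ∈ quads, cell K ⊆ Ω
  /-- Distinct vertices are different points; all other pairs of distinct elements, edges and
  vertices are disjoint too. -/
  disjoint_quads : ∀ K ∈ quads, ∀ K' ∈ quads, K ≠ K' → Disjoint (cell K) (cell K')
  disjoint_edges : ∀ e ∈ edges, ∀ e' ∈ edges, e ≠ e' →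
    Disjoint (openSegment ℝ e.1 e.2) (openSegment ℝ e'.1 e'.2)
  disjoint_quad_edge : ∀ K ∈ quads, ∀ e ∈ edges, Disjoint (cell K) (openSegment ℝ e.1 e.2)
  vertex_notMem_quad : ∀ v ∈ vertices, ∀ K ∈ quads, v ∉ cell K
  vertex_notMem_edge : ∀ v ∈ vertices, ∀ e ∈ edges, v ∉ openSegment ℝ e.1 e.2

/-! ### The local spaces -/

/-- The number of subdivisions in each direction: `3` for `p = 3`, `2` for `p = 4`, and `1` (no
subdivision) for `p ≥ 5`. -/
def subdiv (p : ℕ) : ℕ := max 1 (6 - p)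

/-- `u` is (on the closed quadrilateral `K`) a function of the local Brenner–Sung space of degree
`p`.  For `p ≥ 5` there is one sub-element only, and `u ∘ F` is one polynomial of bi-degree
`(p, p)`; the two smoothness conditions then hold automatically. -/
structure MemLocalSpace (p : ℕ) (K : Fin 4 → Plane) (u : Plane → ℝ) : Prop where
  /-- `u` is of class `C^{p-2}` on the open quadrilateral. -/
  smooth : ContDiffOn ℝ ((p - 2 : ℕ) : WithTop ℕ∞) u (cell K)
  /-- `u ∘ F` is a polynomial of bi-degree `(p, p)` on each closed sub-element. -/
  piecewise : ∀ i < subdiv p, ∀ j < subdiv p, ∃ c : Fin (p + 1) → Fin (p + 1) → ℝ,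
    ∀ s ∈ Icc ((i : ℝ) / subdiv p) ((i + 1 : ℝ) / subdiv p),
    ∀ t ∈ Icc ((j : ℝ) / subdiv p) ((j + 1 : ℝ) / subdiv p),
      u (param K s t) = ∑ a : Fin (p + 1), ∑ b : Fin (p + 1), c a b * s ^ (a : ℕ) * t ^ (b : ℕ)
  /-- The trace of `u` on each open side is of class `C^{p-1}`. -/
  trace_smooth : ∀ i : Fin 4, ContDiffOn ℝ ((p - 1 : ℕ) : WithTop ℕ∞)
    (fun t : ℝ => u (AffineMap.lineMap (K i) (K (i + 1)) t)) (Ioo 0 1)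
  /-- On each side the normal derivative of `u` (its boundary value from inside the element) is
  piecewise a polynomial of degree at most `p - 1`. -/
  normal_piecewise : ∀ i : Fin 4, ∀ j < subdiv p, ∃ r : Polynomial ℝ, r.natDegree ≤ p - 1 ∧
    ∀ t ∈ Ioo (0 : ℝ) 1, t ∈ Icc ((j : ℝ) / subdiv p) ((j + 1 : ℝ) / subdiv p) →
      Tendsto (fun y => fderiv ℝ u y (unitNormal (K i) (K (i + 1))))
        (𝓝[cell K] (AffineMap.lineMap (K i) (K (i + 1)) t)) (𝓝 (r.eval t))

/-! ### Degrees of freedom -/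

/-- Labels of the degrees of freedom: a derivative `∂₁ᵃ ∂₂ᵇ` at a vertex, the value or the normal
derivative at a point of an edge, and the value at the image of `(s, t)` in an element. -/
inductive Dof : Type
  | vertexDeriv (v : Plane) (a b : ℕ)
  | edgeValue (e : Plane × Plane) (t : ℝ)
  | edgeNormal (e : Plane × Plane) (t : ℝ)
  | faceValue (K : Fin 4 → Plane) (s t : ℝ)

/-- The point at which a degree of freedom is evaluated. -/
def Dof.point : Dof → Plane
  | .vertexDeriv v _ _ => v
  | .edgeValue e t => AffineMap.lineMap e.1 e.2 t
  | .edgeNormal e t => AffineMap.lineMap e.1 e.2 t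
  | .faceValue K s t => param K s t

/-- The differential operator of a degree of freedom. -/
def Dof.op : Dof → (Plane → ℝ) → Plane → ℝ
  | .vertexDeriv _ a b, u => mixedD a b u
  | .edgeValue _ _, u => u
  | .edgeNormal e _, u => fun y => fderiv ℝ u y (unitNormal e.1 e.2)
  | .faceValue _ _ _, u => u

open Classical in
/-- Edge parameters of the point values: `j/p` with `3 ≤ j ≤ p - 3` (none for `p ≤ 5`). -/
def edgeValueParams (p : ℕ) : Finset ℝ :=
  (Finset.Icc 3 (p - 3)).image fun j : ℕ => (j : ℝ) / p

open Classical in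
/-- Edge parameters of the normal derivatives: the midpoint for `p ≤ 5`, and in general
`j/(p-1)` with `2 ≤ j ≤ p - 3` for `p ≥ 5`. -/
def edgeNormalParams (p : ℕ) : Finset ℝ :=
  if p ≤ 5 then {1 / 2}
  else (Finset.Icc 2 (p - 3)).image fun j : ℕ => (j : ℝ) / ((p : ℝ) - 1)

open Classical in
/-- Coordinates of the face points. -/
def faceParams (p : ℕ) : Finset ℝ :=
  if p = 3 then {2 / 9, 4 / 9, 5 / 9, 7 / 9}
  else if p = 4 then {1 / 4, 2 / 4, 3 / 4}
  else (Finset.Icc 2 (p - 2)).image fun j : ℕ => (j : ℝ) / p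

namespace QuadMesh

variable {Ω : Set Plane} (M : QuadMesh Ω)

/-- The mesh size `h`. -/
def meshSize : ℝ := ⨆ K : M.quads, longestSide K.1

/-- The shape-regularity constant `ρ`. -/
def shapeConst : ℝ := ⨅ K : M.quads, minAngle K.1

/-- The union of the open elements. -/
def openCells : Set Plane := ⋃ K ∈ M.quads, cell K

open Classical in
/-- The global degrees of freedom of degree `p`. -/
def dofs (p : ℕ) : Finset Dof :=
  (M.vertices ×ˢ ({(0, 0), (1, 0), (0, 1), (2, 0), (1, 1), (0, 2)} : Finset (ℕ × ℕ))).image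
      (fun x => Dof.vertexDeriv x.1 x.2.1 x.2.2)
    ∪ (M.edges ×ˢ edgeValueParams p).image (fun x => Dof.edgeValue x.1 x.2)
    ∪ (M.edges ×ˢ edgeNormalParams p).image (fun x => Dof.edgeNormal x.1 x.2)
    ∪ (M.quads ×ˢ (faceParams p ×ˢ faceParams p)).image
      (fun x => Dof.faceValue x.1 x.2.1 x.2.2)

/-- The degree of freedom `d` is well defined at `u` with value `c`.  The limit is taken in the
union of all open elements, so that the elements around the point all give the same value `c`. -/
def HasDofValue (d : Dof) (u : Plane → ℝ) (c : ℝ) : Prop :=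
  Tendsto (d.op u) (𝓝[M.openCells] d.point) (𝓝 c)

/-- The value of the degree of freedom `d` at `u`. -/
def dofValue (d : Dof) (u : Plane → ℝ) : ℝ :=
  limUnder (𝓝[M.openCells] d.point) (d.op u)

/-- The global Brenner–Sung space of degree `p`: functions on `closure Ω` that belong to the local
space on every element and on which the global degrees of freedom are single-valued. -/
def globalSpace (p : ℕ) : Set (Plane → ℝ) :=
  {u | (∀ K ∈ M.quads, MemLocalSpace p K u) ∧ ∀ d ∈ M.dofs p, ∃ c, M.HasDofValue d u c}

open Classical in
/-- `β` is a basis of the global space that is dual to the global degrees of freedom. -/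
def IsDualBasis (p : ℕ) (β : Dof → Plane → ℝ) : Prop :=
  ∀ d ∈ M.dofs p, β d ∈ M.globalSpace p ∧
    ∀ d' ∈ M.dofs p, M.HasDofValue d' (β d) (if d' = d then 1 else 0)

/-- The global projector `Π u = ∑ λ(u) β_λ`. -/
def projector (p : ℕ) (β : Dof → Plane → ℝ) (u : Plane → ℝ) : Plane → ℝ :=
  fun x => ∑ d ∈ M.dofs p, M.dofValue d u * β d x

end QuadMesh

end

end BSQuad

open Set Filter Topology MeasureTheory
open scoped ENNReal ContDiff

namespace BSQuad

open EuclideanSpace (single norm_sq_eq)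
open AffineMap (lineMap lineMap_apply)
open Polynomial (C X derivative taylor eval_finsetSum natDegree_X_sub_C monic_X_sub_C natDegree_C_mul_le)
open Finset (sum_congr mul_sum sum_mul sum_le_sum sum_comm sum_add_distrib)
open ContinuousLinearMap (fst snd)
open Finset.HasAntidiagonal (mem_antidiagonal)
open Function (iterate_succ_apply)
open Fintype (sum_prod_type sum_sum_type)
open ENNReal (mul_ne_top ofReal_mul toReal_mono ofReal_ne_top ofReal)
open Real (sin)
open Metric (ball)

local notation "vol" => Measure.restrict (volume : Measure Plane)
local notation "I" => Icc (0 : ℝ) 1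
local notation "J" => Ioo (0 : ℝ) 1

noncomputable section

/-- The corners of a quadrilateral. -/
abbrev Quad : Type := Fin 4 → Plane

/-- Real functions on the plane. -/
abbrev Fn : Type := Plane → ℝ

/-- The `i`-th of `k` equal subintervals of `[0, 1]`. -/
abbrev knotIcc (k i : ℕ) : Set ℝ := Icc ((i : ℝ) / k) ((i + 1 : ℝ) / k)

/-- The multi-indices of order `m`. -/
abbrev multiIdx (m : ℕ) : Finset (ℕ × ℕ) := Finset.HasAntidiagonal.antidiagonal m

variable {p : ℕ} {K : Quad} {Ω : Set Plane}

/-- The multi-indices of order at most two. -/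
inductive OrderTwo : ℕ → ℕ → Prop
  | zero : OrderTwo 0 0
  | fst : OrderTwo 1 0
  | snd : OrderTwo 0 1
  | fst_fst : OrderTwo 2 0
  | fst_snd : OrderTwo 1 1
  | snd_snd : OrderTwo 0 2

lemma order_two {a b} (h : a + b ≤ 2) : OrderTwo a b := by
  obtain ⟨ha, hb⟩ : a < 3 ∧ b < 3 := by omega
  interval_cases a <;> interval_cases b <;> first | omega | constructor

/-! ### The bilinear parametrization -/

/-- Strict convexity and counter-clockwise order of the corners. -/
def ConvexQuad (K : Quad) : Prop :=
  ∀ i, 0 < cross (K (i + 1) - K i) (K (i + 2) - K (i + 1))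

/-- The quadrilateral with the corners renumbered from `K i` on. -/
def rot (i : Fin 4) (K : Quad) : Quad := fun j => K (j + i)

/-- The tangent vector `∂ₛ F`. -/
def tanS (K : Quad) (t : ℝ) : Plane := (1 - t) • (K 1 - K 0) + t • (K 2 - K 3)

/-- The tangent vector `∂ₜ F`. -/
def tanT (K : Quad) (s : ℝ) : Plane := (1 - s) • (K 3 - K 0) + s • (K 2 - K 1)

/-- The second derivative `∂ₛ∂ₜ F`. -/
def twist (K : Quad) : Plane := K 2 - K 1 - K 3 + K 0

/-- The Jacobian determinant of `F`. -/
def jac (K : Quad) (s t : ℝ) : ℝ := cross (tanS K t) (tanT K s)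

lemma cross_add_left (u v w) : cross (u + v) w = cross u w + cross v w := by
  simp [cross]; ring
lemma cross_add_right (u v w) : cross w (u + v) = cross w u + cross w v := by
  simp [cross]; ring
lemma cross_smul_left (c : ℝ) (v w) : cross (c • v) w = c * cross v w := by
  simp [cross]; ring
lemma cross_smul_right (c : ℝ) (v w) : cross v (c • w) = c * cross v w := by
  simp [cross]; ring
lemma cross_self (v) : cross v v = 0 := by simp [cross]; ring
lemma cross_swap (v w) : cross v w = -cross w v := by simp [cross]; ring

lemma ConvexQuad.rot (hK : ConvexQuad K) (i) :
    ConvexQuad (rot i K) := by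
  intro j
  have := hK (j + i)
  simpa [BSQuad.rot, add_right_comm] using this

lemma ConvexQuad.corner_pos (hK : ConvexQuad K) (i) :
    0 < cross (K (i + 1) - K i) (K (i + 3) - K i) := by
  have h := hK (i + 3)
  have e1 : i + 3 + 1 = i := by grind
  have e2 : i + 3 + 2 = i + 1 := by grind
  rw [e1, e2] at h
  have : cross (K (i + 1) - K i) (K (i + 3) - K i)
      = cross (K i - K (i + 3)) (K (i + 1) - K i) := by simp [cross]; ring
  rwa [this]

lemma jac_eq (K) (s t : ℝ) : jac K s t =
    (1 - s) * (1 - t) * cross (K 1 - K 0) (K 3 - K 0)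
    + s * (1 - t) * cross (K 2 - K 1) (K 0 - K 1)
    + s * t * cross (K 3 - K 2) (K 1 - K 2)
    + (1 - s) * t * cross (K 0 - K 3) (K 2 - K 3) := by
  simp [jac, tanS, tanT, cross]; ring

lemma le_jac {m : ℝ}
    (h : ∀ i, m ≤ cross (K (i + 1) - K i) (K (i + 3) - K i)) {s t}
    (hs : s ∈ I) (ht : t ∈ I) : m ≤ jac K s t := by
  rw [jac_eq]
  have h0 := h 0; have h1 := h 1; have h2 := h 2; have h3 := h 3
  simp only [Fin.reduceAdd, zero_add] at h0 h1 h2 h3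
  obtain ⟨hs0, hs1⟩ := hs
  obtain ⟨ht0, ht1⟩ := ht
  have e : m = (1 - s) * (1 - t) * m + s * (1 - t) * m + s * t * m + (1 - s) * t * m := by ring
  rw [e]
  have hs1' : 0 ≤ 1 - s := by linarith
  have ht1' : 0 ≤ 1 - t := by linarith
  gcongr

lemma ConvexQuad.exists_corner_min (hK : ConvexQuad K) :
    ∃ m, 0 < m ∧ ∀ i, m ≤ cross (K (i + 1) - K i) (K (i + 3) - K i) :=
  let ⟨i, hi⟩ := Finite.exists_min fun i => cross (K (i + 1) - K i) (K (i + 3) - K i)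
  ⟨_, hK.corner_pos i, hi⟩

lemma ConvexQuad.jac_pos (hK : ConvexQuad K) {s t}
    (hs : s ∈ I) (ht : t ∈ I) : 0 < jac K s t := by
  obtain ⟨m, hm, h⟩ := hK.exists_corner_min
  exact hm.trans_le (le_jac h hs ht)

lemma param_sub (K) (s t s' t' : ℝ) : param K s' t' - param K s t =
    (s' - s) • tanS K ((t + t') / 2) + (t' - t) • tanT K ((s + s') / 2) := by
  ext i; simp [param, tanS, tanT]; ring

lemma mid_mem {s s'} (h : s ∈ I) (h' : s' ∈ I) :
    (s + s') / 2 ∈ I := ⟨by grind, by linarith [h.2, h'.2]⟩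

lemma abs_cross_le (v w) : |cross v w| ≤ ‖v‖ * ‖w‖ := by
  refine abs_le_of_sq_le_sq' ?_ (by positivity) |> fun h => abs_le.2 h
  rw [mul_pow, norm_sq_eq, norm_sq_eq]
  simp [cross, Fin.sum_univ_two]
  nlinarith [sq_nonneg (v 0 * w 0 + v 1 * w 1)]

lemma norm_lineMap_le {v w : Plane} {L t : ℝ} (hv : ‖v‖ ≤ L) (hw : ‖w‖ ≤ L) (ht : t ∈ I) :
    ‖(1 - t) • v + t • w‖ ≤ L := by
  have := convex_closedBall (0 : Plane) L (by simpa using hv) (by simpa using hw)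
    (sub_nonneg.2 ht.2) ht.1 (by ring)
  simpa using this

lemma norm_tanS_le {L : ℝ} (h : ∀ i, dist (K i) (K (i + 1)) ≤ L) {t} (ht : t ∈ I) :
    ‖tanS K t‖ ≤ L :=
  norm_lineMap_le (by simpa [dist_eq_norm, norm_sub_rev] using h 0)
    (by simpa [dist_eq_norm] using h 2) ht

lemma norm_tanT_le {L : ℝ} (h : ∀ i, dist (K i) (K (i + 1)) ≤ L) {s} (hs : s ∈ I) :
    ‖tanT K s‖ ≤ L :=
  norm_lineMap_le (by simpa [dist_eq_norm] using h 3)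
    (by simpa [dist_eq_norm, norm_sub_rev] using h 1) hs

lemma dist_le_longestSide (K) (i) :
    dist (K i) (K (i + 1)) ≤ longestSide K :=
  le_ciSup (f := fun i => dist (K i) (K (i + 1))) (Set.finite_range _).bddAbove i

/-- Quantitative injectivity of the parametrization. -/
lemma abs_sub_le_of_param {m : ℝ} (hm : ∀ i, m ≤ cross (K (i + 1) - K i) (K (i + 3) - K i))
    {s t s' t'} (hs : s ∈ I) (ht : t ∈ I) (hs' : s' ∈ I) (ht' : t' ∈ I) :
    m * |s' - s| ≤ longestSide K * ‖param K s' t' - param K s t‖ ∧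
      m * |t' - t| ≤ longestSide K * ‖param K s' t' - param K s t‖ := by
  set A := tanS K ((t + t') / 2) with hA
  set B := tanT K ((s + s') / 2) with hB
  have hj : m ≤ cross A B := le_jac hm (mid_mem hs hs') (mid_mem ht ht')
  have hAn := norm_tanS_le (dist_le_longestSide K) (mid_mem ht ht')
  have hBn := norm_tanT_le (dist_le_longestSide K) (mid_mem hs hs')
  rw [param_sub, ← hA, ← hB]
  set d := (s' - s) • A + (t' - t) • B with hd
  have e1 : cross d B = (s' - s) * cross A B := by
    rw [hd, cross_add_left, cross_smul_left, cross_smul_left, cross_self]; ring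
  have e2 : cross A d = (t' - t) * cross A B := by
    rw [hd, cross_add_right, cross_smul_right, cross_smul_right, cross_self]; ring
  have b1 := abs_cross_le d B
  have b2 := abs_cross_le A d
  rw [e1, abs_mul] at b1
  rw [e2, abs_mul] at b2
  have hc : m ≤ |cross A B| := hj.trans (le_abs_self _)
  constructor
  · calc m * |s' - s| ≤ |cross A B| * |s' - s| := by gcongr
      _ ≤ ‖d‖ * ‖B‖ := by linarith
      _ ≤ ‖d‖ * longestSide K := by gcongr
      _ = longestSide K * ‖d‖ := mul_comm _ _
  · calc m * |t' - t| ≤ |cross A B| * |t' - t| := by gcongr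
      _ ≤ ‖A‖ * ‖d‖ := by linarith
      _ ≤ longestSide K * ‖d‖ := by gcongr

lemma ConvexQuad.param_inj (hK : ConvexQuad K) {s t s' t'} (hs : s ∈ I)
    (ht : t ∈ I) (hs' : s' ∈ I) (ht' : t' ∈ I)
    (h : param K s t = param K s' t') : s = s' ∧ t = t' := by
  obtain ⟨m, hm, hc⟩ := hK.exists_corner_min
  have b := abs_sub_le_of_param hc hs ht hs' ht'
  rw [h, sub_self, norm_zero, mul_zero] at b
  exact ⟨(sub_eq_zero.1 (abs_nonpos_iff.1 (by nlinarith))).symm,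
    (sub_eq_zero.1 (abs_nonpos_iff.1 (by nlinarith))).symm⟩

/-- The vector with the coordinates `z = α ∂ₛF + β ∂ₜF`. -/
lemma tan_decomp (K) (s t : ℝ) (h : jac K s t ≠ 0) (z) :
    z = (cross z (tanT K s) / jac K s t) • tanS K t
      + (cross (tanS K t) z / jac K s t) • tanT K s := by
  have h' : cross (tanS K t) (tanT K s) ≠ 0 := h
  unfold jac
  ext i
  simp only [PiLp.add_apply, PiLp.smul_apply, smul_eq_mul]
  field_simp
  fin_cases i <;> simp [cross] <;> ring

/-- The derivative of the parametrization. -/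
def dparam (K : Quad) (s t : ℝ) : ℝ × ℝ →L[ℝ] Plane :=
  (fst ℝ ℝ ℝ).smulRight (tanS K t)
    + (snd ℝ ℝ ℝ).smulRight (tanT K s)

@[simp] lemma dparam_apply (K) (s t : ℝ) (v) :
    dparam K s t v = v.1 • tanS K t + v.2 • tanT K s := by
  simp [dparam]

lemma contDiff_param (K) {n : WithTop ℕ∞} :
    ContDiff ℝ n fun q : ℝ × ℝ => param K q.1 q.2 := by
  unfold param; fun_prop

lemma hasFDerivAt_param (K) (s t : ℝ) :
    HasFDerivAt (fun q => param K q.1 q.2) (dparam K s t) (s, t) := by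
  have h1 : HasFDerivAt (fun q => q.1) (fst ℝ ℝ ℝ) (s, t) :=
    hasFDerivAt_fst
  have h2 : HasFDerivAt (fun q => q.2) (snd ℝ ℝ ℝ) (s, t) :=
    hasFDerivAt_snd
  have := (((((h1.const_sub 1).mul (h2.const_sub 1)).smul_const (K 0)).add
    ((h1.mul (h2.const_sub 1)).smul_const (K 1))).add ((h1.mul h2).smul_const (K 2))).add
    (((h1.const_sub 1).mul h2).smul_const (K 3))
  refine HasFDerivAt.congr_fderiv this ?_
  ext v <;> simp [tanS, tanT] <;> ring

/-- The derivative of the parametrization, as an isomorphism. -/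
def dparamEquiv (K : Quad) (s t : ℝ) (h : jac K s t ≠ 0) :
    (ℝ × ℝ) ≃L[ℝ] Plane :=
  ContinuousLinearEquiv.equivOfInverse (dparam K s t)
    (LinearMap.toContinuousLinearMap
      { toFun := fun z => (cross z (tanT K s) / jac K s t, cross (tanS K t) z / jac K s t)
        map_add' := fun x y => by
          simp [cross_add_left, cross_add_right, add_div]
        map_smul' := fun c x => by
          simp [cross_smul_left, cross_smul_right, mul_div_assoc] })
    (fun v => by
      have h' : cross (tanS K t) (tanT K s) ≠ 0 := h
      ext <;> simp [cross_add_left, cross_add_right, cross_smul_left, cross_smul_right, cross_self,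
        jac, h'])
    (fun z => by
      simpa using (tan_decomp K s t h z).symm)

lemma hasFDerivAt_param' (K) (s t : ℝ) (h : jac K s t ≠ 0) :
    HasFDerivAt (fun q => param K q.1 q.2)
      (dparamEquiv K s t h : ℝ × ℝ →L[ℝ] Plane) (s, t) := hasFDerivAt_param K s t

/-- A function that is smooth in the coordinates of the parametrization is smooth. -/
lemma contDiffAt_of_param {s t : ℝ} (h : jac K s t ≠ 0) {n : WithTop ℕ∞}
    {u} {w : ℝ × ℝ → ℝ} (hw : ContDiffAt ℝ n w (s, t))
    (huw : ∀ᶠ q in 𝓝 (s, t), u (param K q.1 q.2) = w q) :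
    ContDiffAt ℝ n u (param K s t) := by
  have hN : max n 1 ≠ 0 := (lt_of_lt_of_le zero_lt_one (le_max_right n 1)).ne'
  have hc : ContDiffAt ℝ (max n 1) (fun q => param K q.1 q.2) (s, t) :=
    (contDiff_param K).contDiffAt
  have hd := hasFDerivAt_param' K s t h
  set g := hc.localInverse hd hN with hg
  have hg1 : ContDiffAt ℝ (max n 1) g (param K s t) := hc.to_localInverse hd hN
  have hg0 : g (param K s t) = (s, t) := hc.localInverse_apply_image hd hN
  have hr : ∀ᶠ x in 𝓝 (param K s t), param K (g x).1 (g x).2 = x :=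
    (hc.hasStrictFDerivAt' hd hN).eventually_right_inverse
  have ht : Tendsto g (𝓝 (param K s t)) (𝓝 (s, t)) := by
    simpa [hg0] using hg1.continuousAt.tendsto
  have : u =ᶠ[𝓝 (param K s t)] w ∘ g := by
    filter_upwards [hr, ht.eventually huw] with x hx hx'
    grind
  refine ContDiffAt.congr_of_eventuallyEq ?_ this
  exact ContDiffAt.comp _ (by grind) (hg1.of_le (le_max_left _ _))

/-! ### Image of the parametrization -/

lemma param_mem_closedCell (K) {s t} (hs : s ∈ I)
    (ht : t ∈ I) : param K s t ∈ closedCell K := by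
  have hm : ∀ i, K i ∈ closedCell K := fun i => subset_convexHull ℝ _ (mem_range_self i)
  have hc : Convex ℝ (closedCell K) := convex_convexHull ℝ _
  have h := hc.sum_mem (t := Finset.univ)
    (w := ![(1 - s) * (1 - t), s * (1 - t), s * t, (1 - s) * t]) (z := K) ?_ ?_ (fun i _ => hm i)
  · simpa [Fin.sum_univ_four, param] using h
  · intro i _
    have : 0 ≤ 1 - s := by grind
    have : 0 ≤ 1 - t := by grind
    have := hs.1
    have := ht.1
    fin_cases i <;> simp <;> positivity
  · simp [Fin.sum_univ_four]; ring

lemma cross_side_nonneg (hK : ConvexQuad K) (i) {x}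
    (hx : x ∈ closedCell K) : 0 ≤ cross (K (i + 1) - K i) (x - K i) := by
  have hsub : closedCell K ⊆ {x | 0 ≤ cross (K (i + 1) - K i) (x - K i)} := by
    refine convexHull_min ?_ ?_
    · rintro _ ⟨j, rfl⟩
      have h0 := hK i
      have h1 := hK.corner_pos i
      have hj : j = i ∨ j = i + 1 ∨ j = i + 2 ∨ j = i + 3 := by
        grind
      rcases hj with rfl | rfl | rfl | rfl
      · simp [cross]
      · simp only [mem_ofPred_eq]; rw [cross_self]
      · simp only [mem_ofPred_eq]
        refine h0.le.trans_eq ?_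
        simp [cross]; ring
      · exact h1.le
    · have hlin : IsLinearMap ℝ fun x => cross (K (i + 1) - K i) x :=
        ⟨fun x y => cross_add_right _ _ _, fun c x => cross_smul_right _ _ _⟩
      have : {x | 0 ≤ cross (K (i + 1) - K i) (x - K i)} =
          {x | cross (K (i + 1) - K i) (K i) ≤ cross (K (i + 1) - K i) x} := by
        ext x
        simp only [mem_ofPred_eq]
        constructor <;> intro h <;> simp [cross] at h ⊢ <;> linarith
      rw [this]
      exact convex_halfSpace_ge hlin _
  exact hsub hx

lemma side_notMem_cell (hK : ConvexQuad K) (i) (τ : ℝ) :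
    lineMap (K i) (K (i + 1)) τ ∉ cell K := by
  intro h
  set x := lineMap (K i) (K (i + 1)) τ with hx
  set a := K (i + 1) - K i
  set n : Plane := !₂[a 1, -a 0]
  have hc : Tendsto (fun ε : ℝ => x + ε • n) (𝓝[>] 0) (𝓝 x) := by
    have : Continuous fun ε : ℝ => x + ε • n := by fun_prop
    have h2 := this.tendsto 0
    simp only [zero_smul, add_zero] at h2
    exact h2.mono_left nhdsWithin_le_nhds
  have ev := hc.eventually (mem_interior_iff_mem_nhds.1 h)
  obtain ⟨ε, hε, hpos⟩ := (ev.and self_mem_nhdsWithin).exists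
  have h0 := cross_side_nonneg hK i hε
  have ha : a ≠ 0 := by
    intro ha
    have := hK i
    change 0 < cross a _ at this
    rw [ha] at this
    simp [cross] at this
  have hpos2 : 0 < a 0 ^ 2 + a 1 ^ 2 := by
    by_contra hcon
    have h1 : a 0 = 0 := by nlinarith [sq_nonneg (a 0), sq_nonneg (a 1)]
    have h2 : a 1 = 0 := by nlinarith [sq_nonneg (a 0), sq_nonneg (a 1)]
    apply ha
    ext j
    fin_cases j <;> simp [h1, h2]
  have e : cross a (x + ε • n - K i) = -ε * (a 0 ^ 2 + a 1 ^ 2) := by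
    have hx' : x = τ • a + K i := by rw [hx, lineMap_apply]; simp [a]
    rw [hx']
    simp [cross, n]; ring
  change 0 ≤ cross a _ at h0
  rw [e] at h0
  have : (0 : ℝ) < ε := hpos
  nlinarith

lemma isCompact_closedCell (K) : IsCompact (closedCell K) :=
  (Set.finite_range K).isCompact_convexHull (𝕜 := ℝ)

lemma isOpen_cell (K) : IsOpen (cell K) := isOpen_interior

lemma convex_cell (K) : Convex ℝ (cell K) := (convex_convexHull ℝ _).interior

/-- The side parameters: the `i`-th rotation of the unit square. -/
def sideCoord : Fin 4 → ℝ × ℝ → ℝ × ℝ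
  | 0, q => q
  | 1, q => (1 - q.2, q.1)
  | 2, q => (1 - q.1, 1 - q.2)
  | 3, q => (q.2, 1 - q.1)

lemma param_sideCoord (K) (i) (q) :
    param K (sideCoord i q).1 (sideCoord i q).2 = param (rot i K) q.1 q.2 := by
  ext j
  fin_cases i <;> simp [param, sideCoord, rot] <;> ring

lemma param_zero (K) (τ : ℝ) :
    param K τ 0 = lineMap (K 0) (K 1) τ := by
  ext j; simp [param, lineMap_apply]; ring

lemma rot_param_zero (K) (i) (τ : ℝ) :
    param (rot i K) τ 0 = lineMap (K i) (K (i + 1)) τ := by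
  rw [param_zero]; simp [rot, add_comm]

lemma closedCell_rot (K) (i) : closedCell (rot i K) = closedCell K := by
  unfold closedCell
  congr 1
  exact (Equiv.addRight i).surjective.range_comp K

lemma cell_rot (K) (i) : cell (rot i K) = cell K := by
  unfold cell; rw [closedCell_rot]

lemma boundary_eq_sideCoord {s t} (hs : s ∈ I) (ht : t ∈ I)
    (h : ¬(s ∈ J ∧ t ∈ J)) :
    ∃ i, ∃ τ ∈ I, (s, t) = sideCoord i (τ, 0) := by
  have : t = 0 ∨ s = 1 ∨ t = 1 ∨ s = 0 := by
    grind
  rcases this with rfl | rfl | rfl | rfl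
  · exact ⟨0, s, hs, by simp [sideCoord]⟩
  · exact ⟨1, t, ht, by simp [sideCoord]⟩
  · exact ⟨2, 1 - s, ⟨by grind, by linarith [hs.1]⟩, by simp [sideCoord]⟩
  · exact ⟨3, 1 - t, ⟨by grind, by linarith [ht.1]⟩, by simp [sideCoord]⟩

lemma boundary_notMem_cell (hK : ConvexQuad K) {s t}
    (hs : s ∈ I) (ht : t ∈ I) (h : param K s t ∈ cell K) :
    s ∈ J ∧ t ∈ J := by
  by_contra hc
  obtain ⟨i, τ, -, hi⟩ := boundary_eq_sideCoord hs ht hc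
  have e := param_sideCoord K i (τ, 0)
  rw [← hi] at e
  simp only at e
  rw [e, rot_param_zero] at h
  exact side_notMem_cell hK i τ h

lemma isOpen_image_param (hK : ConvexQuad K) :
    IsOpen ((fun q => param K q.1 q.2) '' (J ×ˢ J)) := by
  rw [isOpen_iff_mem_nhds]
  rintro _ ⟨⟨s, t⟩, ⟨hs, ht⟩, rfl⟩
  have hj := (hK.jac_pos (Ioo_subset_Icc_self hs) (Ioo_subset_Icc_self ht)).ne'
  have hc : HasStrictFDerivAt (fun q => param K q.1 q.2)
      (dparamEquiv K s t hj : ℝ × ℝ →L[ℝ] Plane) (s, t) :=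
    (contDiff_param K (n := 1)).contDiffAt.hasStrictFDerivAt' (hasFDerivAt_param' K s t hj)
      one_ne_zero
  have := hc.map_nhds_eq_of_equiv
  rw [← this]
  exact image_mem_map ((isOpen_Ioo.prod isOpen_Ioo).mem_nhds ⟨hs, ht⟩)

lemma image_param_subset_cell (hK : ConvexQuad K) :
    (fun q => param K q.1 q.2) '' (J ×ˢ J) ⊆ cell K :=
  interior_maximal (by
    rintro _ ⟨q, ⟨hs, ht⟩, rfl⟩
    exact param_mem_closedCell K (Ioo_subset_Icc_self hs) (Ioo_subset_Icc_self ht))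
    (isOpen_image_param hK)

lemma param_mem_cell (hK : ConvexQuad K) {s t}
    (hs : s ∈ J) (ht : t ∈ J) : param K s t ∈ cell K :=
  image_param_subset_cell hK ⟨(s, t), ⟨hs, ht⟩, rfl⟩

lemma cell_nonempty (hK : ConvexQuad K) : (cell K).Nonempty :=
  ⟨_, param_mem_cell hK (s := 1 / 2) (t := 1 / 2) (by norm_num) (by norm_num)⟩

lemma isCompact_image_param (K) :
    IsCompact ((fun q => param K q.1 q.2) '' (I ×ˢ I)) :=
  (isCompact_Icc.prod isCompact_Icc).image (contDiff_param K (n := 0)).continuous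

lemma image_param_eq_cell (hK : ConvexQuad K) :
    (fun q => param K q.1 q.2) '' (J ×ˢ J) = cell K := by
  refine (image_param_subset_cell hK).antisymm ?_
  refine (convex_cell K).isPreconnected.subset_of_closure_inter_subset (isOpen_image_param hK) ?_ ?_
  · refine ⟨_, param_mem_cell hK (s := 1 / 2) (t := 1 / 2) (by norm_num) (by norm_num),
      ⟨(1 / 2, 1 / 2), ⟨by norm_num, by norm_num⟩, rfl⟩⟩
  · rintro x ⟨hx, hxc⟩
    have hcl : closure ((fun q => param K q.1 q.2) '' (J ×ˢ J)) ⊆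
        (fun q => param K q.1 q.2) '' (I ×ˢ I) :=
      closure_minimal (image_mono (prod_mono Ioo_subset_Icc_self Ioo_subset_Icc_self))
        (isCompact_image_param K).isClosed
    obtain ⟨⟨s, t⟩, ⟨hs, ht⟩, rfl⟩ := hcl hx
    exact ⟨(s, t), boundary_notMem_cell hK hs ht hxc, rfl⟩

lemma closure_cell (hK : ConvexQuad K) : closure (cell K) = closedCell K := by
  have hc : Convex ℝ (closedCell K) := convex_convexHull ℝ _
  unfold cell
  rw [hc.closure_interior_eq_closure_of_nonempty_interior (cell_nonempty hK)]
  exact (isCompact_closedCell K).isClosed.closure_eq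

lemma image_param_eq_closedCell (hK : ConvexQuad K) :
    (fun q => param K q.1 q.2) '' (I ×ˢ I) = closedCell K := by
  refine Subset.antisymm ?_ ?_
  · rintro _ ⟨q, ⟨hs, ht⟩, rfl⟩
    exact param_mem_closedCell K hs ht
  · rw [← closure_cell hK, ← image_param_eq_cell hK]
    exact closure_minimal (image_mono (prod_mono Ioo_subset_Icc_self Ioo_subset_Icc_self))
        (isCompact_image_param K).isClosed

lemma exists_param_of_mem_closedCell (hK : ConvexQuad K) {x}
    (hx : x ∈ closedCell K) :
    ∃ q : ℝ × ℝ, q.1 ∈ I ∧ q.2 ∈ I ∧ param K q.1 q.2 = x := by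
  rw [← image_param_eq_closedCell hK] at hx
  obtain ⟨q, ⟨h1, h2⟩, h⟩ := hx
  grind

lemma exists_param_of_mem_cell (hK : ConvexQuad K) {x}
    (hx : x ∈ cell K) :
    ∃ q : ℝ × ℝ, q.1 ∈ J ∧ q.2 ∈ J ∧ param K q.1 q.2 = x := by
  rw [← image_param_eq_cell hK] at hx
  obtain ⟨q, ⟨h1, h2⟩, h⟩ := hx
  grind

/-- The inverse of the parametrization. -/
def paramInv (K : Quad) : Plane → ℝ × ℝ :=
  Function.invFunOn (fun q => param K q.1 q.2) (I ×ˢ I)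

lemma paramInv_mem (hK : ConvexQuad K) {x} (hx : x ∈ closedCell K) :
    paramInv K x ∈ I ×ˢ I := by
  rw [← image_param_eq_closedCell hK] at hx
  exact Function.invFunOn_mem hx

lemma param_paramInv (hK : ConvexQuad K) {x}
    (hx : x ∈ closedCell K) : param K (paramInv K x).1 (paramInv K x).2 = x := by
  rw [← image_param_eq_closedCell hK] at hx
  exact Function.invFunOn_eq hx

lemma paramInv_param (hK : ConvexQuad K) {s t} (hs : s ∈ I)
    (ht : t ∈ I) : paramInv K (param K s t) = (s, t) := by
  have hx := param_mem_closedCell K hs ht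
  have h1 := paramInv_mem hK hx
  have h2 := hK.param_inj h1.1 h1.2 hs ht (param_paramInv hK hx)
  grind

lemma exists_lipschitz_paramInv (hK : ConvexQuad K) :
    ∃ C, LipschitzOnWith C (paramInv K) (closedCell K) := by
  obtain ⟨m, hm, hi⟩ := hK.exists_corner_min
  have hL : 0 ≤ longestSide K := dist_nonneg.trans (dist_le_longestSide K 0)
  refine ⟨Real.toNNReal (longestSide K / m), LipschitzOnWith.of_dist_le_mul fun x hx y hy => ?_⟩
  have b := abs_sub_le_of_param hi (paramInv_mem hK hy).1 (paramInv_mem hK hy).2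
    (paramInv_mem hK hx).1 (paramInv_mem hK hx).2
  rw [param_paramInv hK hx, param_paramInv hK hy, ← dist_eq_norm] at b
  rw [Real.coe_toNNReal _ (by positivity), Prod.dist_eq, Real.dist_eq, Real.dist_eq]
  refine max_le ?_ ?_
  · rw [div_mul_eq_mul_div, le_div_iff₀ hm, mul_comm]; exact b.1
  · rw [div_mul_eq_mul_div, le_div_iff₀ hm, mul_comm]; exact b.2

lemma continuousOn_paramInv (hK : ConvexQuad K) :
    ContinuousOn (paramInv K) (closedCell K) := by
  obtain ⟨C, hC⟩ := exists_lipschitz_paramInv hK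
  exact hC.continuousOn

lemma tendsto_paramInv (hK : ConvexQuad K) {s t}
    (hs : s ∈ I) (ht : t ∈ I) :
    Tendsto (paramInv K) (𝓝[cell K] (param K s t)) (𝓝[J ×ˢ J] (s, t)) := by
  refine tendsto_nhdsWithin_iff.2 ⟨?_, ?_⟩
  · have := (continuousOn_paramInv hK) _ (param_mem_closedCell K hs ht)
    rw [ContinuousWithinAt, paramInv_param hK hs ht] at this
    exact this.mono_left (nhdsWithin_mono _ interior_subset)
  · filter_upwards [self_mem_nhdsWithin] with x hx
    have hx' : x ∈ closedCell K := interior_subset hx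
    have h := paramInv_mem hK hx'
    refine boundary_notMem_cell hK h.1 h.2 ?_
    rwa [param_paramInv hK hx']

lemma nhdsWithin_cell_neBot (hK : ConvexQuad K) {x}
    (hx : x ∈ closedCell K) : (𝓝[cell K] x).NeBot := by
  rw [← mem_closure_iff_nhdsWithin_neBot, closure_cell hK]; exact hx

/-! ### Splines of one variable -/

/-- `s` is not one of the interior knots `i / k`. -/
def NotKnot (k : ℕ) (s : ℝ) : Prop := ∀ i, 0 < i → i < k → s ≠ (i : ℝ) / k

/-- `f` is of class `C^r`, smooth away from the interior knots, and a polynomial of degree at most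
`d` on each of the `k` equal subintervals of `[0, 1]`. -/
def Spline (d r k : ℕ) (f : ℝ → ℝ) : Prop :=
  ContDiff ℝ r f ∧ (∀ i < k, ∃ P : Polynomial ℝ, P.natDegree ≤ d ∧
    ∀ s ∈ knotIcc k i, f s = P.eval s) ∧
    ∀ s, NotKnot k s → ContDiffAt ℝ ∞ f s

lemma NotKnot.flip {k} {s : ℝ} (h : NotKnot k s) : NotKnot k (1 - s) := by
  intro i h0 hi hs
  have hk : (0 : ℝ) < k := by exact_mod_cast h0.trans hi
  refine h (k - i) (by omega) (by omega) ?_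
  rw [Nat.cast_sub hi.le]
  grind

lemma exists_piece {k : ℕ} (hk : 0 < k) {s : ℝ} (hs : s ∈ I) :
    ∃ i < k, s ∈ Icc ((i : ℝ) / k) ((i + 1 : ℝ) / k) := by
  have hk' : (0 : ℝ) < k := by exact_mod_cast hk
  rcases eq_or_lt_of_le hs.2 with h | h
  · refine ⟨k - 1, by omega, ?_⟩
    rw [Nat.cast_sub hk, h]
    constructor
    · rw [div_le_one hk']; simp
    grind
  · refine ⟨⌊s * k⌋₊, ?_, ?_, ?_⟩
    · rw [Nat.floor_lt (mul_nonneg hs.1 hk'.le)]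
      nlinarith
    · rw [div_le_iff₀ hk']; exact Nat.floor_le (mul_nonneg hs.1 hk'.le)
    · rw [le_div_iff₀ hk']; exact (Nat.lt_floor_add_one _).le

lemma piece_subset {k i} (hi : i < k) :
    knotIcc k i ⊆ I := by
  have hk' : (0 : ℝ) < k := by exact_mod_cast (Nat.zero_le i).trans_lt hi
  refine Icc_subset_Icc (by positivity) ?_
  rw [div_le_one hk']
  exact_mod_cast hi

lemma piece_lt {k i : ℕ} (hi : i < k) : (i : ℝ) / k < (i + 1 : ℝ) / k := by
  have hk' : (0 : ℝ) < k := by exact_mod_cast (Nat.zero_le i).trans_lt hi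
  gcongr; linarith

namespace Spline

variable {d r k : ℕ} {f g : ℝ → ℝ}

lemma mono {d' r'} (hf : Spline d r k f) (hd : d ≤ d') (hr : r' ≤ r) : Spline d' r' k f :=
  ⟨hf.1.of_le (by exact_mod_cast hr), fun i hi => by
    obtain ⟨P, h1, h2⟩ := hf.2.1 i hi
    exact ⟨P, h1.trans hd, h2⟩, hf.2.2⟩

lemma add (hf : Spline d r k f) (hg : Spline d r k g) : Spline d r k fun s => f s + g s :=
  ⟨hf.1.add hg.1, fun i hi => by
    obtain ⟨P, h1, h2⟩ := hf.2.1 i hi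
    obtain ⟨Q, h3, h4⟩ := hg.2.1 i hi
    refine ⟨P + Q, Polynomial.natDegree_add_le_of_degree_le h1 h3, fun s hs => ?_⟩
    simp only [h2 s hs, h4 s hs, Polynomial.eval_add],
    fun s hs => (hf.2.2 s hs).add (hg.2.2 s hs)⟩

lemma const_mul (c : ℝ) (hf : Spline d r k f) : Spline d r k fun s => c * f s :=
  ⟨contDiff_const.mul hf.1, fun i hi => by
    obtain ⟨P, h1, h2⟩ := hf.2.1 i hi
    refine ⟨C c * P, (natDegree_C_mul_le _ _).trans h1, fun s hs => ?_⟩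
    simp only [h2 s hs, Polynomial.eval_mul, Polynomial.eval_C],
    fun s hs => contDiffAt_const.mul (hf.2.2 s hs)⟩

lemma zero : Spline d r k fun _ => 0 :=
  ⟨contDiff_const, fun _ _ => ⟨0, by simp, by simp⟩, fun _ _ => contDiffAt_const⟩

lemma sum {ι : Type*} (S : Finset ι) {f : ι → ℝ → ℝ} (hf : ∀ i ∈ S, Spline d r k (f i)) :
    Spline d r k fun s => ∑ i ∈ S, f i s := by
  classical
  induction S using Finset.induction_on with
  | empty => simpa using zero
  | insert a S ha ih =>
    simp only [Finset.sum_insert ha]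
    exact (hf a (by simp)).add (ih fun i hi => hf i (by simp [hi]))

lemma affine_mul (a b : ℝ) (hf : Spline d r k f) : Spline (d + 1) r k fun s => (a + b * s) * f s :=
  ⟨by have := hf.1; fun_prop, fun i hi => by
    obtain ⟨P, h1, h2⟩ := hf.2.1 i hi
    refine ⟨(C a + C b * X) * P, ?_, fun s hs => ?_⟩
    · refine Polynomial.natDegree_mul_le.trans ?_
      have : (C a + C b * X).natDegree ≤ 1 := by compute_degree
      omega
    · simp [h2 s hs],
    fun s hs => ContDiffAt.mul (by fun_prop) (hf.2.2 s hs)⟩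

lemma flip (hf : Spline d r k f) : Spline d r k fun s => f (1 - s) :=
  ⟨by have := hf.1; fun_prop, fun i hi => by
    obtain ⟨P, h1, h2⟩ := hf.2.1 (k - 1 - i) (by omega)
    refine ⟨P.comp (1 - X), ?_, fun s hs => ?_⟩
    · refine Polynomial.natDegree_comp_le.trans ?_
      have : (1 - X : Polynomial ℝ).natDegree ≤ 1 := by compute_degree
      calc P.natDegree * _ ≤ P.natDegree * 1 := by gcongr
        _ ≤ d := by omega
    · have hk' : (0 : ℝ) < k := by exact_mod_cast (Nat.zero_le i).trans_lt hi
      have e : ((k - 1 - i : ℕ) : ℝ) = k - 1 - i := by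
        rw [Nat.cast_sub (by omega), Nat.cast_sub (by omega)]; simp
      beta_reduce
      rw [h2, Polynomial.eval_comp]
      · simp
      · refine mem_Icc.2 ?_
        rw [e]
        have h3 := hs.1
        have h4 := hs.2
        rw [div_le_iff₀ hk'] at h3
        rw [le_div_iff₀ hk'] at h4
        constructor
        · rw [div_le_iff₀ hk']; linarith
        · rw [le_div_iff₀ hk']; linarith,
    fun s hs => ContDiffAt.comp s (hf.2.2 (1 - s) hs.flip) (by fun_prop)⟩

end Spline

/-- The value of an iterated derivative can be read off a polynomial piece. -/
lemma iteratedDeriv_eq_of_piece {r l : ℕ} {f} {x a b : ℝ} (hab : a < b)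
    (hx : x ∈ Icc a b) (hf : ContDiffAt ℝ r f x) (hl : l ≤ r) {P}
    (hP : ∀ s ∈ Icc a b, f s = P.eval s) :
    iteratedDeriv l f x = (derivative^[l] P).eval x := by
  have hu : UniqueDiffOn ℝ (Icc a b) := uniqueDiffOn_Icc hab
  have h1 := iteratedDerivWithin_eq_iteratedDeriv hu
    (hf.of_le (show (l : WithTop ℕ∞) ≤ r by exact_mod_cast hl)) hx
  have hPc : ContDiff ℝ l fun s => P.eval s := by
    simpa [Polynomial.coe_aeval_eq_eval] using P.contDiff_aeval (𝕜 := ℝ) (n := l)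
  have h2 := iteratedDerivWithin_eq_iteratedDeriv hu (hPc.contDiffAt (x := x)) hx
  rw [← h1, iteratedDerivWithin_congr (g := fun s => P.eval s) hP hx, h2]
  clear h1 h2 hP hl hPc
  induction l generalizing P with
  | zero => simp
  | succ l ih =>
    rw [iteratedDeriv_succ', iterate_succ_apply, ← ih]
    congr 1
    ext s
    simp

lemma contDiffAt_deriv {f : ℝ → ℝ} {s : ℝ} (h : ContDiffAt ℝ ∞ f s) : ContDiffAt ℝ ∞ (deriv f) s := by
  have h1 : ContDiffAt ℝ ∞ (fderiv ℝ f) s := h.fderiv_right (by simp)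
  have : deriv f = fun x => fderiv ℝ f x 1 := by ext x; simp
  rw [this]
  exact h1.clm_apply contDiffAt_const

lemma Spline.deriv {d r k : ℕ} {f} (hf : Spline (d + 1) (r + 1) k f) :
    Spline d r k (deriv f) := by
  refine ⟨?_, fun i hi => ?_, fun s hs => ?_⟩
  · have := hf.1
    push_cast at this
    exact (contDiff_succ_iff_deriv.1 this).2.2
  · obtain ⟨P, h1, h2⟩ := hf.2.1 i hi
    refine ⟨derivative P, (Polynomial.natDegree_derivative_le P).trans (by omega),
      fun s hs => ?_⟩
    have := iteratedDeriv_eq_of_piece (l := 1) (piece_lt hi) hs hf.1.contDiffAt (by omega) h2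
    simpa using this
  · exact contDiffAt_deriv (hf.2.2 s hs)

/-! ### Truncated powers -/

/-- The truncated power `(x - s)₊ⁿ`. -/
def tpow (s : ℝ) (n : ℕ) (x : ℝ) : ℝ := max (x - s) 0 ^ n

lemma hasDerivAt_tpow (s : ℝ) (n) (x : ℝ) :
    HasDerivAt (tpow s (n + 2)) ((n + 2) * tpow s (n + 1) x) x := by
  rcases lt_trichotomy x s with h | rfl | h
  · have e : tpow s (n + 2) =ᶠ[𝓝 x] fun _ => 0 := by
      filter_upwards [gt_mem_nhds h] with y hy
      simp [tpow, max_eq_right (show y - s ≤ 0 by linarith)]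
    have z : ((n : ℝ) + 2) * tpow s (n + 1) x = 0 := by
      simp [tpow, max_eq_right (show x - s ≤ 0 by linarith)]
    rw [z]
    exact (hasDerivAt_const x 0).congr_of_eventuallyEq e
  · have z : ((n : ℝ) + 2) * tpow x (n + 1) x = 0 := by simp [tpow]
    rw [z]
    have : tpow x (n + 2) =O[𝓝 x] fun y => ‖y - x‖ ^ (n + 2) := by
      refine Asymptotics.IsBigO.of_bound 1 (Eventually.of_forall fun y => ?_)
      rw [one_mul, tpow, norm_pow, norm_pow]
      gcongr
      rw [norm_norm, Real.norm_eq_abs, Real.norm_eq_abs, abs_of_nonneg (le_max_right _ _)]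
      grind
    have h := this.hasFDerivAt (𝕜 := ℝ) (by omega)
    have h2 := h.hasDerivAt
    grind
  · have e : tpow s (n + 2) =ᶠ[𝓝 x] fun y => (y - s) ^ (n + 2) := by
      filter_upwards [lt_mem_nhds h] with y hy
      simp [tpow, max_eq_left (show 0 ≤ y - s by linarith)]
    have h2 := ((hasDerivAt_id x).sub_const s).pow (n + 2)
    refine (h2.congr_of_eventuallyEq e).congr_deriv ?_
    simp [tpow, max_eq_left (show 0 ≤ x - s by linarith)]

lemma deriv_tpow (s : ℝ) (n) :
    deriv (tpow s (n + 2)) = fun x => (n + 2) * tpow s (n + 1) x :=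
  funext fun x => (hasDerivAt_tpow s n x).deriv

lemma contDiff_tpow (s : ℝ) (n : ℕ) : ContDiff ℝ n (tpow s (n + 1)) := by
  induction n with
  | zero =>
    have : Continuous (tpow s 1) := by unfold tpow; fun_prop
    exact contDiff_zero.2 this
  | succ n ih =>
    push_cast
    rw [contDiff_succ_iff_deriv]
    refine ⟨fun x => (hasDerivAt_tpow s n x).differentiableAt, by simp, ?_⟩
    rw [deriv_tpow]
    exact contDiff_const.mul ih

lemma iteratedDeriv_tpow (s : ℝ) (n l) :
    iteratedDeriv l (tpow s (n + l + 1)) =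
      fun x => ((n + l + 1).descFactorial l : ℝ) * tpow s (n + 1) x := by
  induction l generalizing n with
  | zero => simp
  | succ l ih =>
    have := ih (n + 1)
    rw [show n + 1 + l + 1 = n + (l + 1) + 1 by ring] at this
    rw [iteratedDeriv_succ, this]
    ext x
    rw [deriv_const_mul_field, deriv_tpow, Nat.descFactorial_succ]
    rw [show n + (l + 1) + 1 - l = n + 2 by omega]
    grind

/-! ### A basis of the spline space -/

/-- Monomials and truncated powers. -/
def splineBasis (d r k : ℕ) : Fin (d + 1) ⊕ (Fin (k - 1) × Fin (d - r)) → ℝ → ℝ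
  | .inl a => fun x => x ^ (a : ℕ)
  | .inr e => tpow (((e.1 : ℕ) + 1 : ℝ) / k) (r + 1 + e.2)

/-- The derivatives of order `l ≤ r` of the basis functions. -/
def splineBasisDeriv (d r k l : ℕ) :
    Fin (d + 1) ⊕ (Fin (k - 1) × Fin (d - r)) → ℝ → ℝ
  | .inl a => fun x => ((a : ℕ).descFactorial l : ℝ) * x ^ ((a : ℕ) - l)
  | .inr e => fun x => ((r + 1 + e.2).descFactorial l : ℝ) *
      tpow (((e.1 : ℕ) + 1 : ℝ) / k) (r + 1 + e.2 - l) x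

lemma contDiff_splineBasis (d r k : ℕ) (j) : ContDiff ℝ r (splineBasis d r k j) := by
  rcases j with a | e
  · simp only [splineBasis]; fun_prop
  · have := contDiff_tpow (((e.1 : ℕ) + 1 : ℝ) / k) (r + e.2)
    rw [show r + (e.2 : ℕ) + 1 = r + 1 + e.2 by ring] at this
    exact this.of_le (by exact_mod_cast Nat.le_add_right _ _)

lemma contDiffAt_tpow {s x : ℝ} (n) (h : x ≠ s) : ContDiffAt ℝ ∞ (tpow s (n + 1)) x := by
  rcases lt_or_gt_of_ne h with h | h
  · refine (contDiffAt_const (c := 0)).congr_of_eventuallyEq ?_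
    filter_upwards [gt_mem_nhds h] with y hy
    simp [tpow, max_eq_right (show y - s ≤ 0 by linarith)]
  · refine ContDiffAt.congr_of_eventuallyEq (f := fun y => (y - s) ^ (n + 1)) (by fun_prop) ?_
    filter_upwards [lt_mem_nhds h] with y hy
    simp [tpow, max_eq_left (show 0 ≤ y - s by linarith)]

lemma contDiffAt_splineBasis (d r k) (j) {x : ℝ} (hx : NotKnot k x) :
    ContDiffAt ℝ ∞ (splineBasis d r k j) x := by
  rcases j with a | e
  · simp only [splineBasis]; fun_prop
  · have h := e.1.2
    have := contDiffAt_tpow (r + e.2) (hx (e.1 + 1) (by omega) (by omega))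
    rw [show r + (e.2 : ℕ) + 1 = r + 1 + e.2 by ring] at this
    push_cast at this
    exact this

lemma iteratedDeriv_splineBasis (d r k l) (hl : l ≤ r) (j) (x : ℝ) :
    iteratedDeriv l (splineBasis d r k j) x = splineBasisDeriv d r k l j x := by
  rcases j with a | e
  · simp only [splineBasis, splineBasisDeriv]
    rw [← iteratedDerivWithin_univ]
    exact iteratedDerivWithin_pow (mem_univ x) uniqueDiffOn_univ _ _
  · simp only [splineBasis, splineBasisDeriv]
    have := iteratedDeriv_tpow (((e.1 : ℕ) + 1 : ℝ) / k) (r - l + e.2) l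
    rw [show r - l + (e.2 : ℕ) + l + 1 = r + 1 + e.2 by omega,
      show r - l + (e.2 : ℕ) + 1 = r + 1 + e.2 - l by omega] at this
    rw [this]

lemma spline_splineBasis {d r k : ℕ} (j) : Spline d r k (splineBasis d r k j) := by
  refine ⟨contDiff_splineBasis d r k j, fun i hi => ?_, fun s hs => ?_⟩
  swap
  · exact contDiffAt_splineBasis d r k j hs
  have hk' : (0 : ℝ) < k := by exact_mod_cast (Nat.zero_le i).trans_lt hi
  rcases j with a | e
  · refine ⟨X ^ (a : ℕ), by simpa using Nat.lt_succ_iff.1 a.2, fun s _ => ?_⟩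
    simp [splineBasis]
  · by_cases h : (e.1 : ℕ) + 1 ≤ i
    · refine ⟨(X - C (((e.1 : ℕ) + 1 : ℝ) / k)) ^ (r + 1 + (e.2 : ℕ)),
        ?_, fun s hs => ?_⟩
      · refine (Polynomial.natDegree_pow_le).trans ?_
        rw [natDegree_X_sub_C]
        grind
      · have : ((e.1 : ℕ) + 1 : ℝ) / k ≤ s := by
          refine le_trans ?_ hs.1
          gcongr
          exact_mod_cast h
        simp [splineBasis, tpow, max_eq_left (sub_nonneg.2 this)]
    · refine ⟨0, by simp, fun s hs => ?_⟩
      have : s ≤ ((e.1 : ℕ) + 1 : ℝ) / k := by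
        refine hs.2.trans ?_
        gcongr
        grind
      simp [splineBasis, tpow, max_eq_right (sub_nonpos.2 this)]

/-- The spline with given coefficients. -/
def splineOf (d r k : ℕ) (c : Fin (d + 1) ⊕ (Fin (k - 1) × Fin (d - r)) → ℝ)
    (x : ℝ) : ℝ := ∑ j, c j * splineBasis d r k j x

lemma spline_splineOf {d r k : ℕ} (c) : Spline d r k (splineOf d r k c) :=
  Spline.sum _ fun j _ => (spline_splineBasis j).const_mul (c j)

lemma eval_eq_sum_fin {d} {P : Polynomial ℝ} (h : P.natDegree ≤ d) (x : ℝ) :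
    P.eval x = ∑ a : Fin (d + 1), P.coeff a * x ^ (a : ℕ) := by
  rw [Polynomial.eval_eq_sum_range' (Nat.lt_succ_of_le h), Finset.sum_range]

lemma eval_eq_sum_shift {d r} (hr : r ≤ d) {D} (h : D.natDegree ≤ d) (x₀ : ℝ)
    (hD : ∀ l ≤ r, (derivative^[l] D).eval x₀ = 0) (x : ℝ) :
    D.eval x = ∑ j : Fin (d - r), (taylor x₀ D).coeff (r + 1 + j) *
      (x - x₀) ^ (r + 1 + (j : ℕ)) := by
  have e : D.eval x = (taylor x₀ D).eval (x - x₀) := by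
    rw [Polynomial.taylor_eval]; grind
  have hdeg : (taylor x₀ D).natDegree < r + 1 + (d - r) := by
    rw [Polynomial.natDegree_taylor]; omega
  rw [e, Polynomial.eval_eq_sum_range' hdeg, Finset.sum_range_add]
  rw [Finset.sum_eq_zero, zero_add, Finset.sum_range]
  intro l hl
  have hl' : l ≤ r := Nat.lt_succ_iff.1 (Finset.mem_range.1 hl)
  have h1 := hD l hl'
  rw [← Polynomial.factorial_smul_hasseDeriv] at h1
  rw [LinearMap.smul_apply, Polynomial.eval_smul, smul_eq_zero] at h1
  rw [Polynomial.taylor_coeff, h1.resolve_left l.factorial_ne_zero, zero_mul]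

/-- A piecewise polynomial function of class `C^r` on the open interval is a combination of
monomials and truncated powers. -/
lemma exists_splineOf {d r k : ℕ} (hk : 0 < k) (hr : r ≤ d) {f}
    (hf : ContDiffOn ℝ r f J)
    (hP : ∀ i < k, ∃ P : Polynomial ℝ, P.natDegree ≤ d ∧
      ∀ s ∈ Icc ((i : ℝ) / k) ((i + 1 : ℝ) / k), f s = P.eval s) :
    ∃ c, EqOn f (splineOf d r k c) I := by
  have hk' : (0 : ℝ) < k := by exact_mod_cast hk
  have : ∀ i, ∃ P : Polynomial ℝ, i < k → P.natDegree ≤ d ∧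
      ∀ s ∈ Icc ((i : ℝ) / k) ((i + 1 : ℝ) / k), f s = P.eval s := by
    grind
  choose P hP using this
  set c : Fin (d + 1) ⊕ (Fin (k - 1) × Fin (d - r)) → ℝ := fun j => match j with
    | .inl a => (P 0).coeff a
    | .inr e => (taylor (((e.1 : ℕ) + 1 : ℝ) / k) (P (e.1 + 1) - P e.1)).coeff
        (r + 1 + e.2) with hc
  refine ⟨c, fun s hs => ?_⟩
  have jump : ∀ m, m + 1 < k → ∀ x : ℝ, (P (m + 1)).eval x - (P m).eval x =
      ∑ j : Fin (d - r), (taylor ((m + 1 : ℝ) / k) (P (m + 1) - P m)).coeff (r + 1 + j) *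
      (x - (m + 1 : ℝ) / k) ^ (r + 1 + (j : ℕ)) := by
    intro m hm x
    have h0 := hP m (by omega)
    have h1 := hP (m + 1) hm
    push_cast at h1
    rw [← Polynomial.eval_sub]
    refine eval_eq_sum_shift hr (Polynomial.natDegree_sub_le_of_le h1.1 h0.1 |>.trans (by simp)) _
      (fun l hl => ?_) x
    have hmem : ((m + 1 : ℝ) / k) ∈ J := by
      refine ⟨by positivity, ?_⟩
      rw [div_lt_one hk']
      exact_mod_cast hm
    have hfa : ContDiffAt ℝ r f ((m + 1 : ℝ) / k) := hf.contDiffAt (isOpen_Ioo.mem_nhds hmem)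
    have l0 := piece_lt (show m < k by omega)
    have l1 := piece_lt hm
    push_cast at l1
    have e0 := iteratedDeriv_eq_of_piece l0 (right_mem_Icc.2 l0.le) hfa hl h0.2
    have e1 := iteratedDeriv_eq_of_piece l1 (left_mem_Icc.2 l1.le) hfa hl h1.2
    rw [Polynomial.iterate_derivative_sub, Polynomial.eval_sub, ← e0, ← e1, sub_self]
  have main : ∀ m < k, (P m).eval s = (P 0).eval s + ∑ l ∈ Finset.range m,
      ((P (l + 1)).eval s - (P l).eval s) := by
    intro m _
    rw [Finset.sum_range_sub (fun l => (P l).eval s)]; ring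
  obtain ⟨i, hi, hsi⟩ := exists_piece hk hs
  rw [(hP i hi).2 s hsi, main i hi, splineOf, sum_sum_type]
  congr 1
  · rw [eval_eq_sum_fin (hP 0 hk).1]
    simp [hc, splineBasis]
  · rw [sum_prod_type]
    have : ∀ m : Fin (k - 1), ∑ j : Fin (d - r), c (.inr (m, j)) * splineBasis d r k (.inr (m, j)) s =
        if (m : ℕ) < i then (P (m + 1)).eval s - (P m).eval s else 0 := by
      intro m
      have hm : (m : ℕ) + 1 < k := by grind
      split_ifs with h
      · rw [jump m hm]
        refine sum_congr rfl fun j _ => ?_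
        have : ((m : ℕ) + 1 : ℝ) / k ≤ s := by
          refine le_trans ?_ hsi.1
          gcongr
          exact_mod_cast h
        simp [hc, splineBasis, tpow, max_eq_left (sub_nonneg.2 this)]
      · refine Finset.sum_eq_zero fun j _ => ?_
        have : s ≤ ((m : ℕ) + 1 : ℝ) / k := by
          refine hsi.2.trans ?_
          gcongr
          grind
        simp [splineBasis, tpow, max_eq_right (sub_nonpos.2 this)]
    simp only [this]
    rw [Fin.sum_univ_eq_sum_range
      (fun m => if m < i then (P (m + 1)).eval s - (P m).eval s else 0) (k - 1),
      ← Finset.sum_filter]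
    refine sum_congr ?_ fun _ _ => rfl
    grind

/-! ### Unisolvence -/

/-- Labels of Hermite functionals on `[0, 1]`: the derivatives of order `< a` at both end points
and the values at the points of `P`. -/
abbrev HermiteIdx (a : ℕ) (P : Finset ℝ) : Type := (Fin 2 × Fin a) ⊕ P

/-- The Hermite functionals. -/
def hermite {a : ℕ} {P : Finset ℝ} : HermiteIdx a P → (ℝ → ℝ) → ℝ
  | .inl bl, f => iteratedDeriv bl.2 f (bl.1 : ℕ)
  | .inr η, f => f η

/-- The Hermite functionals have a dual basis in the spline space and determine a spline. -/
def IsHermiteBasis (d r k a : ℕ) (P : Finset ℝ) (X : HermiteIdx a P → ℝ → ℝ) : Prop :=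
  (∀ j, Spline d r k (X j)) ∧ (∀ i j, hermite i (X j) = if i = j then 1 else 0) ∧
    ∀ f, Spline d r k f → ∀ s ∈ I, f s = ∑ j, hermite j f * X j s

lemma hermite_sum {a r : ℕ} {P : Finset ℝ} (ha : a ≤ r + 1) {ι : Type*} [Fintype ι] (c : ι → ℝ)
    {f : ι → ℝ → ℝ} (hf : ∀ i, ContDiff ℝ r (f i)) (j : HermiteIdx a P) :
    hermite j (fun s => ∑ i, c i * f i s) = ∑ i, c i * hermite j (f i) := by
  rcases j with ⟨b, l⟩ | η
  · simp only [hermite]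
    have hl : ((l : ℕ) : WithTop ℕ∞) ≤ r := by
      have := l.2
      exact_mod_cast (show (l : ℕ) ≤ r by omega)
    rw [iteratedDeriv_fun_sum fun i _ => ?_]
    · exact sum_congr rfl fun i _ => by rw [iteratedDeriv_const_mul_field]
    · exact (contDiff_const.mul ((hf i).of_le hl)).contDiffAt
  · rfl

lemma hermite_congr {a r : ℕ} {P : Finset ℝ} (ha : a ≤ r + 1) (hP : ∀ η ∈ P, η ∈ I)
    {f g : ℝ → ℝ} (hf : ContDiff ℝ r f) (hg : ContDiff ℝ r g) (h : EqOn f g I)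
    (j : HermiteIdx a P) : hermite j f = hermite j g := by
  rcases j with ⟨b, l⟩ | η
  · simp only [hermite]
    have hl : ((l : ℕ) : WithTop ℕ∞) ≤ r := by
      have := l.2
      exact_mod_cast (show (l : ℕ) ≤ r by omega)
    have hb : (((b : ℕ) : ℝ)) ∈ I := by fin_cases b <;> simp
    have hu := uniqueDiffOn_Icc_zero_one
    rw [← iteratedDerivWithin_eq_iteratedDeriv hu (hf.of_le hl).contDiffAt hb,
      ← iteratedDerivWithin_eq_iteratedDeriv hu (hg.of_le hl).contDiffAt hb]
    exact iteratedDerivWithin_congr h hb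
  · exact h (hP _ η.2)

lemma exists_hermiteBasis {d r k a : ℕ} {P : Finset ℝ} (hk : 0 < k) (hr : r ≤ d) (ha : a ≤ r + 1)
    (hP : ∀ η ∈ P, η ∈ I) (hcard : 2 * a + P.card = d + 1 + (k - 1) * (d - r))
    (hinj : ∀ c : Fin (d + 1) ⊕ (Fin (k - 1) × Fin (d - r)) → ℝ, (∀ j : HermiteIdx a P, ∑ i, c i * hermite j (splineBasis d r k i) = 0) → c = 0) :
    ∃ X, IsHermiteBasis d r k a P X := by
  classical
  set Λ : (Fin (d + 1) ⊕ (Fin (k - 1) × Fin (d - r)) → ℝ) →ₗ[ℝ] (HermiteIdx a P → ℝ) :=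
    { toFun := fun c j => ∑ i, c i * hermite j (splineBasis d r k i)
      map_add' := fun c c' => by
        ext j; simp [add_mul, sum_add_distrib]
      map_smul' := fun t c => by
        ext j; simp only [Pi.smul_apply, smul_eq_mul, mul_sum, mul_assoc, RingHom.id_apply] } with hΛ
  have hΛi : Function.Injective Λ := by
    rw [← LinearMap.ker_eq_bot, LinearMap.ker_eq_bot']
    intro c hc
    exact hinj c fun j => congrFun hc j
  have hΛs : Function.Surjective Λ := by
    refine (LinearMap.injective_iff_surjective_of_finrank_eq_finrank ?_).1 hΛi
    simp only [Module.finrank_fintype_fun_eq_card, Fintype.card_sum, Fintype.card_prod,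
      Fintype.card_fin, Fintype.card_coe, hcard]
  choose c hc using fun j : HermiteIdx a P => hΛs (Pi.single j 1)
  have hval : ∀ c' j, hermite j (splineOf d r k c') = Λ c' j := fun c' j =>
    hermite_sum ha c' (contDiff_splineBasis d r k) j
  refine ⟨fun j => splineOf d r k (c j), fun j => spline_splineOf _, fun i j => ?_,
    fun f hf s hs => ?_⟩
  · rw [hval, hc, Pi.single_apply]
  · obtain ⟨c₀, h₀⟩ := exists_splineOf hk hr hf.1.contDiffOn hf.2.1
    have e : c₀ = ∑ j, hermite j f • c j := by
      apply hΛi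
      rw [map_sum]
      ext i
      simp only [map_smul, hc, Finset.sum_apply, Pi.smul_apply, smul_eq_mul, Pi.single_apply,
        mul_ite, mul_one, mul_zero, Finset.sum_ite_eq, Finset.mem_univ, if_true]
      rw [← hval, hermite_congr ha hP hf.1 (spline_splineOf c₀).1 h₀]
    rw [h₀ hs, e, splineOf]
    simp only [splineOf, Finset.sum_apply, Pi.smul_apply, smul_eq_mul, sum_mul,
      mul_sum]
    rw [sum_comm]
    grind

lemma IsHermiteBasis.ext {d r k a} {P : Finset ℝ} {X} (hX : IsHermiteBasis d r k a P X)
    {f g} (hf : Spline d r k f) (hg : Spline d r k g)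
    (h : ∀ j : HermiteIdx a P, hermite j f = hermite j g) : EqOn f g I := fun s hs => by
  rw [hX.2.2 f hf s hs, hX.2.2 g hg s hs]
  grind

lemma IsHermiteBasis.spline_sum {d r k a} {P : Finset ℝ} {X} (hX : IsHermiteBasis d r k a P X)
    (c : HermiteIdx a P → ℝ) : Spline d r k fun s => ∑ j, c j * X j s :=
  Spline.sum _ fun j _ => (hX.1 j).const_mul (c j)

lemma IsHermiteBasis.hermite_sum {d r k a : ℕ} {P : Finset ℝ} {X}
    (hX : IsHermiteBasis d r k a P X) (ha : a ≤ r + 1) (c : HermiteIdx a P → ℝ)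
    (i) : hermite i (fun s => ∑ j, c j * X j s) = c i := by
  rw [BSQuad.hermite_sum ha c (fun j => (hX.1 j).1)]
  simp [hX.2.1]

/-- Unisolvence in the case of a single polynomial. -/
lemma exists_hermiteBasis_polynomial {d r a : ℕ} {P : Finset ℝ} (hr : r ≤ d) (ha : a ≤ r + 1)
    (hP : ∀ η ∈ P, η ∈ J) (hcard : 2 * a + P.card = d + 1) :
    ∃ X, IsHermiteBasis d r 1 a P X := by
  refine exists_hermiteBasis one_pos hr ha (fun η h => Ioo_subset_Icc_self (hP η h))
    (by grind) fun c hc => ?_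
  set Q : Polynomial ℝ := ∑ i : Fin (d + 1), Polynomial.monomial i (c (.inl i)) with hQ
  have hQe : ∀ x, splineOf d r 1 c x = Q.eval x := by
    intro x
    simp [splineOf, hQ, eval_finsetSum, splineBasis]
  have hQd : Q.natDegree ≤ d := by
    refine Polynomial.natDegree_sum_le_of_forall_le _ _ fun i _ => ?_
    exact (Polynomial.natDegree_monomial_le _).trans (Nat.lt_succ_iff.1 i.2)
  have hval : ∀ j, hermite j (splineOf d r 1 c) = 0 := fun j => by
    rw [← hc j]; exact hermite_sum ha c (contDiff_splineBasis d r 1) j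
  have hQ0 : Q = 0 := by
    by_contra hne
    have hend : ∀ b : Fin 2, (X - C (((b : ℕ) : ℝ))) ^ a ∣ Q := by
      intro b
      rcases Nat.eq_zero_or_pos a with h0 | h0
      · simp [h0]
      rw [← Polynomial.le_rootMultiplicity_iff hne]
      have : a - 1 < Polynomial.rootMultiplicity (((b : ℕ) : ℝ)) Q := by
        rw [Polynomial.lt_rootMultiplicity_iff_isRoot_iterate_derivative hne]
        intro l hl
        have h1 := hval (.inl (b, ⟨l, by omega⟩))
        simp only [hermite] at h1
        rw [iteratedDeriv_eq_of_piece (a := 0) (b := 1) one_pos (by fin_cases b <;> simp)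
          (spline_splineOf c).1.contDiffAt (by omega) (fun s _ => hQe s)] at h1
        exact h1
      omega
    have hint : ∀ η ∈ P, X - C η ∣ Q := by
      intro η hη
      rw [Polynomial.dvd_iff_isRoot, Polynomial.IsRoot, ← hQe]
      exact hval (.inr ⟨η, hη⟩)
    have hcop : ∀ x y : ℝ, x ≠ y → IsCoprime (X - C x)
        (X - C y) := fun x y hxy =>
      Polynomial.pairwise_coprime_X_sub_C (s := (id : ℝ → ℝ)) Function.injective_id hxy
    have d1 : (∏ η ∈ P, (X - C η)) ∣ Q :=
      Finset.prod_dvd_of_coprime (fun x _ y _ hxy => hcop x y hxy) hint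
    have d2 := hend 0
    have d3 := hend 1
    simp only [Fin.val_zero, Fin.val_one, Nat.cast_zero, Nat.cast_one] at d2 d3
    have c1 : IsCoprime ((X - C (0 : ℝ)) ^ a)
        ((X - C (1 : ℝ)) ^ a) := (hcop 0 1 zero_ne_one).pow
    have d4 := c1.mul_dvd d2 d3
    have c2 : IsCoprime ((X - C (0 : ℝ)) ^ a *
        (X - C (1 : ℝ)) ^ a) (∏ η ∈ P, (X - C η)) := by
      refine IsCoprime.prod_right fun η hη => IsCoprime.mul_left ?_ ?_
      · exact (hcop 0 η (hP η hη).1.ne).pow_left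
      · exact (hcop 1 η (hP η hη).2.ne').pow_left
    have d5 := c2.mul_dvd d4 d1
    have hle := Polynomial.natDegree_le_of_dvd d5 hne
    have m1 : ((X - C (0 : ℝ)) ^ a).Monic :=
      (monic_X_sub_C _).pow _
    have m2 : ((X - C (1 : ℝ)) ^ a).Monic :=
      (monic_X_sub_C _).pow _
    have m3 : (∏ η ∈ P, (X - C η)).Monic :=
      Polynomial.monic_prod_of_monic _ _ fun η _ => monic_X_sub_C η
    rw [(m1.mul m2).natDegree_mul m3, m1.natDegree_mul m2, Polynomial.natDegree_pow,
      Polynomial.natDegree_pow, natDegree_X_sub_C, natDegree_X_sub_C,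
      Polynomial.natDegree_prod_of_monic _ _ fun η _ => monic_X_sub_C η] at hle
    simp only [natDegree_X_sub_C, Finset.sum_const, smul_eq_mul, mul_one] at hle
    omega
  ext j
  rcases j with i | e
  · have := congrArg (fun q => Polynomial.coeff q (i : ℕ)) hQ0
    simp only [hQ, Polynomial.finsetSum_coeff, Polynomial.coeff_monomial, Polynomial.coeff_zero,
      Fin.val_inj, Finset.sum_ite_eq', Finset.mem_univ, if_true] at this
    exact this
  · exact e.1.elim0

/-! ### The three spline spaces of a side -/

lemma hermite_splineBasis_end {d r k a : ℕ} {P : Finset ℝ} (ha : a ≤ r + 1) (b : Fin 2) (l : Fin a)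
    (j) : hermite (P := P) (.inl (b, l)) (splineBasis d r k j) =
      splineBasisDeriv d r k l j ((b : ℕ) : ℝ) :=
  iteratedDeriv_splineBasis d r k l (by have := l.2; omega) j _

lemma edgeValueParams_of_le (hp : p ≤ 5) : edgeValueParams p = ∅ := by
  unfold edgeValueParams
  rw [Finset.image_eq_empty, Finset.Icc_eq_empty_iff]
  omega

lemma div_mem_J {j n : ℕ} (h0 : 0 < j) (h : j < n) : (j : ℝ) / n ∈ J := by
  have hn : (0 : ℝ) < n := by exact_mod_cast h0.trans h
  exact ⟨by positivity, (div_lt_one hn).2 (by exact_mod_cast h)⟩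

lemma edgeValueParams_mem {η : ℝ} (h : η ∈ edgeValueParams p) : η ∈ J := by
  simp only [edgeValueParams, Finset.mem_image, Finset.mem_Icc] at h
  obtain ⟨j, ⟨h1, h2⟩, rfl⟩ := h
  exact div_mem_J (by omega) (by omega)

lemma edgeNormalParams_mem {η : ℝ} (h : η ∈ edgeNormalParams p) : η ∈ J := by
  unfold edgeNormalParams at h
  split_ifs at h with hp
  · rw [Finset.mem_singleton] at h
    rw [h]; norm_num
  · simp only [Finset.mem_image, Finset.mem_Icc] at h
    obtain ⟨j, ⟨h1, h2⟩, rfl⟩ := h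
    have e : (p : ℝ) - 1 = ((p - 1 : ℕ) : ℝ) := by rw [Nat.cast_sub (by omega)]; simp
    rw [e]
    exact div_mem_J (by omega) (by omega)

lemma faceParams_mem {η : ℝ} (h : η ∈ faceParams p) : η ∈ J := by
  unfold faceParams at h
  split_ifs at h with h3 h4
  · simp only [Finset.mem_insert, Finset.mem_singleton] at h
    rcases h with rfl | rfl | rfl | rfl <;> norm_num
  · simp only [Finset.mem_insert, Finset.mem_singleton] at h
    rcases h with rfl | rfl | rfl <;> norm_num
  · simp only [Finset.mem_image, Finset.mem_Icc] at h
    obtain ⟨j, ⟨h1, h2⟩, rfl⟩ := h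
    exact div_mem_J (by omega) (by omega)

lemma edgeValueParams_flip {η : ℝ} (h : η ∈ edgeValueParams p) :
    1 - η ∈ edgeValueParams p := by
  simp only [edgeValueParams, Finset.mem_image, Finset.mem_Icc] at h ⊢
  obtain ⟨j, ⟨h1, h2⟩, rfl⟩ := h
  have hp : (0 : ℝ) < p := by exact_mod_cast (show 0 < p by omega)
  refine ⟨p - j, by omega, ?_⟩
  rw [Nat.cast_sub (by omega)]
  field_simp

lemma edgeNormalParams_flip {η : ℝ} (h : η ∈ edgeNormalParams p) :
    1 - η ∈ edgeNormalParams p := by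
  unfold edgeNormalParams at h ⊢
  split_ifs at h ⊢ with hp
  · rw [Finset.mem_singleton] at h ⊢
    rw [h]; norm_num
  · simp only [Finset.mem_image, Finset.mem_Icc] at h ⊢
    obtain ⟨j, ⟨h1, h2⟩, rfl⟩ := h
    have hp : (0 : ℝ) < (p : ℝ) - 1 := by
      have : (6 : ℝ) ≤ p := by exact_mod_cast (show 6 ≤ p by omega)
      linarith
    refine ⟨p - 1 - j, by omega, ?_⟩
    rw [Nat.cast_sub (by omega), Nat.cast_sub (by omega)]
    field_simp
    push_cast; ring

lemma card_edgeValueParams (hp : 5 ≤ p) : (edgeValueParams p).card = p - 5 := by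
  have hp' : (p : ℝ) ≠ 0 := by exact_mod_cast (show p ≠ 0 by omega)
  rw [edgeValueParams, Finset.card_image_of_injective, Nat.card_Icc]
  · omega
  · intro a b h
    simpa [div_left_inj' hp'] using h

lemma card_edgeNormalParams (hp : 5 ≤ p) : (edgeNormalParams p).card = p - 4 := by
  unfold edgeNormalParams
  split_ifs with h
  · rw [Finset.card_singleton]; omega
  · have hp' : (p : ℝ) - 1 ≠ 0 := by
      have : (6 : ℝ) ≤ p := by exact_mod_cast (show 6 ≤ p by omega)
      linarith
    rw [Finset.card_image_of_injective, Nat.card_Icc]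
    · omega
    · intro a b h
      simpa [div_left_inj' hp'] using h

lemma card_faceParams (hp : 5 ≤ p) : (faceParams p).card = p - 3 := by
  have hp' : (p : ℝ) ≠ 0 := by exact_mod_cast (show p ≠ 0 by omega)
  rw [faceParams, if_neg (by omega), if_neg (by omega), Finset.card_image_of_injective,
    Nat.card_Icc]
  · omega
  · intro a b h
    simpa [div_left_inj' hp'] using h

lemma exists_traceBasis (hp : 3 ≤ p) :
    ∃ X, IsHermiteBasis p (p - 1) (subdiv p) 3 (edgeValueParams p) X := by
  rcases (show p = 3 ∨ p = 4 ∨ 5 ≤ p by omega) with rfl | rfl | h5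
  · rw [edgeValueParams_of_le (by norm_num)]
    refine exists_hermiteBasis (by decide) (by norm_num) (by norm_num) (by simp) (by simp [subdiv])
      fun c hc => ?_
    change Fin 4 ⊕ (Fin 2 × Fin 1) → ℝ at c
    change ∀ j : HermiteIdx 3 ∅, ∑ i, c i * hermite j (splineBasis 3 2 3 i) = 0 at hc
    have h0 := hc (.inl (0, 0)); have h1 := hc (.inl (0, 1)); have h2 := hc (.inl (0, 2))
    have h3 := hc (.inl (1, 0)); have h4 := hc (.inl (1, 1)); have h5 := hc (.inl (1, 2))
    simp only [hermite_splineBasis_end (show 3 ≤ 2 + 1 by norm_num)] at h0 h1 h2 h3 h4 h5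
    simp [sum_sum_type, sum_prod_type, Fin.sum_univ_succ, splineBasisDeriv, tpow]
      at h0 h1 h2 h3 h4 h5
    norm_num [Nat.descFactorial] at h0 h1 h2 h3 h4 h5
    funext j
    rcases j with i | ⟨a, b⟩
    · fin_cases i <;> (change c _ = 0; simp; linarith)
    · fin_cases a <;> fin_cases b <;> (change c _ = 0; simp; linarith)
  · rw [edgeValueParams_of_le (by norm_num)]
    refine exists_hermiteBasis (by decide) (by norm_num) (by norm_num) (by simp) (by simp [subdiv])
      fun c hc => ?_
    change Fin 5 ⊕ (Fin 1 × Fin 1) → ℝ at c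
    change ∀ j : HermiteIdx 3 ∅, ∑ i, c i * hermite j (splineBasis 4 3 2 i) = 0 at hc
    have h0 := hc (.inl (0, 0)); have h1 := hc (.inl (0, 1)); have h2 := hc (.inl (0, 2))
    have h3 := hc (.inl (1, 0)); have h4 := hc (.inl (1, 1)); have h5 := hc (.inl (1, 2))
    simp only [hermite_splineBasis_end (show 3 ≤ 3 + 1 by norm_num)] at h0 h1 h2 h3 h4 h5
    simp [sum_sum_type, sum_prod_type, Fin.sum_univ_succ, splineBasisDeriv, tpow]
      at h0 h1 h2 h3 h4 h5
    norm_num [Nat.descFactorial] at h0 h1 h2 h3 h4 h5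
    funext j
    rcases j with i | ⟨a, b⟩
    · fin_cases i <;> (change c _ = 0; simp; linarith)
    · fin_cases a; fin_cases b; (change c _ = 0; simp; linarith)
  · have hk : subdiv p = 1 := by unfold subdiv; omega
    rw [hk]
    exact exists_hermiteBasis_polynomial (by omega) (by omega) (fun η => edgeValueParams_mem)
      (by rw [card_edgeValueParams h5]; omega)

lemma exists_normalBasis (hp : 3 ≤ p) :
    ∃ X, IsHermiteBasis (p - 1) (p - 2) (subdiv p) 2 (edgeNormalParams p) X := by
  rcases (show p = 3 ∨ p = 4 ∨ 5 ≤ p by omega) with rfl | rfl | h5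
  · have e : edgeNormalParams 3 = {1 / 2} := by simp [edgeNormalParams]
    rw [e]
    refine exists_hermiteBasis (by decide) (by norm_num) (by norm_num) (by norm_num)
      (by simp [subdiv]) fun c hc => ?_
    change Fin 3 ⊕ (Fin 2 × Fin 1) → ℝ at c
    change ∀ j : HermiteIdx 2 {1 / 2}, ∑ i, c i * hermite j (splineBasis 2 1 3 i) = 0 at hc
    have h0 := hc (.inl (0, 0)); have h1 := hc (.inl (0, 1)); have h2 := hc (.inl (1, 0))
    have h3 := hc (.inl (1, 1)); have h4 := hc (.inr ⟨1 / 2, by simp⟩)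
    simp only [hermite_splineBasis_end (show 2 ≤ 1 + 1 by norm_num)] at h0 h1 h2 h3
    simp [sum_sum_type, sum_prod_type, Fin.sum_univ_succ, splineBasisDeriv, tpow,
      hermite, splineBasis] at h0 h1 h2 h3 h4
    norm_num [Nat.descFactorial] at h0 h1 h2 h3 h4
    funext j
    rcases j with i | ⟨a, b⟩
    · fin_cases i <;> (change c _ = 0; simp; linarith)
    · fin_cases a <;> fin_cases b <;> (change c _ = 0; simp; linarith)
  · have e : edgeNormalParams 4 = {1 / 2} := by simp [edgeNormalParams]
    rw [e]
    refine exists_hermiteBasis (by decide) (by norm_num) (by norm_num) (by norm_num)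
      (by simp [subdiv]) fun c hc => ?_
    change Fin 4 ⊕ (Fin 1 × Fin 1) → ℝ at c
    change ∀ j : HermiteIdx 2 {1 / 2}, ∑ i, c i * hermite j (splineBasis 3 2 2 i) = 0 at hc
    have h0 := hc (.inl (0, 0)); have h1 := hc (.inl (0, 1)); have h2 := hc (.inl (1, 0))
    have h3 := hc (.inl (1, 1)); have h4 := hc (.inr ⟨1 / 2, by simp⟩)
    simp only [hermite_splineBasis_end (show 2 ≤ 2 + 1 by norm_num)] at h0 h1 h2 h3
    simp [sum_sum_type, sum_prod_type, Fin.sum_univ_succ, splineBasisDeriv, tpow,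
      hermite, splineBasis] at h0 h1 h2 h3 h4
    norm_num [Nat.descFactorial] at h0 h1 h2 h3 h4
    funext j
    rcases j with i | ⟨a, b⟩
    · fin_cases i <;> (change c _ = 0; simp; linarith)
    · fin_cases a; fin_cases b; (change c _ = 0; simp; linarith)
  · have hk : subdiv p = 1 := by unfold subdiv; omega
    rw [hk]
    exact exists_hermiteBasis_polynomial (by omega) (by omega) (fun η => edgeNormalParams_mem)
      (by rw [card_edgeNormalParams h5]; omega)

lemma exists_crossBasis (hp : 3 ≤ p) :
    ∃ X, IsHermiteBasis p (p - 2) (subdiv p) 2 (faceParams p) X := by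
  rcases (show p = 3 ∨ p = 4 ∨ 5 ≤ p by omega) with rfl | rfl | h5
  · have e : faceParams 3 = {2 / 9, 4 / 9, 5 / 9, 7 / 9} := by simp [faceParams]
    rw [e]
    refine exists_hermiteBasis (by decide) (by norm_num) (by norm_num) (by norm_num)
      ?_ fun c hc => ?_
    · rw [Finset.card_insert_of_notMem, Finset.card_insert_of_notMem, Finset.card_insert_of_notMem,
        Finset.card_singleton] <;> norm_num [subdiv]
    change Fin 4 ⊕ (Fin 2 × Fin 2) → ℝ at c
    change ∀ j : HermiteIdx 2 {2 / 9, 4 / 9, 5 / 9, 7 / 9},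
      ∑ i, c i * hermite j (splineBasis 3 1 3 i) = 0 at hc
    have h0 := hc (.inl (0, 0)); have h1 := hc (.inl (0, 1)); have h2 := hc (.inl (1, 0))
    have h3 := hc (.inl (1, 1)); have h4 := hc (.inr ⟨2 / 9, by simp⟩)
    have h5 := hc (.inr ⟨4 / 9, by simp⟩); have h6 := hc (.inr ⟨5 / 9, by simp⟩)
    have h7 := hc (.inr ⟨7 / 9, by simp⟩)
    simp only [hermite_splineBasis_end (show 2 ≤ 1 + 1 by norm_num)] at h0 h1 h2 h3
    simp [sum_sum_type, sum_prod_type, Fin.sum_univ_succ, splineBasisDeriv, tpow,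
      hermite, splineBasis] at h0 h1 h2 h3 h4 h5 h6 h7
    norm_num [Nat.descFactorial] at h0 h1 h2 h3 h4 h5 h6 h7
    funext j
    rcases j with i | ⟨a, b⟩
    · fin_cases i <;> (change c _ = 0; simp; linarith)
    · fin_cases a <;> fin_cases b <;> (change c _ = 0; simp; linarith)
  · have e : faceParams 4 = {1 / 4, 2 / 4, 3 / 4} := by simp [faceParams]
    rw [e]
    refine exists_hermiteBasis (by decide) (by norm_num) (by norm_num) (by norm_num)
      ?_ fun c hc => ?_
    · rw [Finset.card_insert_of_notMem, Finset.card_insert_of_notMem,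
        Finset.card_singleton] <;> norm_num [subdiv]
    change Fin 5 ⊕ (Fin 1 × Fin 2) → ℝ at c
    change ∀ j : HermiteIdx 2 {1 / 4, 2 / 4, 3 / 4},
      ∑ i, c i * hermite j (splineBasis 4 2 2 i) = 0 at hc
    have h0 := hc (.inl (0, 0)); have h1 := hc (.inl (0, 1)); have h2 := hc (.inl (1, 0))
    have h3 := hc (.inl (1, 1)); have h4 := hc (.inr ⟨1 / 4, by simp⟩)
    have h5 := hc (.inr ⟨2 / 4, by simp⟩); have h6 := hc (.inr ⟨3 / 4, by simp⟩)
    simp only [hermite_splineBasis_end (show 2 ≤ 2 + 1 by norm_num)] at h0 h1 h2 h3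
    simp [sum_sum_type, sum_prod_type, Fin.sum_univ_succ, splineBasisDeriv, tpow,
      hermite, splineBasis] at h0 h1 h2 h3 h4 h5 h6
    norm_num [Nat.descFactorial] at h0 h1 h2 h3 h4 h5 h6
    funext j
    rcases j with i | ⟨a, b⟩
    · fin_cases i <;> (change c _ = 0; simp; linarith)
    · fin_cases a; fin_cases b <;> (change c _ = 0; simp; linarith)
  · have hk : subdiv p = 1 := by unfold subdiv; omega
    rw [hk]
    exact exists_hermiteBasis_polynomial (by omega) (by omega) (fun η => faceParams_mem)
      (by rw [card_faceParams h5]; omega)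

/-! ### Chain rule -/

/-- The linear functional `(x, y) ↦ a x + b y`. -/
def pairing (a b : ℝ) : ℝ × ℝ →L[ℝ] ℝ :=
  a • fst ℝ ℝ ℝ + b • snd ℝ ℝ ℝ

@[simp] lemma pairing_apply (a b : ℝ) (v) : pairing a b v = a * v.1 + b * v.2 := by
  simp [pairing]

lemma fderiv_tan {s t : ℝ} {u} {w} {a b : ℝ}
    (hu : DifferentiableAt ℝ u (param K s t)) (hw : HasFDerivAt w (pairing a b) (s, t))
    (huw : ∀ᶠ q in 𝓝 (s, t), u (param K q.1 q.2) = w q) :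
    fderiv ℝ u (param K s t) (tanS K t) = a ∧ fderiv ℝ u (param K s t) (tanT K s) = b := by
  have h1 : HasFDerivAt (fun q => u (param K q.1 q.2))
      ((fderiv ℝ u (param K s t)).comp (dparam K s t)) (s, t) :=
    HasFDerivAt.comp (s, t) (g := u) hu.hasFDerivAt (hasFDerivAt_param K s t)
  have h2 : HasFDerivAt (fun q => u (param K q.1 q.2)) (pairing a b) (s, t) :=
    hw.congr_of_eventuallyEq huw
  have h := h1.unique h2
  constructor
  · simpa using congrArg (fun L => L (1, 0)) h
  · simpa using congrArg (fun L => L (0, 1)) h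

/-- The directional derivative in terms of the coordinates of the parametrization. -/
def gradForm (K : Quad) (s t a b : ℝ) (z : Plane) : ℝ :=
  cross z (tanT K s) / jac K s t * a + cross (tanS K t) z / jac K s t * b

lemma apply_eq_gradForm {s t : ℝ} (h : jac K s t ≠ 0) (L : Plane →ₗ[ℝ] ℝ)
    (z) : L z = gradForm K s t (L (tanS K t)) (L (tanT K s)) z := by
  conv_lhs => rw [tan_decomp K s t h z]
  simp [gradForm]

lemma fderiv_eq_gradForm {s t : ℝ} (h : jac K s t ≠ 0) {u}
    {w} {a b : ℝ} (hu : DifferentiableAt ℝ u (param K s t))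
    (hw : HasFDerivAt w (pairing a b) (s, t))
    (huw : ∀ᶠ q in 𝓝 (s, t), u (param K q.1 q.2) = w q) (z) :
    fderiv ℝ u (param K s t) z = gradForm K s t a b z := by
  obtain ⟨h1, h2⟩ := fderiv_tan hu hw huw
  have := apply_eq_gradForm h (fderiv ℝ u (param K s t)).toLinearMap z
  simpa [h1, h2] using this

/-- The second derivative in terms of the coordinates of the parametrization. -/
def hessForm (K : Quad) (s t a b aa ab bb : ℝ) (z z' : Plane) : ℝ :=
  cross z (tanT K s) / jac K s t * (cross z' (tanT K s) / jac K s t) * aa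
  + (cross z (tanT K s) / jac K s t * (cross (tanS K t) z' / jac K s t)
    + cross (tanS K t) z / jac K s t * (cross z' (tanT K s) / jac K s t))
    * (ab - gradForm K s t a b (twist K))
  + cross (tanS K t) z / jac K s t * (cross (tanS K t) z' / jac K s t) * bb

lemma hasFDerivAt_tanS (K) (q) :
    HasFDerivAt (fun q => tanS K q.2)
      ((snd ℝ ℝ ℝ).smulRight (twist K)) q := by
  have h2 : HasFDerivAt (fun q => q.2) (snd ℝ ℝ ℝ) q := hasFDerivAt_snd
  have := ((h2.const_sub 1).smul_const (K 1 - K 0)).add (h2.smul_const (K 2 - K 3))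
  refine HasFDerivAt.congr_fderiv this ?_
  ext v <;> simp [twist]; ring

lemma hasFDerivAt_tanT (K) (q) :
    HasFDerivAt (fun q => tanT K q.1)
      ((fst ℝ ℝ ℝ).smulRight (twist K)) q := by
  have h2 : HasFDerivAt (fun q => q.1) (fst ℝ ℝ ℝ) q := hasFDerivAt_fst
  have := ((h2.const_sub 1).smul_const (K 3 - K 0)).add (h2.smul_const (K 2 - K 1))
  refine HasFDerivAt.congr_fderiv this ?_
  ext v <;> simp [twist]; ring

lemma fderiv_fderiv_eq_hessForm {s t : ℝ} (h : jac K s t ≠ 0) {u}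
    {w wa wb} {aa ab ba bb : ℝ} (hu : ContDiffAt ℝ 2 u (param K s t))
    (hw : ∀ᶠ q in 𝓝 (s, t), HasFDerivAt w (pairing (wa q) (wb q)) q)
    (hwa : HasFDerivAt wa (pairing aa ab) (s, t)) (hwb : HasFDerivAt wb (pairing ba bb) (s, t))
    (huw : ∀ᶠ q in 𝓝 (s, t), u (param K q.1 q.2) = w q) (z z') :
    fderiv ℝ (fderiv ℝ u) (param K s t) z z' =
      hessForm K s t (wa (s, t)) (wb (s, t)) aa ab bb z z' := by
  set x := param K s t with hx
  have hcp : Tendsto (fun q => param K q.1 q.2) (𝓝 (s, t)) (𝓝 x) :=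
    (contDiff_param K (n := 0)).continuous.tendsto _
  have hu1 : ∀ᶠ y in 𝓝 x, DifferentiableAt ℝ u y :=
    (hu.eventually (by simp)).mono fun y hy => hy.differentiableAt (by norm_num)
  have hev : ∀ᶠ q in 𝓝 (s, t), fderiv ℝ u (param K q.1 q.2) (tanS K q.2) = wa q ∧
      fderiv ℝ u (param K q.1 q.2) (tanT K q.1) = wb q := by
    filter_upwards [hcp.eventually hu1, hw, huw.eventually_nhds] with q h1 h2 h3
    exact fderiv_tan h1 h2 h3
  have hd : DifferentiableAt ℝ (fderiv ℝ u) x :=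
    (hu.fderiv_right (m := 1) (by norm_num)).differentiableAt (by norm_num)
  have hcomp : HasFDerivAt (fun q => fderiv ℝ u (param K q.1 q.2))
      ((fderiv ℝ (fderiv ℝ u) x).comp (dparam K s t)) (s, t) :=
    HasFDerivAt.comp (s, t) (g := fderiv ℝ u) hd.hasFDerivAt (hasFDerivAt_param K s t)
  have hS := (hcomp.clm_apply (hasFDerivAt_tanS K (s, t))).congr_of_eventuallyEq
    (hev.mono fun q hq => hq.1.symm)
  have hT := (hcomp.clm_apply (hasFDerivAt_tanT K (s, t))).congr_of_eventuallyEq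
    (hev.mono fun q hq => hq.2.symm)
  have eS := hS.unique hwa
  have eT := hT.unique hwb
  have e1 := congrArg (fun L => L (1, 0)) eS
  have e2 := congrArg (fun L => L (0, 1)) eS
  have e3 := congrArg (fun L => L (0, 1)) eT
  simp at e1 e2 e3
  have hsym : ∀ a b, fderiv ℝ (fderiv ℝ u) x a b = fderiv ℝ (fderiv ℝ u) x b a := fun a b =>
    (hu.isSymmSndFDerivAt (by simp)) a b
  have etw : fderiv ℝ u x (twist K) = gradForm K s t (wa (s, t)) (wb (s, t)) (twist K) :=
    fderiv_eq_gradForm h hu1.self_of_nhds hw.self_of_nhds huw _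
  rw [etw] at e2
  set B := fderiv ℝ (fderiv ℝ u) x
  have e4 : B (tanT K s) (tanS K t) =
      ab - gradForm K s t (wa (s, t)) (wb (s, t)) (twist K) := by linarith
  have e5 := hsym (tanT K s) (tanS K t)
  rw [hessForm, ← e4, ← e1, ← e3]
  conv_lhs => rw [tan_decomp K s t h z, tan_decomp K s t h z']
  simp only [map_add, map_smul, add_apply, smul_apply,
    smul_eq_mul]
  rw [← e5]
  ring

lemma partialD_partialD {u} {x} (hu : ContDiffAt ℝ 2 u x) (i j) :
    partialD i (partialD j u) x =
      fderiv ℝ (fderiv ℝ u) x (single i 1) (single j 1) := by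
  have hd : DifferentiableAt ℝ (fderiv ℝ u) x :=
    (hu.fderiv_right (m := 1) (by norm_num)).differentiableAt (by norm_num)
  have := (hd.hasFDerivAt.clm_apply (hasFDerivAt_const (single j (1 : ℝ)) x)).fderiv
  unfold partialD
  rw [this]
  simp

/-! ### Local degrees of freedom -/

/-- Local data on a cell: jets at the corners, values and normal derivatives on the sides, and
values in the interior. -/
abbrev CellData : Type :=
  (Fin 4 → ℕ → ℕ → ℝ) × (Fin 4 → ℝ → ℝ) × (Fin 4 → ℝ → ℝ) × (ℝ → ℝ → ℝ)

namespace CellData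

variable (D : CellData)

/-- The derivative at the corner `i` in the direction `z`. -/
def grad (i : Fin 4) (z : Plane) : ℝ := D.1 i 1 0 * z 0 + D.1 i 0 1 * z 1

/-- The second derivative at the corner `i` in the directions `z`, `z'`. -/
def hess (i : Fin 4) (z z' : Plane) : ℝ :=
  D.1 i 2 0 * (z 0 * z' 0) + D.1 i 1 1 * (z 0 * z' 1 + z 1 * z' 0) + D.1 i 0 2 * (z 1 * z' 1)

/-- The data with renumbered corners and sides. -/
def rot (i : Fin 4) : CellData :=
  (fun j => D.1 (j + i), fun j => D.2.1 (j + i), fun j => D.2.2.1 (j + i), D.2.2.2)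

end CellData

/-- The basis of the space of traces. -/
def traceBasis (p : ℕ) : HermiteIdx 3 (edgeValueParams p) → ℝ → ℝ :=
  Classical.epsilon (IsHermiteBasis p (p - 1) (subdiv p) 3 (edgeValueParams p))

/-- The basis of the space of normal derivatives. -/
def normalBasis (p : ℕ) : HermiteIdx 2 (edgeNormalParams p) → ℝ → ℝ :=
  Classical.epsilon (IsHermiteBasis (p - 1) (p - 2) (subdiv p) 2 (edgeNormalParams p))

/-- The univariate basis of the tensor product space. -/
def crossBasis (p : ℕ) : HermiteIdx 2 (faceParams p) → ℝ → ℝ :=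
  Classical.epsilon (IsHermiteBasis p (p - 2) (subdiv p) 2 (faceParams p))

lemma traceBasis_spec (hp : 3 ≤ p) :
    IsHermiteBasis p (p - 1) (subdiv p) 3 (edgeValueParams p) (traceBasis p) :=
  Classical.epsilon_spec (exists_traceBasis hp)

lemma normalBasis_spec (hp : 3 ≤ p) :
    IsHermiteBasis (p - 1) (p - 2) (subdiv p) 2 (edgeNormalParams p) (normalBasis p) :=
  Classical.epsilon_spec (exists_normalBasis hp)

lemma crossBasis_spec (hp : 3 ≤ p) :
    IsHermiteBasis p (p - 2) (subdiv p) 2 (faceParams p) (crossBasis p) :=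
  Classical.epsilon_spec (exists_crossBasis hp)

/-- The number of the corner `b` of the side `0`. -/
def sideCorner : Fin 2 → Fin 4 := ![0, 1]

/-- The Hermite data of the trace on the side `0`. -/
def traceCoef (p : ℕ) (K : Quad) (D : CellData) :
    HermiteIdx 3 (edgeValueParams p) → ℝ
  | .inl (b, l) => ![D.1 (sideCorner b) 0 0, D.grad (sideCorner b) (K 1 - K 0),
      D.hess (sideCorner b) (K 1 - K 0) (K 1 - K 0)] l
  | .inr η => D.2.1 0 η

/-- The Hermite data of the normal derivative on the side `0`. -/
def normalCoef (p : ℕ) (K : Quad) (D : CellData) :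
    HermiteIdx 2 (edgeNormalParams p) → ℝ
  | .inl (b, l) => ![D.grad (sideCorner b) (unitNormal (K 0) (K 1)),
      D.hess (sideCorner b) (K 1 - K 0) (unitNormal (K 0) (K 1))] l
  | .inr η => D.2.2.1 0 η

/-- The trace on the side `0`. -/
def traceFn (p : ℕ) (K : Quad) (D : CellData) (τ : ℝ) : ℝ :=
  ∑ j, traceCoef p K D j * traceBasis p j τ

/-- The normal derivative on the side `0`. -/
def normalFn (p : ℕ) (K : Quad) (D : CellData) (τ : ℝ) : ℝ :=
  ∑ j, normalCoef p K D j * normalBasis p j τ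

/-- The Euclidean product, in coordinates. -/
def dot (v w : Plane) : ℝ := v 0 * w 0 + v 1 * w 1

/-- The derivative `∂ₜ` of the coordinate function on the side `0`. -/
def crossFn (p : ℕ) (K : Quad) (D : CellData) (τ : ℝ) : ℝ :=
  cross (K 1 - K 0) (tanT K τ) / dist (K 0) (K 1) * normalFn p K D τ
    + dot (K 1 - K 0) (tanT K τ) / dist (K 0) (K 1) ^ 2 * deriv (traceFn p K D) τ

lemma spline_traceFn (hp : 3 ≤ p) (K) (D) :
    Spline p (p - 1) (subdiv p) (traceFn p K D) := (traceBasis_spec hp).spline_sum _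

lemma spline_normalFn (hp : 3 ≤ p) (K) (D) :
    Spline (p - 1) (p - 2) (subdiv p) (normalFn p K D) := (normalBasis_spec hp).spline_sum _

lemma cross_tanT (K) (v) (τ : ℝ) :
    cross v (tanT K τ) = cross v (K 3 - K 0) + cross v (twist K) * τ := by
  simp [cross, tanT, twist]; ring

lemma dot_tanT (K) (v) (τ : ℝ) :
    dot v (tanT K τ) = dot v (K 3 - K 0) + dot v (twist K) * τ := by
  simp [dot, tanT, twist]; ring

lemma spline_crossFn (hp : 3 ≤ p) (K) (D) :
    Spline p (p - 2) (subdiv p) (crossFn p K D) := by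
  have hT := spline_traceFn hp K D
  have hG := spline_normalFn hp K D
  obtain ⟨q, rfl⟩ : ∃ q, p = q + 3 := ⟨p - 3, by omega⟩
  have hT' : Spline (q + 2) (q + 1) (subdiv (q + 3)) (deriv (traceFn (q + 3) K D)) := Spline.deriv hT
  have h1 := (hG.affine_mul (cross (K 1 - K 0) (K 3 - K 0)) (cross (K 1 - K 0) (twist K))).const_mul
    (dist (K 0) (K 1))⁻¹
  have h2 := (hT'.affine_mul (dot (K 1 - K 0) (K 3 - K 0)) (dot (K 1 - K 0) (twist K))).const_mul
    (dist (K 0) (K 1) ^ 2)⁻¹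
  have e : crossFn (q + 3) K D = _ := funext fun τ => by
    rw [crossFn, cross_tanT, dot_tanT, div_mul_eq_mul_div, div_mul_eq_mul_div,
      div_eq_inv_mul, div_eq_inv_mul]
  rw [e]
  exact h1.add h2

lemma hermite_traceFn (hp : 3 ≤ p) (K) (D) (j) :
    hermite j (traceFn p K D) = traceCoef p K D j :=
  (traceBasis_spec hp).hermite_sum (by omega) _ _

lemma hermite_normalFn (hp : 3 ≤ p) (K) (D) (j) :
    hermite j (normalFn p K D) = normalCoef p K D j :=
  (normalBasis_spec hp).hermite_sum (by omega) _ _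

lemma traceFn_end (hp : 3 ≤ p) (K) (D) (b : Fin 2) :
    traceFn p K D (b : ℕ) = D.1 (sideCorner b) 0 0 ∧
    deriv (traceFn p K D) (b : ℕ) = D.grad (sideCorner b) (K 1 - K 0) ∧
    iteratedDeriv 2 (traceFn p K D) (b : ℕ) = D.hess (sideCorner b) (K 1 - K 0) (K 1 - K 0) := by
  have h0 := hermite_traceFn hp K D (.inl (b, 0))
  have h1 := hermite_traceFn hp K D (.inl (b, 1))
  have h2 := hermite_traceFn hp K D (.inl (b, 2))
  simp [hermite, traceCoef] at h0 h1 h2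
  exact ⟨h0, h1, h2⟩

lemma normalFn_end (hp : 3 ≤ p) (K) (D) (b : Fin 2) :
    normalFn p K D (b : ℕ) = D.grad (sideCorner b) (unitNormal (K 0) (K 1)) ∧
    deriv (normalFn p K D) (b : ℕ) =
      D.hess (sideCorner b) (K 1 - K 0) (unitNormal (K 0) (K 1)) := by
  have h0 := hermite_normalFn hp K D (.inl (b, 0))
  have h1 := hermite_normalFn hp K D (.inl (b, 1))
  simp [hermite, normalCoef] at h0 h1
  exact ⟨h0, h1⟩

lemma ConvexQuad.ne (hK : ConvexQuad K) (i) : K i ≠ K (i + 1) := by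
  intro h
  have := hK i
  rw [h, sub_self] at this
  simp [cross] at this

lemma dist_sq (x y) : dist x y ^ 2 = dot (y - x) (y - x) := by
  rw [dist_comm, dist_eq_norm, norm_sq_eq]
  simp [dot, Fin.sum_univ_two]; ring

/-- Decomposition into a tangential and a normal part. -/
lemma side_decomp {x y} (h : x ≠ y) (v) :
    v = (dot (y - x) v / dist x y ^ 2) • (y - x)
      + (cross (y - x) v / dist x y) • unitNormal x y := by
  have h0 : dist x y ≠ 0 := dist_ne_zero.2 h
  have h2 := dist_sq x y
  have h3 : dist x y ^ 2 ≠ 0 := pow_ne_zero 2 h0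
  ext i
  rw [unitNormal, smul_smul, div_mul_eq_mul_div, div_eq_mul_inv (cross _ _ * _),
    mul_assoc, ← mul_inv, ← pow_two, ← div_eq_mul_inv]
  simp only [PiLp.add_apply, PiLp.smul_apply, smul_eq_mul]
  field_simp
  rw [h2]
  fin_cases i <;> simp [dot, cross] <;> ring

lemma CellData.grad_add (D : CellData) (i) (a b : ℝ) (v w) :
    D.grad i (a • v + b • w) = a * D.grad i v + b * D.grad i w := by
  simp [grad]; ring

lemma CellData.hess_add (D : CellData) (i) (a b : ℝ) (z v w) :
    D.hess i z (a • v + b • w) = a * D.hess i z v + b * D.hess i z w := by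
  simp [hess]; ring

lemma crossFn_end (hp : 3 ≤ p) (hK : ConvexQuad K) (D)
    (b : Fin 2) :
    crossFn p K D (b : ℕ) = D.grad (sideCorner b) (tanT K (b : ℕ)) ∧
    deriv (crossFn p K D) (b : ℕ) =
      D.hess (sideCorner b) (K 1 - K 0) (tanT K (b : ℕ)) + D.grad (sideCorner b) (twist K) := by
  obtain ⟨t0, t1, t2⟩ := traceFn_end hp K D b
  obtain ⟨n0, n1⟩ := normalFn_end hp K D b
  have hne : K 0 ≠ K 1 := hK.ne 0
  constructor
  · rw [crossFn, n0, t1]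
    conv_rhs => rw [side_decomp hne (tanT K (b : ℕ)), CellData.grad_add]
    ring
  · have hT := spline_traceFn hp K D
    have hG := spline_normalFn hp K D
    obtain ⟨q, rfl⟩ : ∃ q, p = q + 3 := ⟨p - 3, by omega⟩
    have hT' : Spline (q + 2) (q + 1) (subdiv (q + 3)) (deriv (traceFn (q + 3) K D)) :=
      Spline.deriv hT
    have d1 : HasDerivAt (normalFn (q + 3) K D) (D.hess (sideCorner b) (K 1 - K 0)
        (unitNormal (K 0) (K 1))) (b : ℕ) := by
      rw [← n1]
      exact (hG.1.differentiable (by simp) _).hasDerivAt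
    have d2 : HasDerivAt (deriv (traceFn (q + 3) K D))
        (D.hess (sideCorner b) (K 1 - K 0) (K 1 - K 0)) (b : ℕ) := by
      rw [← t2, iteratedDeriv_succ, iteratedDeriv_one]
      exact (hT'.1.differentiable (by simp) _).hasDerivAt
    have d3 : HasDerivAt (fun τ => cross (K 1 - K 0) (tanT K τ) / dist (K 0) (K 1))
        (cross (K 1 - K 0) (twist K) / dist (K 0) (K 1)) (b : ℕ) := by
      simp only [cross_tanT]
      have := ((hasDerivAt_id (((b : ℕ) : ℝ))).const_mul (cross (K 1 - K 0) (twist K))).const_add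
        (cross (K 1 - K 0) (K 3 - K 0))
      simpa using this.div_const (dist (K 0) (K 1))
    have d4 : HasDerivAt (fun τ => dot (K 1 - K 0) (tanT K τ) / dist (K 0) (K 1) ^ 2)
        (dot (K 1 - K 0) (twist K) / dist (K 0) (K 1) ^ 2) (b : ℕ) := by
      simp only [dot_tanT]
      have := ((hasDerivAt_id (((b : ℕ) : ℝ))).const_mul (dot (K 1 - K 0) (twist K))).const_add
        (dot (K 1 - K 0) (K 3 - K 0))
      simpa using this.div_const (dist (K 0) (K 1) ^ 2)
    have := ((d3.mul d1).add (d4.mul d2)).deriv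
    change deriv (crossFn (q + 3) K D) _ = _ at this
    rw [this, n0, t1]
    conv_rhs => rw [side_decomp hne (tanT K (b : ℕ)), CellData.hess_add,
      side_decomp hne (twist K), CellData.grad_add]
    ring

/-! ### The interpolant on a cell -/

/-- The number of the corner `(b, b')` of the unit square. -/
def cornerIdx (b b' : Fin 2) : Fin 4 := ![![0, 3], ![1, 2]] b b'

/-- The coefficients of the interpolant in the tensor product basis. -/
def tensorCoef (p : ℕ) (K : Quad) (D : CellData) :
    HermiteIdx 2 (faceParams p) → HermiteIdx 2 (faceParams p) → ℝ
  | .inl (b, l), .inl (b', l') =>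
    ![![D.1 (cornerIdx b b') 0 0, D.grad (cornerIdx b b') (tanT K (b : ℕ))],
      ![D.grad (cornerIdx b b') (tanS K (b' : ℕ)),
        D.hess (cornerIdx b b') (tanS K (b' : ℕ)) (tanT K (b : ℕ))
          + D.grad (cornerIdx b b') (twist K)]] l l'
  | .inr η, .inl (b', l') =>
    ![![traceFn p K D η, crossFn p K D η],
      ![traceFn p (rot 2 K) (D.rot 2) (1 - η), -crossFn p (rot 2 K) (D.rot 2) (1 - η)]] b' l'
  | .inl (b, l), .inr η =>
    ![![traceFn p (rot 3 K) (D.rot 3) (1 - η), crossFn p (rot 3 K) (D.rot 3) (1 - η)],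
      ![traceFn p (rot 1 K) (D.rot 1) η, -crossFn p (rot 1 K) (D.rot 1) η]] b l
  | .inr ξ, .inr η => D.2.2.2 ξ η

/-- The partial derivatives of the interpolant in the coordinates of the parametrization. -/
def interpD (p : ℕ) (K : Quad) (D : CellData) (l l' : ℕ) (s t : ℝ) : ℝ :=
  ∑ i, ∑ j, tensorCoef p K D i j * iteratedDeriv l (crossBasis p i) s
    * iteratedDeriv l' (crossBasis p j) t

/-- The boundary functions on the sides `t = b'`, as functions of `s`. -/
def sideRow (p : ℕ) (K : Quad) (D : CellData) (b' l' : Fin 2) : ℝ → ℝ :=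
  ![![traceFn p K D, crossFn p K D],
    ![fun s => traceFn p (rot 2 K) (D.rot 2) (1 - s),
      fun s => -1 * crossFn p (rot 2 K) (D.rot 2) (1 - s)]] b' l'

/-- The boundary functions on the sides `s = b`, as functions of `t`. -/
def sideCol (p : ℕ) (K : Quad) (D : CellData) (b l : Fin 2) : ℝ → ℝ :=
  ![![fun t => traceFn p (rot 3 K) (D.rot 3) (1 - t),
      fun t => crossFn p (rot 3 K) (D.rot 3) (1 - t)],
    ![traceFn p (rot 1 K) (D.rot 1), fun t => -1 * crossFn p (rot 1 K) (D.rot 1) t]] b l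

lemma spline_traceFn' (hp : 3 ≤ p) (K) (D) :
    Spline p (p - 2) (subdiv p) (traceFn p K D) :=
  (spline_traceFn hp K D).mono le_rfl (by omega)

lemma spline_sideRow (hp : 3 ≤ p) (K) (D) (b' l') :
    Spline p (p - 2) (subdiv p) (sideRow p K D b' l') := by
  fin_cases b' <;> fin_cases l'
  · exact spline_traceFn' hp K D
  · exact spline_crossFn hp K D
  · exact (spline_traceFn' hp _ _).flip
  · exact (spline_crossFn hp _ _).flip.const_mul (-1)

lemma spline_sideCol (hp : 3 ≤ p) (K) (D) (b l) :
    Spline p (p - 2) (subdiv p) (sideCol p K D b l) := by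
  fin_cases b <;> fin_cases l
  · exact (spline_traceFn' hp _ _).flip
  · exact (spline_crossFn hp _ _).flip
  · exact spline_traceFn' hp _ _
  · exact (spline_crossFn hp _ _).const_mul (-1)

lemma deriv_flip (f : ℝ → ℝ) (s : ℝ) : deriv (fun s => f (1 - s)) s = -deriv f (1 - s) :=
  deriv_comp_const_sub f 1 s

lemma hermite_sideRow (hp : 3 ≤ p) (hK : ConvexQuad K) (D)
    (b' l') (i) : hermite i (sideRow p K D b' l') = tensorCoef p K D i (.inl (b', l')) := by
  rcases i with ⟨b, l⟩ | η
  · have t0 := traceFn_end hp K D b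
    have c0 := crossFn_end hp hK D b
    have t2 := traceFn_end hp (rot 2 K) (D.rot 2) (1 - b)
    have c2 := crossFn_end hp (hK.rot 2) (D.rot 2) (1 - b)
    fin_cases b <;> fin_cases l <;> fin_cases b' <;> fin_cases l' <;>
      simp [hermite, sideRow, tensorCoef, deriv_flip, iteratedDeriv_one, sideCorner, cornerIdx,
        CellData.grad, CellData.hess, CellData.rot, tanS, tanT, rot, twist] at t0 c0 t2 c2 ⊢ <;>
      simp only [t0, c0, t2, c2] <;> ring
  · fin_cases b' <;> fin_cases l' <;> simp [hermite, sideRow, tensorCoef]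

lemma hermite_sideCol (hp : 3 ≤ p) (hK : ConvexQuad K) (D)
    (b l) (j) : hermite j (sideCol p K D b l) = tensorCoef p K D (.inl (b, l)) j := by
  rcases j with ⟨b', l'⟩ | η
  · have t1 := traceFn_end hp (rot 1 K) (D.rot 1) b'
    have c1 := crossFn_end hp (hK.rot 1) (D.rot 1) b'
    have t3 := traceFn_end hp (rot 3 K) (D.rot 3) (1 - b')
    have c3 := crossFn_end hp (hK.rot 3) (D.rot 3) (1 - b')
    fin_cases b <;> fin_cases l <;> fin_cases b' <;> fin_cases l' <;>
      simp [hermite, sideCol, tensorCoef, deriv_flip, iteratedDeriv_one, sideCorner, cornerIdx,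
        CellData.grad, CellData.hess, CellData.rot, tanS, tanT, rot, twist] at t1 c1 t3 c3 ⊢ <;>
      simp only [t1, c1, t3, c3] <;> ring
  · fin_cases b <;> fin_cases l <;> simp [hermite, sideCol, tensorCoef]

lemma iteratedDeriv_eq_of_eqOn {f g : ℝ → ℝ} {l : ℕ} {s} (h : EqOn f g I)
    (hs : s ∈ I) (hf : ContDiffAt ℝ l f s) (hg : ContDiffAt ℝ l g s) :
    iteratedDeriv l f s = iteratedDeriv l g s := by
  have hu := uniqueDiffOn_Icc_zero_one
  rw [← iteratedDerivWithin_eq_iteratedDeriv hu hf hs,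
    ← iteratedDerivWithin_eq_iteratedDeriv hu hg hs]
  exact iteratedDerivWithin_congr h hs

lemma Spline.contDiffAt {d r k l} {f} (hf : Spline d r k f) {s : ℝ}
    (h : l ≤ r ∨ NotKnot k s) : ContDiffAt ℝ l f s := by
  rcases h with h | h
  · exact (hf.1.of_le (by exact_mod_cast h)).contDiffAt
  · exact (hf.2.2 s h).of_le (by exact_mod_cast le_top)

lemma notKnot_end (k) (b : Fin 2) : NotKnot k (b : ℕ) := by
  intro i h0 hi
  have hi0 : (0 : ℝ) < i := by exact_mod_cast h0
  have hk : (0 : ℝ) < k := by exact_mod_cast h0.trans hi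
  have hik : (i : ℝ) < k := by exact_mod_cast hi
  fin_cases b
  · exact fun h => (div_pos hi0 hk).ne (by simpa using h)
  · have : (i : ℝ) / k < 1 := by rwa [div_lt_one hk]
    simpa using this.ne'

lemma iteratedDeriv_sum_crossBasis {p l} (hp : 3 ≤ p) (c : HermiteIdx 2 (faceParams p) → ℝ)
    {s : ℝ} (h : l ≤ p - 2 ∨ NotKnot (subdiv p) s) :
    iteratedDeriv l (fun s => ∑ i, c i * crossBasis p i s) s =
      ∑ i, c i * iteratedDeriv l (crossBasis p i) s := by
  rw [iteratedDeriv_fun_sum fun i _ => contDiffAt_const.mul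
    (((crossBasis_spec hp).1 i).contDiffAt h)]
  exact sum_congr rfl fun i _ => by rw [iteratedDeriv_const_mul_field]

lemma interpD_row {p l} (hp : 3 ≤ p) (hK : ConvexQuad K) (D)
    (b' l' : Fin 2) {s} (hs : s ∈ I) (h : l ≤ p - 2 ∨ NotKnot (subdiv p) s) :
    interpD p K D l l' s (b' : ℕ) = iteratedDeriv l (sideRow p K D b' l') s := by
  have hX := crossBasis_spec hp
  have hδ : ∀ j, iteratedDeriv l' (crossBasis p j) ((b' : ℕ) : ℝ) =
      if (.inl (b', l')) = j then 1 else 0 := fun j => by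
    have := hX.2.1 (.inl (b', l')) j
    simpa [hermite] using this
  have h1 : EqOn (sideRow p K D b' l')
      (fun s => ∑ i, tensorCoef p K D i (.inl (b', l')) * crossBasis p i s) I := by
    intro s hs
    rw [hX.2.2 _ (spline_sideRow hp K D b' l') s hs]
    simp only [hermite_sideRow hp hK]
  rw [iteratedDeriv_eq_of_eqOn h1 hs ((spline_sideRow hp K D b' l').contDiffAt h)
    ((hX.spline_sum _).contDiffAt h), iteratedDeriv_sum_crossBasis hp _ h, interpD]
  simp [hδ]

lemma interpD_col {p l'} (hp : 3 ≤ p) (hK : ConvexQuad K) (D)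
    (b l : Fin 2) {t} (ht : t ∈ I) (h : l' ≤ p - 2 ∨ NotKnot (subdiv p) t) :
    interpD p K D l l' (b : ℕ) t = iteratedDeriv l' (sideCol p K D b l) t := by
  have hX := crossBasis_spec hp
  have hδ : ∀ j, iteratedDeriv l (crossBasis p j) ((b : ℕ) : ℝ) =
      if (.inl (b, l)) = j then 1 else 0 := fun j => by
    have := hX.2.1 (.inl (b, l)) j
    simpa [hermite] using this
  have h1 : EqOn (sideCol p K D b l)
      (fun s => ∑ i, tensorCoef p K D (.inl (b, l)) i * crossBasis p i s) I := by
    intro s hs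
    rw [hX.2.2 _ (spline_sideCol hp K D b l) s hs]
    simp only [hermite_sideCol hp hK]
  rw [iteratedDeriv_eq_of_eqOn h1 ht ((spline_sideCol hp K D b l).contDiffAt h)
    ((hX.spline_sum _).contDiffAt h), iteratedDeriv_sum_crossBasis hp _ h, interpD]
  simp [hδ]

lemma interpD_face (hp : 3 ≤ p) (K) (D) {ξ η : ℝ}
    (hξ : ξ ∈ faceParams p) (hη : η ∈ faceParams p) : interpD p K D 0 0 ξ η = D.2.2.2 ξ η := by
  have hX := crossBasis_spec hp
  have hδ : ∀ (ζ : faceParams p) j, crossBasis p j ζ = if (.inr ζ) = j then 1 else 0 :=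
    fun ζ j => hX.2.1 (.inr ζ) j
  have h1 := hδ ⟨ξ, hξ⟩
  have h2 := hδ ⟨η, hη⟩
  simp only at h1 h2
  simp [interpD, h1, h2, tensorCoef]

lemma contDiffAt_iteratedDeriv {s : ℝ} {n} (l) :
    ∀ {f : ℝ → ℝ}, ContDiffAt ℝ (l + n : ℕ) f s → ContDiffAt ℝ n (iteratedDeriv l f) s := by
  induction l with
  | zero => intro f h; simpa using h
  | succ l ih =>
    intro f h
    rw [iteratedDeriv_succ']
    have h1 : ContDiffAt ℝ (l + n : ℕ) (fderiv ℝ f) s := h.fderiv_right (by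
      rw [show l + 1 + n = l + n + 1 by ring]; exact le_rfl)
    have : deriv f = fun x => fderiv ℝ f x 1 := by ext x; simp
    rw [this] at *
    exact ih (h1.clm_apply contDiffAt_const)

lemma hasDerivAt_iteratedDeriv {f : ℝ → ℝ} {l} {s : ℝ} (h : ContDiffAt ℝ (l + 1 : ℕ) f s) :
    HasDerivAt (iteratedDeriv l f) (iteratedDeriv (l + 1) f s) s := by
  rw [iteratedDeriv_succ]
  refine DifferentiableAt.hasDerivAt ?_
  exact (contDiffAt_iteratedDeriv l h).differentiableAt (by simp)

lemma hasFDerivAt_interpD {p l l'} (hp : 3 ≤ p) (K) (D) {s t : ℝ}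
    (hs : l + 1 ≤ p - 2 ∨ NotKnot (subdiv p) s) (ht : l' + 1 ≤ p - 2 ∨ NotKnot (subdiv p) t) :
    HasFDerivAt (fun q => interpD p K D l l' q.1 q.2)
      (pairing (interpD p K D (l + 1) l' s t) (interpD p K D l (l' + 1) s t)) (s, t) := by
  have hX := crossBasis_spec hp
  have h1 : ∀ i, HasFDerivAt (fun q => iteratedDeriv l (crossBasis p i) q.1)
      (iteratedDeriv (l + 1) (crossBasis p i) s • fst ℝ ℝ ℝ) (s, t) := fun i =>
    HasDerivAt.comp_hasFDerivAt (f := Prod.fst) (s, t)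
      (hasDerivAt_iteratedDeriv ((hX.1 i).contDiffAt hs)) hasFDerivAt_fst
  have h2 : ∀ i, HasFDerivAt (fun q => iteratedDeriv l' (crossBasis p i) q.2)
      (iteratedDeriv (l' + 1) (crossBasis p i) t • snd ℝ ℝ ℝ) (s, t) := fun i =>
    HasDerivAt.comp_hasFDerivAt (f := Prod.snd) (s, t)
      (hasDerivAt_iteratedDeriv ((hX.1 i).contDiffAt ht)) hasFDerivAt_snd
  have := HasFDerivAt.fun_sum (u := Finset.univ) fun i _ =>
    HasFDerivAt.fun_sum (u := Finset.univ) fun j _ =>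
      (((h1 i).const_mul (tensorCoef p K D i j)).mul (h2 j))
  refine HasFDerivAt.congr_fderiv this ?_
  ext <;> simp only [interpD, pairing] <;>
    simp [mul_comm, mul_assoc, -sum_sum_type]

lemma contDiff_interp (hp : 3 ≤ p) (K) (D) :
    ContDiff ℝ (p - 2 : ℕ) fun q : ℝ × ℝ => interpD p K D 0 0 q.1 q.2 := by
  have hX := crossBasis_spec hp
  simp only [interpD, iteratedDeriv_zero]
  refine ContDiff.sum fun i _ => ContDiff.sum fun j _ => ?_
  have h1 := (hX.1 i).1
  have h2 := (hX.1 j).1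
  fun_prop

lemma contDiffAt_interp (hp : 3 ≤ p) (K) (D) {s t : ℝ}
    (hs : NotKnot (subdiv p) s) (ht : NotKnot (subdiv p) t) :
    ContDiffAt ℝ ∞ (fun q => interpD p K D 0 0 q.1 q.2) (s, t) := by
  have hX := crossBasis_spec hp
  simp only [interpD, iteratedDeriv_zero]
  refine ContDiffAt.sum fun i _ => ContDiffAt.sum fun j _ => ?_
  have h1 : ContDiffAt ℝ ∞ (fun q => crossBasis p i q.1) (s, t) :=
    ContDiffAt.comp (s, t) (f := fun q => q.1) ((hX.1 i).2.2 s hs) (by fun_prop)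
  have h2 : ContDiffAt ℝ ∞ (fun q => crossBasis p j q.2) (s, t) :=
    ContDiffAt.comp (s, t) (f := fun q => q.2) ((hX.1 j).2.2 t ht) (by fun_prop)
  fun_prop

lemma continuousAt_interpD {p l l'} (hp : 3 ≤ p) (K) (D) {s t : ℝ}
    (hs : l ≤ p - 2 ∨ NotKnot (subdiv p) s) (ht : l' ≤ p - 2 ∨ NotKnot (subdiv p) t) :
    ContinuousAt (fun q => interpD p K D l l' q.1 q.2) (s, t) := by
  have hX := crossBasis_spec hp
  have key : ∀ {l : ℕ} {s : ℝ}, (l ≤ p - 2 ∨ NotKnot (subdiv p) s) → ∀ i,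
      ContinuousAt (iteratedDeriv l (crossBasis p i)) s := fun h i => by
    exact (contDiffAt_iteratedDeriv (n := 0) _ ((hX.1 i).contDiffAt h)).continuousAt
  unfold interpD
  refine tendsto_finsetSum _ fun i _ => tendsto_finsetSum _ fun j _ => ?_
  refine (tendsto_const_nhds.mul ?_).mul ?_
  · exact (key hs i).tendsto.comp (continuous_fst.tendsto (s, t))
  · exact (key ht j).tendsto.comp (continuous_snd.tendsto (s, t))

lemma continuous_interpD {p l l'} (hp : 3 ≤ p) (K) (D)
    (hl : l ≤ 1) (hl' : l' ≤ 1) : Continuous fun q : ℝ × ℝ => interpD p K D l l' q.1 q.2 :=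
  continuous_iff_continuousAt.2 fun q =>
    continuousAt_interpD hp K D (s := q.1) (t := q.2) (.inl (by omega)) (.inl (by omega))

/-! ### Values and gradients of the interpolant on the boundary -/

lemma NotKnot.eventually {k} {s : ℝ} (h : NotKnot k s) : ∀ᶠ s' in 𝓝 s, NotKnot k s' := by
  have : ∀ i ∈ Finset.range k, ∀ᶠ s' in 𝓝 s, 0 < i → s' ≠ (i : ℝ) / k := fun i hi => by
    by_cases h0 : 0 < i
    · filter_upwards [isOpen_ne.mem_nhds (h i h0 (Finset.mem_range.1 hi))] with s' hs _ using hs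
    · exact Eventually.of_forall fun _ hc => absurd hc h0
  filter_upwards [(Finset.eventually_all (Finset.range k)).2 this] with s' hs i h0 hi
  exact hs i (Finset.mem_range.2 hi) h0

/-- The gradient of the interpolant in the coordinates of the parametrization. -/
def gradFn (p : ℕ) (K : Quad) (D : CellData) (z : Plane) (q : ℝ × ℝ) : ℝ :=
  gradForm K q.1 q.2 (interpD p K D 1 0 q.1 q.2) (interpD p K D 0 1 q.1 q.2) z

/-- The second derivatives of the interpolant in the coordinates of the parametrization. -/
def hessFn (p : ℕ) (K : Quad) (D : CellData) (z z' : Plane) (q : ℝ × ℝ) : ℝ :=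
  hessForm K q.1 q.2 (interpD p K D 1 0 q.1 q.2) (interpD p K D 0 1 q.1 q.2)
    (interpD p K D 2 0 q.1 q.2) (interpD p K D 1 1 q.1 q.2) (interpD p K D 0 2 q.1 q.2) z z'

lemma rot_zero (K) : rot 0 K = K := by ext; simp [rot]

lemma CellData.rot_zero (D : CellData) : D.rot 0 = D := by simp [CellData.rot]

lemma sideCoord_mem {i} {q} (h1 : q.1 ∈ I) (h2 : q.2 ∈ I) :
    (sideCoord i q).1 ∈ I ∧ (sideCoord i q).2 ∈ I := by
  simp only [mem_Icc] at h1 h2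
  fin_cases i <;> simp only [sideCoord, mem_Icc] <;> constructor <;> constructor <;> linarith

lemma interpD_side (hp : 3 ≤ p) (hK : ConvexQuad K) (D)
    (i) {τ} (hτ : τ ∈ I) :
    interpD p K D 0 0 (sideCoord i (τ, 0)).1 (sideCoord i (τ, 0)).2 =
      traceFn p (rot i K) (D.rot i) τ := by
  have hτ' : 1 - τ ∈ I := ⟨by linarith [hτ.2], by linarith [hτ.1]⟩
  have r0 := interpD_row (l := 0) hp hK D 0 0 hτ (.inl (by omega))
  have r2 := interpD_row (l := 0) hp hK D 1 0 hτ' (.inl (by omega))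
  have r1 := interpD_col (l' := 0) hp hK D 1 0 hτ (.inl (by omega))
  have r3 := interpD_col (l' := 0) hp hK D 0 0 hτ' (.inl (by omega))
  fin_cases i
  · simpa [sideCoord, sideRow, rot_zero, CellData.rot_zero] using r0
  · simpa [sideCoord, sideCol] using r1
  · simpa [sideCoord, sideRow] using r2
  · simpa [sideCoord, sideCol] using r3

lemma gradFn_side (hp : 3 ≤ p) (hK : ConvexQuad K) (D)
    (i) {τ} (hτ : τ ∈ I) (z) :
    gradFn p K D z (sideCoord i (τ, 0)) =
      dot (K (i + 1) - K i) z / dist (K i) (K (i + 1)) ^ 2 * deriv (traceFn p (rot i K) (D.rot i)) τ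
      + cross (K (i + 1) - K i) z / dist (K i) (K (i + 1)) * normalFn p (rot i K) (D.rot i) τ := by
  have hτ' : 1 - τ ∈ I := ⟨by linarith [hτ.2], by linarith [hτ.1]⟩
  set e := K (i + 1) - K i with he
  set ℓ := dist (K i) (K (i + 1)) with hℓ
  set a := deriv (traceFn p (rot i K) (D.rot i)) τ with ha
  set b := normalFn p (rot i K) (D.rot i) τ with hb
  have hℓ0 : ℓ ≠ 0 := dist_ne_zero.2 (hK.ne i)
  have hℓ2 : ℓ ^ 2 = dot e e := dist_sq _ _
  let L : Plane →ₗ[ℝ] ℝ :=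
    { toFun := fun z => dot e z / ℓ ^ 2 * a + cross e z / ℓ * b
      map_add' := fun v w => by simp [dot, cross]; ring
      map_smul' := fun c w => by simp [dot, cross]; ring }
  have hLe : L e = a := by
    change dot e e / ℓ ^ 2 * a + cross e e / ℓ * b = a
    rw [cross_self, ← hℓ2, div_self (pow_ne_zero 2 hℓ0)]; ring
  have hLT : L (tanT (rot i K) τ) = crossFn p (rot i K) (D.rot i) τ := by
    change dot e _ / ℓ ^ 2 * a + cross e _ / ℓ * b = _
    simp only [crossFn, ← ha, ← hb]
    have e1 : rot i K 1 = K (i + 1) := by simp [rot, add_comm]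
    have e0 : rot i K 0 = K i := by simp [rot]
    rw [e0, e1]; ring
  have hm := sideCoord_mem (i := i) (q := (τ, 0)) hτ (by simp)
  have hj := (hK.jac_pos hm.1 hm.2).ne'
  have key := apply_eq_gradForm hj L z
  suffices h : L (tanS K (sideCoord i (τ, 0)).2) =
        interpD p K D 1 0 (sideCoord i (τ, 0)).1 (sideCoord i (τ, 0)).2 ∧
      L (tanT K (sideCoord i (τ, 0)).1) =
        interpD p K D 0 1 (sideCoord i (τ, 0)).1 (sideCoord i (τ, 0)).2 by
    rw [h.1, h.2] at key; exact key.symm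
  clear key
  have r0 := interpD_row (l := 1) hp hK D 0 0 hτ (.inl (by omega))
  have r2 := interpD_row (l := 1) hp hK D 1 0 hτ' (.inl (by omega))
  have r1 := interpD_col (l' := 1) hp hK D 1 0 hτ (.inl (by omega))
  have r3 := interpD_col (l' := 1) hp hK D 0 0 hτ' (.inl (by omega))
  have s0 := interpD_row (l := 0) hp hK D 0 1 hτ (.inl (by omega))
  have s2 := interpD_row (l := 0) hp hK D 1 1 hτ' (.inl (by omega))
  have s1 := interpD_col (l' := 0) hp hK D 1 1 hτ (.inl (by omega))
  have s3 := interpD_col (l' := 0) hp hK D 0 1 hτ' (.inl (by omega))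
  clear_value L a b ℓ
  rw [he] at hLe
  clear hℓ2 hℓ0 hℓ hb hj hm hK
  fin_cases i
  · have e1 : tanS K 0 = K 1 - K 0 := by simp [tanS]
    simp [sideRow, rot_zero, CellData.rot_zero, iteratedDeriv_one, sideCoord, -map_sub, -map_neg] at *
    exact ⟨by rw [e1, hLe, r0, ha], by rw [hLT, s0]⟩
  · have e1 : tanS K τ = -tanT (rot 1 K) τ := by ext j; simp [tanS, tanT, rot]; ring
    have e2 : tanT K 1 = K 2 - K 1 := by simp [tanT]
    simp [sideCol, iteratedDeriv_one, sideCoord, -map_sub, -map_neg] at *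
    exact ⟨by rw [e1, map_neg, hLT, s1], by rw [e2, hLe, r1, ha]⟩
  · have e1 : tanS K 1 = -(K 3 - K 2) := by simp [tanS]
    have e2 : tanT K (1 - τ) = -tanT (rot 2 K) τ := by ext j; simp [tanT, rot]; ring
    simp [sideRow, iteratedDeriv_one, sideCoord, deriv_flip, -neg_sub, -map_sub,
      -map_neg] at *
    exact ⟨by rw [e1, map_neg, hLe, r2, ha], by rw [e2, map_neg, hLT, s2]⟩
  · have e1 : tanS K (1 - τ) = tanT (rot 3 K) τ := by ext j; simp [tanS, tanT, rot]; ring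
    have e2 : tanT K 0 = -(K 0 - K 3) := by simp [tanT]
    simp [sideCol, iteratedDeriv_one, sideCoord, deriv_flip, -neg_sub, -map_sub,
      -map_neg] at *
    exact ⟨by rw [e1, hLT, s3], by rw [e2, map_neg, hLe, r3, ha]⟩

lemma dot_unitNormal (x y) : dot (y - x) (unitNormal x y) = 0 := by
  simp [dot, unitNormal]; ring

lemma cross_unitNormal {x y} (h : x ≠ y) : cross (y - x) (unitNormal x y) = dist x y := by
  have h0 : dist x y ≠ 0 := dist_ne_zero.2 h
  have h2 := dist_sq x y
  have : cross (y - x) (unitNormal x y) = (dist x y)⁻¹ * dot (y - x) (y - x) := by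
    simp [dot, cross, unitNormal]; ring
  rw [this, ← h2]; field_simp

lemma gradFn_side_normal (hp : 3 ≤ p) (hK : ConvexQuad K) (D)
    (i) {τ} (hτ : τ ∈ I) :
    gradFn p K D (unitNormal (K i) (K (i + 1))) (sideCoord i (τ, 0)) =
      normalFn p (rot i K) (D.rot i) τ := by
  rw [gradFn_side hp hK D i hτ, dot_unitNormal, cross_unitNormal (hK.ne i),
    div_self (dist_ne_zero.2 (hK.ne i))]
  ring

lemma gradFn_corner (hp : 3 ≤ p) (hK : ConvexQuad K) (D)
    (i) (z) : gradFn p K D z (sideCoord i (0, 0)) = D.grad i z := by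
  rw [gradFn_side hp hK D i (by simp)]
  have h1 := (traceFn_end hp (rot i K) (D.rot i) 0).2.1
  have h2 := (normalFn_end hp (rot i K) (D.rot i) 0).1
  simp only [Fin.val_zero, Nat.cast_zero] at h1 h2
  rw [h1, h2]
  conv_rhs => rw [side_decomp (hK.ne i) z, CellData.grad_add]
  simp [sideCorner, CellData.rot, CellData.grad, rot, add_comm]

lemma interpD_corner (hp : 3 ≤ p) (hK : ConvexQuad K) (D)
    (i) : interpD p K D 0 0 (sideCoord i (0, 0)).1 (sideCoord i (0, 0)).2 = D.1 i 0 0 := by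
  rw [interpD_side hp hK D i (by simp)]
  have h1 := (traceFn_end hp (rot i K) (D.rot i) 0).1
  simp only [Fin.val_zero, Nat.cast_zero] at h1
  rw [h1]; simp [sideCorner, CellData.rot]

lemma iteratedDeriv_two_flip (f : ℝ → ℝ) (s : ℝ) :
    iteratedDeriv 2 (fun s => f (1 - s)) s = iteratedDeriv 2 f (1 - s) := by
  rw [iteratedDeriv_succ, iteratedDeriv_one, iteratedDeriv_succ, iteratedDeriv_one]
  have : deriv (fun s => f (1 - s)) = fun s => -deriv f (1 - s) := funext (deriv_flip f)
  rw [this, deriv.fun_neg, deriv_flip]; ring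

lemma hessFn_corner (hp : 3 ≤ p) (hK : ConvexQuad K) (D)
    (i) (z z') : hessFn p K D z z' (sideCoord i (0, 0)) = D.hess i z z' := by
  have hX := crossBasis_spec hp
  have hm := sideCoord_mem (i := i) (q := (0, 0)) (by simp) (by simp)
  have hj := (hK.jac_pos hm.1 hm.2).ne'
  have hg := gradFn_corner hp hK D i (twist K)
  unfold gradFn at hg
  rw [hessFn, hessForm, hg]
  obtain ⟨b, b', hi, hc⟩ : ∃ b b', i = cornerIdx b b' ∧
      sideCoord i (0, 0) = (((b : ℕ) : ℝ), ((b' : ℕ) : ℝ)) := by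
    fin_cases i
    · exact ⟨0, 0, rfl, by simp [sideCoord]⟩
    · exact ⟨1, 0, rfl, by simp [sideCoord]⟩
    · exact ⟨1, 1, rfl, by simp [sideCoord]⟩
    · exact ⟨0, 1, rfl, by simp [sideCoord]⟩
  rw [hc] at hj ⊢
  have hb : ∀ b : Fin 2, ((b : ℕ) : ℝ) ∈ I := fun b => by fin_cases b <;> simp
  have r := interpD_row (l := 2) hp hK D b' 0 (hb b) (.inr (notKnot_end _ b))
  have c := interpD_col (l' := 2) hp hK D b 0 (hb b') (.inr (notKnot_end _ b'))
  have m := interpD_row (l := 1) hp hK D b' 1 (hb b) (.inl (by omega))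
  have m' := hermite_sideRow hp hK D b' 1 (.inl (b, 1))
  have r' : iteratedDeriv 2 (sideRow p K D b' 0) (b : ℕ) =
      D.hess i (tanS K (b' : ℕ)) (tanS K (b' : ℕ)) := by
    have t0 := (traceFn_end hp K D b).2.2
    have t2 := (traceFn_end hp (rot 2 K) (D.rot 2) (1 - b)).2.2
    subst hi
    fin_cases b <;> fin_cases b' <;>
      simp [sideRow, iteratedDeriv_two_flip, sideCorner, cornerIdx, CellData.hess, CellData.rot,
        tanS, rot] at t0 t2 ⊢ <;> simp only [t0, t2] <;> ring
  have c' : iteratedDeriv 2 (sideCol p K D b 0) (b' : ℕ) =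
      D.hess i (tanT K (b : ℕ)) (tanT K (b : ℕ)) := by
    have t1 := (traceFn_end hp (rot 1 K) (D.rot 1) b').2.2
    have t3 := (traceFn_end hp (rot 3 K) (D.rot 3) (1 - b')).2.2
    subst hi
    fin_cases b <;> fin_cases b' <;>
      simp [sideCol, iteratedDeriv_two_flip, sideCorner, cornerIdx, CellData.hess, CellData.rot,
        tanT, rot] at t1 t3 ⊢ <;> simp only [t1, t3] <;> ring
  simp only [Fin.val_zero, Fin.val_one] at r c m
  rw [r'] at r
  rw [c'] at c
  simp only [hermite, Fin.val_one] at m'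
  rw [m'] at m
  have m2 : interpD p K D 1 1 (b : ℕ) (b' : ℕ) =
      D.hess i (tanS K (b' : ℕ)) (tanT K (b : ℕ)) + D.grad i (twist K) := by
    rw [m, hi]; simp [tensorCoef]
  rw [r, c, m2]
  conv_rhs => rw [tan_decomp K _ _ hj z, tan_decomp K _ _ hj z']
  simp [CellData.hess]; ring

/-! ### Functions that are given by the interpolant -/

/-- `u` is the interpolant of the data `D` on the closed quadrilateral `K`. -/
def IsInterp (p : ℕ) (K : Quad) (D : CellData) (u : Fn) : Prop :=
  ∀ s ∈ I, ∀ t ∈ I, u (param K s t) = interpD p K D 0 0 s t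

/-- The local degrees of freedom of `u` on `K`, as limits from inside, are the data `D`. -/
structure HasLocalData (p : ℕ) (K : Quad) (D : CellData) (u : Fn) : Prop where
  jet : ∀ i a b, a + b ≤ 2 → Tendsto (mixedD a b u) (𝓝[cell K] (K i)) (𝓝 (D.1 i a b))
  value : ∀ i, ∀ η ∈ edgeValueParams p,
    Tendsto u (𝓝[cell K] (lineMap (K i) (K (i + 1)) η)) (𝓝 (D.2.1 i η))
  normal : ∀ i, ∀ η ∈ edgeNormalParams p,
    Tendsto (fun y => fderiv ℝ u y (unitNormal (K i) (K (i + 1))))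
      (𝓝[cell K] (lineMap (K i) (K (i + 1)) η)) (𝓝 (D.2.2.1 i η))
  face : ∀ ξ ∈ faceParams p, ∀ η ∈ faceParams p,
    Tendsto u (𝓝[cell K] (param K ξ η)) (𝓝 (D.2.2.2 ξ η))

lemma tendsto_of_param (hK : ConvexQuad K) {s t}
    (hs : s ∈ I) (ht : t ∈ I) {f} {g} {c : ℝ}
    (h : ∀ᶠ q in 𝓝[J ×ˢ J] (s, t), f (param K q.1 q.2) = g q)
    (hg : Tendsto g (𝓝[J ×ˢ J] (s, t)) (𝓝 c)) :
    Tendsto f (𝓝[cell K] (param K s t)) (𝓝 c) := by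
  have h1 := tendsto_paramInv hK hs ht
  refine (hg.comp h1).congr' ?_
  filter_upwards [h1.eventually h, self_mem_nhdsWithin] with y hy hyK
  rw [← param_paramInv hK (interior_subset hyK), hy, param_paramInv hK (interior_subset hyK)]
  rfl

lemma two_le_infty : (2 : WithTop ℕ∞) ≤ ((⊤ : ℕ∞) : WithTop ℕ∞) :=
  WithTop.coe_le_coe.2 le_top

lemma continuous_cross_tanT (K) (z) :
    Continuous fun q : ℝ × ℝ => cross z (tanT K q.1) := by
  unfold cross tanT; fun_prop

lemma continuous_cross_tanS (K) (z) :
    Continuous fun q : ℝ × ℝ => cross (tanS K q.2) z := by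
  unfold cross tanS; fun_prop

lemma continuous_jac (K) : Continuous fun q : ℝ × ℝ => jac K q.1 q.2 := by
  unfold jac cross tanS tanT; fun_prop

lemma continuousAt_gradFn (hp : 3 ≤ p) (hK : ConvexQuad K)
    (D) (z) {s t} (hs : s ∈ I) (ht : t ∈ I) :
    ContinuousAt (gradFn p K D z) (s, t) := by
  have hj := (hK.jac_pos hs ht).ne'
  have h1 := (continuous_interpD (l := 1) (l' := 0) hp K D le_rfl zero_le_one).continuousAt
    (x := (s, t))
  have h2 := (continuous_interpD (l := 0) (l' := 1) hp K D zero_le_one le_rfl).continuousAt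
    (x := (s, t))
  have A : ContinuousAt (fun q => cross z (tanT K q.1) / jac K q.1 q.2) (s, t) :=
    (continuous_cross_tanT K z).continuousAt.div (continuous_jac K).continuousAt hj
  have B : ContinuousAt (fun q => cross (tanS K q.2) z / jac K q.1 q.2) (s, t) :=
    (continuous_cross_tanS K z).continuousAt.div (continuous_jac K).continuousAt hj
  exact (A.tendsto.mul h1.tendsto).add (B.tendsto.mul h2.tendsto)

lemma continuousAt_hessFn (hp : 3 ≤ p) (hK : ConvexQuad K)
    (D) (z z') {s t} (hs : s ∈ I) (ht : t ∈ I)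
    (hs' : NotKnot (subdiv p) s) (ht' : NotKnot (subdiv p) t) :
    ContinuousAt (hessFn p K D z z') (s, t) := by
  have hj := (hK.jac_pos hs ht).ne'
  have hg := continuousAt_gradFn hp hK D (twist K) hs ht
  have A : ∀ z, ContinuousAt (fun q => cross z (tanT K q.1) / jac K q.1 q.2) (s, t) :=
    fun z => (continuous_cross_tanT K z).continuousAt.div (continuous_jac K).continuousAt hj
  have B : ∀ z, ContinuousAt (fun q => cross (tanS K q.2) z / jac K q.1 q.2) (s, t) :=
    fun z => (continuous_cross_tanS K z).continuousAt.div (continuous_jac K).continuousAt hj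
  have c := fun l l' =>
    (continuousAt_interpD (l := l) (l' := l') hp K D (.inr hs') (.inr ht')).tendsto
  exact ((((A z).tendsto.mul (A z')).mul (c 2 0)).add
    ((((A z).tendsto.mul (B z')).add ((B z).tendsto.mul (A z'))).mul ((c 1 1).sub hg.tendsto))).add
    (((B z).tendsto.mul (B z')).mul (c 0 2))

variable {D : CellData} {u : Fn}

lemma IsInterp.eventually (hu : IsInterp p K D u) {s t} (hs : s ∈ J)
    (ht : t ∈ J) :
    ∀ᶠ q : ℝ × ℝ in 𝓝 (s, t), u (param K q.1 q.2) = interpD p K D 0 0 q.1 q.2 := by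
  filter_upwards [(isOpen_Ioo.prod isOpen_Ioo).mem_nhds (mk_mem_prod hs ht)] with q hq
  exact hu _ (Ioo_subset_Icc_self hq.1) _ (Ioo_subset_Icc_self hq.2)

lemma jac_ne_zero_of_mem_Ioo (hK : ConvexQuad K) {s t} (hs : s ∈ J)
    (ht : t ∈ J) : jac K s t ≠ 0 :=
  (hK.jac_pos (Ioo_subset_Icc_self hs) (Ioo_subset_Icc_self ht)).ne'

lemma IsInterp.contDiffAt (hp : 3 ≤ p) (hK : ConvexQuad K) (hu : IsInterp p K D u) {s t}
    (hs : s ∈ J) (ht : t ∈ J) :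
    ContDiffAt ℝ (p - 2 : ℕ) u (param K s t) :=
  contDiffAt_of_param (jac_ne_zero_of_mem_Ioo hK hs ht) (contDiff_interp hp K D).contDiffAt
    (hu.eventually hs ht)

lemma IsInterp.fderiv_eq (hp : 3 ≤ p) (hK : ConvexQuad K) (hu : IsInterp p K D u) {s t}
    (hs : s ∈ J) (ht : t ∈ J) (z) :
    fderiv ℝ u (param K s t) z = gradFn p K D z (s, t) :=
  fderiv_eq_gradForm (jac_ne_zero_of_mem_Ioo hK hs ht)
    ((hu.contDiffAt hp hK hs ht).differentiableAt (by norm_cast; omega))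
    (hasFDerivAt_interpD hp K D (.inl (by omega)) (.inl (by omega))) (hu.eventually hs ht) z

lemma IsInterp.contDiffAt_of_notKnot (hp : 3 ≤ p) (hK : ConvexQuad K) (hu : IsInterp p K D u)
    {s t} (hs : s ∈ J) (ht : t ∈ J) (hs' : NotKnot (subdiv p) s)
    (ht' : NotKnot (subdiv p) t) : ContDiffAt ℝ ∞ u (param K s t) :=
  contDiffAt_of_param (jac_ne_zero_of_mem_Ioo hK hs ht) (contDiffAt_interp hp K D hs' ht')
    (hu.eventually hs ht)

lemma IsInterp.fderiv_fderiv_eq (hp : 3 ≤ p) (hK : ConvexQuad K) (hu : IsInterp p K D u)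
    {s t} (hs : s ∈ J) (ht : t ∈ J) (hs' : NotKnot (subdiv p) s)
    (ht' : NotKnot (subdiv p) t) (z z') :
    fderiv ℝ (fderiv ℝ u) (param K s t) z z' = hessFn p K D z z' (s, t) :=
  fderiv_fderiv_eq_hessForm (jac_ne_zero_of_mem_Ioo hK hs ht)
    (wa := fun q => interpD p K D 1 0 q.1 q.2) (wb := fun q => interpD p K D 0 1 q.1 q.2)
    ((hu.contDiffAt_of_notKnot hp hK hs ht hs' ht').of_le two_le_infty)
    (Eventually.of_forall fun q =>
      hasFDerivAt_interpD hp K D (s := q.1) (t := q.2) (.inl (by omega)) (.inl (by omega)))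
    (hasFDerivAt_interpD hp K D (.inr hs') (.inr ht'))
    (hasFDerivAt_interpD hp K D (.inr hs') (.inr ht')) (hu.eventually hs ht) z z'

lemma IsInterp.tendsto (hp : 3 ≤ p) (hK : ConvexQuad K) (hu : IsInterp p K D u) {s t}
    (hs : s ∈ I) (ht : t ∈ I) :
    Tendsto u (𝓝[cell K] (param K s t)) (𝓝 (interpD p K D 0 0 s t)) := by
  refine tendsto_of_param hK hs ht (g := fun q => interpD p K D 0 0 q.1 q.2) ?_ ?_
  · filter_upwards [self_mem_nhdsWithin] with q hq
    exact hu _ (Ioo_subset_Icc_self hq.1) _ (Ioo_subset_Icc_self hq.2)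
  · exact ((continuous_interpD hp K D zero_le_one zero_le_one).tendsto (s, t)).mono_left
      nhdsWithin_le_nhds

lemma IsInterp.tendsto_fderiv (hp : 3 ≤ p) (hK : ConvexQuad K) (hu : IsInterp p K D u) {s t}
    (hs : s ∈ I) (ht : t ∈ I) (z) :
    Tendsto (fun y => fderiv ℝ u y z) (𝓝[cell K] (param K s t)) (𝓝 (gradFn p K D z (s, t))) := by
  refine tendsto_of_param hK hs ht ?_
    ((continuousAt_gradFn hp hK D z hs ht).mono_left nhdsWithin_le_nhds)
  filter_upwards [self_mem_nhdsWithin] with q hq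
  exact hu.fderiv_eq hp hK hq.1 hq.2 z

lemma IsInterp.tendsto_partialD_partialD (hp : 3 ≤ p) (hK : ConvexQuad K) (hu : IsInterp p K D u)
    {s t} (hs : s ∈ I) (ht : t ∈ I) (hs' : NotKnot (subdiv p) s)
    (ht' : NotKnot (subdiv p) t) (i j) :
    Tendsto (partialD i (partialD j u)) (𝓝[cell K] (param K s t))
      (𝓝 (hessFn p K D (single i 1) (single j 1) (s, t))) := by
  refine tendsto_of_param hK hs ht ?_
    ((continuousAt_hessFn hp hK D _ _ hs ht hs' ht').mono_left nhdsWithin_le_nhds)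
  have h1 := (continuous_fst.tendsto (s, t)).eventually hs'.eventually
  have h2 := (continuous_snd.tendsto (s, t)).eventually ht'.eventually
  filter_upwards [self_mem_nhdsWithin, nhdsWithin_le_nhds h1, nhdsWithin_le_nhds h2]
    with q hq hq1 hq2
  rw [partialD_partialD ((hu.contDiffAt_of_notKnot hp hK hq.1 hq.2 hq1 hq2).of_le
    two_le_infty), hu.fderiv_fderiv_eq hp hK hq.1 hq.2 hq1 hq2]

lemma edgeValueParams_mem_Icc {η : ℝ} (h : η ∈ edgeValueParams p) : η ∈ I :=
  Ioo_subset_Icc_self (edgeValueParams_mem h)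

lemma param_sideCoord_zero (K) (i) (τ : ℝ) :
    param K (sideCoord i (τ, 0)).1 (sideCoord i (τ, 0)).2 =
      lineMap (K i) (K (i + 1)) τ := by
  rw [param_sideCoord, rot_param_zero]

lemma corner_eq_param (K) (i) :
    param K (sideCoord i (0, 0)).1 (sideCoord i (0, 0)).2 = K i := by
  rw [param_sideCoord_zero]; simp

lemma sideCoord_corner_notKnot (k) (i) :
    NotKnot k (sideCoord i (0, 0)).1 ∧ NotKnot k (sideCoord i (0, 0)).2 := by
  have h0 : NotKnot k (0 : ℝ) := by simpa using notKnot_end k 0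
  have h1 : NotKnot k (1 : ℝ) := by simpa using notKnot_end k 1
  fin_cases i <;> simp [sideCoord, h0, h1]

lemma IsInterp.hasLocalData (hp : 3 ≤ p) (hK : ConvexQuad K) (hu : IsInterp p K D u) :
    HasLocalData p K D u where
  jet i a b hab := by
    have hm := sideCoord_mem (i := i) (q := (0, 0)) (by simp) (by simp)
    have hk := sideCoord_corner_notKnot (subdiv p) i
    have h0 := hu.tendsto hp hK hm.1 hm.2
    have h1 := fun z => hu.tendsto_fderiv hp hK hm.1 hm.2 z
    have h2 := fun j k => hu.tendsto_partialD_partialD hp hK hm.1 hm.2 hk.1 hk.2 j k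
    simp only [corner_eq_param] at h0 h1 h2
    rw [interpD_corner hp hK] at h0
    simp only [Prod.mk.eta, gradFn_corner hp hK] at h1
    simp only [Prod.mk.eta, hessFn_corner hp hK] at h2
    cases order_two hab
    · exact h0
    · have h := h1 (single 0 1)
      simp [CellData.grad] at h
      exact h
    · have h := h1 (single 1 1)
      simp [CellData.grad] at h
      exact h
    · have h := h2 0 0
      simp [CellData.hess] at h
      exact h
    · have h := h2 0 1
      simp [CellData.hess] at h
      exact h
    · have h := h2 1 1
      simp [CellData.hess] at h
      exact h
  value i η hη := by
    have hη' := Ioo_subset_Icc_self (edgeValueParams_mem hη)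
    have hm := sideCoord_mem (i := i) (q := (η, 0)) hη' (by simp)
    have h := hu.tendsto hp hK hm.1 hm.2
    rw [param_sideCoord_zero, interpD_side hp hK D i hη'] at h
    have h2 := hermite_traceFn hp (rot i K) (D.rot i) (.inr ⟨η, hη⟩)
    simp only [hermite, traceCoef] at h2
    rw [h2] at h
    simpa [CellData.rot] using h
  normal i η hη := by
    have hη' := Ioo_subset_Icc_self (edgeNormalParams_mem hη)
    have hm := sideCoord_mem (i := i) (q := (η, 0)) hη' (by simp)
    have h := hu.tendsto_fderiv hp hK hm.1 hm.2 (unitNormal (K i) (K (i + 1)))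
    rw [param_sideCoord_zero, Prod.mk.eta, gradFn_side_normal hp hK D i hη'] at h
    have h2 := hermite_normalFn hp (rot i K) (D.rot i) (.inr ⟨η, hη⟩)
    simp only [hermite, normalCoef] at h2
    rw [h2] at h
    simpa [CellData.rot] using h
  face ξ hξ η hη := by
    have h := hu.tendsto hp hK (Ioo_subset_Icc_self (faceParams_mem hξ))
      (Ioo_subset_Icc_self (faceParams_mem hη))
    rwa [interpD_face hp K D hξ hη] at h

lemma subdiv_pos (p) : 0 < subdiv p := by unfold subdiv; omega

lemma IsInterp.memLocalSpace (hp : 3 ≤ p) (hK : ConvexQuad K) (hu : IsInterp p K D u) :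
    MemLocalSpace p K u where
  smooth x hx := by
    obtain ⟨q, h1, h2, rfl⟩ := exists_param_of_mem_cell hK hx
    exact (hu.contDiffAt hp hK h1 h2).contDiffWithinAt
  piecewise i hi j hj := by
    have hX := crossBasis_spec hp
    choose P hPd hP using fun a => (hX.1 a).2.1 i hi
    choose Q hQd hQ using fun a => (hX.1 a).2.1 j hj
    refine ⟨fun a b => ∑ x, ∑ y, tensorCoef p K D x y * (P x).coeff a * (Q y).coeff b, ?_⟩
    intro s hs t ht
    have hs' := piece_subset hi hs
    have ht' := piece_subset hj ht
    rw [hu s hs' t ht']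
    simp only [interpD, iteratedDeriv_zero]
    have e1 : ∀ x, crossBasis p x s = ∑ a : Fin (p + 1), (P x).coeff a * s ^ (a : ℕ) := fun x => by
      rw [hP x s hs, eval_eq_sum_fin (hPd x)]
    have e2 : ∀ x, crossBasis p x t = ∑ a : Fin (p + 1), (Q x).coeff a * t ^ (a : ℕ) := fun x => by
      rw [hQ x t ht, eval_eq_sum_fin (hQd x)]
    simp only [e1, e2, mul_sum, sum_mul]
    rw [sum_congr rfl fun x _ => sum_congr rfl fun y _ => sum_comm]
    rw [sum_congr rfl fun x _ => sum_comm, sum_comm]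
    refine sum_congr rfl fun a _ => ?_
    rw [sum_congr rfl fun x _ => sum_comm, sum_comm]
    refine sum_congr rfl fun b _ => sum_congr rfl fun x _ =>
      sum_congr rfl fun y _ => by ring
  trace_smooth i := by
    refine (spline_traceFn hp (rot i K) (D.rot i)).1.contDiffOn.congr fun τ hτ => ?_
    have hτ' := Ioo_subset_Icc_self hτ
    have hm := sideCoord_mem (i := i) (q := (τ, 0)) hτ' (by simp)
    rw [← param_sideCoord_zero, hu _ hm.1 _ hm.2, interpD_side hp hK D i hτ']
  normal_piecewise i j hj := by
    obtain ⟨r, hr, hr'⟩ := (spline_normalFn hp (rot i K) (D.rot i)).2.1 j hj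
    refine ⟨r, hr, fun τ hτ hτj => ?_⟩
    have hτ' := Ioo_subset_Icc_self hτ
    have hm := sideCoord_mem (i := i) (q := (τ, 0)) hτ' (by simp)
    have h := hu.tendsto_fderiv hp hK hm.1 hm.2 (unitNormal (K i) (K (i + 1)))
    rw [param_sideCoord_zero, Prod.mk.eta, gradFn_side_normal hp hK D i hτ'] at h
    rwa [← hr' τ hτj]

/-! ### Boundary behaviour of functions of the local space -/

/-- The partial derivative in the first coordinate. -/
def d1 (P : ℝ × ℝ → ℝ) (q : ℝ × ℝ) : ℝ := fderiv ℝ P q (1, 0)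

/-- The partial derivative in the second coordinate. -/
def d2 (P : ℝ × ℝ → ℝ) (q : ℝ × ℝ) : ℝ := fderiv ℝ P q (0, 1)

lemma hasFDerivAt_pairing {P : ℝ × ℝ → ℝ} {q : ℝ × ℝ} (h : DifferentiableAt ℝ P q) :
    HasFDerivAt P (pairing (d1 P q) (d2 P q)) q := by
  refine h.hasFDerivAt.congr_fderiv ?_
  ext <;> simp [d1, d2]

lemma contDiff_d1 {P : ℝ × ℝ → ℝ} (h : ContDiff ℝ ∞ P) : ContDiff ℝ ∞ (d1 P) :=
  (h.fderiv_right (m := ∞) (by simp)).clm_apply contDiff_const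

lemma contDiff_d2 {P : ℝ × ℝ → ℝ} (h : ContDiff ℝ ∞ P) : ContDiff ℝ ∞ (d2 P) :=
  (h.fderiv_right (m := ∞) (by simp)).clm_apply contDiff_const

lemma hasDerivAt_d1 {P : ℝ × ℝ → ℝ} {s t : ℝ} (h : DifferentiableAt ℝ P (s, t)) :
    HasDerivAt (fun s => P (s, t)) (d1 P (s, t)) s := by
  have h1 : HasDerivAt (fun s : ℝ => (s, t)) ((1 : ℝ), (0 : ℝ)) s :=
    (hasDerivAt_id s).prodMk (hasDerivAt_const s t)
  exact HasFDerivAt.comp_hasDerivAt (f := fun s : ℝ => (s, t)) s h.hasFDerivAt h1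

lemma hasDerivAt_d2 {P : ℝ × ℝ → ℝ} {s t : ℝ} (h : DifferentiableAt ℝ P (s, t)) :
    HasDerivAt (fun t => P (s, t)) (d2 P (s, t)) t := by
  have h1 : HasDerivAt (fun t : ℝ => (s, t)) ((0 : ℝ), (1 : ℝ)) t :=
    (hasDerivAt_const t s).prodMk (hasDerivAt_id t)
  exact HasFDerivAt.comp_hasDerivAt (f := fun t : ℝ => (s, t)) t h.hasFDerivAt h1

lemma iteratedDeriv_eq_of_eqOn_Icc {f g : ℝ → ℝ} {l : ℕ} {a b s : ℝ} (hab : a < b)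
    (h : EqOn f g (Icc a b)) (hs : s ∈ Icc a b) (hf : ContDiffAt ℝ l f s)
    (hg : ContDiffAt ℝ l g s) : iteratedDeriv l f s = iteratedDeriv l g s := by
  have hu := uniqueDiffOn_Icc hab
  rw [← iteratedDerivWithin_eq_iteratedDeriv hu hf hs,
    ← iteratedDerivWithin_eq_iteratedDeriv hu hg hs]
  exact iteratedDerivWithin_congr h hs

/-- The part of the local space and of its degrees of freedom that concerns the sides. -/
structure BoundaryReg (p : ℕ) (K : Quad) (D : CellData) (u : Fn) : Prop where
  smooth : ContDiffOn ℝ ((p - 2 : ℕ) : WithTop ℕ∞) u (cell K)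
  pieces : ∀ i < subdiv p, ∀ j < subdiv p, ∃ P, ContDiff ℝ ∞ P ∧
    (∀ t, ∃ R : Polynomial ℝ, R.natDegree ≤ p ∧ ∀ s, P (s, t) = R.eval s) ∧
    (∀ s, ∃ R : Polynomial ℝ, R.natDegree ≤ p ∧ ∀ t, P (s, t) = R.eval t) ∧
    ∀ s ∈ knotIcc (subdiv p) i,
    ∀ t ∈ knotIcc (subdiv p) j, u (param K s t) = P (s, t)
  trace_smooth : ∀ i, ContDiffOn ℝ ((p - 1 : ℕ) : WithTop ℕ∞)
    (fun t : ℝ => u (lineMap (K i) (K (i + 1)) t)) J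
  normal_piecewise : ∀ i, ∀ j < subdiv p, ∃ r : Polynomial ℝ, r.natDegree ≤ p - 1 ∧
    ∀ t ∈ J, t ∈ knotIcc (subdiv p) j →
      Tendsto (fun y => fderiv ℝ u y (unitNormal (K i) (K (i + 1))))
        (𝓝[cell K] (lineMap (K i) (K (i + 1)) t)) (𝓝 (r.eval t))
  jet : ∀ i a b, a + b ≤ 2 → Tendsto (mixedD a b u) (𝓝[cell K] (K i)) (𝓝 (D.1 i a b))
  value : ∀ i, ∀ η ∈ edgeValueParams p,
    Tendsto u (𝓝[cell K] (lineMap (K i) (K (i + 1)) η)) (𝓝 (D.2.1 i η))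
  normal : ∀ i, ∀ η ∈ edgeNormalParams p,
    Tendsto (fun y => fderiv ℝ u y (unitNormal (K i) (K (i + 1))))
      (𝓝[cell K] (lineMap (K i) (K (i + 1)) η)) (𝓝 (D.2.2.1 i η))

lemma MemLocalSpace.boundaryReg {D : CellData} {u}
    (hu : MemLocalSpace p K u) (hd : HasLocalData p K D u) : BoundaryReg p K D u where
  smooth := hu.smooth
  pieces i hi j hj := by
    obtain ⟨c, hc⟩ := hu.piecewise i hi j hj
    refine ⟨fun q => ∑ a : Fin (p + 1), ∑ b : Fin (p + 1), c a b * q.1 ^ (a : ℕ) * q.2 ^ (b : ℕ),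
      by fun_prop, fun t => ?_, fun s => ?_, hc⟩
    · refine ⟨∑ a : Fin (p + 1), Polynomial.monomial a (∑ b : Fin (p + 1), c a b * t ^ (b : ℕ)),
        Polynomial.natDegree_sum_le_of_forall_le _ _ fun a _ =>
          (Polynomial.natDegree_monomial_le _).trans (Nat.lt_succ_iff.1 a.2), fun s => ?_⟩
      simp only [eval_finsetSum, Polynomial.eval_monomial, sum_mul]
      exact sum_congr rfl fun a _ => sum_congr rfl fun b _ => by ring
    · refine ⟨∑ b : Fin (p + 1), Polynomial.monomial b (∑ a : Fin (p + 1), c a b * s ^ (a : ℕ)),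
        Polynomial.natDegree_sum_le_of_forall_le _ _ fun a _ =>
          (Polynomial.natDegree_monomial_le _).trans (Nat.lt_succ_iff.1 a.2), fun t => ?_⟩
      simp only [eval_finsetSum, Polynomial.eval_monomial, sum_mul]
      exact sum_comm
  trace_smooth := hu.trace_smooth
  normal_piecewise := hu.normal_piecewise
  jet := hd.jet
  value := hd.value
  normal := hd.normal

lemma piece_flip {k i : ℕ} (hi : i < k) {s : ℝ} (hs : s ∈ knotIcc k i) :
    1 - s ∈ Icc (((k - 1 - i : ℕ) : ℝ) / k) (((k - 1 - i : ℕ) + 1 : ℝ) / k) := by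
  have hk : (0 : ℝ) < k := by exact_mod_cast (Nat.zero_le i).trans_lt hi
  have e : ((k - 1 - i : ℕ) : ℝ) = k - 1 - i := by
    rw [Nat.cast_sub (by omega), Nat.cast_sub (by omega)]; simp
  rw [e]
  obtain ⟨h1, h2⟩ := hs
  rw [div_le_iff₀ hk] at h1
  rw [le_div_iff₀ hk] at h2
  constructor
  · rw [div_le_iff₀ hk]; linarith
  · rw [le_div_iff₀ hk]; linarith

lemma param_rot_one (K : Quad) (s t : ℝ) : param (rot 1 K) s t = param K (1 - t) s :=
  (param_sideCoord K 1 (s, t)).symm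

lemma BoundaryReg.rot_one {D : CellData} {u}
    (h : BoundaryReg p K D u) : BoundaryReg p (rot 1 K) (D.rot 1) u where
  smooth := by rw [cell_rot]; exact h.smooth
  pieces i hi j hj := by
    obtain ⟨P, h1, h2, h3, h4⟩ := h.pieces (subdiv p - 1 - j) (by omega) i hi
    refine ⟨fun q => P (1 - q.2, q.1), by fun_prop, fun t => h3 (1 - t), fun s => ?_, ?_⟩
    · obtain ⟨R, hR, hR'⟩ := h2 s
      refine ⟨R.comp (1 - X), ?_, fun t => by simp [hR']⟩
      refine Polynomial.natDegree_comp_le.trans ?_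
      have : (1 - X : Polynomial ℝ).natDegree ≤ 1 :=
        (Polynomial.natDegree_sub_le _ _).trans (by simp)
      nlinarith
    · intro s hs t ht
      rw [param_rot_one]
      exact h4 _ (piece_flip hj ht) _ hs
  trace_smooth i := by
    have := h.trace_smooth (i + 1)
    rwa [add_right_comm] at this
  normal_piecewise i := by
    have := h.normal_piecewise (i + 1)
    simp only [cell_rot]
    rwa [add_right_comm] at this
  jet i := by rw [cell_rot]; exact h.jet (i + 1)
  value i := by
    have := h.value (i + 1)
    rw [cell_rot]
    rwa [add_right_comm] at this
  normal i := by
    have := h.normal (i + 1)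
    rw [cell_rot]
    rwa [add_right_comm] at this

lemma BoundaryReg.rot {D} {u}
    (h : BoundaryReg p K D u) (i) : BoundaryReg p (rot i K) (D.rot i) u := by
  have e : ∀ a b, BSQuad.rot a (BSQuad.rot b K) = BSQuad.rot (a + b) K := fun a b => by
    ext; simp [BSQuad.rot, add_assoc]
  have e' : ∀ a b, (D.rot b).rot a = D.rot (a + b) := fun a b => by
    simp [CellData.rot, add_assoc]
  have h1 := h.rot_one
  have h2 := h1.rot_one
  have h3 := h2.rot_one
  simp only [e, e'] at h2 h3
  fin_cases i
  · simpa [rot_zero, CellData.rot_zero] using h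
  · exact h1
  · exact h2
  · exact h3

section piece

variable (hK : ConvexQuad K) {u : Fn} {P : ℝ × ℝ → ℝ}
  (hP : ContDiff ℝ ∞ P) {a b c d : ℝ} (ha : 0 ≤ a) (hb : b ≤ 1) (hc : 0 ≤ c) (hd : d ≤ 1)
  (hab : a < b) (hcd : c < d)
  (huP : ∀ s ∈ Icc a b, ∀ t ∈ Icc c d, u (param K s t) = P (s, t))

include hK hP ha hb hc hd huP

lemma contDiffAt_of_piece {q} (hq : q ∈ Ioo a b ×ˢ Ioo c d) :
    ContDiffAt ℝ ∞ u (param K q.1 q.2) ∧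
      ∀ z, fderiv ℝ u (param K q.1 q.2) z = gradForm K q.1 q.2 (d1 P q) (d2 P q) z := by
  have hj : jac K q.1 q.2 ≠ 0 := jac_ne_zero_of_mem_Ioo hK
    ⟨ha.trans_lt hq.1.1, hq.1.2.trans_le hb⟩ ⟨hc.trans_lt hq.2.1, hq.2.2.trans_le hd⟩
  have hev : ∀ᶠ q' : ℝ × ℝ in 𝓝 (q.1, q.2), u (param K q'.1 q'.2) = P q' := by
    filter_upwards [(isOpen_Ioo.prod isOpen_Ioo).mem_nhds hq] with q' hq'
    exact huP _ (Ioo_subset_Icc_self hq'.1) _ (Ioo_subset_Icc_self hq'.2)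
  have hu : ContDiffAt ℝ ∞ u (param K q.1 q.2) := contDiffAt_of_param hj hP.contDiffAt hev
  exact ⟨hu, fun z => fderiv_eq_gradForm hj (hu.differentiableAt (by simp))
    (hasFDerivAt_pairing (hP.differentiable (by simp) _)) hev z⟩

omit hP huP in
lemma tendsto_param_piece {s t : ℝ} : Tendsto (fun q => param K q.1 q.2)
    (𝓝[Ioo a b ×ˢ Ioo c d] (s, t)) (𝓝[cell K] (param K s t)) := by
  refine tendsto_nhdsWithin_iff.2 ⟨?_, ?_⟩
  · exact ((contDiff_param K (n := 0)).continuous.tendsto (s, t)).mono_left nhdsWithin_le_nhds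
  · filter_upwards [self_mem_nhdsWithin] with q hq
    exact param_mem_cell hK ⟨ha.trans_lt hq.1.1, hq.1.2.trans_le hb⟩
      ⟨hc.trans_lt hq.2.1, hq.2.2.trans_le hd⟩

omit hK hP ha hb hc hd huP in
include hab hcd in
lemma nhdsWithin_piece_neBot {s t : ℝ} (hs : s ∈ Icc a b) (ht : t ∈ Icc c d) :
    (𝓝[Ioo a b ×ˢ Ioo c d] (s, t)).NeBot := by
  rw [← mem_closure_iff_nhdsWithin_neBot, closure_prod_eq, closure_Ioo hab.ne, closure_Ioo hcd.ne]
  exact ⟨hs, ht⟩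

omit ha hb hc hd huP in
lemma contDiffAt_gradForm {s t} (hs : s ∈ I) (ht : t ∈ I) (z) :
    ContDiffAt ℝ ∞ (fun q => gradForm K q.1 q.2 (d1 P q) (d2 P q) z) (s, t) := by
  have hj := (hK.jac_pos hs ht).ne'
  have h1 := (contDiff_d1 hP).contDiffAt (x := (s, t))
  have h2 := (contDiff_d2 hP).contDiffAt (x := (s, t))
  have h3 : ContDiffAt ℝ ∞ (fun q => jac K q.1 q.2) (s, t) := by
    unfold jac cross tanS tanT; fun_prop
  have h4 : ContDiffAt ℝ ∞ (fun q => cross z (tanT K q.1)) (s, t) := by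
    unfold cross tanT; fun_prop
  have h5 : ContDiffAt ℝ ∞ (fun q => cross (tanS K q.2) z) (s, t) := by
    unfold cross tanS; fun_prop
  exact ((h4.div h3 hj).mul h1).add ((h5.div h3 hj).mul h2)

include hab hcd

lemma piece_value {s t : ℝ} (hs : s ∈ Icc a b) (ht : t ∈ Icc c d) {v : ℝ}
    (h : Tendsto u (𝓝[cell K] (param K s t)) (𝓝 v)) : P (s, t) = v := by
  have := nhdsWithin_piece_neBot hab hcd hs ht
  have h1 := h.comp (tendsto_param_piece hK ha hb hc hd (s := s) (t := t))
  refine tendsto_nhds_unique (l := 𝓝[Ioo a b ×ˢ Ioo c d] (s, t)) (((hP.continuous).tendsto (s, t)).mono_left nhdsWithin_le_nhds) ?_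
  refine h1.congr' ?_
  filter_upwards [self_mem_nhdsWithin] with q hq
  exact huP _ (Ioo_subset_Icc_self hq.1) _ (Ioo_subset_Icc_self hq.2)

lemma piece_grad {s t : ℝ} (hs : s ∈ Icc a b) (ht : t ∈ Icc c d) {z} {v : ℝ}
    (h : Tendsto (fun y => fderiv ℝ u y z) (𝓝[cell K] (param K s t)) (𝓝 v)) :
    gradForm K s t (d1 P (s, t)) (d2 P (s, t)) z = v := by
  have := nhdsWithin_piece_neBot hab hcd hs ht
  have h1 := h.comp (tendsto_param_piece hK ha hb hc hd (s := s) (t := t))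
  refine tendsto_nhds_unique (l := 𝓝[Ioo a b ×ˢ Ioo c d] (s, t)) ((contDiffAt_gradForm hK hP ⟨ha.trans hs.1, hs.2.trans hb⟩
    ⟨hc.trans ht.1, ht.2.trans hd⟩ z).continuousAt.mono_left nhdsWithin_le_nhds) ?_
  refine h1.congr' ?_
  filter_upwards [self_mem_nhdsWithin] with q hq
  exact (contDiffAt_of_piece hK hP ha hb hc hd huP hq).2 z

lemma piece_hess {s t : ℝ} (hs : s ∈ Icc a b) (ht : t ∈ Icc c d) {D : CellData} {i}
    (hi : param K s t = K i)
    (h : ∀ a b, a + b ≤ 2 → Tendsto (mixedD a b u) (𝓝[cell K] (K i)) (𝓝 (D.1 i a b)))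
    (z) :
    HasDerivAt (fun s => gradForm K s t (d1 P (s, t)) (d2 P (s, t)) z)
      (D.hess i (tanS K t) z) s := by
  have := nhdsWithin_piece_neBot hab hcd hs ht
  have hG := contDiffAt_gradForm hK hP (P := P) (s := s) (t := t) ⟨ha.trans hs.1, hs.2.trans hb⟩
    ⟨hc.trans ht.1, ht.2.trans hd⟩ z
  set G := fun q => gradForm K q.1 q.2 (d1 P q) (d2 P q) z with hGdef
  have key := hasDerivAt_d1 (P := G) (hG.differentiableAt (by simp))
  suffices e : d1 G (s, t) = D.hess i (tanS K t) z by rwa [e] at key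
  have hcont : ContinuousAt (d1 G) (s, t) :=
    ((hG.fderiv_right (m := 0) (by simp)).clm_apply contDiffAt_const).continuousAt
  refine tendsto_nhds_unique (l := 𝓝[Ioo a b ×ˢ Ioo c d] (s, t)) (hcont.mono_left nhdsWithin_le_nhds) ?_
  have hl := tendsto_param_piece hK ha hb hc hd (s := s) (t := t)
  rw [hi] at hl
  have h20 := (h 2 0 (by norm_num)).comp hl
  have h11 := (h 1 1 (by norm_num)).comp hl
  have h02 := (h 0 2 (by norm_num)).comp hl
  have hv : ∀ j, Tendsto (fun q => tanS K q.2 j) (𝓝[Ioo a b ×ˢ Ioo c d] (s, t))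
      (𝓝 (tanS K t j)) := fun j => by
    have : Continuous fun q : ℝ × ℝ => tanS K q.2 j := by unfold tanS; fun_prop
    exact (this.tendsto (s, t)).mono_left nhdsWithin_le_nhds
  have hlim := ((h20.mul ((hv 0).mul_const (z 0))).add
    (h11.mul (((hv 0).mul_const (z 1)).add ((hv 1).mul_const (z 0))))).add
    (h02.mul ((hv 1).mul_const (z 1)))
  refine hlim.congr' ?_
  filter_upwards [self_mem_nhdsWithin] with q hq
  have hu := (contDiffAt_of_piece hK hP ha hb hc hd huP hq).1
  have hu2 : ContDiffAt ℝ 2 u (param K q.1 q.2) := hu.of_le two_le_infty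
  have hd' : DifferentiableAt ℝ (fderiv ℝ u) (param K q.1 q.2) :=
    (hu2.fderiv_right (m := 1) (by norm_num)).differentiableAt (by norm_num)
  have hcomp : HasFDerivAt (fun q => fderiv ℝ u (param K q.1 q.2))
      ((fderiv ℝ (fderiv ℝ u) (param K q.1 q.2)).comp (dparam K q.1 q.2)) q :=
    HasFDerivAt.comp q (g := fderiv ℝ u) hd'.hasFDerivAt (hasFDerivAt_param K q.1 q.2)
  have hz := hcomp.clm_apply (hasFDerivAt_const z q)
  have hGz : G =ᶠ[𝓝 q] fun q => fderiv ℝ u (param K q.1 q.2) z := by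
    filter_upwards [(isOpen_Ioo.prod isOpen_Ioo).mem_nhds hq] with q' hq'
    exact ((contDiffAt_of_piece hK hP ha hb hc hd huP hq').2 z).symm
  have e1 : d1 G q = fderiv ℝ (fderiv ℝ u) (param K q.1 q.2) (tanS K q.2) z := by
    rw [d1, (hz.congr_of_eventuallyEq hGz).fderiv]
    simp
  have hsym := (hu2.isSymmSndFDerivAt (by simp)) (single 1 1)
    (single 0 1)
  have ev : ∀ v : Plane, v = v 0 • single 0 1 + v 1 • single 1 1 :=
    fun v => by ext j; fin_cases j <;> simp
  have m20 : mixedD 2 0 u (param K q.1 q.2) = _ := partialD_partialD hu2 0 0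
  have m11 : mixedD 1 1 u (param K q.1 q.2) = _ := partialD_partialD hu2 0 1
  have m02 : mixedD 0 2 u (param K q.1 q.2) = _ := partialD_partialD hu2 1 1
  simp only [Function.comp_apply]
  rw [e1, m20, m11, m02]
  conv_rhs => rw [ev (tanS K q.2), ev z]
  simp only [map_add, map_smul, add_apply, smul_apply, smul_eq_mul, hsym]
  ring

end piece

lemma gradForm_tanS {s t : ℝ} (h : jac K s t ≠ 0) (a b : ℝ) :
    gradForm K s t a b (tanS K t) = a := by
  have : cross (tanS K t) (tanT K s) / jac K s t = 1 := div_self h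
  rw [gradForm, this, cross_self]; ring

lemma gradForm_tanT {s t : ℝ} (h : jac K s t ≠ 0) (a b : ℝ) :
    gradForm K s t a b (tanT K s) = b := by
  have : cross (tanS K t) (tanT K s) / jac K s t = 1 := div_self h
  rw [gradForm, this, cross_self]; ring

lemma gradForm_add_smul (K) (s t a b α β : ℝ) (v w) :
    gradForm K s t a b (α • v + β • w) = α * gradForm K s t a b v + β * gradForm K s t a b w := by
  simp only [gradForm, cross_add_left, cross_add_right, cross_smul_left, cross_smul_right]; ring

variable {D : CellData} {u : Fn}

lemma BoundaryReg.tendsto_fderiv_corner (h : BoundaryReg p K D u) (i) (z) :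
    Tendsto (fun y => fderiv ℝ u y z) (𝓝[cell K] (K i)) (𝓝 (D.grad i z)) := by
  have h1 := (h.jet i 1 0 (by norm_num)).mul_const (z 0)
  have h2 := (h.jet i 0 1 (by norm_num)).mul_const (z 1)
  refine (h1.add h2).congr fun y => ?_
  have ev : z = z 0 • single 0 1 + z 1 • single 1 1 := by
    ext j; fin_cases j <;> simp
  conv_rhs => rw [ev]
  rw [map_add, map_smul, map_smul, smul_eq_mul, smul_eq_mul, mul_comm (z 0), mul_comm (z 1)]
  rfl

lemma param_sideCorner (K) (b : Fin 2) :
    param K (b : ℕ) 0 = K (sideCorner b) := by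
  rw [param_zero]; fin_cases b <;> simp [sideCorner]

lemma natCast_fin_two_mem (b : Fin 2) : ((b : ℕ) : ℝ) ∈ I := by
  fin_cases b <;> simp

section

variable (hp : 3 ≤ p) (hK : ConvexQuad K) (h : BoundaryReg p K D u) {P : ℝ × ℝ → ℝ}
  (hP : ContDiff ℝ ∞ P) {x y d : ℝ} (hx : 0 ≤ x) (hy : y ≤ 1) (hd : d ≤ 1) (hxy : x < y)
  (hd0 : 0 < d) (huP : ∀ s ∈ Icc x y, ∀ t ∈ Icc 0 d, u (param K s t) = P (s, t))

include hK h hP hx hy hd hxy hd0 huP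

lemma BoundaryReg.corner {b : Fin 2} (hb : ((b : ℕ) : ℝ) ∈ Icc x y) :
    P ((b : ℕ), 0) = D.1 (sideCorner b) 0 0 ∧
    (∀ z, gradForm K (b : ℕ) 0 (d1 P ((b : ℕ), 0)) (d2 P ((b : ℕ), 0)) z =
      D.grad (sideCorner b) z) ∧
    ∀ z, HasDerivAt (fun s => gradForm K s 0 (d1 P (s, 0)) (d2 P (s, 0)) z)
      (D.hess (sideCorner b) (K 1 - K 0) z) (b : ℕ) := by
  have h0 : (0 : ℝ) ∈ Icc 0 d := ⟨le_rfl, hd0.le⟩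
  refine ⟨?_, fun z => ?_, fun z => ?_⟩
  · refine piece_value hK hP hx hy le_rfl hd hxy hd0 huP hb h0 ?_
    rw [param_sideCorner]
    exact h.jet (sideCorner b) 0 0 (by norm_num)
  · refine piece_grad hK hP hx hy le_rfl hd hxy hd0 huP hb h0 ?_
    rw [param_sideCorner]
    exact h.tendsto_fderiv_corner (sideCorner b) z
  · have := piece_hess hK hP hx hy le_rfl hd hxy hd0 huP hb h0 (param_sideCorner K b)
      (h.jet (sideCorner b)) z
    simpa [tanS] using this

lemma BoundaryReg.hermite_corner {b : Fin 2} (hb : ((b : ℕ) : ℝ) ∈ Icc x y) (l : Fin 3) :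
    iteratedDeriv l (fun s => P (s, 0)) (b : ℕ) = traceCoef p K D (.inl (b, l)) := by
  obtain ⟨h0, h1, h2⟩ := h.corner hK hP hx hy hd hxy hd0 huP hb
  have hdP : ∀ s, HasDerivAt (fun s => P (s, 0)) (d1 P (s, 0)) s := fun s =>
    hasDerivAt_d1 (hP.differentiable (by simp) _)
  have hj := (hK.jac_pos (natCast_fin_two_mem b) (show (0 : ℝ) ∈ I by simp)).ne'
  have e : tanS K 0 = K 1 - K 0 := by simp [tanS]
  have ed : deriv (fun s => P (s, 0)) = fun s => d1 P (s, 0) := funext fun s => (hdP s).deriv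
  fin_cases l
  · simpa [traceCoef] using h0
  · have := h1 (tanS K 0)
    rw [gradForm_tanS hj, e] at this
    simpa [traceCoef, iteratedDeriv_one, ed] using this
  · have := h2 (tanS K 0)
    have hev : (fun s => gradForm K s 0 (d1 P (s, 0)) (d2 P (s, 0)) (tanS K 0)) =ᶠ[𝓝 ((b : ℕ) : ℝ)]
        fun s => d1 P (s, 0) := by
      have hc : ContinuousAt (fun s => jac K s 0) (b : ℕ) :=
        ((continuous_jac K).comp (f := fun s : ℝ => (s, 0)) (by fun_prop)).continuousAt
      filter_upwards [hc.eventually_ne hj] with s hs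
      exact gradForm_tanS hs _ _
    have hde := (this.congr_of_eventuallyEq hev.symm).deriv
    rw [e] at hde
    simp [traceCoef, iteratedDeriv_succ, ed, hde]

end

lemma BoundaryReg.side (hp : 3 ≤ p) (hK : ConvexQuad K) (h : BoundaryReg p K D u) :
    (∀ τ ∈ I, u (param K τ 0) = traceFn p K D τ) ∧
    ∀ τ ∈ I,
      HasDerivWithinAt (fun t => u (param K τ t)) (crossFn p K D τ) I 0 := by
  set k := subdiv p with hk
  have hk0 : 0 < k := subdiv_pos p
  have hk0' : (0 : ℝ) < k := by exact_mod_cast hk0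
  have hd0 : (0 : ℝ) < 1 / k := by positivity
  have hd : (1 : ℝ) / k ≤ 1 := by
    rw [div_le_one hk0']; exact_mod_cast hk0
  have h00 : (0 : ℝ) ∈ Icc (0 : ℝ) (1 / k) := ⟨le_rfl, hd0.le⟩
  have hpc : ∀ i, ∃ P, i < k → ContDiff ℝ ∞ P ∧
      (∃ R : Polynomial ℝ, R.natDegree ≤ p ∧ ∀ s, P (s, 0) = R.eval s) ∧
      ∀ s ∈ knotIcc k i, ∀ t ∈ Icc (0 : ℝ) (1 / k),
        u (param K s t) = P (s, t) := fun i => by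
    by_cases hi : i < k
    · obtain ⟨P, h1, h2, -, h3⟩ := h.pieces i hi 0 hk0
      exact ⟨P, fun _ => ⟨h1, h2 0, by grind⟩⟩
    · exact ⟨0, fun hi' => absurd hi' hi⟩
  choose P hP using hpc
  have hx0 : ∀ i : ℕ, (0 : ℝ) ≤ (i : ℝ) / k := fun i => by positivity
  have hy1 : ∀ i < k, (i + 1 : ℝ) / k ≤ 1 := fun i hi => by
    rw [div_le_one hk0']; exact_mod_cast hi
  have hxy : ∀ i < k, (i : ℝ) / k < (i + 1 : ℝ) / k := fun i hi => piece_lt hi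
  have hjac : ∀ τ ∈ I, jac K τ 0 ≠ 0 := fun τ hτ => (hK.jac_pos hτ (by simp)).ne'
  -- the trace
  obtain ⟨c, hc⟩ := exists_splineOf (d := p) (r := p - 1) hk0 (by omega)
    (f := fun τ => u (param K τ 0))
    (by simp only [param_zero]; simpa using h.trace_smooth 0) (fun i hi => by
      grind)
  have hT : EqOn (splineOf p (p - 1) k c) (traceFn p K D) I := by
    refine (traceBasis_spec hp).ext (spline_splineOf c) (spline_traceFn hp K D) ?_
    rintro (⟨b, l⟩ | η)
    · rw [hermite_traceFn hp]
      obtain ⟨i, hi, hb⟩ := exists_piece hk0 (natCast_fin_two_mem b)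
      rw [← h.hermite_corner hK (hP i hi).1 (hx0 i) (hy1 i hi) hd (hxy i hi) hd0 (hP i hi).2.2 hb l]
      refine iteratedDeriv_eq_of_eqOn_Icc (hxy i hi) (fun s hs => ?_) hb ?_ ?_
      · rw [← hc (piece_subset hi hs)]
        grind
      · exact ((spline_splineOf c).contDiffAt (.inl (by omega)))
      · have := ((hP i hi).1.of_le (m := ((l : ℕ) : WithTop ℕ∞)) (by exact_mod_cast le_top))
        exact (this.comp (f := fun s : ℝ => (s, (0 : ℝ))) (by fun_prop)).contDiffAt
    · rw [hermite_traceFn hp]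
      have hη := Ioo_subset_Icc_self (edgeValueParams_mem η.2)
      obtain ⟨i, hi, hb⟩ := exists_piece hk0 hη
      have := piece_value hK (hP i hi).1 (hx0 i) (hy1 i hi) le_rfl hd (hxy i hi) hd0 (hP i hi).2.2
        hb h00 (v := D.2.1 0 η) (by rw [param_zero]; simpa using h.value 0 η η.2)
      simp only [hermite, traceCoef]
      grind
  have hS1 : ∀ τ ∈ I, u (param K τ 0) = traceFn p K D τ := fun τ hτ => by
    grind
  have hd1 : ∀ i < k, ∀ τ ∈ knotIcc k i,
      deriv (traceFn p K D) τ = d1 (P i) (τ, 0) := fun i hi τ hτ => by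
    rw [← iteratedDeriv_one, ← (hasDerivAt_d1 ((hP i hi).1.differentiable (by simp) _)).deriv,
      ← iteratedDeriv_one]
    refine iteratedDeriv_eq_of_eqOn_Icc (hxy i hi) (fun s hs => ?_) hτ ?_ ?_
    · grind
    · exact ((spline_traceFn hp K D).contDiffAt (.inl (by omega)))
    · have := ((hP i hi).1.of_le (m := ((1 : ℕ) : WithTop ℕ∞)) (by exact_mod_cast le_top))
      exact (this.comp (f := fun s : ℝ => (s, (0 : ℝ))) (by fun_prop)).contDiffAt
  -- the transversal derivative
  have hW : ∀ i < k, ∀ τ ∈ knotIcc k i,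
      HasDerivWithinAt (fun t => u (param K τ t)) (d2 (P i) (τ, 0)) I 0 :=
    fun i hi τ hτ => by
      have h1 := (hasDerivAt_d2 (s := τ) (t := 0)
        ((hP i hi).1.differentiable (by simp) _)).hasDerivWithinAt (s := I)
      refine h1.congr_of_eventuallyEq ?_ ((hP i hi).2.2 τ hτ 0 h00)
      filter_upwards [self_mem_nhdsWithin, nhdsWithin_le_nhds (Iio_mem_nhds hd0)] with t ht ht'
      grind
  have hW' : ∀ τ : I, ∃ w, HasDerivWithinAt (fun t => u (param K τ t)) w I 0 :=
    fun τ => by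
      obtain ⟨i, hi, hb⟩ := exists_piece hk0 τ.2
      grind
  choose W hWd using hW'
  have hu0 : UniqueDiffWithinAt ℝ I 0 := uniqueDiffOn_Icc_zero_one 0 (by simp)
  obtain ⟨c', hc'⟩ : ∃ c' : HermiteIdx 2 (faceParams p) → ℝ, ∀ τ : I,
      ∑ j, c' j * crossBasis p j τ = W τ := by
    let S : Submodule ℝ (I → ℝ) :=
      Submodule.span ℝ (range fun j => fun τ : I => crossBasis p j τ)
    have hSf : FiniteDimensional ℝ S := FiniteDimensional.span_of_finite ℝ (finite_range _)
    have hmem : ∀ f : ℝ → ℝ, Spline p (p - 2) k f → (fun τ : I => f τ) ∈ S := by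
      intro f hf
      refine (Submodule.mem_span_range_iff_exists_fun ℝ).2 ⟨fun j => hermite j f, ?_⟩
      ext τ
      rw [(crossBasis_spec hp).2.2 f hf τ τ.2]
      simp
    have hin : ∀ t ∈ Ioo (0 : ℝ) (1 / k), (fun τ : I => u (param K τ t)) ∈ S := by
      intro t ht
      have ht1 : t ∈ J := ⟨ht.1, ht.2.trans_le hd⟩
      obtain ⟨c, hc⟩ := exists_splineOf (d := p) (r := p - 2) hk0 (by omega)
        (f := fun τ => u (param K τ t)) (h.smooth.comp
          ((contDiff_param K).comp (f := fun s : ℝ => (s, t)) (by fun_prop)).contDiffOn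
          fun s hs => param_mem_cell hK hs ht1) (fun i hi => by
          obtain ⟨Q, -, h2, -, h4⟩ := h.pieces i hi 0 hk0
          obtain ⟨R, hR, hR'⟩ := h2 t
          grind)
      have := hmem _ (spline_splineOf c)
      grind
    have h0 : (fun τ : I => u (param K τ 0)) ∈ S := by
      have := hmem _ ((spline_traceFn hp K D).mono le_rfl (by omega))
      grind
    have hWS : W ∈ S := by
      have hne : (𝓝[Ioo (0 : ℝ) (1 / k)] 0).NeBot := by
        rw [← mem_closure_iff_nhdsWithin_neBot, closure_Ioo hd0.ne]; exact h00
      refine (Submodule.closed_of_finiteDimensional S).mem_of_tendsto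
        (f := fun t => (t - 0)⁻¹ • ((fun τ : I => u (param K τ t)) -
          fun τ : I => u (param K τ 0))) (b := 𝓝[Ioo (0 : ℝ) (1 / k)] 0) ?_ ?_
      · refine tendsto_pi_nhds.2 fun τ => ?_
        refine (hasDerivWithinAt_iff_tendsto_slope.1 (hWd τ)).mono_left (nhdsWithin_mono _ ?_)
        grind
      · filter_upwards [self_mem_nhdsWithin] with t ht
        exact S.smul_mem _ (S.sub_mem (hin t ht) h0)
    obtain ⟨c', hc'⟩ := (Submodule.mem_span_range_iff_exists_fun ℝ).1 hWS
    exact ⟨c', fun τ => by simpa using congrFun hc' τ⟩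
  set V : ℝ → ℝ := fun τ => ∑ j, c' j * crossBasis p j τ with hV
  have hVs : Spline p (p - 2) k V := (crossBasis_spec hp).spline_sum c'
  have hd2 : ∀ i < k, ∀ τ ∈ knotIcc k i, V τ = d2 (P i) (τ, 0) :=
    fun i hi τ hτ => by
      have := hc' ⟨τ, piece_subset hi hτ⟩
      exact this.trans (hu0.eq_deriv _ (hWd ⟨τ, piece_subset hi hτ⟩) (hW i hi τ hτ))
  -- the normal derivative
  set n := unitNormal (K 0) (K 1) with hn
  set g : ℝ → ℝ := fun τ => gradForm K τ 0 (deriv (traceFn p K D) τ) (V τ) n with hg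
  have hgP : ∀ i < k, ∀ τ ∈ knotIcc k i,
      g τ = gradForm K τ 0 (d1 (P i) (τ, 0)) (d2 (P i) (τ, 0)) n := fun i hi τ hτ => by
    grind
  have hgc : ∀ τ ∈ I, ContDiffAt ℝ (p - 2 : ℕ) g τ := fun τ hτ => by
    have h1 : ContDiffAt ℝ (p - 2 : ℕ) (deriv (traceFn p K D)) τ := by
      have := contDiffAt_iteratedDeriv (n := p - 2) (f := traceFn p K D) (s := τ) 1
        ((spline_traceFn hp K D).contDiffAt (.inl (by omega)))
      rwa [iteratedDeriv_one] at this
    have h2 : ContDiffAt ℝ (p - 2 : ℕ) V τ := hVs.1.contDiffAt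
    have h3 : ContDiffAt ℝ (p - 2 : ℕ) (fun τ => jac K τ 0) τ := by
      unfold jac cross tanS tanT; fun_prop
    have h4 : ContDiffAt ℝ (p - 2 : ℕ) (fun τ => cross n (tanT K τ)) τ := by
      unfold cross tanT; fun_prop
    have h5 : ContDiffAt ℝ (p - 2 : ℕ) (fun τ : ℝ => cross (tanS K 0) n) τ := contDiffAt_const
    exact ((h4.div h3 (hjac τ hτ)).mul h1).add ((h5.div h3 (hjac τ hτ)).mul h2)
  obtain ⟨c2, hc2⟩ := exists_splineOf (d := p - 1) (r := p - 2) hk0 (by omega) (f := g)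
    (fun τ hτ => (hgc τ (Ioo_subset_Icc_self hτ)).contDiffWithinAt) (fun i hi => by
      obtain ⟨r, hr, hr'⟩ := h.normal_piecewise 0 i hi
      refine ⟨r, hr, ?_⟩
      refine EqOn.of_subset_closure (s := Ioo ((i : ℝ) / k) ((i + 1 : ℝ) / k)) (fun τ hτ => ?_)
        (fun τ hτ => (hgc τ (piece_subset hi hτ)).continuousAt.continuousWithinAt)
        r.continuous.continuousOn Ioo_subset_Icc_self (by rw [closure_Ioo (hxy i hi).ne])
      have hτ' := Ioo_subset_Icc_self hτ
      have hlim := hr' τ ⟨(hx0 i).trans_lt hτ.1, hτ.2.trans_le (hy1 i hi)⟩ hτ'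
      rw [zero_add, ← param_zero] at hlim
      rw [hgP i hi τ hτ']
      exact piece_grad hK (hP i hi).1 (hx0 i) (hy1 i hi) le_rfl hd (hxy i hi) hd0 (hP i hi).2.2
        hτ' h00 hlim)
  have hN : EqOn (splineOf (p - 1) (p - 2) k c2) (normalFn p K D) I := by
    refine (normalBasis_spec hp).ext (spline_splineOf c2) (spline_normalFn hp K D) ?_
    rintro (⟨b, l⟩ | η)
    · rw [hermite_normalFn hp]
      have hb1 := natCast_fin_two_mem b
      obtain ⟨i, hi, hb⟩ := exists_piece hk0 hb1
      obtain ⟨-, e1, e2⟩ := h.corner hK (hP i hi).1 (hx0 i) (hy1 i hi) hd (hxy i hi) hd0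
        (hP i hi).2.2 hb
      fin_cases l
      · have := e1 n
        rw [← hgP i hi _ hb, hc2 hb1] at this
        simpa [hermite, normalCoef] using this
      · have hde : iteratedDeriv 1 (splineOf (p - 1) (p - 2) k c2) (b : ℕ) = iteratedDeriv 1
            (fun s => gradForm K s 0 (d1 (P i) (s, 0)) (d2 (P i) (s, 0)) n) (b : ℕ) := by
          refine iteratedDeriv_eq_of_eqOn_Icc (hxy i hi) (fun s hs => ?_) hb ?_ ?_
          · grind
          · exact ((spline_splineOf c2).contDiffAt (.inl (by omega)))
          · have := ((contDiffAt_gradForm hK (hP i hi).1 hb1 (t := 0) (by simp) n).of_le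
              (m := ((1 : ℕ) : WithTop ℕ∞)) (by exact_mod_cast le_top))
            exact ContDiffAt.comp (b : ℕ) (f := fun s : ℝ => (s, (0 : ℝ))) this (by fun_prop)
        rw [iteratedDeriv_one, iteratedDeriv_one, (e2 n).deriv] at hde
        simpa [hermite, normalCoef, iteratedDeriv_one] using hde
    · rw [hermite_normalFn hp]
      have hη := Ioo_subset_Icc_self (edgeNormalParams_mem η.2)
      obtain ⟨i, hi, hb⟩ := exists_piece hk0 hη
      have := piece_grad hK (hP i hi).1 (hx0 i) (hy1 i hi) le_rfl hd (hxy i hi) hd0 (hP i hi).2.2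
        hb h00 (z := n) (v := D.2.2.1 0 η) (by rw [param_zero]; simpa using h.normal 0 η η.2)
      rw [← hgP i hi _ hb, hc2 hη] at this
      simpa [hermite, normalCoef] using this
  refine ⟨hS1, fun τ hτ => ?_⟩
  have hgn : g τ = normalFn p K D τ := by grind
  have e : tanS K 0 = K 1 - K 0 := by simp [tanS]
  have hVc : V τ = crossFn p K D τ := by
    rw [← gradForm_tanT (hjac τ hτ) (deriv (traceFn p K D) τ) (V τ),
      side_decomp (hK.ne 0) (tanT K τ), gradForm_add_smul]
    have e1 := gradForm_tanS (hjac τ hτ) (deriv (traceFn p K D) τ) (V τ)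
    rw [e] at e1
    have e2 : gradForm K τ 0 (deriv (traceFn p K D) τ) (V τ) n = _ := hgn
    simp only [zero_add, e1, ← hn, e2, crossFn]
    ring
  rw [← hVc]
  have := hWd ⟨τ, hτ⟩
  grind

/-! ### Unisolvence of the local degrees of freedom -/

lemma param_rot_two (K : Quad) (s t : ℝ) :
    param (rot 2 K) s t = param K (1 - s) (1 - t) := (param_sideCoord K 2 (s, t)).symm

lemma param_rot_three (K : Quad) (s t : ℝ) : param (rot 3 K) s t = param K t (1 - s) :=
  (param_sideCoord K 3 (s, t)).symm

variable {D : CellData} {u w : Fn}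

lemma BoundaryReg.exists_splineOf_col (hK : ConvexQuad K) (h : BoundaryReg p K D u) {ξ : ℝ}
    (hξ : ξ ∈ J) :
    ∃ c, EqOn (fun t => u (param K ξ t)) (splineOf p (p - 2) (subdiv p) c) I := by
  refine exists_splineOf (subdiv_pos p) (by omega) (h.smooth.comp
    ((contDiff_param K).comp (f := fun t : ℝ => (ξ, t)) (by fun_prop)).contDiffOn
    fun t ht => param_mem_cell hK hξ ht) fun j hj => ?_
  obtain ⟨i, hi, hi'⟩ := exists_piece (subdiv_pos p) (Ioo_subset_Icc_self hξ)
  obtain ⟨Q, -, -, h3, h4⟩ := h.pieces i hi j hj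
  obtain ⟨R, hR, hR'⟩ := h3 ξ
  exact ⟨R, hR, fun t ht => by rw [h4 ξ hi' t ht, hR']⟩

lemma BoundaryReg.eqOn_col (hp : 3 ≤ p) (hK : ConvexQuad K) (hu : BoundaryReg p K D u)
    (hw : BoundaryReg p K D w) {ξ : ℝ} (hξ : ξ ∈ J)
    (hf : ∀ η ∈ faceParams p, u (param K ξ η) = w (param K ξ η)) :
    ∀ t ∈ I, u (param K ξ t) = w (param K ξ t) := by
  obtain ⟨c, hc⟩ := hu.exists_splineOf_col hK hξ
  obtain ⟨c', hc'⟩ := hw.exists_splineOf_col hK hξ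
  have hξ' := Ioo_subset_Icc_self hξ
  have hξ2 : 1 - ξ ∈ I := ⟨by linarith [hξ'.2], by linarith [hξ'.1]⟩
  have hun : UniqueDiffWithinAt ℝ I 0 := uniqueDiffOn_Icc_zero_one 0 (by simp)
  have hdiff : ∀ c, Differentiable ℝ (splineOf p (p - 2) (subdiv p) c) := fun c =>
    (spline_splineOf c).1.differentiable (by norm_cast; omega)
  have key : EqOn (splineOf p (p - 2) (subdiv p) c) (splineOf p (p - 2) (subdiv p) c')
      I := by
    refine (crossBasis_spec hp).ext (spline_splineOf c) (spline_splineOf c') ?_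
    rintro (⟨b, l⟩ | η)
    · obtain ⟨u1, u2⟩ := hu.side hp hK
      obtain ⟨w1, w2⟩ := hw.side hp hK
      obtain ⟨u3, u4⟩ := (hu.rot 2).side hp (hK.rot 2)
      obtain ⟨w3, w4⟩ := (hw.rot 2).side hp (hK.rot 2)
      simp only [param_rot_two] at u3 u4 w3 w4
      have m0 : (0 : ℝ) ∈ I := by simp
      have m1 : (1 : ℝ) ∈ I := by simp
      have d0 : ∀ {v : Fn} {c} {D' : ℝ}, EqOn (fun t => v (param K ξ t)) (splineOf p (p - 2) (subdiv p) c)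
          I → HasDerivWithinAt (fun t => v (param K ξ t)) D' I 0 →
          deriv (splineOf p (p - 2) (subdiv p) c) 0 = D' := fun {v c D'} he hd =>
        hun.eq_deriv _ (hdiff c 0).hasDerivAt.hasDerivWithinAt
          (hd.congr (fun t ht => (he ht).symm) (he m0).symm)
      have d1 : ∀ {v : Fn} {c} {D' : ℝ}, EqOn (fun t => v (param K ξ t)) (splineOf p (p - 2) (subdiv p) c)
          I → HasDerivWithinAt (fun t => v (param K ξ (1 - t))) D' I 0 →
          deriv (splineOf p (p - 2) (subdiv p) c) 1 = -D' := fun {v c D'} he hd => by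
        have hm : ∀ t ∈ I, 1 - t ∈ I := fun t ht =>
          ⟨by linarith [ht.2], by linarith [ht.1]⟩
        have h1 : HasDerivWithinAt (fun t => splineOf p (p - 2) (subdiv p) c (1 - t)) D' I 0 :=
          hd.congr (fun t ht => (he (hm t ht)).symm) (he (hm 0 m0)).symm
        have h2 := ((hdiff c).comp (f := fun t : ℝ => 1 - t)
          (by fun_prop)).differentiableAt (x := 0).hasDerivAt.hasDerivWithinAt (s := I)
        have h3 := hun.eq_deriv _ h2 h1
        change deriv (fun t => splineOf p (p - 2) (subdiv p) c (1 - t)) 0 = D' at h3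
        rw [deriv_flip, sub_zero] at h3
        linarith
      fin_cases b <;> fin_cases l
      · simpa [hermite] using (hc m0).symm.trans (((u1 ξ hξ').trans (w1 ξ hξ').symm).trans (hc' m0))
      · have a1 := d0 hc (u2 ξ hξ')
        have a2 := d0 hc' (w2 ξ hξ')
        simp [hermite, iteratedDeriv_one, a1, a2]
      · have e1 := u3 (1 - ξ) hξ2
        have e2 := w3 (1 - ξ) hξ2
        simp only [sub_sub_cancel, sub_zero] at e1 e2
        simpa [hermite] using (hc m1).symm.trans ((e1.trans e2.symm).trans (hc' m1))
      · have e1 := u4 (1 - ξ) hξ2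
        have e2 := w4 (1 - ξ) hξ2
        simp only [sub_sub_cancel] at e1 e2
        have a1 := d1 hc e1
        have a2 := d1 hc' e2
        simp [hermite, iteratedDeriv_one, a1, a2]
    · have hη := Ioo_subset_Icc_self (faceParams_mem η.2)
      exact (hc hη).symm.trans ((hf η η.2).trans (hc' hη))
  intro t ht
  exact (hc ht).trans ((key ht).trans (hc' ht).symm)

/-- The interpolant of the data `D`. -/
def interpFn (p : ℕ) (K : Quad) (D : CellData) (x : Plane) : ℝ :=
  interpD p K D 0 0 (paramInv K x).1 (paramInv K x).2

lemma isInterp_interpFn (hK : ConvexQuad K) (D : CellData) :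
    IsInterp p K D (interpFn p K D) := fun s hs t ht => by
  rw [interpFn, paramInv_param hK hs ht]

lemma HasLocalData.face_eq (hK : ConvexQuad K) (hu : MemLocalSpace p K u)
    (hd : HasLocalData p K D u) {ξ η : ℝ} (hξ : ξ ∈ faceParams p) (hη : η ∈ faceParams p) :
    u (param K ξ η) = D.2.2.2 ξ η := by
  have hm := param_mem_cell hK (faceParams_mem hξ) (faceParams_mem hη)
  have hne := nhdsWithin_cell_neBot hK (interior_subset hm)
  exact tendsto_nhds_unique ((hu.smooth.continuousOn) _ hm) (hd.face ξ hξ η hη)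

/-- A function of the local space is the interpolant of its local degrees of freedom. -/
theorem MemLocalSpace.isInterp (hp : 3 ≤ p) (hK : ConvexQuad K) (hu : MemLocalSpace p K u)
    (hd : HasLocalData p K D u) : IsInterp p K D u := by
  set w := interpFn p K D
  have hw : IsInterp p K D w := isInterp_interpFn hK D
  have hwm := hw.memLocalSpace hp hK
  have hwd := hw.hasLocalData hp hK
  have bu := hu.boundaryReg hd
  have bw := hwm.boundaryReg hwd
  have hflip : ∀ t ∈ I, 1 - t ∈ I := fun t ht =>
    ⟨by linarith [ht.2], by linarith [ht.1]⟩
  have step1 : ∀ ξ ∈ faceParams p, ∀ t ∈ I, u (param K ξ t) = w (param K ξ t) :=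
    fun ξ hξ => bu.eqOn_col hp hK bw (faceParams_mem hξ) fun η hη => by
      rw [hd.face_eq hK hu hξ hη, hwd.face_eq hK hwm hξ hη]
  intro s hs t ht
  rw [← hw s hs t ht]
  by_cases ht' : t ∈ J
  · have ht2 : 1 - t ∈ J := ⟨by linarith [ht'.2], by linarith [ht'.1]⟩
    have := (bu.rot 3).eqOn_col hp (hK.rot 3) (bw.rot 3) ht2 (fun η hη => by
      simp only [param_rot_three, sub_sub_cancel]
      exact step1 η hη t ht) s hs
    simpa only [param_rot_three, sub_sub_cancel] using this
  · have : t = 0 ∨ t = 1 := by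
      by_contra hc
      push Not at hc
      exact ht' ⟨lt_of_le_of_ne ht.1 (Ne.symm hc.1), lt_of_le_of_ne ht.2 hc.2⟩
    rcases this with rfl | rfl
    · exact ((bu.side hp hK).1 s hs).trans ((bw.side hp hK).1 s hs).symm
    · have := (((bu.rot 2).side hp (hK.rot 2)).1 (1 - s) (hflip s hs)).trans
        (((bw.rot 2).side hp (hK.rot 2)).1 (1 - s) (hflip s hs)).symm
      simpa only [param_rot_two, sub_sub_cancel, sub_zero] using this

/-! ### Compatibility of the interpolants of neighbouring cells -/

lemma mem_closedCell_cases (hK : ConvexQuad K) {x : Plane}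
    (hx : x ∈ closedCell K) : x ∈ cell K ∨ (∃ i, x = K i) ∨
      ∃ i, ∃ τ ∈ J, x = AffineMap.lineMap (K i) (K (i + 1)) τ := by
  obtain ⟨q, h1, h2, rfl⟩ := exists_param_of_mem_closedCell hK hx
  by_cases h : q.1 ∈ J ∧ q.2 ∈ J
  · exact .inl (param_mem_cell hK h.1 h.2)
  · right
    obtain ⟨i, τ, hτ, he⟩ := boundary_eq_sideCoord h1 h2 h
    have e : param K q.1 q.2 = AffineMap.lineMap (K i) (K (i + 1)) τ := by
      rw [← param_sideCoord_zero, ← he]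
    rcases eq_or_lt_of_le hτ.1 with h0 | h0
    · exact .inl ⟨i, by rw [e, ← h0]; simp⟩
    rcases eq_or_lt_of_le hτ.2 with h1 | h1
    · exact .inl ⟨i + 1, by rw [e, h1]; simp⟩
    · exact .inr ⟨i, τ, ⟨h0, h1⟩, e⟩

lemma paramInv_side (hK : ConvexQuad K) (i : Fin 4) {τ : ℝ}
    (hτ : τ ∈ I) :
    paramInv K (lineMap (K i) (K (i + 1)) τ) = sideCoord i (τ, 0) := by
  have hm := sideCoord_mem (i := i) (q := (τ, 0)) hτ (by simp)
  rw [← param_sideCoord_zero, paramInv_param hK hm.1 hm.2]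

lemma paramInv_corner (hK : ConvexQuad K) (i : Fin 4) :
    paramInv K (K i) = sideCoord i (0, 0) := by
  simpa using paramInv_side hK i (τ := 0) (by simp)

lemma unitNormal_swap (x y : Plane) : unitNormal y x = -unitNormal x y := by
  ext j; fin_cases j <;> simp [unitNormal, dist_comm x y] <;> ring

/-- The gradient of the interpolant. -/
def interpGrad (p : ℕ) (K : Quad) (D : CellData) (z x : Plane) : ℝ :=
  gradFn p K D z (paramInv K x)

/-- The data on the side `i` of `K` and on the side `i'` of `K'` correspond to each other. -/
def SidesMatch (p : ℕ) (K K' : Quad) (D D' : CellData) : Prop :=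
  (K 0 = K' 0 ∧ K 1 = K' 1 ∧ D.1 0 = D'.1 0 ∧ D.1 1 = D'.1 1 ∧
    (∀ η ∈ edgeValueParams p, D.2.1 0 η = D'.2.1 0 η) ∧
    ∀ η ∈ edgeNormalParams p, D.2.2.1 0 η = D'.2.2.1 0 η) ∨
  (K 0 = K' 1 ∧ K 1 = K' 0 ∧ D.1 0 = D'.1 1 ∧ D.1 1 = D'.1 0 ∧
    (∀ η ∈ edgeValueParams p, D.2.1 0 η = D'.2.1 0 (1 - η)) ∧
    ∀ η ∈ edgeNormalParams p, D.2.2.1 0 η = -D'.2.2.1 0 (1 - η))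

lemma SidesMatch.fn_eq (hp : 3 ≤ p) {K K' : Quad} {D D' : CellData}
    (h : SidesMatch p K K' D D') :
    (K 0 = K' 0 ∧ K 1 = K' 1 ∧ traceFn p K D = traceFn p K' D' ∧
      normalFn p K D = normalFn p K' D') ∨
    (K 0 = K' 1 ∧ K 1 = K' 0 ∧
      EqOn (traceFn p K D) (fun τ => traceFn p K' D' (1 - τ)) I ∧
      EqOn (normalFn p K D) (fun τ => -1 * normalFn p K' D' (1 - τ)) I) := by
  rcases h with ⟨k0, k1, d0, d1, hv, hn⟩ | ⟨k0, k1, d0, d1, hv, hn⟩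
  · refine .inl ⟨k0, k1, ?_, ?_⟩
    · have : traceCoef p K D = traceCoef p K' D' := by
        ext j
        rcases j with ⟨b, l⟩ | η
        · fin_cases b <;> fin_cases l <;>
            simp [traceCoef, sideCorner, CellData.grad, CellData.hess, d0, d1, k0, k1]
        · exact hv η η.2
      ext τ; simp only [traceFn, this]
    · have : normalCoef p K D = normalCoef p K' D' := by
        ext j
        rcases j with ⟨b, l⟩ | η
        · fin_cases b <;> fin_cases l <;>
            simp [normalCoef, sideCorner, CellData.grad, CellData.hess, d0, d1, k0, k1]
        · exact hn η η.2
      ext τ; simp only [normalFn, this]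
  · refine .inr ⟨k0, k1, ?_, ?_⟩
    · refine (traceBasis_spec hp).ext (spline_traceFn hp K D) (spline_traceFn hp K' D').flip ?_
      rintro (⟨b, l⟩ | η)
      · obtain ⟨e0, e1, e2⟩ := traceFn_end hp K D b
        obtain ⟨f0, f1, f2⟩ := traceFn_end hp K' D' (1 - b)
        fin_cases b <;> fin_cases l <;>
          simp [hermite, deriv_flip, iteratedDeriv_two_flip, iteratedDeriv_one, sideCorner,
            CellData.grad, CellData.hess, d0, d1, k0, k1] at e0 e1 e2 f0 f1 f2 ⊢ <;>
          simp only [e0, e1, e2, f0, f1, f2] <;> ring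
      · have := hermite_traceFn hp K D (.inr η)
        have h2 := hermite_traceFn hp K' D' (.inr ⟨1 - η, edgeValueParams_flip η.2⟩)
        simp only [hermite, traceCoef] at this h2 ⊢
        rw [this, h2, hv η η.2]
    · refine (normalBasis_spec hp).ext (spline_normalFn hp K D)
        ((spline_normalFn hp K' D').flip.const_mul (-1)) ?_
      rintro (⟨b, l⟩ | η)
      · obtain ⟨e0, e1⟩ := normalFn_end hp K D b
        obtain ⟨f0, f1⟩ := normalFn_end hp K' D' (1 - b)
        rw [k0, k1, unitNormal_swap] at e0 e1
        fin_cases b <;> fin_cases l <;>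
          simp [hermite, deriv_flip, iteratedDeriv_one, sideCorner,
            CellData.grad, CellData.hess, d0, d1] at e0 e1 f0 f1 ⊢ <;>
          simp only [e0, e1, f0, f1] <;> ring
      · have := hermite_normalFn hp K D (.inr η)
        have h2 := hermite_normalFn hp K' D' (.inr ⟨1 - η, edgeNormalParams_flip η.2⟩)
        simp only [hermite, normalCoef] at this h2 ⊢
        rw [this, h2, hn η η.2]; ring

lemma deriv_eq_of_eqOn_Icc {f g : ℝ → ℝ} {s : ℝ} (h : EqOn f g I) (hs : s ∈ I)
    (hf : DifferentiableAt ℝ f s) (hg : DifferentiableAt ℝ g s) : deriv f s = deriv g s :=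
  (uniqueDiffOn_Icc_zero_one s hs).eq_deriv _ (hf.hasDerivAt.hasDerivWithinAt.congr
    (fun _ ht => (h ht).symm) (h hs).symm) hg.hasDerivAt.hasDerivWithinAt

lemma lineMap_inj_param {x y : Plane} (h : x ≠ y) {τ τ' : ℝ}
    (he : lineMap x y τ = lineMap x y τ') : τ = τ' :=
  AffineMap.lineMap_injective ℝ h he

lemma lineMap_swap (x y : Plane) (τ : ℝ) :
    lineMap y x τ = lineMap x y (1 - τ) := by
  rw [AffineMap.lineMap_apply_one_sub]

lemma interp_eq_of_sidesMatch (hp : 3 ≤ p) {K K' : Quad} (hK : ConvexQuad K)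
    (hK' : ConvexQuad K') {D D' : CellData} {i i' : Fin 4} {τ τ' : ℝ} (hτ : τ ∈ I)
    (hτ' : τ' ∈ I) {x : Plane}
    (hx : x = lineMap (K i) (K (i + 1)) τ)
    (hx' : x = lineMap (K' i') (K' (i' + 1)) τ')
    (h : SidesMatch p (rot i K) (rot i' K') (D.rot i) (D'.rot i')) :
    interpFn p K D x = interpFn p K' D' x ∧ ∀ z, interpGrad p K D z x = interpGrad p K' D' z x := by
  have e1 : paramInv K x = sideCoord i (τ, 0) := by rw [hx, paramInv_side hK i hτ]
  have e2 : paramInv K' x = sideCoord i' (τ', 0) := by rw [hx', paramInv_side hK' i' hτ']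
  simp only [interpFn, interpGrad, e1, e2, interpD_side hp hK D i hτ, gradFn_side hp hK D i hτ,
    interpD_side hp hK' D' i' hτ', gradFn_side hp hK' D' i' hτ']
  have r0 : ∀ (i : Fin 4) (K : Quad), rot i K 0 = K i := fun i K => by simp [rot]
  have r1 : ∀ (i : Fin 4) (K : Quad), rot i K 1 = K (i + 1) := fun i K => by
    simp [rot, add_comm]
  rcases h.fn_eq hp with ⟨k0, k1, hT, hN⟩ | ⟨k0, k1, hT, hN⟩ <;>
    simp only [r0, r1] at k0 k1
  · rw [hx, k0, k1] at hx'
    obtain rfl := lineMap_inj_param (hK'.ne i') hx'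
    simp [k0, k1, hT, hN]
  · rw [hx, k0, k1, lineMap_swap] at hx'
    obtain rfl := lineMap_inj_param (hK'.ne i') hx'
    have hd := deriv_eq_of_eqOn_Icc hT hτ
      ((spline_traceFn hp _ _).1.differentiable (by norm_cast; omega) _)
      ((spline_traceFn hp _ _).flip.1.differentiable (by norm_cast; omega) _)
    rw [deriv_flip] at hd
    refine ⟨hT hτ, fun z => ?_⟩
    rw [hd, hN hτ, k0, k1, dist_comm]
    simp [dot, cross]; ring

/-! ### Meshes -/

namespace QuadMesh

variable (M : QuadMesh Ω) {K K' : Quad} {c : Dof → ℝ}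

open Classical in
/-- The local data on the cell `K` of a family of values of the degrees of freedom. -/
def cellData (c : Dof → ℝ) (K : Quad) : CellData :=
  (fun i a b => c (.vertexDeriv (K i) a b),
   fun i η => if (K i, K (i + 1)) ∈ M.edges then c (.edgeValue (K i, K (i + 1)) η)
     else c (.edgeValue (K (i + 1), K i) (1 - η)),
   fun i η => if (K i, K (i + 1)) ∈ M.edges then c (.edgeNormal (K i, K (i + 1)) η)
     else -c (.edgeNormal (K (i + 1), K i) (1 - η)),
   fun ξ η => c (.faceValue K ξ η))

variable {M}

lemma lineMap_mem_openSegment {x y : Plane} {τ} (h : τ ∈ J) :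
    lineMap x y τ ∈ openSegment ℝ x y := by
  rw [openSegment_eq_image_lineMap]; exact ⟨τ, h, rfl⟩

lemma edge_not_both {x y} (h : (x, y) ∈ M.edges) : (y, x) ∉ M.edges := fun h' => by
  have hne : (x, y) ≠ (y, x) := fun e => (M.edge_ends _ h).2.2 (congrArg Prod.fst e)
  have := M.disjoint_edges _ h _ h' hne
  rw [openSegment_symm ℝ y x, disjoint_self] at this
  exact (this ▸ lineMap_mem_openSegment (x := x) (y := y) (τ := 1 / 2) (by norm_num) : _ ∈ (∅ : Set Plane))

lemma vertex_mem_iff (hK : K ∈ M.quads) {v} (hv : v ∈ M.vertices)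
    (h : v ∈ closedCell K) : ∃ i, v = K i := by
  rcases mem_closedCell_cases (M.quad_convex K hK) h with h | h | ⟨i, τ, hτ, h⟩
  · exact absurd h (M.vertex_notMem_quad v hv K hK)
  · exact h
  · have hm := lineMap_mem_openSegment (x := K i) (y := K (i + 1)) hτ
    rw [← h] at hm
    rcases M.quad_sides K hK i with he | he
    · exact absurd hm (M.vertex_notMem_edge v hv _ he)
    · rw [openSegment_symm] at hm
      exact absurd hm (M.vertex_notMem_edge v hv _ he)

lemma edge_mem_iff (hK : K ∈ M.quads) {e} (he : e ∈ M.edges) {η}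
    (hη : η ∈ J) (h : lineMap e.1 e.2 η ∈ closedCell K) :
    ∃ i, (K i, K (i + 1)) = e ∨ (K (i + 1), K i) = e := by
  have hm := lineMap_mem_openSegment (x := e.1) (y := e.2) hη
  rcases mem_closedCell_cases (M.quad_convex K hK) h with h | ⟨i, h⟩ | ⟨i, τ, hτ, h⟩
  · exact absurd h fun h => (Set.disjoint_left.1 (M.disjoint_quad_edge K hK e he)) h hm
  · exact absurd hm (h ▸ M.vertex_notMem_edge _ (M.quad_corners K hK i) e he)
  · have hm' := lineMap_mem_openSegment (x := K i) (y := K (i + 1)) hτ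
    rw [← h] at hm'
    refine ⟨i, (M.quad_sides K hK i).imp (fun h' => ?_) fun h' => ?_⟩ <;> by_contra hne
    · exact Set.disjoint_left.1 (M.disjoint_edges _ h' _ he hne) hm' hm
    · rw [openSegment_symm] at hm'
      exact Set.disjoint_left.1 (M.disjoint_edges _ h' _ he hne) hm' hm

lemma eq_of_mem_cell (hK : K ∈ M.quads) (hK' : K' ∈ M.quads) {x} (h : x ∈ cell K)
    (h' : x ∈ closedCell K') : K = K' := by
  by_contra hne
  rw [← closure_cell (M.quad_convex K' hK'), mem_closure_iff] at h'
  obtain ⟨y, hy, hy'⟩ := h' _ (isOpen_cell K) h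
  exact Set.disjoint_left.1 (M.disjoint_quads K hK K' hK' hne) hy hy'

lemma value_entry (hK : K ∈ M.quads) (i) :
    (∀ η, (M.cellData c K).2.1 i η = c (.edgeValue (K i, K (i + 1)) η)) ∧
      (∀ η, (M.cellData c K).2.2.1 i η = c (.edgeNormal (K i, K (i + 1)) η)) ∧
      (K i, K (i + 1)) ∈ M.edges ∨
    (∀ η, (M.cellData c K).2.1 i η = c (.edgeValue (K (i + 1), K i) (1 - η))) ∧
      (∀ η, (M.cellData c K).2.2.1 i η = -c (.edgeNormal (K (i + 1), K i) (1 - η))) ∧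
      (K (i + 1), K i) ∈ M.edges := by
  by_cases h : (K i, K (i + 1)) ∈ M.edges
  · exact .inl ⟨fun η => if_pos h, fun η => if_pos h, h⟩
  · exact .inr ⟨fun η => if_neg h, fun η => if_neg h, (M.quad_sides K hK i).resolve_left h⟩

lemma interp_compat (hp : 3 ≤ p) (hK : K ∈ M.quads) (hK' : K' ∈ M.quads) {x}
    (hx : x ∈ closedCell K) (hx' : x ∈ closedCell K') :
    interpFn p K (M.cellData c K) x = interpFn p K' (M.cellData c K') x ∧
      ∀ z, interpGrad p K (M.cellData c K) z x = interpGrad p K' (M.cellData c K') z x := by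
  have cK := M.quad_convex K hK
  have cK' := M.quad_convex K' hK'
  rcases mem_closedCell_cases cK hx with h | ⟨i, h⟩ | ⟨i, τ, hτ, h⟩
  · rw [eq_of_mem_cell hK hK' h hx']; simp
  · obtain ⟨i', h'⟩ := vertex_mem_iff hK' (h ▸ M.quad_corners K hK i) hx'
    have e1 : paramInv K x = sideCoord i (0, 0) := by rw [h, paramInv_corner cK]
    have e2 : paramInv K' x = sideCoord i' (0, 0) := by rw [h', paramInv_corner cK']
    have e3 : K i = K' i' := h.symm.trans h'
    simp only [interpFn, interpGrad, e1, e2, interpD_corner hp cK, interpD_corner hp cK',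
      gradFn_corner hp cK, gradFn_corner hp cK']
    simp [cellData, CellData.grad, e3]
  · have hτ' := Ioo_subset_Icc_self hτ
    have r0 : ∀ (i : Fin 4) (K : Quad), rot i K 0 = K i := fun i K => by simp [rot]
    have r1 : ∀ (i : Fin 4) (K : Quad), rot i K 1 = K (i + 1) := fun i K => by
      simp [rot, add_comm]
    have hside : ∃ i', (K i = K' i' ∧ K (i + 1) = K' (i' + 1)) ∨
        (K i = K' (i' + 1) ∧ K (i + 1) = K' i') := by
      rcases M.quad_sides K hK i with he | he
      · obtain ⟨i', h'⟩ := edge_mem_iff hK' he hτ (h ▸ hx')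
        refine ⟨i', h'.imp ?_ ?_⟩ <;> intro h' <;> simp only [Prod.mk.injEq] at h'
        · exact ⟨h'.1.symm, h'.2.symm⟩
        · exact ⟨h'.1.symm, h'.2.symm⟩
      · have hτ2 : 1 - τ ∈ J := ⟨by linarith [hτ.2], by linarith [hτ.1]⟩
        obtain ⟨i', h'⟩ := edge_mem_iff hK' he hτ2
          (by rw [lineMap_swap, sub_sub_cancel, ← h]; exact hx')
        refine ⟨i', h'.symm.imp ?_ ?_⟩ <;> intro h' <;> simp only [Prod.mk.injEq] at h'
        · exact ⟨h'.2.symm, h'.1.symm⟩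
        · exact ⟨h'.2.symm, h'.1.symm⟩
    obtain ⟨i', hi'⟩ := hside
    have hτ3 : 1 - τ ∈ I := ⟨by linarith [hτ.2], by linarith [hτ.1]⟩
    have a1 := value_entry (c := c) hK i
    have a2 := value_entry (c := c) hK' i'
    have hj : ∀ i K, (M.cellData c K).1 i = fun a b => c (.vertexDeriv (K i) a b) := fun _ _ => rfl
    rcases hi' with ⟨k0, k1⟩ | ⟨k0, k1⟩
    · refine interp_eq_of_sidesMatch (i' := i') hp cK cK' hτ' hτ' h (by rw [← k0, ← k1]; exact h) (.inl ?_)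
      simp only [r0, r1, CellData.rot, zero_add, hj, add_comm (1 : Fin 4), k0, k1, true_and]
      rw [k0, k1] at a1
      rcases a1 with ⟨a, b, n⟩ | ⟨a, b, n⟩ <;> rcases a2 with ⟨a', b', n'⟩ | ⟨a', b', n'⟩
      · simp [a, b, a', b']
      · exact absurd n' (edge_not_both n)
      · exact absurd n (edge_not_both n')
      · simp [a, b, a', b']
    · refine interp_eq_of_sidesMatch (i' := i') hp cK cK' hτ' hτ3 h
        (by rw [← k0, ← k1, ← lineMap_swap]; exact h) (.inr ?_)
      simp only [r0, r1, CellData.rot, zero_add, hj, add_comm (1 : Fin 4), k0, k1, true_and]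
      rw [k0, k1] at a1
      rcases a1 with ⟨a, b, n⟩ | ⟨a, b, n⟩ <;> rcases a2 with ⟨a', b', n'⟩ | ⟨a', b', n'⟩
      · exact absurd n' (edge_not_both n)
      · simp [a, b, a', b']
      · simp [a, b, a', b']
      · exact absurd n' (edge_not_both n)

lemma exists_glue (f : (Quad) → Fn)
    (hf : ∀ K ∈ M.quads, ∀ K' ∈ M.quads, ∀ x ∈ closedCell K, x ∈ closedCell K' → f K x = f K' x) :
    ∃ g, ∀ K ∈ M.quads, EqOn g (f K) (closedCell K) := by
  classical
  refine ⟨fun x => if h : ∃ K ∈ M.quads, x ∈ closedCell K then f h.choose x else 0,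
    fun K hK x hx => ?_⟩
  have h : ∃ K ∈ M.quads, x ∈ closedCell K := ⟨K, hK, hx⟩
  simp only [dif_pos h]
  exact hf _ h.choose_spec.1 _ hK x h.choose_spec.2 hx

lemma nhdsWithin_openCells (x) : 𝓝[M.openCells] x = ⨆ K ∈ M.quads, 𝓝[cell K] x :=
  nhdsWithin_biUnion M.quads.finite_toSet _ _

lemma tendsto_openCells {f} {x} {a : ℝ}
    (h : ∀ K ∈ M.quads, x ∈ closedCell K → Tendsto f (𝓝[cell K] x) (𝓝 a)) :
    Tendsto f (𝓝[M.openCells] x) (𝓝 a) := by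
  rw [nhdsWithin_openCells]
  simp only [tendsto_iSup]
  intro K hK
  by_cases hx : x ∈ closedCell K
  · exact h K hK hx
  · rw [← closure_cell (M.quad_convex K hK), mem_closure_iff_nhdsWithin_neBot, not_neBot] at hx
    rw [hx]; exact tendsto_bot

lemma cell_subset_openCells (hK : K ∈ M.quads) : cell K ⊆ M.openCells :=
  subset_biUnion_of_mem (u := fun K => cell K) hK

lemma mem_dofs_vertex {v} (hv : v ∈ M.vertices) {a b} (hab : a + b ≤ 2) :
    Dof.vertexDeriv v a b ∈ M.dofs p := by
  classical
  simp only [dofs, Finset.mem_union, Finset.mem_image, Finset.mem_product]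
  refine .inl (.inl (.inl ⟨(v, a, b), ⟨hv, ?_⟩, rfl⟩))
  cases order_two hab
  all_goals simp

lemma mem_dofs_edgeValue {e} (he : e ∈ M.edges) {η : ℝ}
    (hη : η ∈ edgeValueParams p) : Dof.edgeValue e η ∈ M.dofs p := by
  simp only [dofs, Finset.mem_union, Finset.mem_image, Finset.mem_product]
  exact .inl (.inl (.inr ⟨(e, η), ⟨he, hη⟩, rfl⟩))

lemma mem_dofs_edgeNormal {e} (he : e ∈ M.edges) {η : ℝ}
    (hη : η ∈ edgeNormalParams p) : Dof.edgeNormal e η ∈ M.dofs p := by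
  simp only [dofs, Finset.mem_union, Finset.mem_image, Finset.mem_product]
  exact .inl (.inr ⟨(e, η), ⟨he, hη⟩, rfl⟩)

lemma mem_dofs_faceValue (hK : K ∈ M.quads) {ξ η : ℝ} (hξ : ξ ∈ faceParams p)
    (hη : η ∈ faceParams p) : Dof.faceValue K ξ η ∈ M.dofs p := by
  simp only [dofs, Finset.mem_union, Finset.mem_image, Finset.mem_product]
  exact .inr ⟨(K, ξ, η), ⟨hK, hξ, hη⟩, rfl⟩

lemma dofs_cases {d} (hd : d ∈ M.dofs p) :
    (∃ v ∈ M.vertices, ∃ a b, a + b ≤ 2 ∧ d = .vertexDeriv v a b) ∨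
    (∃ e ∈ M.edges, ∃ η ∈ edgeValueParams p, d = .edgeValue e η) ∨
    (∃ e ∈ M.edges, ∃ η ∈ edgeNormalParams p, d = .edgeNormal e η) ∨
    ∃ K ∈ M.quads, ∃ ξ ∈ faceParams p, ∃ η ∈ faceParams p, d = .faceValue K ξ η := by
  classical
  simp only [dofs, Finset.mem_union, Finset.mem_image, Finset.mem_product] at hd
  rcases hd with ((⟨x, hx, rfl⟩ | ⟨x, hx, rfl⟩) | ⟨x, hx, rfl⟩) | ⟨x, hx, rfl⟩
  · refine .inl ⟨x.1, hx.1, x.2.1, x.2.2, ?_, rfl⟩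
    have := hx.2
    simp only [Finset.mem_insert, Finset.mem_singleton, Prod.ext_iff] at this
    rcases this with h | h | h | h | h | h <;> rw [h.1, h.2]
    all_goals norm_num
  · exact .inr (.inl ⟨x.1, hx.1, x.2, hx.2, rfl⟩)
  · exact .inr (.inr (.inl ⟨x.1, hx.1, x.2, hx.2, rfl⟩))
  · exact .inr (.inr (.inr ⟨x.1, hx.1, x.2.1, hx.2.1, x.2.2, hx.2.2, rfl⟩))

lemma fderiv_neg_unitNormal (u : Fn) (x y) :
    (fun w => fderiv ℝ u w (unitNormal x y)) = fun w => -fderiv ℝ u w (unitNormal y x) := by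
  ext w; rw [unitNormal_swap y x, map_neg]

/-- Values of the global degrees of freedom are values of the local degrees of freedom. -/
lemma hasLocalData_of_hasDofValue {u} (h : ∀ d ∈ M.dofs p, M.HasDofValue d u (c d))
    (hK : K ∈ M.quads) : HasLocalData p K (M.cellData c K) u := by
  have mono : ∀ {f : Fn} {x a}, Tendsto f (𝓝[M.openCells] x) (𝓝 a) →
      Tendsto f (𝓝[cell K] x) (𝓝 a) := fun h =>
    h.mono_left (nhdsWithin_mono _ (cell_subset_openCells hK))
  refine ⟨fun i a b hab => mono (h _ (mem_dofs_vertex (M.quad_corners K hK i) hab)),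
    fun i η hη => ?_, fun i η hη => ?_,
    fun ξ hξ η hη => mono (h _ (mem_dofs_faceValue hK hξ hη))⟩
  · rcases value_entry (c := c) hK i with ⟨a, -, he⟩ | ⟨a, -, he⟩ <;> rw [a]
    · exact mono (h _ (mem_dofs_edgeValue he hη))
    · have := mono (h _ (mem_dofs_edgeValue he (edgeValueParams_flip hη)))
      simp only [Dof.point, lineMap_swap (K i) (K (i + 1)), sub_sub_cancel] at this
      exact this
  · rcases value_entry (c := c) hK i with ⟨-, a, he⟩ | ⟨-, a, he⟩ <;> rw [a]
    · exact mono (h _ (mem_dofs_edgeNormal he hη))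
    · have := mono (h _ (mem_dofs_edgeNormal he (edgeNormalParams_flip hη)))
      simp only [Dof.point, lineMap_swap (K i) (K (i + 1)), sub_sub_cancel] at this
      rw [fderiv_neg_unitNormal]
      exact this.neg

/-- The converse of the above. -/
lemma hasDofValue_of_hasLocalData {u}
    (h : ∀ K ∈ M.quads, HasLocalData p K (M.cellData c K) u) {d} (hd : d ∈ M.dofs p) :
    M.HasDofValue d u (c d) := by
  refine tendsto_openCells fun K hK hx => ?_
  rcases dofs_cases hd with ⟨v, hv, a, b, hab, rfl⟩ | ⟨e, he, η, hη, rfl⟩ | ⟨e, he, η, hη, rfl⟩ |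
    ⟨K', hK', ξ, hξ, η, hη, rfl⟩ <;> simp only [Dof.point, Dof.op] at hx ⊢
  · obtain ⟨i, rfl⟩ := vertex_mem_iff hK hv hx
    exact (h K hK).jet i a b hab
  · obtain ⟨i, rfl | rfl⟩ := edge_mem_iff hK he (edgeValueParams_mem hη) hx
    · have := (h K hK).value i η hη
      rcases value_entry (c := c) hK i with ⟨a, -, he'⟩ | ⟨a, -, he'⟩
      · rwa [a] at this
      · exact absurd he (edge_not_both he')
    · have := (h K hK).value i (1 - η) (edgeValueParams_flip hη)
      rw [← lineMap_swap] at this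
      rcases value_entry (c := c) hK i with ⟨a, -, he'⟩ | ⟨a, -, he'⟩
      · exact absurd he (edge_not_both he')
      · rwa [a, sub_sub_cancel] at this
  · obtain ⟨i, rfl | rfl⟩ := edge_mem_iff hK he (edgeNormalParams_mem hη) hx
    · have := (h K hK).normal i η hη
      rcases value_entry (c := c) hK i with ⟨-, a, he'⟩ | ⟨-, a, he'⟩
      · rwa [a] at this
      · exact absurd he (edge_not_both he')
    · have := (h K hK).normal i (1 - η) (edgeNormalParams_flip hη)
      rw [← lineMap_swap] at this
      rcases value_entry (c := c) hK i with ⟨-, a, he'⟩ | ⟨-, a, he'⟩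
      · exact absurd he (edge_not_both he')
      · rw [a, sub_sub_cancel] at this
        simp only [fderiv_neg_unitNormal u (K (i + 1))]
        simpa using this.neg
  · have hm := param_mem_cell (M.quad_convex K' hK') (faceParams_mem hξ) (faceParams_mem hη)
    obtain rfl := eq_of_mem_cell hK' hK hm hx
    exact (h K' hK).face ξ hξ η hη

lemma IsInterp.congr_interpFn {u} {D} (hK : ConvexQuad K)
    (h : EqOn u (interpFn p K D) (closedCell K)) : IsInterp p K D u := fun s hs t ht => by
  rw [h (param_mem_closedCell K hs ht), isInterp_interpFn hK D s hs t ht]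

lemma exists_isInterp (hp : 3 ≤ p) (c : Dof → ℝ) :
    ∃ u, ∀ K ∈ M.quads, IsInterp p K (M.cellData c K) u := by
  obtain ⟨u, hu⟩ := exists_glue (M := M) (fun K => interpFn p K (M.cellData c K))
    fun K hK K' hK' x hx hx' => (interp_compat hp hK hK' hx hx').1
  exact ⟨u, fun K hK => IsInterp.congr_interpFn (M.quad_convex K hK) (hu K hK)⟩

theorem exists_isDualBasis (hp : 3 ≤ p) (M : QuadMesh Ω) : ∃ β, M.IsDualBasis p β := by
  classical
  choose u hu using fun d =>
    exists_isInterp (M := M) hp fun d' => if d' = d then 1 else 0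
  refine ⟨u, fun d _ => ?_⟩
  have hv : ∀ d' ∈ M.dofs p, M.HasDofValue d' (u d) (if d' = d then 1 else 0) := fun d' hd' =>
    hasDofValue_of_hasLocalData (c := fun d' => if d' = d then 1 else 0)
      (fun K hK => (hu d K hK).hasLocalData hp (M.quad_convex K hK)) hd'
  refine ⟨⟨fun K hK => (hu d K hK).memLocalSpace hp (M.quad_convex K hK),
    fun d' hd' => ⟨_, hv d' hd'⟩⟩, fun d' hd' => ?_⟩
  have := hv d' hd'
  convert this

end QuadMesh

/-! ### Linearity of the interpolant in the data -/

section linear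

variable (K : Quad) (a : ℝ) (D D' : CellData)

lemma CellData.grad_lin (i : Fin 4) (z : Plane) :
    (a • D + D').grad i z = a * D.grad i z + D'.grad i z := by
  simp [CellData.grad]; ring

lemma CellData.hess_lin (i : Fin 4) (z z' : Plane) :
    (a • D + D').hess i z z' = a * D.hess i z z' + D'.hess i z z' := by
  simp [CellData.hess]; ring

lemma traceFn_lin (τ : ℝ) : traceFn p K (a • D + D') τ = a * traceFn p K D τ + traceFn p K D' τ := by
  simp only [traceFn, mul_sum, ← sum_add_distrib]
  refine sum_congr rfl fun j _ => ?_
  rcases j with ⟨b, l⟩ | η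
  · fin_cases l <;> simp [traceCoef, CellData.grad_lin, CellData.hess_lin] <;> ring
  · simp [traceCoef]; ring

lemma normalFn_lin (τ : ℝ) :
    normalFn p K (a • D + D') τ = a * normalFn p K D τ + normalFn p K D' τ := by
  simp only [normalFn, mul_sum, ← sum_add_distrib]
  refine sum_congr rfl fun j _ => ?_
  rcases j with ⟨b, l⟩ | η
  · fin_cases l <;> simp [normalCoef, CellData.grad_lin, CellData.hess_lin] <;> ring
  · simp [normalCoef]; ring

lemma crossFn_lin (hp : 3 ≤ p) (τ : ℝ) :
    crossFn p K (a • D + D') τ = a * crossFn p K D τ + crossFn p K D' τ := by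
  have h : ∀ D, DifferentiableAt ℝ (traceFn p K D) τ := fun D =>
    (spline_traceFn hp K D).1.differentiable (by norm_cast; omega) τ
  have e : deriv (traceFn p K (a • D + D')) τ
      = a * deriv (traceFn p K D) τ + deriv (traceFn p K D') τ := by
    rw [show traceFn p K (a • D + D') = fun τ => a * traceFn p K D τ + traceFn p K D' τ from
      funext (traceFn_lin K a D D'), deriv_fun_add ((h D).const_mul a) (h D'), deriv_const_mul _ (h D)]
  rw [crossFn, e, normalFn_lin, crossFn, crossFn]; ring

lemma tensorCoef_lin (hp : 3 ≤ p) (i j) :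
    tensorCoef p K (a • D + D') i j = a * tensorCoef p K D i j + tensorCoef p K D' i j := by
  have r : ∀ i, (a • D + D').rot i = a • D.rot i + D'.rot i := fun _ => rfl
  rcases i with ⟨b, l⟩ | ξ <;> rcases j with ⟨b', l'⟩ | η
  · fin_cases l <;> fin_cases l' <;>
      simp [tensorCoef, CellData.grad_lin, CellData.hess_lin] <;> ring
  · fin_cases b <;> fin_cases l <;> simp [tensorCoef, r, traceFn_lin, crossFn_lin _ _ _ _ hp] <;> ring
  · fin_cases b' <;> fin_cases l' <;>
      simp [tensorCoef, r, traceFn_lin, crossFn_lin _ _ _ _ hp] <;> ring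
  · simp [tensorCoef]

/-- The interpolant as a linear function of the data. -/
def interpLin (hp : 3 ≤ p) (l l' : ℕ) (s t : ℝ) : CellData →ₗ[ℝ] ℝ where
  toFun D := interpD p K D l l' s t
  map_add' D D' := by
    have := tensorCoef_lin K 1 D D' hp
    simp only [one_smul, one_mul] at this
    simp only [interpD, this, add_mul, sum_add_distrib]
  map_smul' a D := by
    have h0 := tensorCoef_lin K (-1) (0 : CellData) 0 hp
    simp only [smul_zero, add_zero] at h0
    have := tensorCoef_lin K a D 0 hp
    simp only [add_zero] at this
    have h1 : ∀ i j, tensorCoef p K 0 i j = 0 := fun i j => by linarith [h0 i j]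
    simp only [interpD, this, h1, add_zero, mul_sum, smul_eq_mul, RingHom.id_apply, mul_assoc]

end linear

lemma IsInterp.sum (hp : 3 ≤ p) {ι : Type*} (S : Finset ι) (c : ι → ℝ)
    {D : ι → CellData} {u : ι → Fn} (h : ∀ d ∈ S, IsInterp p K (D d) (u d)) :
    IsInterp p K (∑ d ∈ S, c d • D d) fun x => ∑ d ∈ S, c d * u d x := fun s hs t ht => by
  have e := map_sum (interpLin K hp 0 0 s t) (fun d => c d • D d) S
  simp only [map_smul, smul_eq_mul] at e
  change interpD p K _ 0 0 s t = _ at e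
  rw [e]
  exact sum_congr rfl fun d hd => by rw [h d hd s hs t ht]; rfl

/-- The data on which the interpolant depends. -/
structure DataEq (p : ℕ) (D D' : CellData) : Prop where
  jet : ∀ i a b, a + b ≤ 2 → D.1 i a b = D'.1 i a b
  value : ∀ i, ∀ η ∈ edgeValueParams p, D.2.1 i η = D'.2.1 i η
  normal : ∀ i, ∀ η ∈ edgeNormalParams p, D.2.2.1 i η = D'.2.2.1 i η
  face : ∀ ξ ∈ faceParams p, ∀ η ∈ faceParams p, D.2.2.2 ξ η = D'.2.2.2 ξ η

lemma HasLocalData.congr {D D' : CellData} {u : Fn}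
    (h : HasLocalData p K D u) (e : DataEq p D D') : HasLocalData p K D' u where
  jet i a b hab := e.jet i a b hab ▸ h.jet i a b hab
  value i η hη := e.value i η hη ▸ h.value i η hη
  normal i η hη := e.normal i η hη ▸ h.normal i η hη
  face ξ hξ η hη := e.face ξ hξ η hη ▸ h.face ξ hξ η hη

lemma IsInterp.congr (hp : 3 ≤ p) (hK : ConvexQuad K)
    {D D' : CellData} {u : Fn} (h : IsInterp p K D u) (e : DataEq p D D') :
    IsInterp p K D' u :=
  (h.memLocalSpace hp hK).isInterp hp hK ((h.hasLocalData hp hK).congr e)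

namespace QuadMesh

variable {M : QuadMesh Ω}

open Classical in
lemma dataEq_cellData (c : Dof → ℝ) (hK : K ∈ M.quads) :
    DataEq p (∑ d ∈ M.dofs p, c d • M.cellData (fun d' => if d' = d then 1 else 0) K)
      (M.cellData c K) := by
  have key : ∀ d ∈ M.dofs p, ∑ d' ∈ M.dofs p, c d' * (if d = d' then 1 else 0) = c d :=
    fun d hd => by simp [hd]
  refine ⟨fun i a b hab => ?_, fun i η hη => ?_, fun i η hη => ?_, fun ξ hξ η hη => ?_⟩
  · rw [Prod.fst_sum, Finset.sum_apply, Finset.sum_apply, Finset.sum_apply]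
    exact key _ (mem_dofs_vertex (M.quad_corners K hK i) hab)
  · rw [Prod.snd_sum, Prod.fst_sum, Finset.sum_apply, Finset.sum_apply]
    simp only [Prod.smul_snd, Prod.smul_fst, Pi.smul_apply, smul_eq_mul]
    by_cases h : (K i, K (i + 1)) ∈ M.edges
    · simp only [cellData, if_pos h]
      exact key _ (mem_dofs_edgeValue h hη)
    · simp only [cellData, if_neg h]
      exact key _ (mem_dofs_edgeValue ((M.quad_sides K hK i).resolve_left h)
        (edgeValueParams_flip hη))
  · rw [Prod.snd_sum, Prod.snd_sum, Prod.fst_sum, Finset.sum_apply, Finset.sum_apply]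
    simp only [Prod.smul_snd, Prod.smul_fst, Pi.smul_apply, smul_eq_mul]
    by_cases h : (K i, K (i + 1)) ∈ M.edges
    · simp only [cellData, if_pos h]
      exact key _ (mem_dofs_edgeNormal h hη)
    · simp only [cellData, if_neg h, mul_neg, Finset.sum_neg_distrib]
      rw [key _ (mem_dofs_edgeNormal ((M.quad_sides K hK i).resolve_left h)
        (edgeNormalParams_flip hη))]
  · rw [Prod.snd_sum, Prod.snd_sum, Prod.snd_sum, Finset.sum_apply, Finset.sum_apply]
    exact key _ (mem_dofs_faceValue hK hξ hη)

/-- The projection is on each cell the interpolant of the degrees of freedom. -/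
theorem isInterp_projector (hp : 3 ≤ p) {β : Dof → Fn} (hβ : M.IsDualBasis p β)
    (v : Fn) (hK : K ∈ M.quads) :
    IsInterp p K (M.cellData (fun d => M.dofValue d v) K) (M.projector p β v) := by
  classical
  have cK := M.quad_convex K hK
  have h : ∀ d ∈ M.dofs p,
      IsInterp p K (M.cellData (fun d' => if d' = d then 1 else 0) K) (β d) := fun d hd => by
    refine ((hβ d hd).1.1 K hK).isInterp hp cK (hasLocalData_of_hasDofValue (fun d' hd' => ?_) hK)
    have := (hβ d hd).2 d' hd'
    convert this
  refine (IsInterp.sum hp (M.dofs p) (fun d => M.dofValue d v) h).congr hp cK ?_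
  convert dataEq_cellData (M := M) (p := p) (fun d => M.dofValue d v) hK

lemma closedCell_subset_closure (hK : K ∈ M.quads) :
    closedCell K ⊆ closure Ω := by
  rw [M.closure_eq]; exact subset_biUnion_of_mem (u := fun K => closedCell K) hK

lemma point_mem {d : Dof} (hd : d ∈ M.dofs p) : ∃ K ∈ M.quads, d.point ∈ closedCell K := by
  have hedge : ∀ e ∈ M.edges, ∀ η ∈ J, ∃ K ∈ M.quads,
      AffineMap.lineMap e.1 e.2 η ∈ closedCell K := fun e he η hη => by
    obtain ⟨K, hK, i, h⟩ := M.edge_used e he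
    have hv : ∀ i, K i ∈ closedCell K := fun i => subset_convexHull ℝ _ ⟨i, rfl⟩
    have hcv : Convex ℝ (closedCell K) := convex_convexHull ℝ _
    refine ⟨K, hK, hcv.lineMap_mem ?_ ?_ (Ioo_subset_Icc_self hη)⟩ <;> rcases h with rfl | rfl <;>
      exact hv _
  rcases dofs_cases hd with ⟨v, hv, a, b, hab, rfl⟩ | ⟨e, he, η, hη, rfl⟩ | ⟨e, he, η, hη, rfl⟩ |
    ⟨K', hK', ξ, hξ, η, hη, rfl⟩
  · obtain ⟨K, hK, i, rfl⟩ := M.vertex_used v hv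
    exact ⟨K, hK, subset_convexHull ℝ _ ⟨i, rfl⟩⟩
  · exact hedge e he η (edgeValueParams_mem hη)
  · exact hedge e he η (edgeNormalParams_mem hη)
  · exact ⟨K', hK', param_mem_closedCell K' (Ioo_subset_Icc_self (faceParams_mem hξ))
      (Ioo_subset_Icc_self (faceParams_mem hη))⟩

lemma openCells_subset : M.openCells ⊆ Ω := iUnion₂_subset M.cell_subset

/-- The degrees of freedom of a function in `C²(closure Ω)` are well defined. -/
lemma hasDofValue_of_memC2Closure {v : Fn} (hv : MemC2Closure Ω v) {d : Dof}
    (hd : d ∈ M.dofs p) : M.HasDofValue d v (M.dofValue d v) := by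
  obtain ⟨K, hK, hx⟩ := point_mem hd
  have hx' := closedCell_subset_closure hK hx
  have hne : (𝓝[M.openCells] d.point).NeBot :=
    (nhdsWithin_cell_neBot (M.quad_convex K hK) hx).mono
      (nhdsWithin_mono _ (cell_subset_openCells hK))
  have hlim : ∀ a b, a + b ≤ 2 → ∃ y,
      Tendsto (mixedD a b v) (𝓝[M.openCells] d.point) (𝓝 y) := fun a b hab => by
    obtain ⟨g, hg, hge⟩ := hv.2.2 a b hab
    refine ⟨g d.point, ((hg _ hx').mono_left (nhdsWithin_mono _
      (openCells_subset.trans subset_closure))).congr' ?_⟩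
    filter_upwards [self_mem_nhdsWithin] with y hy using hge (openCells_subset hy)
  have : ∃ y, Tendsto (d.op v) (𝓝[M.openCells] d.point) (𝓝 y) := by
    rcases dofs_cases hd with ⟨w, hw, a, b, hab, rfl⟩ | ⟨e, he, η, hη, rfl⟩ |
      ⟨e, he, η, hη, rfl⟩ | ⟨K', hK', ξ, hξ, η, hη, rfl⟩
    · exact hlim a b hab
    · exact hlim 0 0 (by norm_num)
    · obtain ⟨y, hy⟩ := hlim 1 0 (by norm_num)
      obtain ⟨y', hy'⟩ := hlim 0 1 (by norm_num)
      have h := (hy.mul_const (unitNormal e.1 e.2 0)).add (hy'.mul_const (unitNormal e.1 e.2 1))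
      refine ⟨_, h.congr fun x => ?_⟩
      have ev : unitNormal e.1 e.2 = unitNormal e.1 e.2 0 • single 0 1
          + unitNormal e.1 e.2 1 • single 1 1 := by
        ext j; fin_cases j <;> simp
      simp only [Dof.op]
      conv_rhs => rw [ev]
      rw [map_add, map_smul, map_smul, smul_eq_mul, smul_eq_mul, mul_comm _ (fderiv ℝ v x _),
        mul_comm _ (fderiv ℝ v x _)]
      rfl
    · exact hlim 0 0 (by norm_num)
  exact tendsto_nhds_limUnder this

end QuadMesh

/-! ### Lipschitz functions and weak derivatives -/

lemma lipschitzOn_of_cover {E : Type*} [NormedAddCommGroup E] [NormedSpace ℝ E] {ι : Type*}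
    [Finite ι] {A : ι → Set E} (hA : ∀ i, IsClosed (A i)) {S : Set E} (hS : Convex ℝ S)
    (hSA : S ⊆ ⋃ i, A i) {f : E → ℝ} (hf : ContinuousOn f S) {C : ℝ}
    (hC : ∀ i, ∀ x ∈ A i ∩ S, ∀ y ∈ A i ∩ S, |f x - f y| ≤ C * dist x y) :
    ∀ x ∈ S, ∀ y ∈ S, |f x - f y| ≤ C * dist x y := by
  intro x hx y hy
  set γ : ℝ → E := fun τ => lineMap x y τ with hγ
  have hγc : Continuous γ := AffineMap.lineMap_continuous
  have hγS : ∀ τ ∈ I, γ τ ∈ S := fun τ hτ => hS.lineMap_mem hx hy hτ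
  have hγd : ∀ τ τ', dist (γ τ) (γ τ') = |τ - τ'| * dist x y := fun τ τ' => by
    rw [hγ, dist_lineMap_lineMap, Real.dist_eq]
  have hfγ : ContinuousOn (fun τ => f (γ τ)) I := hf.comp hγc.continuousOn hγS
  have key : I ⊆ {τ | |f x - f (γ τ)| ≤ C * (τ * dist x y)} := by
    refine IsClosed.Icc_subset_of_forall_exists_gt ?_ ?_ ?_
    · rw [inter_comm]
      exact isClosed_Icc.isClosed_le (continuousOn_const.sub hfγ).abs (by fun_prop)
    · simp [hγ]
    · rintro τ ⟨hτ, hτ01⟩ τ' hτ'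
      have hlt : τ < min τ' 1 := lt_min hτ' hτ01.2
      have hfr : ∃ᶠ σ in 𝓝[>] τ, σ ∈ Ioo τ (min τ' 1) :=
        Filter.Eventually.frequently
          (show ∀ᶠ σ in 𝓝[>] τ, σ ∈ Ioo τ (min τ' 1) from Ioo_mem_nhdsGT hlt)
      have : ∃ i, ∃ᶠ σ in 𝓝[>] τ, σ ∈ Ioo τ (min τ' 1) ∧ γ σ ∈ A i := by
        by_contra hcon
        push Not at hcon
        refine hfr ?_
        filter_upwards [eventually_all.2 hcon] with σ hσ hσ'
        obtain ⟨i, hi⟩ := mem_iUnion.1 (hSA (hγS σ ⟨hτ01.1.trans hσ'.1.le,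
          (hσ'.2.trans_le (min_le_right _ _)).le⟩))
        exact hσ i hσ' hi
      obtain ⟨i, hi⟩ := this
      have hτi : γ τ ∈ A i := by
        refine (hA i).mem_of_frequently_of_tendsto (hi.mono fun σ h => h.2)
          ((hγc.tendsto τ).mono_left nhdsWithin_le_nhds)
      obtain ⟨σ, hσ, hσi⟩ := hi.exists
      have hσ1 : σ ∈ I :=
        ⟨hτ01.1.trans hσ.1.le, (hσ.2.trans_le (min_le_right _ _)).le⟩
      refine ⟨σ, ?_, hσ.1, (hσ.2.trans_le (min_le_left _ _)).le⟩
      have h1 := hC i (γ τ) ⟨hτi, hγS τ ⟨hτ01.1, hτ01.2.le⟩⟩ (γ σ) ⟨hσi, hγS σ hσ1⟩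
      rw [hγd, abs_sub_comm τ σ, abs_of_pos (sub_pos.2 hσ.1)] at h1
      have h2 := abs_sub_le (f x) (f (γ τ)) (f (γ σ))
      simp only [mem_ofPred_eq] at hτ ⊢
      nlinarith
  have := key (right_mem_Icc.2 zero_le_one)
  simpa [hγ] using this

lemma partialD_eq_zero {i} {ψ} {x} (hx : x ∉ tsupport ψ) :
    partialD i ψ x = 0 := by
  have : fderiv ℝ ψ x = 0 := by
    by_contra h
    exact hx (support_fderiv_subset ℝ h)
  simp [partialD, this]

/-- A smooth function with compact support in `Ω`. -/
structure IsTest (Ω : Set Plane) (ψ : Fn) : Prop where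
  smooth : ContDiff ℝ ∞ ψ
  compact : HasCompactSupport ψ
  subset : tsupport ψ ⊆ Ω

lemma contDiff_partialD {ψ} (h : ContDiff ℝ ∞ ψ) (i) :
    ContDiff ℝ ∞ (partialD i ψ) :=
  (h.fderiv_right (m := ∞) (by simp)).clm_apply contDiff_const

lemma IsTest.partialD {ψ} (h : IsTest Ω ψ) (i) : IsTest Ω (partialD i ψ) := by
  have hs : tsupport (BSQuad.partialD i ψ) ⊆ tsupport ψ := by
    refine closure_minimal (fun x hx => ?_) (isClosed_tsupport ψ)
    by_contra hc
    exact hx (partialD_eq_zero hc)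
  exact ⟨contDiff_partialD h.smooth i, h.compact.mono' (subset_closure.trans hs), hs.trans h.subset⟩

lemma partialD_swap {ψ} {x} (h : ContDiffAt ℝ 2 ψ x) (i j) :
    partialD i (partialD j ψ) x = partialD j (partialD i ψ) x := by
  rw [partialD_partialD h, partialD_partialD h]
  exact (h.isSymmSndFDerivAt (by simp)) _ _

lemma integral_mul_partialD (hΩ : IsOpen Ω) {f ψ} (hf : LocallyLipschitzOn Ω f)
    (hψ : IsTest Ω ψ) (i) :
    ∫ x in Ω, f x * partialD i ψ x = -∫ x in Ω, partialD i f x * ψ x := by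
  obtain ⟨L, hL, hψL, hLΩ⟩ := exists_compact_between hψ.compact.isCompact hΩ hψ.subset
  obtain ⟨C, hC⟩ := (hf.mono hLΩ).exists_lipschitzOnWith_of_compact hL
  obtain ⟨g, hg, hgf⟩ := hC.extend_real
  obtain ⟨D, hD⟩ := hψ.smooth.lipschitzWith_of_hasCompactSupport hψ.compact (by simp)
  have hψ0 : ∀ x, x ∉ tsupport ψ → ψ x = 0 := fun x hx => image_eq_zero_of_notMem_tsupport hx
  rw [setIntegral_eq_integral_of_forall_compl_eq_zero (fun x hx => by
      rw [partialD_eq_zero fun h => hx (hψ.subset h), mul_zero]),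
    setIntegral_eq_integral_of_forall_compl_eq_zero (fun x hx => by
      rw [hψ0 x fun h => hx (hψ.subset h), mul_zero])]
  have key := hg.integral_lineDeriv_mul_eq (μ := volume) hD hψ.compact
    (single i 1)
  have e1 : ∫ x, lineDeriv ℝ g x (single i 1) * ψ x =
      ∫ x, partialD i f x * ψ x := by
    refine integral_congr_ae ?_
    filter_upwards [hg.ae_differentiableAt] with x hx
    by_cases h : x ∈ tsupport ψ
    · have : f =ᶠ[𝓝 x] g := by
        filter_upwards [isOpen_interior.mem_nhds (hψL h)] with y hy using hgf (interior_subset hy)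
      rw [hx.lineDeriv_eq_fderiv, partialD, this.fderiv_eq]
    · rw [hψ0 x h, mul_zero, mul_zero]
  rw [← e1, key, ← integral_neg]
  refine integral_congr_ae (Eventually.of_forall fun x => ?_)
  simp only
  rw [((hψ.smooth.differentiable (by simp)) x).lineDeriv_eq_fderiv, map_neg]
  by_cases h : x ∈ tsupport ψ
  · rw [hgf (interior_subset (hψL h)), partialD]; ring
  · rw [partialD_eq_zero h]
    have : fderiv ℝ ψ x (single i 1) = 0 := partialD_eq_zero h
    rw [this]; simp

lemma locallyIntegrableOn_partialD (hΩ : IsOpen Ω) {f} (hf : LocallyLipschitzOn Ω f)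
    (i) : LocallyIntegrableOn (partialD i f) Ω := by
  intro x hx
  obtain ⟨C, t, ht, hC⟩ := hf hx
  rw [hΩ.nhdsWithin_eq hx] at ht
  obtain ⟨r, hr, hrt⟩ := Metric.mem_nhds_iff.1 ht
  refine ⟨ball x r, nhdsWithin_le_nhds (Metric.ball_mem_nhds x hr), ?_⟩
  refine Measure.integrableOn_of_bounded (M := C * ‖single i (1 : ℝ)‖)
    measure_ball_lt_top.ne
    (measurable_fderiv_apply_const ℝ f _).aestronglyMeasurable ?_
  refine (ae_restrict_iff' measurableSet_ball).2 (Eventually.of_forall fun y hy => ?_)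
  refine (ContinuousLinearMap.le_opNorm _ _).trans ?_
  gcongr
  refine norm_fderiv_le_of_lip' ℝ C.2 ?_
  filter_upwards [Metric.isOpen_ball.mem_nhds hy] with z hz
  have := hC.dist_le_mul z (hrt hz) y (hrt hy)
  rwa [dist_eq_norm, dist_eq_norm] at this

lemma LocallyLipschitzOn.locallyIntegrableOn (hΩ : IsOpen Ω) {f : Fn}
    (hf : LocallyLipschitzOn Ω f) : LocallyIntegrableOn f Ω :=
  hf.continuousOn.locallyIntegrableOn hΩ.measurableSet

lemma locallyIntegrableOn_congr {f g : Fn} (hf : LocallyIntegrableOn f Ω)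
    (h : f =ᵐ[vol Ω] g) (hΩ : IsOpen Ω) : LocallyIntegrableOn g Ω := by
  rw [locallyIntegrableOn_iff hΩ.isLocallyClosed] at hf ⊢
  intro k hk hkc
  exact (hf k hk hkc).congr (ae_restrict_of_ae_restrict_of_subset hk h)

lemma integral_congr_test {u u' ψ : Fn} (h : u =ᵐ[vol Ω] u') :
    ∫ x in Ω, u x * ψ x = ∫ x in Ω, u' x * ψ x :=
  integral_congr_ae (h.mono fun x hx => by simp only [hx])

lemma IsWeakDeriv.congr (hΩ : IsOpen Ω) {a b} {u u' g g'}
    (h : IsWeakDeriv Ω a b u g) (hu : u =ᵐ[vol Ω] u')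
    (hg : g =ᵐ[vol Ω] g') : IsWeakDeriv Ω a b u' g' :=
  ⟨locallyIntegrableOn_congr h.1 hu hΩ, locallyIntegrableOn_congr h.2.1 hg hΩ,
    fun ψ h1 h2 h3 => by
      rw [← integral_congr_test hu, ← integral_congr_test hg]; exact h.2.2 ψ h1 h2 h3⟩

lemma integrableOn_mul_test (hΩ : IsOpen Ω) {g ψ} (hg : LocallyIntegrableOn g Ω)
    (hψ : IsTest Ω ψ) : IntegrableOn (fun x => g x * ψ x) Ω := by
  have h1 : IntegrableOn (fun x => g x * ψ x) (tsupport ψ) :=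
    (hg.integrableOn_compact_subset hψ.subset hψ.compact.isCompact).mul_continuousOn
      hψ.smooth.continuous.continuousOn hψ.compact.isCompact
  refine h1.of_forall_sdiff_eq_zero hΩ.measurableSet fun x hx => ?_
  rw [image_eq_zero_of_notMem_tsupport hx.2, mul_zero]

lemma IsWeakDeriv.ae_unique (hΩ : IsOpen Ω) {a b} {u g g'}
    (h : IsWeakDeriv Ω a b u g) (h' : IsWeakDeriv Ω a b u g') : g =ᵐ[vol Ω] g' := by
  have key : ∀ᵐ x ∂(volume : Measure Plane), x ∈ Ω → (g - g') x = 0 := by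
    refine hΩ.ae_eq_zero_of_integral_contDiff_smul_eq_zero (h.2.1.sub h'.2.1) ?_
    intro ψ h1 h2 h3
    have hψ : IsTest Ω ψ := ⟨h1, h2, h3⟩
    have e := (h.2.2 ψ h1 h2 h3).symm.trans (h'.2.2 ψ h1 h2 h3)
    have e' := mul_left_cancel₀ (pow_ne_zero (a + b) (by norm_num : (-1 : ℝ) ≠ 0)) e
    rw [← setIntegral_eq_integral_of_forall_compl_eq_zero (s := Ω) (fun x hx => by
      rw [image_eq_zero_of_notMem_tsupport fun hc => hx (h3 hc), zero_smul])]
    have := integral_sub (integrableOn_mul_test hΩ h.2.1 hψ) (integrableOn_mul_test hΩ h'.2.1 hψ)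
    rw [e', sub_self] at this
    rw [← this]
    refine integral_congr_ae (Eventually.of_forall fun x => ?_)
    simp only [Pi.sub_apply, smul_eq_mul]; ring
  rw [EventuallyEq, ae_restrict_iff' hΩ.measurableSet]
  filter_upwards [key] with x hx hxΩ
  exact sub_eq_zero.1 (hx hxΩ)

lemma weakDeriv_ae (hΩ : IsOpen Ω) {a b} {u g} (h : IsWeakDeriv Ω a b u g) :
    weakDeriv Ω a b u =ᵐ[vol Ω] g := by
  have he : ∃ g, IsWeakDeriv Ω a b u g := ⟨g, h⟩
  unfold weakDeriv
  rw [dif_pos he]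
  exact he.choose_spec.ae_unique hΩ h

/-- The derivatives of order at most two of a function with a locally Lipschitz gradient that is
`C²` almost everywhere are weak derivatives. -/
theorem isWeakDeriv_of_locallyLipschitzOn (hΩ : IsOpen Ω) {f} {F : Fin 2 → Fn}
    (hf : LocallyLipschitzOn Ω f) (hF : ∀ i, LocallyLipschitzOn Ω (F i))
    (h : ∀ᵐ x ∂vol Ω, ContDiffAt ℝ 2 f x ∧ ∀ i, F i =ᶠ[𝓝 x] partialD i f)
    {a b} (hab : a + b ≤ 2) : IsWeakDeriv Ω a b f (mixedD a b f) := by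
  have h0 := LocallyLipschitzOn.locallyIntegrableOn hΩ hf
  have hFp : ∀ i, F i =ᵐ[vol Ω] partialD i f := fun i =>
    h.mono fun x hx => (hx.2 i).self_of_nhds
  have hFpp : ∀ i j, partialD j (F i) =ᵐ[vol Ω] partialD j (partialD i f) := fun i j =>
    h.mono fun x hx => by simp only [partialD]; rw [(hx.2 i).fderiv_eq]
  have first : ∀ i, ∀ ψ, IsTest Ω ψ →
      ∫ x in Ω, f x * partialD i ψ x = -∫ x in Ω, partialD i f x * ψ x := fun i ψ hψ =>
    integral_mul_partialD hΩ hf hψ i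
  have second : ∀ i j, ∀ ψ, IsTest Ω ψ →
      ∫ x in Ω, f x * partialD i (partialD j ψ) x =
        ∫ x in Ω, partialD j (partialD i f) x * ψ x := fun i j ψ hψ => by
    rw [first i _ (hψ.partialD j), ← integral_congr_test (hFp i),
      integral_mul_partialD hΩ (hF i) hψ j, neg_neg, integral_congr_test (hFpp i j)]
  have l1 : ∀ i, LocallyIntegrableOn (partialD i f) Ω := locallyIntegrableOn_partialD hΩ hf
  have l2 : ∀ i j, LocallyIntegrableOn (partialD j (partialD i f)) Ω := fun i j =>
    locallyIntegrableOn_congr (locallyIntegrableOn_partialD hΩ (hF i) j) (hFpp i j) hΩ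
  cases order_two hab
  · exact ⟨h0, h0, fun ψ _ _ _ => by simp [mixedD]⟩
  · exact ⟨h0, l1 0, fun ψ h1 h2 h3 => by simpa [mixedD] using first 0 ψ ⟨h1, h2, h3⟩⟩
  · exact ⟨h0, l1 1, fun ψ h1 h2 h3 => by simpa [mixedD] using first 1 ψ ⟨h1, h2, h3⟩⟩
  · exact ⟨h0, l2 0 0, fun ψ h1 h2 h3 => by simpa [mixedD] using second 0 0 ψ ⟨h1, h2, h3⟩⟩
  · refine ⟨h0, l2 1 0, fun ψ h1 h2 h3 => ?_⟩
    have e := second 1 0 ψ ⟨h1, h2, h3⟩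
    have : ∀ x, partialD 1 (partialD 0 ψ) x = partialD 0 (partialD 1 ψ) x := fun x =>
      partialD_swap ((h1.of_le two_le_infty).contDiffAt) 1 0
    simp only [this] at e
    simpa [mixedD] using e
  · exact ⟨h0, l2 1 1, fun ψ h1 h2 h3 => by simpa [mixedD] using second 1 1 ψ ⟨h1, h2, h3⟩⟩

/-! ### Weak derivatives of the interpolation error -/

lemma locallyLipschitzOn_of_cover {ι : Type*} [Finite ι] {A : ι → Set Plane}
    (hA : ∀ i, IsClosed (A i)) (hΩ : IsOpen Ω) (hΩA : Ω ⊆ ⋃ i, A i)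
    {f} (hC : ∀ i, ∃ C : ℝ, ∀ x ∈ A i, ∀ y ∈ A i, |f x - f y| ≤ C * dist x y) :
    LocallyLipschitzOn Ω f := by
  classical
  have := Fintype.ofFinite ι
  choose C hC using hC
  have hcont : ContinuousOn f (⋃ i, A i) := by
    refine (locallyFinite_of_finite A).continuousOn_iUnion hA fun i => ?_
    have : LipschitzOnWith (C i).toNNReal f (A i) := LipschitzOnWith.of_dist_le_mul fun x hx y hy =>
      (hC i x hx y hy).trans (by gcongr; exact Real.le_coe_toNNReal _)
    exact this.continuousOn
  intro x hx
  obtain ⟨r, hr, hrΩ⟩ := Metric.isOpen_iff.1 hΩ x hx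
  refine ⟨Real.toNNReal (∑ i, |C i|), ball x r,
    nhdsWithin_le_nhds (Metric.ball_mem_nhds x hr), LipschitzOnWith.of_dist_le_mul ?_⟩
  intro y hy z hz
  rw [Real.coe_toNNReal _ (Finset.sum_nonneg fun i _ => abs_nonneg _)]
  refine lipschitzOn_of_cover hA (convex_ball x r) (hrΩ.trans hΩA) (hcont.mono (hrΩ.trans hΩA))
    (fun i a ha b hb => (hC i a ha.1 b hb.1).trans ?_) y hy z hz
  gcongr
  exact (le_abs_self _).trans (Finset.single_le_sum (f := fun i => |C i|)
    (fun i _ => abs_nonneg _) (Finset.mem_univ i))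

/-- A square of the subdivision of the unit square. -/
def subSquare (k i j : ℕ) : Set (ℝ × ℝ) :=
  knotIcc k i ×ˢ knotIcc k j

lemma subSquare_subset {k i j} (hi : i < k) (hj : j < k) :
    subSquare k i j ⊆ I ×ˢ I := prod_mono (piece_subset hi) (piece_subset hj)

lemma isCompact_subSquare (k i j) : IsCompact (subSquare k i j) :=
  isCompact_Icc.prod isCompact_Icc

lemma convex_subSquare (k i j) : Convex ℝ (subSquare k i j) :=
  (convex_Icc _ _).prod (convex_Icc _ _)

/-- The image of a square of the subdivision. -/
def subCell (k : ℕ) (K : Quad) (i j : ℕ) : Set Plane :=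
  (fun q => param K q.1 q.2) '' subSquare k i j

lemma isCompact_subCell (k) (K) (i j) : IsCompact (subCell k K i j) :=
  (isCompact_subSquare k i j).image (contDiff_param K (n := 0)).continuous

lemma closedCell_subset_subCell {k} (hk : 0 < k) (hK : ConvexQuad K)
    {x} (hx : x ∈ closedCell K) : ∃ i < k, ∃ j < k, x ∈ subCell k K i j := by
  obtain ⟨q, h1, h2, rfl⟩ := exists_param_of_mem_closedCell hK hx
  obtain ⟨i, hi, h1⟩ := exists_piece hk h1
  obtain ⟨j, hj, h2⟩ := exists_piece hk h2
  exact ⟨i, hi, j, hj, q, ⟨h1, h2⟩, rfl⟩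

lemma exists_contDiff_interpD {p l l' i j} (hp : 3 ≤ p) (K) (D)
    (hl : l ≤ p - 2) (hl' : l' ≤ p - 2) (hi : i < subdiv p) (hj : j < subdiv p) :
    ∃ g, ContDiff ℝ ∞ g ∧
      EqOn (fun q => interpD p K D l l' q.1 q.2) g (subSquare (subdiv p) i j) := by
  have hX := crossBasis_spec hp
  have key : ∀ {l i : ℕ}, l ≤ p - 2 → i < subdiv p → ∀ m, ∃ g, ContDiff ℝ ∞ g ∧
      EqOn (iteratedDeriv l (crossBasis p m)) g
        (knotIcc (subdiv p) i) := by
    intro l i hl hi m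
    obtain ⟨P, -, hP⟩ := (hX.1 m).2.1 i hi
    refine ⟨fun s => (derivative^[l] P).eval s, ?_, fun s hs =>
      iteratedDeriv_eq_of_piece (piece_lt hi) hs (hX.1 m).1.contDiffAt hl hP⟩
    simpa [Polynomial.coe_aeval_eq_eval] using
      (derivative^[l] P).contDiff_aeval (𝕜 := ℝ) (n := ∞)
  choose g hg hgX using key hl hi
  choose g' hg' hgX' using key hl' hj
  refine ⟨fun q => ∑ m, ∑ m', tensorCoef p K D m m' * g m q.1 * g' m' q.2, ?_, fun q hq => ?_⟩
  · refine ContDiff.sum fun m _ => ContDiff.sum fun m' _ => ?_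
    have h1 := hg m
    have h2 := hg' m'
    fun_prop
  · simp only [interpD]
    refine sum_congr rfl fun m _ => sum_congr rfl fun m' _ => ?_
    rw [hgX m hq.1, hgX' m' hq.2]

lemma contDiff_cross_tanT (K) (z) :
    ContDiff ℝ 1 fun q : ℝ × ℝ => cross z (tanT K q.1) := by
  simp only [cross, tanT, PiLp.add_apply, PiLp.smul_apply, PiLp.sub_apply, smul_eq_mul]
  fun_prop

lemma contDiff_cross_tanS (K) (z) :
    ContDiff ℝ 1 fun q : ℝ × ℝ => cross (tanS K q.2) z := by
  simp only [cross, tanS, PiLp.add_apply, PiLp.smul_apply, PiLp.sub_apply, smul_eq_mul]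
  fun_prop

lemma contDiff_jac (K) : ContDiff ℝ 1 fun q : ℝ × ℝ => jac K q.1 q.2 := by
  simp only [jac, cross, tanS, tanT, PiLp.add_apply, PiLp.smul_apply, PiLp.sub_apply, smul_eq_mul]
  fun_prop

lemma exists_lipschitz_comp_paramInv (hK : ConvexQuad K) {k i j}
    (hi : i < k) (hj : j < k) {f} (hf : ContDiffOn ℝ 1 f (subSquare k i j)) :
    ∃ C : ℝ, ∀ x ∈ subCell k K i j, ∀ y ∈ subCell k K i j,
      |f (paramInv K x) - f (paramInv K y)| ≤ C * dist x y := by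
  obtain ⟨C, hC⟩ := hf.exists_lipschitzOnWith one_ne_zero (convex_subSquare k i j)
    (isCompact_subSquare k i j)
  obtain ⟨C', hC'⟩ := exists_lipschitz_paramInv hK
  have h : ∀ x ∈ subCell k K i j, paramInv K x ∈ subSquare k i j ∧ x ∈ closedCell K := by
    rintro _ ⟨q, hq, rfl⟩
    have hq' := subSquare_subset hi hj hq
    simp only
    rw [paramInv_param hK hq'.1 hq'.2]
    exact ⟨hq, param_mem_closedCell K hq'.1 hq'.2⟩
  refine ⟨C * C', fun x hx y hy => ?_⟩
  refine (hC.dist_le_mul _ (h x hx).1 _ (h y hy).1).trans ?_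
  rw [mul_assoc]
  gcongr
  exact hC'.dist_le_mul _ (h x hx).2 _ (h y hy).2

lemma exists_lipschitz_interpFn (hp : 3 ≤ p) (hK : ConvexQuad K) (D) {i j}
    (hi : i < subdiv p) (hj : j < subdiv p) :
    ∃ C : ℝ, ∀ x ∈ subCell (subdiv p) K i j, ∀ y ∈ subCell (subdiv p) K i j,
      |interpFn p K D x - interpFn p K D y| ≤ C * dist x y := by
  obtain ⟨g, hg, hgD⟩ := exists_contDiff_interpD hp K D (l := 0) (l' := 0) (by omega) (by omega)
    hi hj
  exact exists_lipschitz_comp_paramInv hK hi hj (f := fun q => interpD p K D 0 0 q.1 q.2)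
    (((hg.of_le (by simp)).contDiffOn).congr hgD)

lemma exists_lipschitz_interpGrad (hp : 3 ≤ p) (hK : ConvexQuad K) (D) (z)
    {i j} (hi : i < subdiv p) (hj : j < subdiv p) :
    ∃ C : ℝ, ∀ x ∈ subCell (subdiv p) K i j, ∀ y ∈ subCell (subdiv p) K i j,
      |interpGrad p K D z x - interpGrad p K D z y| ≤ C * dist x y := by
  obtain ⟨g, hg, hgD⟩ := exists_contDiff_interpD hp K D (l := 1) (l' := 0) (by omega) (by omega)
    hi hj
  obtain ⟨g', hg', hgD'⟩ := exists_contDiff_interpD hp K D (l := 0) (l' := 1) (by omega) (by omega)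
    hi hj
  have h1 : ContDiffOn ℝ 1 g (subSquare (subdiv p) i j) := (hg.of_le (by simp)).contDiffOn
  have h2 : ContDiffOn ℝ 1 g' (subSquare (subdiv p) i j) := (hg'.of_le (by simp)).contDiffOn
  have hj0 : ∀ q ∈ subSquare (subdiv p) i j, jac K q.1 q.2 ≠ 0 := fun q hq =>
    (hK.jac_pos (subSquare_subset hi hj hq).1 (subSquare_subset hi hj hq).2).ne'
  refine exists_lipschitz_comp_paramInv hK hi hj (f := gradFn p K D z) ?_
  refine ((((contDiff_cross_tanT K z).contDiffOn.div (contDiff_jac K).contDiffOn hj0).mul h1).add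
    (((contDiff_cross_tanS K z).contDiffOn.div (contDiff_jac K).contDiffOn hj0).mul h2)).congr
    fun q hq => ?_
  simp only [gradFn, gradForm]
  rw [← hgD hq, ← hgD' hq]
  rfl

lemma volume_level_eq_zero {L : Plane →ₗ[ℝ] ℝ} (hL : L ≠ 0) (x₀) :
    volume {x : Plane | L (x - x₀) = 0} = 0 := by
  have h := Measure.addHaar_affineSubspace (volume : Measure Plane)
    (AffineSubspace.mk' x₀ (LinearMap.ker L)) (fun h => by
      have := congrArg AffineSubspace.direction h
      rw [AffineSubspace.direction_mk', AffineSubspace.direction_top] at this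
      exact hL (LinearMap.ker_eq_top.1 this))
  convert h using 2
  ext x
  simp [AffineSubspace.mem_mk']

/-- The linear form `det (·, w)`. -/
def crossLin (w : Plane) : Plane →ₗ[ℝ] ℝ where
  toFun z := cross z w
  map_add' u v := cross_add_left u v w
  map_smul' c u := cross_smul_left c u w

lemma ae_notKnot (hK : ConvexQuad K) (k) : ∀ᵐ x : Plane, x ∈ cell K →
    NotKnot k (paramInv K x).1 ∧ NotKnot k (paramInv K x).2 := by
  have h1 : ∀ i : ℕ, ∀ᵐ x : Plane, x ∈ cell K → (paramInv K x).1 ≠ (i : ℝ) / k := fun i => by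
    by_cases hi : (i : ℝ) / k ∈ I
    · have hL : crossLin (tanT K ((i : ℝ) / k)) ≠ 0 := fun h => by
        have := congrArg (fun L => L (tanS K 0)) h
        exact (hK.jac_pos hi (left_mem_Icc.2 zero_le_one)).ne' this
      filter_upwards [compl_mem_ae_iff.2 (volume_level_eq_zero hL (param K ((i : ℝ) / k) 0))]
        with x hx hxK hxi
      refine hx ?_
      rw [mem_ofPred_eq, ← param_paramInv hK (interior_subset hxK), hxi, param_sub]
      simp [crossLin, cross_self]
    · exact Eventually.of_forall fun x hx hxi =>
        hi (hxi ▸ (paramInv_mem hK (interior_subset hx)).1)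
  have h2 : ∀ i : ℕ, ∀ᵐ x : Plane, x ∈ cell K → (paramInv K x).2 ≠ (i : ℝ) / k := fun i => by
    by_cases hi : (i : ℝ) / k ∈ I
    · have hL : crossLin (tanS K ((i : ℝ) / k)) ≠ 0 := fun h => by
        have := congrArg (fun L => L (tanT K 0)) h
        refine (hK.jac_pos (left_mem_Icc.2 zero_le_one) hi).ne' ?_
        rw [jac, cross_swap]
        exact neg_eq_zero.2 this
      filter_upwards [compl_mem_ae_iff.2 (volume_level_eq_zero hL (param K 0 ((i : ℝ) / k)))]
        with x hx hxK hxi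
      refine hx ?_
      rw [mem_ofPred_eq, ← param_paramInv hK (interior_subset hxK), hxi, param_sub]
      simp [crossLin, cross_self]
    · exact Eventually.of_forall fun x hx hxi =>
        hi (hxi ▸ (paramInv_mem hK (interior_subset hx)).2)
  filter_upwards [ae_all_iff.2 h1, ae_all_iff.2 h2] with x hx1 hx2 hx
  exact ⟨fun i _ _ => hx1 i hx, fun i _ _ => hx2 i hx⟩

lemma volume_closedCell_diff_cell (K) : volume (closedCell K \ cell K) = 0 := by
  have := (convex_convexHull ℝ (range K)).addHaar_frontier (volume : Measure Plane)
  rwa [← closedCell, (isCompact_closedCell K).isClosed.frontier_eq] at this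

lemma _root_.LocallyLipschitzOn.sub_real {f g : Fn}
    (hf : LocallyLipschitzOn Ω f) (hg : LocallyLipschitzOn Ω g) :
    LocallyLipschitzOn Ω (f - g) := fun x hx => by
  obtain ⟨C, t, ht, hC⟩ := hf hx
  obtain ⟨C', t', ht', hC'⟩ := hg hx
  refine ⟨C + C', t ∩ t', inter_mem ht ht', ?_⟩
  exact (hC.mono inter_subset_left).sub (hC'.mono inter_subset_right)

lemma locallyLipschitzOn_of_contDiffOn (hΩ : IsOpen Ω) {f : Fn}
    (hf : ContDiffOn ℝ 1 f Ω) : LocallyLipschitzOn Ω f := fun x hx => by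
  obtain ⟨C, t, ht, hC⟩ := (hf.contDiffAt (hΩ.mem_nhds hx)).exists_lipschitzOnWith
  exact ⟨C, t, nhdsWithin_le_nhds ht, hC⟩

namespace QuadMesh

variable {M : QuadMesh Ω}

lemma ae_mem_cell (hΩ : IsOpen Ω) (k) : ∀ᵐ x ∂vol Ω, ∃ K ∈ M.quads, x ∈ cell K ∧
    NotKnot k (paramInv K x).1 ∧ NotKnot k (paramInv K x).2 := by
  have h1 : ∀ᵐ x : Plane, ∀ K ∈ M.quads, x ∉ closedCell K \ cell K :=
    (ae_ball_iff M.quads.countable_toSet).2 fun K _ =>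
      compl_mem_ae_iff.2 (volume_closedCell_diff_cell K)
  have h2 : ∀ᵐ x : Plane, ∀ K ∈ M.quads, x ∈ cell K →
      NotKnot k (paramInv K x).1 ∧ NotKnot k (paramInv K x).2 :=
    (ae_ball_iff M.quads.countable_toSet).2 fun K hK => ae_notKnot (M.quad_convex K hK) k
  have h3 : ∀ᵐ x : Plane, x ∈ Ω → ∃ K ∈ M.quads, x ∈ cell K ∧
      NotKnot k (paramInv K x).1 ∧ NotKnot k (paramInv K x).2 := by
    filter_upwards [h1, h2] with x hx1 hx2 hx
    have := subset_closure hx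
    rw [M.closure_eq] at this
    obtain ⟨K, hK, hxK⟩ := mem_iUnion₂.1 this
    have hxc : x ∈ cell K := by
      by_contra hc
      exact hx1 K hK ⟨hxK, hc⟩
    exact ⟨K, hK, hxc, hx2 K hK hxc⟩
  exact (ae_restrict_iff' hΩ.measurableSet).2 h3

/-- A function that is given by interpolants of one family of degrees of freedom differs from a
`C²` function by a function with weak derivatives of order two. -/
theorem isWeakDeriv_sub_interp (hp : 3 ≤ p) (hΩ : IsOpen Ω) {v w}
    (hv : ContDiffOn ℝ 2 v Ω) (c : Dof → ℝ)
    (hw : ∀ K ∈ M.quads, IsInterp p K (M.cellData c K) w) {a b} (hab : a + b ≤ 2) :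
    IsWeakDeriv Ω a b (v - w) (mixedD a b (v - w)) := by
  have hk := subdiv_pos p
  choose G hG using fun z => exists_glue (M := M) (fun K => interpGrad p K (M.cellData c K) z)
    fun K hK K' hK' x hx hx' => (interp_compat hp hK hK' hx hx').2 z
  have hwE : ∀ K ∈ M.quads, EqOn w (interpFn p K (M.cellData c K)) (closedCell K) :=
    fun K hK x hx => by
      have h := paramInv_mem (M.quad_convex K hK) hx
      have := hw K hK _ h.1 _ h.2
      rwa [param_paramInv (M.quad_convex K hK) hx] at this
  let A : (M.quads × Fin (subdiv p) × Fin (subdiv p)) → Set Plane :=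
    fun n => subCell (subdiv p) n.1.1 n.2.1 n.2.2
  have hA : ∀ n, IsClosed (A n) := fun n => (isCompact_subCell _ _ _ _).isClosed
  have hAK : ∀ n, A n ⊆ closedCell n.1.1 := fun n => by
    rintro _ ⟨q, hq, rfl⟩
    have := subSquare_subset n.2.1.2 n.2.2.2 hq
    exact param_mem_closedCell _ this.1 this.2
  have hΩA : Ω ⊆ ⋃ n, A n := fun x hx => by
    have := subset_closure hx
    rw [M.closure_eq] at this
    obtain ⟨K, hK, hxK⟩ := mem_iUnion₂.1 this
    obtain ⟨i, hi, j, hj, h⟩ := closedCell_subset_subCell hk (M.quad_convex K hK) hxK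
    exact mem_iUnion.2 ⟨(⟨K, hK⟩, ⟨i, hi⟩, ⟨j, hj⟩), h⟩
  have hwL : LocallyLipschitzOn Ω w := locallyLipschitzOn_of_cover hA hΩ hΩA fun n => by
    obtain ⟨C, hC⟩ := exists_lipschitz_interpFn hp (M.quad_convex _ n.1.2) (M.cellData c n.1.1)
      n.2.1.2 n.2.2.2
    refine ⟨C, fun x hx y hy => ?_⟩
    rw [hwE _ n.1.2 (hAK n hx), hwE _ n.1.2 (hAK n hy)]
    grind
  have hGL : ∀ z, LocallyLipschitzOn Ω (G z) := fun z =>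
    locallyLipschitzOn_of_cover hA hΩ hΩA fun n => by
      obtain ⟨C, hC⟩ := exists_lipschitz_interpGrad hp (M.quad_convex _ n.1.2) (M.cellData c n.1.1)
        z n.2.1.2 n.2.2.2
      refine ⟨C, fun x hx y hy => ?_⟩
      rw [hG z _ n.1.2 (hAK n hx), hG z _ n.1.2 (hAK n hy)]
      grind
  have hvL := locallyLipschitzOn_of_contDiffOn hΩ (hv.of_le one_le_two)
  have hvG : ∀ i, LocallyLipschitzOn Ω (partialD i v) := fun i =>
    locallyLipschitzOn_of_contDiffOn hΩ
      (((hv.fderiv_of_isOpen hΩ (m := 1) (by norm_num))).clm_apply contDiffOn_const)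
  refine isWeakDeriv_of_locallyLipschitzOn hΩ (hvL.sub_real hwL)
    (F := fun i => partialD i v - G (single i 1))
    (fun i => (hvG i).sub_real (hGL _)) ?_ hab
  filter_upwards [ae_mem_cell (M := M) hΩ (subdiv p), ae_restrict_mem hΩ.measurableSet]
    with x ⟨K, hK, hxK, hx1, hx2⟩ hxΩ
  have hKc := M.quad_convex K hK
  have hpar : ∀ y ∈ cell K, (paramInv K y).1 ∈ J ∧ (paramInv K y).2 ∈ J ∧
      param K (paramInv K y).1 (paramInv K y).2 = y := fun y hy => by
    have e := param_paramInv hKc (interior_subset hy)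
    have m := paramInv_mem hKc (interior_subset hy)
    have := boundary_notMem_cell hKc m.1 m.2 (e.symm ▸ hy)
    grind
  have hvx : ∀ y ∈ Ω, ContDiffAt ℝ 2 v y := fun y hy => hv.contDiffAt (hΩ.mem_nhds hy)
  constructor
  · obtain ⟨m1, m2, e⟩ := hpar x hxK
    have := (hw K hK).contDiffAt_of_notKnot hp hKc m1 m2 hx1 hx2
    rw [e] at this
    exact (hvx x hxΩ).sub (this.of_le two_le_infty)
  · intro i
    filter_upwards [(isOpen_cell K).mem_nhds hxK, hΩ.mem_nhds hxΩ] with y hy hyΩ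
    obtain ⟨m1, m2, e⟩ := hpar y hy
    have h1 := (hw K hK).fderiv_eq hp hKc m1 m2 (single i 1)
    have h2 := (hw K hK).contDiffAt hp hKc m1 m2
    rw [e] at h1 h2
    rw [Pi.sub_apply, hG _ K hK (interior_subset hy)]
    simp only [partialD, interpGrad]
    rw [fderiv_sub ((hvx y hyΩ).differentiableAt two_ne_zero)
      (h2.differentiableAt (by norm_cast; omega)), sub_apply, h1]

end QuadMesh

/-! ### Derivatives of smooth functions -/

lemma contDiff_iterate_partialD {f} (hf : ContDiff ℝ ∞ f) (i) (n) :
    ContDiff ℝ ∞ ((partialD i)^[n] f) := by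
  induction n generalizing f with
  | zero => exact hf
  | succ n ih => exact ih (contDiff_partialD hf i)

lemma contDiff_mixedD {f} (hf : ContDiff ℝ ∞ f) (a b) :
    ContDiff ℝ ∞ (mixedD a b f) :=
  contDiff_iterate_partialD (contDiff_iterate_partialD hf 1 b) 0 a

lemma partialD_zero_mixedD (f) (a b) :
    partialD 0 (mixedD a b f) = mixedD (a + 1) b f := by
  simp only [mixedD, Function.iterate_succ_apply']

lemma partialD_iterate_comm {f} (hf : ContDiff ℝ ∞ f) (a) :
    partialD 1 ((partialD 0)^[a] f) = (partialD 0)^[a] (partialD 1 f) := by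
  induction a generalizing f with
  | zero => rfl
  | succ a ih =>
    rw [iterate_succ_apply, iterate_succ_apply, ih (contDiff_partialD hf 0)]
    congr 1
    ext x
    exact partialD_swap (hf.of_le two_le_infty).contDiffAt 1 0

lemma partialD_one_mixedD {f} (hf : ContDiff ℝ ∞ f) (a b) :
    partialD 1 (mixedD a b f) = mixedD a (b + 1) f := by
  unfold mixedD
  rw [partialD_iterate_comm (contDiff_iterate_partialD hf 1 b), Function.iterate_succ_apply']

lemma fderiv_eq_partialD (g) (x v) :
    fderiv ℝ g x v = v 0 * partialD 0 g x + v 1 * partialD 1 g x := by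
  have hv : v = v 0 • single 0 (1 : ℝ) + v 1 • single 1 (1 : ℝ) := by
    ext i; fin_cases i <;> simp
  conv_lhs => rw [hv]
  simp [partialD]

lemma partialD_sum {ι : Type*} (S : Finset ι) (c : ι → ℝ) {g : ι → Fn}
    (hg : ∀ k, ContDiff ℝ ∞ (g k)) (i) :
    partialD i (fun z => ∑ k ∈ S, c k * g k z) = fun z => ∑ k ∈ S, c k * partialD i (g k) z := by
  ext z
  have h : ∀ k, DifferentiableAt ℝ (g k) z := fun k => (hg k).differentiable (by simp) z
  simp only [partialD]
  rw [fderiv_fun_sum fun k _ => (h k).const_mul (c k)]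
  simp only [sum_apply, fderiv_const_mul (h _), smul_apply, smul_eq_mul]

lemma mixedD_sum {ι : Type*} (S : Finset ι) (c : ι → ℝ) {g : ι → Fn}
    (hg : ∀ k, ContDiff ℝ ∞ (g k)) (a b) :
    mixedD a b (fun z => ∑ k ∈ S, c k * g k z) = fun z => ∑ k ∈ S, c k * mixedD a b (g k) z := by
  have key : ∀ (i : Fin 2) (n : ℕ) {g : ι → Fn}, (∀ k, ContDiff ℝ ∞ (g k)) →
      (partialD i)^[n] (fun z => ∑ k ∈ S, c k * g k z) =
        fun z => ∑ k ∈ S, c k * (partialD i)^[n] (g k) z := by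
    intro i n
    induction n with
    | zero => intro g _; rfl
    | succ n ih =>
      intro g hg
      simp only [iterate_succ_apply]
      rw [partialD_sum S c hg, ih fun k => contDiff_partialD (hg k) i]
  unfold mixedD
  rw [key 1 b hg, key 0 a fun k => contDiff_iterate_partialD (hg k) 1 b]

lemma mixedD_sub {f g} (hf : ContDiff ℝ ∞ f) (hg : ContDiff ℝ ∞ g) (a b) :
    mixedD a b (f - g) = mixedD a b f - mixedD a b g := by
  have h := mixedD_sum (Finset.univ : Finset (Fin 2)) ![1, -1] (g := ![f, g])
    (fun k => by fin_cases k <;> assumption) a b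
  have e : (fun z => ∑ k, (![1, -1] : Fin 2 → ℝ) k * (![f, g] : Fin 2 → Fn) k z) =
      f - g := by
    ext z; simp [Fin.sum_univ_two, sub_eq_add_neg]
  rw [e] at h
  rw [h]
  ext z; simp [Fin.sum_univ_two, sub_eq_add_neg]

lemma hasFDerivAt_coord (i) (z) :
    HasFDerivAt (fun z => z i) (EuclideanSpace.proj (𝕜 := ℝ) i : Plane →L[ℝ] ℝ) z :=
  (EuclideanSpace.proj (𝕜 := ℝ) i : Plane →L[ℝ] ℝ).hasFDerivAt

lemma mixedD_mul {u v : ℝ → ℝ} (hu : ContDiff ℝ ∞ u) (hv : ContDiff ℝ ∞ v) (a b) :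
    mixedD a b (fun z => u (z 0) * v (z 1)) =
      fun z => iteratedDeriv a u (z 0) * iteratedDeriv b v (z 1) := by
  have hd : ∀ {u : ℝ → ℝ}, ContDiff ℝ ∞ u → ContDiff ℝ ∞ (deriv u) := fun h => by
    have := contDiff_infty_iff_deriv.1 h; exact this.2
  have key : ∀ {u v : ℝ → ℝ}, ContDiff ℝ ∞ u → ContDiff ℝ ∞ v → ∀ z i,
      partialD i (fun z => u (z 0) * v (z 1)) z =
        ![deriv u (z 0) * v (z 1), u (z 0) * deriv v (z 1)] i := fun hu hv z i => by
    have := ((((hu.differentiable (by simp)) (z 0)).hasDerivAt.comp_hasFDerivAt z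
      (hasFDerivAt_coord 0 z)).mul (((hv.differentiable (by simp)) (z 1)).hasDerivAt.comp_hasFDerivAt
      z (hasFDerivAt_coord 1 z))).fderiv
    refine (congrArg (fun L => L (single i 1)) this).trans ?_
    fin_cases i <;> simp [mul_comm]
  have h0 := fun {u v : ℝ → ℝ} (hu : ContDiff ℝ ∞ u) (hv : ContDiff ℝ ∞ v) =>
    funext fun z => key hu hv z 0
  have h1 := fun {u v : ℝ → ℝ} (hu : ContDiff ℝ ∞ u) (hv : ContDiff ℝ ∞ v) =>
    funext fun z => key hu hv z 1
  have k1 : ∀ (b : ℕ) {v : ℝ → ℝ}, ContDiff ℝ ∞ v →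
      (partialD 1)^[b] (fun z => u (z 0) * v (z 1)) = fun z => u (z 0) * iteratedDeriv b v (z 1) := by
    intro b
    induction b with
    | zero => intro v _; simp
    | succ b ih =>
      intro v hv
      rw [iterate_succ_apply, h1 hu hv, iteratedDeriv_succ']
      exact ih (hd hv)
  have k0 : ∀ (a : ℕ) {u v : ℝ → ℝ}, ContDiff ℝ ∞ u → ContDiff ℝ ∞ v →
      (partialD 0)^[a] (fun z => u (z 0) * v (z 1)) = fun z => iteratedDeriv a u (z 0) * v (z 1) := by
    intro a
    induction a with
    | zero => intro u v _ _; simp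
    | succ a ih =>
      intro u v hu hv
      rw [iterate_succ_apply, h0 hu hv, iteratedDeriv_succ']
      exact ih (hd hu) hv
  have hvb : ContDiff ℝ ∞ (iteratedDeriv b v) := by
    rw [contDiff_infty]
    intro n
    rw [iteratedDeriv_eq_iterate]
    exact (hv.of_le (by exact_mod_cast le_top)).iterate_deriv' n b
  unfold mixedD
  grind

/-! ### Taylor polynomials -/

/-- The exponents of the monomials of degree less than `m`. -/
def polyIdx (m : ℕ) : Finset (ℕ × ℕ) :=
  (Finset.range m ×ˢ Finset.range m).filter fun x => x.1 + x.2 < m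

lemma mem_polyIdx {m} {x} : x ∈ polyIdx m ↔ x.1 + x.2 < m := by
  simp only [polyIdx, Finset.mem_filter, Finset.mem_product, Finset.mem_range]; omega

/-- The Taylor polynomial of degree less than `m` at `y`. -/
def taylorPoly (m : ℕ) (f : Fn) (y z : Plane) : ℝ :=
  ∑ x ∈ polyIdx m, mixedD x.1 x.2 f y / (x.1.factorial * x.2.factorial) *
    ((z 0 - y 0) ^ x.1 * (z 1 - y 1) ^ x.2)

lemma iteratedDeriv_sub_pow (n a) (c x : ℝ) :
    iteratedDeriv a (fun x => (x - c) ^ n) x = n.descFactorial a * (x - c) ^ (n - a) := by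
  rw [iteratedDeriv_comp_sub_const (f := fun x : ℝ => x ^ n)]
  simp

lemma contDiff_sub_pow (c : Plane) (x : ℕ × ℕ) :
    ContDiff ℝ ∞ fun z : Plane => (z 0 - c 0) ^ x.1 * (z 1 - c 1) ^ x.2 := by fun_prop

lemma mixedD_taylorPoly (m) (f) (y z) (a b) :
    mixedD a b (taylorPoly m f y) z = ∑ x ∈ polyIdx m,
      mixedD x.1 x.2 f y / (x.1.factorial * x.2.factorial) *
      ((x.1.descFactorial a * (z 0 - y 0) ^ (x.1 - a)) *
        (x.2.descFactorial b * (z 1 - y 1) ^ (x.2 - b))) := by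
  unfold taylorPoly
  have := mixedD_sum (polyIdx m)
    (fun x => mixedD x.1 x.2 f y / (x.1.factorial * x.2.factorial)) (contDiff_sub_pow y) a b
  rw [this]
  refine sum_congr rfl fun x _ => ?_
  have := mixedD_mul (u := fun t => (t - y 0) ^ x.1) (v := fun t => (t - y 1) ^ x.2)
    (by fun_prop) (by fun_prop) a b
  simp only [this, iteratedDeriv_sub_pow]

lemma contDiff_taylorPoly (m) (f) (y) :
    ContDiff ℝ ∞ (taylorPoly m f y) :=
  ContDiff.sum fun x _ => contDiff_const.mul (contDiff_sub_pow y x)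

lemma mixedD_taylorPoly_self {m} (f) (y) {a b} (h : a + b < m) :
    mixedD a b (taylorPoly m f y) y = mixedD a b f y := by
  rw [mixedD_taylorPoly, Finset.sum_eq_single (a, b)]
  · simp only [Nat.sub_self, pow_zero, mul_one, Nat.descFactorial_self]
    have : (a.factorial : ℝ) ≠ 0 := by positivity
    have : (b.factorial : ℝ) ≠ 0 := by positivity
    field_simp
  · rintro ⟨i, j⟩ - hne
    simp only [sub_self]
    by_cases hi : i < a
    · simp [Nat.descFactorial_eq_zero_iff_lt.2 hi]
    by_cases hj : j < b
    · simp [Nat.descFactorial_eq_zero_iff_lt.2 hj]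
    have : i - a ≠ 0 ∨ j - b ≠ 0 := by
      grind
    rcases this with h | h <;> simp [zero_pow h]
  · intro hn
    exact absurd (mem_polyIdx.2 h) hn

lemma mixedD_taylorPoly_of_le {m} (f) (y z) {a b} (h : m ≤ a + b) :
    mixedD a b (taylorPoly m f y) z = 0 := by
  rw [mixedD_taylorPoly]
  refine Finset.sum_eq_zero fun x hx => ?_
  have := mem_polyIdx.1 hx
  rcases (by omega : x.1 < a ∨ x.2 < b) with h | h <;> simp [Nat.descFactorial_eq_zero_iff_lt.2 h]

/-- The sum of the absolute values of the derivatives of order `k`. -/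
def absD (k : ℕ) (f : Fn) (x : Plane) : ℝ :=
  ∑ α ∈ multiIdx k, |mixedD α.1 α.2 f x|

lemma absD_nonneg (k) (f) (x) : 0 ≤ absD k f x :=
  Finset.sum_nonneg fun _ _ => abs_nonneg _

lemma continuous_absD {f} (hf : ContDiff ℝ ∞ f) (k) : Continuous (absD k f) :=
  continuous_finsetSum _ fun α _ => (contDiff_mixedD hf α.1 α.2).continuous.abs

lemma abs_mixedD_le_absD {a b k} (h : a + b = k) (f) (x) :
    |mixedD a b f x| ≤ absD k f x :=
  Finset.single_le_sum (f := fun α => |mixedD α.1 α.2 f x|) (fun _ _ => abs_nonneg _)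
    (mem_antidiagonal.2 h : (a, b) ∈ _)

lemma abs_coord_le (v : Plane) (i) : |v i| ≤ ‖v‖ := by
  simpa using PiLp.norm_apply_le v i

lemma hasDerivAt_segment {g : Fn} (hg : ContDiff ℝ ∞ g) (y v) (s : ℝ) :
    HasDerivAt (fun s : ℝ => g (y + s • v)) (fderiv ℝ g (y + s • v) v) s := by
  have h1 : HasDerivAt (fun s : ℝ => y + s • v) v s := by
    simpa using ((hasDerivAt_id s).smul_const v).const_add y
  exact ((hg.differentiable (by simp)) _).hasFDerivAt.comp_hasDerivAt s h1

lemma continuous_segment {g : Fn} (hg : Continuous g) (y v) :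
    Continuous fun s : ℝ => g (y + s • v) := hg.comp (by fun_prop)

lemma absD_le_integral {w} (hw : ContDiff ℝ ∞ w) {k} {y v}
    (h0 : ∀ a b, a + b = k → mixedD a b w y = 0) {σ : ℝ} (hσ : 0 ≤ σ) :
    absD k w (y + σ • v) ≤ 2 * ‖v‖ * ∫ s in (0 : ℝ)..σ, absD (k + 1) w (y + s • v) := by
  have hc : ∀ a b, Continuous fun s : ℝ => |mixedD a b w (y + s • v)| := fun a b =>
    (continuous_segment (contDiff_mixedD hw a b).continuous y v).abs
  have key : ∀ α ∈ multiIdx k, |mixedD α.1 α.2 w (y + σ • v)| ≤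
      ‖v‖ * ((∫ s in 0..σ, |mixedD (α.1 + 1) α.2 w (y + s • v)|)
        + ∫ s in 0..σ, |mixedD α.1 (α.2 + 1) w (y + s • v)|) := by
    intro α hα
    have hg := contDiff_mixedD hw α.1 α.2
    have hd := fun s => hasDerivAt_segment hg y v s
    have hcd : Continuous fun s : ℝ => fderiv ℝ (mixedD α.1 α.2 w) (y + s • v) v := by
      have : Continuous fun x => fderiv ℝ (mixedD α.1 α.2 w) x v :=
        (hg.continuous_fderiv (by simp)).clm_apply continuous_const
      exact continuous_segment this y v
    have e := intervalIntegral.integral_eq_sub_of_hasDerivAt (a := 0) (b := σ)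
      (fun s _ => hd s) (hcd.intervalIntegrable _ _)
    rw [zero_smul, add_zero, h0 α.1 α.2 (mem_antidiagonal.1 hα), sub_zero] at e
    rw [← e, ← intervalIntegral.integral_add ((hc _ _).intervalIntegrable _ _)
      ((hc _ _).intervalIntegrable _ _), ← intervalIntegral.integral_const_mul]
    refine (intervalIntegral.abs_integral_le_integral_abs hσ).trans ?_
    refine intervalIntegral.integral_mono_on hσ (hcd.abs.intervalIntegrable _ _)
      ((continuous_const.mul ((hc _ _).add (hc _ _))).intervalIntegrable _ _) fun s _ => ?_
    rw [fderiv_eq_partialD, partialD_zero_mixedD, partialD_one_mixedD hw]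
    refine (abs_add_le _ _).trans ?_
    rw [abs_mul, abs_mul, mul_add]
    gcongr <;> exact abs_coord_le _ _
  have e : ∀ r : ℕ × ℕ → ℕ × ℕ,
      (∀ x, ∑ α ∈ multiIdx k, |mixedD (r α).1 (r α).2 w x| ≤ absD (k + 1) w x) →
      ∑ α ∈ multiIdx k, ∫ s in 0..σ, |mixedD (r α).1 (r α).2 w (y + s • v)| ≤
        ∫ s in 0..σ, absD (k + 1) w (y + s • v) := fun r hr => by
    rw [← intervalIntegral.integral_finsetSum fun α _ => (hc _ _).intervalIntegrable _ _]
    exact intervalIntegral.integral_mono_on hσ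
      ((continuous_finsetSum _ fun α _ => hc _ _).intervalIntegrable _ _)
      ((continuous_segment (continuous_absD hw _) y v).intervalIntegrable _ _) fun s _ => hr _
  have e1 := e (fun α => (α.1 + 1, α.2)) fun x => by
    rw [absD, Finset.Nat.sum_antidiagonal_succ]; grind
  have e2 := e (fun α => (α.1, α.2 + 1)) fun x => by
    rw [absD, Finset.Nat.sum_antidiagonal_succ']; grind
  refine (sum_le_sum key).trans ?_
  rw [← mul_sum, sum_add_distrib, mul_comm 2 ‖v‖, mul_assoc, two_mul]
  gcongr

/-- The weight in the remainder of a Taylor expansion `k` orders below the top. -/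
def taylorWeight (k : ℕ) (s : ℝ) : ℝ := if k = 1 then 1 else 1 - s

lemma integral_integral_eq {g} (hg : Continuous g) :
    ∫ σ in (0 : ℝ)..1, ∫ s in (0 : ℝ)..σ, g s = ∫ s in (0 : ℝ)..1, (1 - s) * g s := by
  have h1 : ∀ σ ∈ uIcc 0 1, HasDerivAt (fun σ => ∫ s in (0 : ℝ)..σ, g s) (g σ) σ :=
    fun σ _ => (hg.integral_hasStrictDerivAt 0 σ).hasDerivAt
  have h2 : ∀ σ ∈ uIcc 0 1, HasDerivAt (fun σ : ℝ => σ - 1) 1 σ :=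
    fun σ _ => (hasDerivAt_id σ).sub_const 1
  have := intervalIntegral.integral_mul_deriv_eq_deriv_mul h1 h2 (hg.intervalIntegrable _ _)
    (intervalIntegrable_const)
  simp only [mul_one, sub_self, mul_zero, intervalIntegral.integral_same, zero_mul,
    zero_sub] at this
  rw [this, ← intervalIntegral.integral_neg]
  grind

/-- The remainder of a Taylor expansion. -/
theorem absD_sub_taylorPoly_le {f} (hf : ContDiff ℝ ∞ f) {m k} (hk : 1 ≤ k)
    (hkm : k ≤ m) (y z) :
    absD (m - k) (f - taylorPoly m f y) z ≤ (2 * ‖z - y‖) ^ k *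
      ∫ s in (0 : ℝ)..1, taylorWeight k s * absD m f (y + s • (z - y)) := by
  set w := f - taylorPoly m f y with hw
  set v := z - y with hv
  have hwc : ContDiff ℝ ∞ w := hf.sub (contDiff_taylorPoly m f y)
  have h0 : ∀ j < m, ∀ a b, a + b = j → mixedD a b w y = 0 := fun j hj a b hab => by
    rw [hw, mixedD_sub hf (contDiff_taylorPoly m f y), Pi.sub_apply,
      mixedD_taylorPoly_self f y (by omega), sub_self]
  have hm : absD m w = absD m f := by
    ext x
    unfold absD
    refine Finset.sum_congr rfl fun α hα => ?_
    have := Finset.HasAntidiagonal.mem_antidiagonal.1 hα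
    rw [hw, mixedD_sub hf (contDiff_taylorPoly m f y), Pi.sub_apply,
      mixedD_taylorPoly_of_le f y x this.ge, sub_zero]
  have hcm := continuous_segment (continuous_absD hf m) y v
  have hd : 0 ≤ 2 * ‖v‖ := by positivity
  have hpos : ∀ j (σ : ℝ), 0 ≤ absD j w (y + σ • v) := fun _ _ => absD_nonneg _ _ _
  have hcj : ∀ j, Continuous fun s : ℝ => absD j w (y + s • v) := fun j =>
    continuous_segment (continuous_absD hwc j) y v
  have mono : ∀ j, ∀ σ ∈ I, ∫ s in (0 : ℝ)..σ, absD j w (y + s • v) ≤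
      ∫ s in 0..1, absD j w (y + s • v) := fun j σ hσ =>
    intervalIntegral.integral_mono_interval le_rfl hσ.1 hσ.2
      (Eventually.of_forall fun s => hpos j s) ((hcj j).intervalIntegrable _ _)
  have hz : y + (1 : ℝ) • v = z := by rw [one_smul, hv, add_sub_cancel]
  have step1 : ∀ σ : ℝ, 0 ≤ σ → 1 ≤ m → absD (m - 1) w (y + σ • v) ≤
      2 * ‖v‖ * ∫ s in 0..σ, absD m f (y + s • v) := fun σ hσ hm1 => by
    have := absD_le_integral (v := v) hwc (h0 (m - 1) (by omega)) hσ
    rwa [Nat.sub_add_cancel hm1, hm] at this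
  rcases eq_or_lt_of_le hk with rfl | hk2
  · have := step1 1 zero_le_one hkm
    rw [hz] at this
    simpa [taylorWeight] using this
  have hA : Continuous fun σ : ℝ => ∫ s in (0 : ℝ)..σ, absD m f (y + s • v) :=
    intervalIntegral.continuous_primitive (fun a b => hcm.intervalIntegrable _ _) 0
  have key : ∀ k, 2 ≤ k → k ≤ m → ∀ σ ∈ I, absD (m - k) w (y + σ • v) ≤
      (2 * ‖v‖) ^ k * ∫ s in 0..1, (1 - s) * absD m f (y + s • v) := by
    intro k hk2 hkm
    induction k, hk2 using Nat.le_induction with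
    | base =>
      intro σ hσ
      have h := absD_le_integral (v := v) hwc (h0 (m - 2) (by omega)) hσ.1
      rw [show m - 2 + 1 = m - 1 by omega] at h
      refine h.trans ?_
      rw [pow_two, mul_assoc (2 * ‖v‖)]
      refine mul_le_mul_of_nonneg_left ?_ hd
      refine (mono (m - 1) σ hσ).trans ?_
      rw [← integral_integral_eq hcm, ← intervalIntegral.integral_const_mul]
      exact intervalIntegral.integral_mono_on zero_le_one ((hcj _).intervalIntegrable _ _)
        ((continuous_const.mul hA).intervalIntegrable _ _)
        fun s hs => step1 s hs.1 (by omega)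
    | succ k hk2 ih =>
      intro σ hσ
      have h := absD_le_integral (v := v) hwc (h0 (m - (k + 1)) (by omega)) hσ.1
      rw [show m - (k + 1) + 1 = m - k by omega] at h
      refine h.trans ?_
      rw [pow_succ', mul_assoc (2 * ‖v‖)]
      refine mul_le_mul_of_nonneg_left ?_ hd
      refine (mono (m - k) σ hσ).trans ?_
      have := intervalIntegral.integral_mono_on zero_le_one
        ((hcj (m - k)).intervalIntegrable (μ := volume) 0 1) (intervalIntegrable_const)
        fun s hs => ih (by omega) s hs
      simpa using this
  have := key k hk2 hkm 1 (right_mem_Icc.2 zero_le_one)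
  rw [hz] at this
  simpa [taylorWeight, show k ≠ 1 by omega] using this

/-! ### Averaged Taylor polynomials -/

lemma two_div_toReal_le {q : ℝ≥0∞} (hq : 1 ≤ q) : 2 / q.toReal ≤ 2 := by
  by_cases hqt : q = ⊤
  · simp [hqt]
  · have : 1 ≤ q.toReal := by simpa using toReal_mono hqt hq
    exact div_le_self (by norm_num) this

lemma map_homothety_le {U} {r : ℝ} (hr : 0 < r) {b}
    (h : ∀ x ∈ U, r • x + b ∈ U) :
    (vol U).map (fun x => r • x + b) ≤
      ofReal (r ^ (-2 : ℝ)) • vol U := by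
  have hm : Measurable fun x => r • x + b := by fun_prop
  refine Measure.le_iff.2 fun s hs => ?_
  rw [Measure.map_apply hm hs, Measure.smul_apply, Measure.restrict_apply hs,
    Measure.restrict_apply (hm hs), smul_eq_mul]
  have h1 : (fun x => r • x + b) ⁻¹' s ∩ U ⊆
      (r • ·) ⁻¹' ((fun x => x + b) ⁻¹' (s ∩ U)) := fun x hx => ⟨hx.1, h x hx.2⟩
  refine (measure_mono h1).trans (le_of_eq ?_)
  rw [Measure.addHaar_preimage_smul _ hr.ne', measure_preimage_add_right]
  congr 2
  rw [abs_of_pos (by positivity)]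
  simp only [finrank_euclideanSpace, Fintype.card_fin]
  rw [Real.rpow_neg hr.le]
  norm_cast

lemma eLpNorm_comp_homothety_le {U} {r : ℝ} (hr : 0 < r) {b}
    (h : ∀ x ∈ U, r • x + b ∈ U) (q) {F : Fn}
    (hF : AEStronglyMeasurable F (vol U)) :
    eLpNorm (fun x => F (r • x + b)) q (vol U) ≤
      ofReal (r ^ (-(2 / q.toReal))) * eLpNorm F q (vol U) := by
  have hm : Measurable fun x => r • x + b := by fun_prop
  have hle := map_homothety_le hr h
  have hc : ofReal (r ^ (-2 : ℝ)) ≠ 0 := by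
    rw [Ne, ENNReal.ofReal_eq_zero, not_le]; positivity
  have hF' : AEStronglyMeasurable F ((vol U).map fun x => r • x + b) :=
    (hF.smul_measure (ofReal (r ^ (-2 : ℝ)))).mono_measure hle
  have e := eLpNorm_map_measure (p := q) hF' hm.aemeasurable
  change eLpNorm (F ∘ fun x => r • x + b) q (vol U) ≤ _
  rw [← e]
  refine (eLpNorm_mono_measure F hle).trans ?_
  rw [eLpNorm_smul_measure_of_ne_zero hc, smul_eq_mul]
  gcongr
  rw [ENNReal.toReal_div, ENNReal.toReal_one, ENNReal.ofReal_rpow_of_nonneg (by positivity)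
    (by positivity), ← Real.rpow_mul hr.le]
  apply le_of_eq
  congr 2
  ring

lemma lintegral_enorm_le_eLpNorm {U} {q} (hq : 1 ≤ q) {f : Fn}
    (hf : AEStronglyMeasurable f (vol U)) :
    ∫⁻ y in U, ‖f y‖ₑ ≤ eLpNorm f q (vol U) * volume U ^ (1 - 1 / q.toReal) := by
  simpa [eLpNorm_one_eq_lintegral_enorm] using eLpNorm_le_eLpNorm_mul_rpow_measure_univ hq hf

lemma inv_mul_rpow_one_sub {V : ℝ≥0∞} (h0 : V ≠ 0) (ht : V ≠ ⊤) (r : ℝ) :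
    V⁻¹ * V ^ (1 - r) = V ^ (-r) := by
  rw [← ENNReal.rpow_neg_one, ← ENNReal.rpow_add _ _ h0 ht]
  ring_nf

lemma lintegral_segment_le {U} (hc : Convex ℝ U) {z}
    (hz : z ∈ U) {q} (hq : 1 ≤ q) {N : Plane → ℝ} (hN : Continuous N) {s : ℝ}
    (hs : s ∈ Ico 0 1) :
    ∫⁻ y in U, ‖N (y + s • (z - y))‖ₑ ≤ ofReal ((1 - s) ^ (-(2 / q.toReal))) *
      (eLpNorm N q (vol U) * volume U ^ (1 - 1 / q.toReal)) := by
  have h1s : 0 < 1 - s := sub_pos.2 hs.2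
  have hmaps : ∀ x ∈ U, (1 - s) • x + s • z ∈ U := fun x hx =>
    hc hx hz h1s.le hs.1 (by ring)
  have e : ∀ y, y + s • (z - y) = (1 - s) • y + s • z := fun y => by module
  simp only [e]
  refine (lintegral_enorm_le_eLpNorm hq (Continuous.aestronglyMeasurable (by fun_prop))).trans ?_
  rw [← mul_assoc]
  gcongr
  exact eLpNorm_comp_homothety_le h1s hmaps q hN.aestronglyMeasurable

lemma lintegral_rpow_neg_half :
    ∫⁻ s in J, ofReal ((1 - s) ^ (-(1 / 2) : ℝ)) = 2 := by
  have hi : IntervalIntegrable (fun s : ℝ => (1 - s) ^ (-(1 / 2) : ℝ)) volume 0 1 := by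
    have := (intervalIntegral.intervalIntegrable_rpow' (a := 0) (b := 1)
      (show (-1 : ℝ) < -(1 / 2) by norm_num)).comp_sub_left 1
    simpa using this.symm
  rw [restrict_Ioo_eq_restrict_Ioc, ← ofReal_integral_eq_lintegral_ofReal hi.1,
    ← intervalIntegral.integral_of_le zero_le_one,
    intervalIntegral.integral_comp_sub_left (fun s => s ^ (-(1 / 2) : ℝ)) 1]
  · rw [integral_rpow (.inl (by norm_num))]
    norm_num
  · exact ae_restrict_of_forall_mem measurableSet_Ioc fun s hs =>
      Real.rpow_nonneg (by linarith [hs.2]) _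

lemma taylorWeight_mul_le {k} {q : ℝ≥0∞} (hq : 2 ≤ q) (hqk : 2 ≤ k ∨ 4 ≤ q) {s}
    (hs : s ∈ J) :
    taylorWeight k s * (1 - s) ^ (-(2 / q.toReal)) ≤ (1 - s) ^ (-(1 / 2) : ℝ) := by
  have h0 : 0 < 1 - s := sub_pos.2 hs.2
  have h1 : 1 - s ≤ 1 := by linarith [hs.1]
  have hq' : ∀ r : ℝ, 0 < r → ofReal r ≤ q → 2 / q.toReal ≤ 2 / r := fun r hr hrq => by
    by_cases ht : q = ⊤
    · rw [ht, ENNReal.toReal_top, div_zero]; positivity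
    · have : r ≤ q.toReal := (ENNReal.ofReal_le_iff_le_toReal ht).1 hrq
      gcongr
  have hq2 := hq' 2 (by norm_num) (by simpa using hq)
  unfold taylorWeight
  split_ifs with hk
  · rw [one_mul]
    have := hq' 4 (by norm_num) (by simpa using hqk.resolve_left (by omega))
    exact Real.rpow_le_rpow_of_exponent_ge h0 h1 (by linarith)
  · have : (1 - s) * (1 - s) ^ (-(2 / q.toReal)) = (1 - s) ^ (1 + -(2 / q.toReal)) := by
      rw [Real.rpow_add h0, Real.rpow_one]
    rw [this]
    exact Real.rpow_le_rpow_of_exponent_ge h0 h1 (by linarith)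

lemma taylorWeight_nonneg (k) {s : ℝ} (hs : s ≤ 1) : 0 ≤ taylorWeight k s := by
  unfold taylorWeight; split_ifs <;> linarith

lemma continuous_taylorWeight (k) : Continuous (taylorWeight k) := by
  unfold taylorWeight; split_ifs <;> fun_prop

/-- `q` is a polynomial of degree less than `m`. -/
def IsPoly (m : ℕ) (q : Fn) : Prop :=
  ∃ c : ℕ × ℕ → ℝ, q = fun z => ∑ x ∈ polyIdx m, c x * (z 0 ^ x.1 * z 1 ^ x.2)

lemma contDiff_mono (x : ℕ × ℕ) : ContDiff ℝ ∞ fun z : Plane => z 0 ^ x.1 * z 1 ^ x.2 := by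
  fun_prop

lemma IsPoly.contDiff {m} {q} (hq : IsPoly m q) : ContDiff ℝ ∞ q := by
  obtain ⟨c, rfl⟩ := hq
  exact ContDiff.sum fun x _ => contDiff_const.mul (contDiff_mono x)

/-- The coefficients of a Taylor polynomial with respect to the monomials centred at the origin. -/
def taylorCoeff (m : ℕ) (f : Fn) (y : Plane) (x : ℕ × ℕ) : ℝ :=
  mixedD x.1 x.2 (taylorPoly m f y) 0 / (x.1.factorial * x.2.factorial)

lemma taylorPoly_eq_sum (m) (f) (y) :
    taylorPoly m f y = fun z => ∑ x ∈ polyIdx m, taylorCoeff m f y x * (z 0 ^ x.1 * z 1 ^ x.2) := by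
  ext z
  rcases Nat.eq_zero_or_pos m with rfl | hm
  · simp [taylorPoly, polyIdx]
  have hz : ∀ x, absD m (taylorPoly m f y) x = 0 := fun x => Finset.sum_eq_zero fun α hα => by
    rw [mixedD_taylorPoly_of_le f y x (mem_antidiagonal.1 hα).ge, abs_zero]
  have h := absD_sub_taylorPoly_le (contDiff_taylorPoly m f y) (k := m) hm le_rfl 0 z
  simp only [hz, mul_zero, intervalIntegral.integral_zero, Nat.sub_self] at h
  have h2 := (abs_mixedD_le_absD (a := 0) (b := 0) rfl _ z).trans h
  have h3 := abs_nonpos_iff.1 h2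
  simp only [mixedD, Function.iterate_zero, id, Pi.sub_apply, sub_eq_zero] at h3
  rw [h3]
  simp only [taylorPoly, taylorCoeff]
  simp

lemma continuous_mixedD_taylorPoly {f} (hf : ContDiff ℝ ∞ f) (m a b) :
    Continuous fun w : Plane × Plane => mixedD a b (taylorPoly m f w.1) w.2 := by
  simp only [mixedD_taylorPoly]
  refine continuous_finsetSum _ fun x _ => ?_
  have := (contDiff_mixedD hf x.1 x.2).continuous
  fun_prop

lemma continuous_taylorCoeff {f} (hf : ContDiff ℝ ∞ f) (m) (x) :
    Continuous fun y => taylorCoeff m f y x := by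
  unfold taylorCoeff
  have := (continuous_mixedD_taylorPoly hf m x.1 x.2).comp
    (Continuous.prodMk_left 0)
  exact this.div_const _

/-- The uniform probability measure on `U`. -/
def avgMeasure (U : Set Plane) : Measure Plane := (volume U)⁻¹ • vol U

/-- The `L^q` norms of the functions `g α` with `|α| = m`, weighted with the area of `U`. -/
abbrev avgNorm (q : ℝ≥0∞) (m : ℕ) (g : ℕ × ℕ → Fn) (U : Set Plane) : ℝ :=
  (volume U ^ (-(1 / q.toReal)) * ∑ α ∈ multiIdx m, eLpNorm (g α) q (vol U)).toReal

/-- The average of the Taylor polynomials at the points of `U`. -/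
def avgTaylor (m : ℕ) (f : Fn) (U : Set Plane) (z : Plane) : ℝ :=
  ∑ x ∈ polyIdx m, (∫ y, taylorCoeff m f y x ∂avgMeasure U) * (z 0 ^ x.1 * z 1 ^ x.2)

lemma isPoly_avgTaylor (m) (f) (U) : IsPoly m (avgTaylor m f U) :=
  ⟨_, rfl⟩

section

variable {U : Set Plane} (hU : IsOpen U) (hne : U.Nonempty) (hb : Bornology.IsBounded U)
include hU hne hb

lemma isProbabilityMeasure_avgMeasure : IsProbabilityMeasure (avgMeasure U) := by
  refine ⟨?_⟩
  rw [avgMeasure, Measure.smul_apply, Measure.restrict_apply_univ, smul_eq_mul]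
  exact ENNReal.inv_mul_cancel (hU.measure_pos volume hne).ne' hb.measure_lt_top.ne

lemma integrable_avgMeasure {g : Fn} (hg : Continuous g) : Integrable g (avgMeasure U) := by
  have h1 : IntegrableOn g U :=
    (hg.continuousOn.integrableOn_compact (hb.isCompact_closure)).mono_set subset_closure
  exact h1.smul_measure (ENNReal.inv_ne_top.2 (hU.measure_pos volume hne).ne')

lemma mixedD_avgTaylor {f} (hf : ContDiff ℝ ∞ f) (m a b) (z) :
    mixedD a b (avgTaylor m f U) z = ∫ y, mixedD a b (taylorPoly m f y) z ∂avgMeasure U := by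
  have h1 := congrFun (mixedD_sum (polyIdx m) (fun x => ∫ y, taylorCoeff m f y x ∂avgMeasure U)
    contDiff_mono a b) z
  have h2 : ∀ y, mixedD a b (taylorPoly m f y) z =
      ∑ x ∈ polyIdx m, taylorCoeff m f y x * mixedD a b (fun z => z 0 ^ x.1 * z 1 ^ x.2) z :=
    fun y => by
      rw [taylorPoly_eq_sum, mixedD_sum (polyIdx m) (taylorCoeff m f y) contDiff_mono a b]
  refine h1.trans ?_
  simp only [h2]
  rw [integral_finsetSum _ fun x _ =>
    (integrable_avgMeasure hU hne hb (continuous_taylorCoeff hf m x)).mul_const _]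
  simp only [integral_mul_const]

/-- The error of an averaged Taylor polynomial. -/
theorem enorm_mixedD_sub_avgTaylor_le (hc : Convex ℝ U) {d : ℝ}
    (hd : ∀ x ∈ U, ∀ y ∈ U, dist x y ≤ d) {f} (hf : ContDiff ℝ ∞ f) {m k a b}
    (habk : a + b + k = m) (hk : 1 ≤ k) {q} (hq : 2 ≤ q) (hqk : 2 ≤ k ∨ 4 ≤ q) {z}
    (hz : z ∈ U) :
    ‖mixedD a b (f - avgTaylor m f U) z‖ₑ ≤ ofReal (2 * (2 * d) ^ k) *
      (volume U ^ (-(1 / q.toReal)) * eLpNorm (absD m f) q (vol U)) := by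
  have := isProbabilityMeasure_avgMeasure hU hne hb
  have hd0 : 0 ≤ d := dist_nonneg.trans (hd z hz z hz)
  have hV0 : volume U ≠ 0 := (hU.measure_pos volume hne).ne'
  have hVt : volume U ≠ ⊤ := hb.measure_lt_top.ne
  have hN := continuous_absD hf m
  rw [mixedD_sub hf (isPoly_avgTaylor m f U).contDiff, Pi.sub_apply, mixedD_avgTaylor hU hne hb hf]
  have e1 : mixedD a b f z = ∫ _, mixedD a b f z ∂avgMeasure U := by simp
  have hcT : Continuous fun y => mixedD a b (taylorPoly m f y) z :=
    (continuous_mixedD_taylorPoly hf m a b).comp (Continuous.prodMk_left z)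
  rw [e1, ← integral_sub (integrable_const _) (integrable_avgMeasure hU hne hb hcT)]
  refine (enorm_integral_le_lintegral_enorm _).trans ?_
  have hpt : ∀ y ∈ U, ‖mixedD a b f z - mixedD a b (taylorPoly m f y) z‖ₑ ≤
      ofReal ((2 * d) ^ k) * ∫⁻ s in J,
        ofReal (taylorWeight k s) * ‖absD m f (y + s • (z - y))‖ₑ := by
    intro y hy
    have h1 := absD_sub_taylorPoly_le hf hk (by omega : k ≤ m) y z
    have h2 := (abs_mixedD_le_absD (a := a) (b := b) (by omega : a + b = m - k)
      (f - taylorPoly m f y) z).trans h1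
    rw [mixedD_sub hf (contDiff_taylorPoly m f y), Pi.sub_apply] at h2
    rw [Real.enorm_eq_ofReal_abs]
    have hcs : Continuous fun s : ℝ => taylorWeight k s * absD m f (y + s • (z - y)) :=
      (continuous_taylorWeight k).mul (continuous_segment hN y (z - y))
    have h3 : (2 * ‖z - y‖) ^ k ≤ (2 * d) ^ k := by
      gcongr
      rw [← dist_eq_norm]; exact hd z hz y hy
    have h0 : ∀ s ∈ Ioc 0 1, 0 ≤ taylorWeight k s * absD m f (y + s • (z - y)) :=
      fun s hs => mul_nonneg (taylorWeight_nonneg k hs.2) (absD_nonneg _ _ _)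
    have hI : 0 ≤ ∫ s in (0 : ℝ)..1, taylorWeight k s * absD m f (y + s • (z - y)) := by
      rw [intervalIntegral.integral_of_le zero_le_one]
      exact setIntegral_nonneg measurableSet_Ioc h0
    refine (ENNReal.ofReal_le_ofReal (h2.trans (mul_le_mul_of_nonneg_right h3 hI))).trans ?_
    rw [ofReal_mul (by positivity), intervalIntegral.integral_of_le zero_le_one,
      ofReal_integral_eq_lintegral_ofReal (hcs.intervalIntegrable 0 1).1
        (ae_restrict_of_forall_mem measurableSet_Ioc h0),
      ← restrict_Ioo_eq_restrict_Ioc]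
    refine mul_le_mul_right (setLIntegral_mono' measurableSet_Ioo fun s hs => ?_) _
    rw [ofReal_mul (taylorWeight_nonneg k hs.2.le),
      Real.enorm_of_nonneg (absD_nonneg _ _ _)]
  set A := eLpNorm (absD m f) q (vol U) with hA
  have hq1 : 1 ≤ q := le_trans (by norm_num) hq
  have hswap : ∫⁻ y in U, ∫⁻ s in J,
      ofReal (taylorWeight k s) * ‖absD m f (y + s • (z - y))‖ₑ ≤
      2 * (A * volume U ^ (1 - 1 / q.toReal)) := by
    have hmeas : Measurable fun w : Plane × ℝ =>
        ofReal (taylorWeight k w.2) * ‖absD m f (w.1 + w.2 • (z - w.1))‖ₑ :=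
      ((continuous_taylorWeight k).measurable.comp measurable_snd).ennreal_ofReal.mul
        (hN.comp (by fun_prop)).measurable.enorm
    rw [lintegral_lintegral_swap hmeas.aemeasurable]
    refine le_trans ?_ (le_of_eq (congrArg (· * (A * volume U ^ (1 - 1 / q.toReal)))
      lintegral_rpow_neg_half))
    rw [← lintegral_mul_const _ (by fun_prop)]
    refine setLIntegral_mono' measurableSet_Ioo fun s hs => ?_
    have hcs : Measurable fun y : Plane => ‖absD m f (y + s • (z - y))‖ₑ :=
      (hN.comp (by fun_prop)).measurable.enorm
    rw [lintegral_const_mul _ hcs]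
    have h1 := lintegral_segment_le hc hz hq1 hN ⟨hs.1.le, hs.2⟩
    refine (mul_le_mul_right h1 _).trans ?_
    rw [← mul_assoc, ← ofReal_mul (taylorWeight_nonneg k hs.2.le)]
    gcongr
    exact taylorWeight_mul_le hq hqk hs
  rw [avgMeasure, lintegral_smul_measure, smul_eq_mul]
  refine (mul_le_mul_right (setLIntegral_mono' hU.measurableSet hpt) _).trans ?_
  rw [lintegral_const_mul' _ _ ofReal_ne_top]
  refine (mul_le_mul_right (mul_le_mul_right hswap _) _).trans (le_of_eq ?_)
  rw [← inv_mul_rpow_one_sub hV0 hVt, ofReal_mul zero_le_two, ENNReal.ofReal_ofNat]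
  ring

end

/-! ### Mollification on convex sets -/

/-- The convolution of `g` with `ψ`. -/
def conv (ψ g : Fn) (x : Plane) : ℝ := ∫ u, g u * ψ (x - u)

lemma conv_eq_convolution (ψ g) :
    conv ψ g = MeasureTheory.convolution g ψ (ContinuousLinearMap.mul ℝ ℝ) volume := rfl

lemma contDiff_conv {ψ g} (hψ : ContDiff ℝ ∞ ψ) (hc : HasCompactSupport ψ)
    (hg : LocallyIntegrable g) : ContDiff ℝ ∞ (conv ψ g) :=
  hc.contDiff_convolution_right (n := ⊤) (ContinuousLinearMap.mul ℝ ℝ) hg hψ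

lemma isTest_univ {ψ} (hψ : ContDiff ℝ ∞ ψ) (hc : HasCompactSupport ψ) :
    IsTest univ ψ := ⟨hψ, hc, subset_univ _⟩

lemma partialD_conv {ψ g} (hψ : IsTest univ ψ) (hg : LocallyIntegrable g) (i) :
    partialD i (conv ψ g) = conv (partialD i ψ) g := by
  ext x
  have h1 : ContDiff ℝ 1 ψ := hψ.smooth.of_le (by simp)
  have h := hψ.compact.hasFDerivAt_convolution_right (ContinuousLinearMap.mul ℝ ℝ) hg h1 x
  unfold partialD
  rw [conv_eq_convolution, h.fderiv,
    convolution_precompR_apply (ContinuousLinearMap.mul ℝ ℝ) hg (hψ.compact.fderiv ℝ)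
      (h1.continuous_fderiv one_ne_zero)]
  rfl

lemma IsTest.iterate_partialD {ψ} (h : IsTest Ω ψ) (i)
    (n) : IsTest Ω ((BSQuad.partialD i)^[n] ψ) := by
  induction n generalizing ψ with
  | zero => exact h
  | succ n ih => exact ih (h.partialD i)

lemma mixedD_conv {ψ g} (hψ : IsTest univ ψ) (hg : LocallyIntegrable g) (a b) :
    mixedD a b (conv ψ g) = conv (mixedD a b ψ) g := by
  have key : ∀ (i : Fin 2) (n : ℕ) {ψ : Fn}, IsTest univ ψ →
      (partialD i)^[n] (conv ψ g) = conv ((partialD i)^[n] ψ) g := by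
    intro i n
    induction n with
    | zero => intro ψ _; rfl
    | succ n ih =>
      intro ψ hψ
      rw [iterate_succ_apply, partialD_conv hψ hg, ih (hψ.partialD i),
        iterate_succ_apply]
  unfold mixedD
  rw [key 1 b hψ, key 0 a (hψ.iterate_partialD 1 b)]

lemma mixedD_comp_smul_add {f} (hf : ContDiff ℝ ∞ f) (r : ℝ) (c) (a b) :
    mixedD a b (fun x => f (r • x + c)) = fun x => r ^ (a + b) * mixedD a b f (r • x + c) := by
  have h1 : ∀ (i : Fin 2) {f : Fn}, ContDiff ℝ ∞ f → ∀ s : ℝ,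
      partialD i (fun x => s * f (r • x + c)) = fun x => s * r * partialD i f (r • x + c) := by
    intro i f hf s
    ext x
    have e1 : HasFDerivAt (fun x => r • x + c) (r • ContinuousLinearMap.id ℝ Plane) x :=
      ((hasFDerivAt_id x).const_smul r).add_const c
    have e2 := (((hf.differentiable (by simp)) (r • x + c)).hasFDerivAt.comp x e1).const_mul s
    unfold partialD
    refine (congrArg (fun L => L (single i 1)) e2.fderiv).trans ?_
    simp [mul_assoc]
  have key : ∀ (i : Fin 2) (n : ℕ) {f : Fn}, ContDiff ℝ ∞ f → ∀ s : ℝ,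
      (partialD i)^[n] (fun x => s * f (r • x + c)) =
        fun x => s * r ^ n * (partialD i)^[n] f (r • x + c) := by
    intro i n
    induction n with
    | zero => intro f _ s; simp
    | succ n ih =>
      intro f hf s
      rw [iterate_succ_apply, h1 i hf, ih (contDiff_partialD hf i),
        iterate_succ_apply]
      ext x; ring
  have e := key 1 b hf 1
  simp only [one_mul] at e
  unfold mixedD
  rw [e, key 0 a (contDiff_iterate_partialD hf 1 b)]
  ext x; ring

/-- A mollifier that maps functions on `U` to functions on `U`, together with the contraction
`x ↦ (1 - t) • x`. -/
structure IsMollifier (U : Set Plane) (d t : ℝ) (ψ : Fn) : Prop where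
  smooth : ContDiff ℝ ∞ ψ
  compact : HasCompactSupport ψ
  nonneg : ∀ w, 0 ≤ ψ w
  integral_eq : ∫ w, ψ w = 1
  mapsTo : ∀ x ∈ U, ∀ w ∈ tsupport ψ, (1 - t) • x - w ∈ U
  dist_le : ∀ x ∈ U, ∀ w ∈ tsupport ψ, dist ((1 - t) • x - w) x ≤ t * d

lemma exists_isMollifier {U} (hU : IsOpen U) (hne : U.Nonempty) (hc : Convex ℝ U)
    {d : ℝ} (hd : ∀ x ∈ U, ∀ y ∈ U, dist x y ≤ d) {t} (ht : t ∈ J) :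
    ∃ ψ, IsMollifier U d t ψ := by
  obtain ⟨y, hy⟩ := hne
  obtain ⟨r, hr, hrU⟩ := Metric.nhds_basis_closedBall.mem_iff.1 (hU.mem_nhds hy)
  have htr : 0 < t * r := mul_pos ht.1 hr
  let φ : ContDiffBump (-(t • y)) := ⟨t * r / 2, t * r, by positivity, by linarith⟩
  have hsupp : ∀ w ∈ tsupport (φ.normed volume), ∃ z ∈ U, w = -(t • z) := fun w hw => by
    rw [φ.tsupport_normed_eq, Metric.mem_closedBall, dist_eq_norm] at hw
    refine ⟨-(t⁻¹ • w), hrU ?_, ?_⟩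
    · rw [Metric.mem_closedBall, dist_eq_norm]
      have e : -(t⁻¹ • w) - y = -(t⁻¹ • (w - -(t • y))) := by
        rw [smul_sub, smul_neg, smul_smul, inv_mul_cancel₀ ht.1.ne']; module
      rw [e, norm_neg, norm_smul, norm_inv, Real.norm_of_nonneg ht.1.le,
        inv_mul_le_iff₀ ht.1]
      exact hw
    · rw [smul_neg, smul_smul, mul_inv_cancel₀ ht.1.ne', one_smul, neg_neg]
  refine ⟨φ.normed volume, φ.contDiff_normed, φ.hasCompactSupport_normed, φ.nonneg_normed,
    φ.integral_normed, fun x hx w hw => ?_, fun x hx w hw => ?_⟩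
  · obtain ⟨z, hz, rfl⟩ := hsupp w hw
    rw [sub_neg_eq_add]
    exact hc hx hz (by linarith [ht.2]) ht.1.le (by ring)
  · obtain ⟨z, hz, rfl⟩ := hsupp w hw
    rw [dist_eq_norm, show (1 - t) • x - -(t • z) - x = t • (z - x) by module, norm_smul,
      Real.norm_of_nonneg ht.1.le, ← dist_eq_norm]
    exact mul_le_mul_of_nonneg_left (hd z hz x hx) ht.1.le

/-- The mollification of a function on `U`. -/
def moll (U : Set Plane) (t : ℝ) (ψ v : Fn) (x : Plane) : ℝ :=
  conv ψ (U.indicator v) ((1 - t) • x)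

section

variable {U : Set Plane} {d t : ℝ} {ψ : Fn} (hψ : IsMollifier U d t ψ)
include hψ

lemma IsMollifier.isTest : IsTest univ ψ := isTest_univ hψ.smooth hψ.compact

lemma IsMollifier.integrable : Integrable ψ :=
  hψ.smooth.continuous.integrable_of_hasCompactSupport hψ.compact

lemma contDiff_moll (hU : MeasurableSet U) {v} (hv : IntegrableOn v U) :
    ContDiff ℝ ∞ (moll U t ψ v) :=
  (contDiff_conv hψ.smooth hψ.compact
    ((integrable_indicator_iff hU).2 hv).locallyIntegrable).comp (contDiff_const_smul _)

/-- Mollification commutes with weak derivatives. -/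
lemma mixedD_moll (hU : IsOpen U) {v g} (hv : IntegrableOn v U) {a b}
    (hg : IsWeakDeriv U a b v g) {x} (hx : x ∈ U) :
    mixedD a b (moll U t ψ v) x = (1 - t) ^ (a + b) * moll U t ψ g x := by
  have hvi : LocallyIntegrable (U.indicator v) :=
    ((integrable_indicator_iff hU.measurableSet).2 hv).locallyIntegrable
  have e1 := congrFun (mixedD_comp_smul_add (contDiff_conv hψ.smooth hψ.compact hvi) (1 - t) 0 a b) x
  simp only [add_zero] at e1
  refine e1.trans ?_
  rw [mixedD_conv hψ.isTest hvi]
  congr 1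
  unfold moll conv
  set x' := (1 - t) • x with hx'
  have hθ := mixedD_comp_smul_add hψ.smooth (-1) x' a b
  have hθ' : ∀ u, (-1 : ℝ) • u + x' = x' - u := fun u => by module
  simp only [hθ'] at hθ
  have hts : ∀ u, x' - u ∈ tsupport ψ → u ∈ U := fun u hu => by
    have := hψ.mapsTo x hx _ hu
    rwa [← hx', sub_sub_cancel] at this
  have hsub : tsupport (fun u => ψ (x' - u)) ⊆ (fun u => x' - u) ⁻¹' tsupport ψ :=
    closure_minimal (fun u hu => subset_closure hu) ((isClosed_tsupport ψ).preimage (by fun_prop))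
  have hcs : HasCompactSupport fun u => ψ (x' - u) :=
    hψ.compact.comp_homeomorph (Homeomorph.subLeft x')
  have h := hg.2.2 (fun u => ψ (x' - u)) (hψ.smooth.comp (contDiff_const.sub contDiff_id)) hcs
    (hsub.trans hts)
  simp only [hθ] at h
  have e2 : ∀ F G : Fn, ∫ u, U.indicator F u * G (x' - u) = ∫ u in U, F u * G (x' - u) := by
    intro F G
    rw [← integral_indicator hU.measurableSet]
    congr 1
    ext u
    by_cases hu : u ∈ U <;> simp [hu]
  rw [e2, e2]
  have e3 : ∫ u in U, v u * ((-1) ^ (a + b) * mixedD a b ψ (x' - u)) =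
      (-1) ^ (a + b) * ∫ u in U, v u * mixedD a b ψ (x' - u) := by
    rw [← integral_const_mul]
    congr 1; ext u; ring
  rw [e3] at h
  exact mul_left_cancel₀ (pow_ne_zero _ (by norm_num)) h

omit hψ in
lemma moll_eq_integral (v) (x) :
    moll U t ψ v x = ∫ w, U.indicator v ((1 - t) • x - w) * ψ w := by
  unfold moll conv
  rw [← integral_sub_left_eq_self _ volume ((1 - t) • x)]
  simp

lemma integrable_moll (hU : MeasurableSet U) {v} (hv : IntegrableOn v U) (x) :
    Integrable fun w => U.indicator v ((1 - t) • x - w) * ψ w := by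
  have h1 := (((integrable_indicator_iff hU).2 hv).comp_sub_left ((1 - t) • x))
  obtain ⟨C, hC⟩ := hψ.compact.exists_bound_of_continuous hψ.smooth.continuous
  exact h1.mul_bdd (c := C) hψ.smooth.continuous.aestronglyMeasurable (Eventually.of_forall hC)

lemma abs_moll_sub_le (hU : MeasurableSet U) {v} (hv : IntegrableOn v U) {x}
    (hx : x ∈ U) {ε : ℝ} (h : ∀ u ∈ U, dist u x ≤ t * d → |v u - v x| ≤ ε) :
    |moll U t ψ v x - v x| ≤ ε := by
  rw [moll_eq_integral]
  have e : v x = ∫ w, v x * ψ w := by rw [integral_const_mul, hψ.integral_eq, mul_one]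
  have e' : ε = ∫ w, ε * ψ w := by rw [integral_const_mul, hψ.integral_eq, mul_one]
  rw [e, ← integral_sub (integrable_moll hψ hU hv x) (hψ.integrable.const_mul _), e']
  refine abs_integral_le_integral_abs.trans (integral_mono_of_nonneg
    (Eventually.of_forall fun _ => abs_nonneg _) (hψ.integrable.const_mul _)
    (Eventually.of_forall fun w => ?_))
  simp only
  by_cases hw : w ∈ tsupport ψ
  · have hm := hψ.mapsTo x hx w hw
    rw [indicator_of_mem hm, ← sub_mul, abs_mul, abs_of_nonneg (hψ.nonneg w)]
    exact mul_le_mul_of_nonneg_right (h _ hm (hψ.dist_le x hx w hw)) (hψ.nonneg w)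
  · simp [image_eq_zero_of_notMem_tsupport hw]

omit hψ in
lemma moll_congr {v v'} (hU : MeasurableSet U) (h : v =ᵐ[vol U] v')
    (x) : moll U t ψ v x = moll U t ψ v' x := by
  unfold moll conv
  refine integral_congr_ae ?_
  filter_upwards [indicator_ae_eq_of_ae_eq_set (f := v) (ae_eq_refl U),
    (ae_restrict_iff' hU).1 h] with u _ hu
  by_cases huU : u ∈ U
  · simp [huU, hu huU]
  · simp [huU]

lemma lintegral_mollifier : ∫⁻ w, ofReal (ψ w) = 1 := by
  rw [← ofReal_integral_eq_lintegral_ofReal hψ.integrable (Eventually.of_forall hψ.nonneg),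
    hψ.integral_eq, ENNReal.ofReal_one]

lemma enorm_moll_le (v) (x) :
    ‖moll U t ψ v x‖ₑ ≤ ∫⁻ w, ‖U.indicator v ((1 - t) • x - w)‖ₑ * ofReal (ψ w) := by
  rw [moll_eq_integral]
  refine (enorm_integral_le_lintegral_enorm _).trans (le_of_eq ?_)
  congr 1; ext w
  rw [enorm_mul, Real.enorm_of_nonneg (hψ.nonneg w)]

/-- Mollification is bounded on `L^q(U)`. -/
lemma eLpNorm_moll_le (hU : MeasurableSet U) (ht : t ∈ J) {q} (hq : 1 ≤ q)
    {v} (hv : AEStronglyMeasurable v (vol U)) :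
    eLpNorm (moll U t ψ v) q (vol U) ≤
      ofReal ((1 - t) ^ (-(2 / q.toReal))) * eLpNorm v q (vol U) := by
  have hv' := hv.stronglyMeasurable_mk
  set v' := hv.mk v with hv'd
  have hvv : v =ᵐ[vol U] v' := hv.ae_eq_mk
  rw [eLpNorm_congr_ae hvv, show moll U t ψ v = moll U t ψ v' from
    funext fun x => moll_congr hU hvv x]
  clear_value v'
  have hm : Measurable (U.indicator v') := hv'.measurable.indicator hU
  have h1t : 0 < 1 - t := by linarith [ht.2]
  by_cases hqt : q = ⊤
  · subst hqt
    simp only [ENNReal.toReal_top, div_zero, neg_zero, Real.rpow_zero, ENNReal.ofReal_one, one_mul]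
    have hb : ∀ᵐ u, ‖U.indicator v' u‖ₑ ≤ eLpNorm v' ⊤ (vol U) := by
      rw [← eLpNorm_indicator_eq_eLpNorm_restrict hU, eLpNorm_exponent_top]
      exact ae_le_eLpNormEssSup
    refine (eLpNorm_exponent_top (f := moll U t ψ v')).trans_le ?_
    refine essSup_le_of_ae_le _ (Eventually.of_forall fun x => ?_)
    refine (enorm_moll_le hψ v' x).trans ?_
    have hb' := (Measure.measurePreserving_sub_left volume ((1 - t) • x)).quasiMeasurePreserving.ae hb
    refine (lintegral_mono_ae (hb'.mono fun w hw =>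
      mul_le_mul_left hw (ofReal (ψ w)))).trans ?_
    rw [lintegral_const_mul _ hψ.smooth.continuous.measurable.ennreal_ofReal,
      lintegral_mollifier hψ, mul_one]
  have hq0 : q ≠ 0 := (lt_of_lt_of_le one_pos hq).ne'
  set r := q.toReal with hr
  have hr1 : 1 ≤ r := by
    have := toReal_mono hqt hq
    simpa using this
  set ν : Measure Plane := volume.withDensity fun w => ofReal (ψ w) with hν
  have hψm : Measurable fun w => ofReal (ψ w) :=
    hψ.smooth.continuous.measurable.ennreal_ofReal
  have hνp : IsProbabilityMeasure ν := ⟨by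
    rw [hν, withDensity_apply _ MeasurableSet.univ, Measure.restrict_univ, lintegral_mollifier hψ]⟩
  have hJ : ∀ x, ‖moll U t ψ v' x‖ₑ ^ r ≤ ∫⁻ w, ‖U.indicator v' ((1 - t) • x - w)‖ₑ ^ r ∂ν := by
    intro x
    have hmx : Measurable fun w => U.indicator v' ((1 - t) • x - w) :=
      hm.comp (measurable_const.sub measurable_id)
    have h1 := enorm_moll_le hψ v' x
    have h2 := eLpNorm_le_eLpNorm_of_exponent_le (μ := ν) hq hmx.aestronglyMeasurable
    rw [eLpNorm_one_eq_lintegral_enorm, eLpNorm_eq_lintegral_rpow_enorm_toReal hq0 hqt] at h2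
    have e : ∫⁻ w, ‖U.indicator v' ((1 - t) • x - w)‖ₑ ∂ν =
        ∫⁻ w, ‖U.indicator v' ((1 - t) • x - w)‖ₑ * ofReal (ψ w) := by
      rw [hν, lintegral_withDensity_eq_lintegral_mul _ hψm hmx.enorm]
      simp only [Pi.mul_apply, mul_comm]
    rw [← e] at h1
    have h3 := ENNReal.rpow_le_rpow (h1.trans h2) (by linarith : 0 ≤ r)
    rwa [← ENNReal.rpow_mul, one_div_mul_cancel (by linarith : r ≠ 0), ENNReal.rpow_one] at h3
  have hx : ∀ w, ∫⁻ x in U, ‖U.indicator v' ((1 - t) • x - w)‖ₑ ^ r ≤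
      (ofReal ((1 - t) ^ (-(2 / r))) * eLpNorm v' q (vol U)) ^ r := by
    intro w
    have h1 := eLpNorm_comp_homothety_le h1t (U := univ) (b := -w) (fun _ _ => mem_univ _) q
      (F := U.indicator v') hm.aestronglyMeasurable
    rw [Measure.restrict_univ, eLpNorm_indicator_eq_eLpNorm_restrict hU] at h1
    have h2 := (eLpNorm_mono_measure (p := q) (fun x => U.indicator v' ((1 - t) • x + -w))
      (Measure.restrict_le_self (s := U) (μ := volume))).trans h1
    rw [eLpNorm_eq_lintegral_rpow_enorm_toReal hq0 hqt] at h2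
    have h3 := ENNReal.rpow_le_rpow h2 (by linarith : 0 ≤ r)
    rw [← ENNReal.rpow_mul, one_div_mul_cancel (by linarith : r ≠ 0), ENNReal.rpow_one] at h3
    simpa only [sub_eq_add_neg] using h3
  rw [eLpNorm_eq_lintegral_rpow_enorm_toReal hq0 hqt, one_div,
    ENNReal.rpow_inv_le_iff (by linarith : 0 < r)]
  refine (lintegral_mono fun x => hJ x).trans ?_
  have hmm : Measurable fun z : Plane × Plane => ‖U.indicator v' ((1 - t) • z.1 - z.2)‖ₑ ^ r :=
    (hm.comp (by fun_prop)).enorm.pow_const r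
  rw [lintegral_lintegral_swap hmm.aemeasurable]
  refine (lintegral_mono fun w => hx w).trans ?_
  rw [lintegral_const, measure_univ, mul_one]

end

/-! ### Polynomial approximation on convex sets -/

lemma isWeakDeriv_of_contDiffOn (hΩ : IsOpen Ω) {v}
    (hv : ContDiffOn ℝ 2 v Ω) {a b} (hab : a + b ≤ 2) :
    IsWeakDeriv Ω a b v (mixedD a b v) :=
  isWeakDeriv_of_locallyLipschitzOn hΩ (F := fun i => partialD i v)
    (locallyLipschitzOn_of_contDiffOn hΩ (hv.of_le one_le_two))
    (fun i => locallyLipschitzOn_of_contDiffOn hΩ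
      ((hv.fderiv_of_isOpen hΩ (m := 1) (by norm_num)).clm_apply contDiffOn_const))
    ((ae_restrict_mem hΩ.measurableSet).mono fun _ hx =>
      ⟨hv.contDiffAt (hΩ.mem_nhds hx), fun _ => EventuallyEq.rfl⟩) hab

lemma MemC2Closure.mono {Ω U} {v} (hv : MemC2Closure Ω v) (h : U ⊆ Ω) :
    MemC2Closure U v :=
  ⟨hv.1.mono h, hv.2.1.mono (closure_mono h), fun a b hab => by
    obtain ⟨g, h1, h2⟩ := hv.2.2 a b hab
    exact ⟨g, h1.mono (closure_mono h), h2.mono h⟩⟩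

section

variable {U : Set Plane} (hU : IsOpen U) (hne : U.Nonempty) (hc : Convex ℝ U) {d : ℝ}
  (hd : ∀ x ∈ U, ∀ y ∈ U, dist x y ≤ d)
include hU hd

omit hU in
lemma isBounded_of_dist_le : Bornology.IsBounded U := Metric.isBounded_iff.2 ⟨d, fun x hx y hy =>
  hd x hx y hy⟩

lemma eventually_mixedD_moll_sub_le {v} (hv : MemC2Closure U v) {ψ : ℝ → Fn}
    (hψ : ∀ t ∈ J, IsMollifier U d t (ψ t)) {a b} (hab : a + b ≤ 2) {δ : ℝ}
    (hδ : 0 < δ) :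
    ∀ᶠ t in 𝓝[>] (0 : ℝ), ∀ z ∈ U,
      |mixedD a b (moll U t (ψ t) v) z - mixedD a b v z| ≤ δ := by
  have hcomp : IsCompact (closure U) := (isBounded_of_dist_le hd).isCompact_closure
  obtain ⟨g, hg, hgv⟩ := hv.2.2 a b hab
  obtain ⟨B, hB⟩ := hcomp.exists_bound_of_continuousOn hg
  have hB' : ∀ z ∈ U, |mixedD a b v z| ≤ |B| := fun z hz => by
    rw [← hgv hz]; exact (hB z (subset_closure hz)).trans (le_abs_self B)
  have hgi : IntegrableOn (mixedD a b v) U :=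
    ((hg.integrableOn_compact hcomp).mono_set subset_closure).congr_fun hgv hU.measurableSet
  have hvi : IntegrableOn v U := (hv.2.1.integrableOn_compact hcomp).mono_set subset_closure
  obtain ⟨η, hη, hgη⟩ := Metric.uniformContinuousOn_iff.1
    (hcomp.uniformContinuousOn_of_continuous hg) (δ / 2) (by positivity)
  have h1 : ∀ᶠ t in 𝓝[>] (0 : ℝ), t < 1 := nhdsWithin_le_nhds (gt_mem_nhds one_pos)
  have h2 : ∀ᶠ t in 𝓝[>] (0 : ℝ), t * d < η := by
    have : Tendsto (fun t : ℝ => t * d) (𝓝[>] 0) (𝓝 (0 * d)) :=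
      (tendsto_id.mul_const d).mono_left nhdsWithin_le_nhds
    rw [zero_mul] at this
    exact this.eventually (gt_mem_nhds hη)
  have h3 : ∀ᶠ t in 𝓝[>] (0 : ℝ), t * (2 * |B|) < δ / 2 := by
    have : Tendsto (fun t : ℝ => t * (2 * |B|)) (𝓝[>] 0) (𝓝 (0 * (2 * |B|))) :=
      (tendsto_id.mul_const _).mono_left nhdsWithin_le_nhds
    rw [zero_mul] at this
    exact this.eventually (gt_mem_nhds (by positivity))
  filter_upwards [h1, h2, h3, self_mem_nhdsWithin] with t ht1 ht2 ht3 ht0 z hz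
  have ht : t ∈ J := ⟨ht0, ht1⟩
  rw [mixedD_moll (hψ t ht) hU hvi (isWeakDeriv_of_contDiffOn hU hv.1 hab) hz]
  have e1 := abs_moll_sub_le (hψ t ht) hU.measurableSet hgi hz (ε := δ / 2) fun u hu hut => by
    rw [← hgv hu, ← hgv hz, ← Real.dist_eq]
    exact (hgη u (subset_closure hu) z (subset_closure hz) (hut.trans_lt ht2)).le
  set X := moll U t (ψ t) (mixedD a b v) z
  set Y := mixedD a b v z with hY
  have hp0 : 0 ≤ (1 - t) ^ (a + b) := pow_nonneg (by linarith) _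
  have hp1 : (1 - t) ^ (a + b) ≤ 1 := pow_le_one₀ (by linarith) (by linarith [ht.1])
  have hp2 : 1 - (1 - t) ^ (a + b) ≤ 2 * t := by
    have h := one_add_mul_le_pow (show (-2 : ℝ) ≤ -t by linarith) (a + b)
    have h' : ((a + b : ℕ) : ℝ) ≤ 2 := by exact_mod_cast hab
    have : ((a + b : ℕ) : ℝ) * t ≤ 2 * t := by gcongr; exact ht.1.le
    rw [show 1 - t = 1 + -t by ring]
    nlinarith
  have e2 : (1 - t) ^ (a + b) * X - Y = (1 - t) ^ (a + b) * (X - Y) - (1 - (1 - t) ^ (a + b)) * Y := by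
    ring
  rw [e2]
  refine (abs_sub _ _).trans ?_
  rw [abs_mul, abs_mul, abs_of_nonneg hp0, abs_of_nonneg (sub_nonneg.2 hp1)]
  have e3 : (1 - t) ^ (a + b) * |X - Y| ≤ 1 * (δ / 2) := by gcongr
  have e4 : (1 - (1 - t) ^ (a + b)) * |Y| ≤ 2 * t * |B| :=
    mul_le_mul hp2 (hB' z hz) (abs_nonneg _) (by linarith [ht.1])
  linarith

omit hd in
lemma eLpNorm_absD_moll_le {t} (ht : t ∈ J) {ψ}
    (hψ : IsMollifier U d t ψ) {v} (hv : IntegrableOn v U) {m} (hm : 2 ≤ m)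
    {q} (hq : 1 ≤ q) {g : ℕ × ℕ → Fn}
    (hg : ∀ α ∈ multiIdx m, IsWeakDeriv U α.1 α.2 v (g α))
    (hgm : ∀ α ∈ multiIdx m, AEStronglyMeasurable (g α) (vol U)) :
    eLpNorm (absD m (moll U t ψ v)) q (vol U) ≤
      ∑ α ∈ multiIdx m, eLpNorm (g α) q (vol U) := by
  have hf := contDiff_moll hψ hU.measurableSet hv
  have e : absD m (moll U t ψ v) = ∑ α ∈ multiIdx m,
      fun x => |mixedD α.1 α.2 (moll U t ψ v) x| := by
    ext x; simp [absD]
  rw [e]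
  refine (eLpNorm_sum_le (fun α _ =>
    (contDiff_mixedD hf α.1 α.2).continuous.abs.aestronglyMeasurable) hq).trans ?_
  refine sum_le_sum fun α hα => ?_
  have hαm := mem_antidiagonal.1 hα
  have h1 : eLpNorm (fun x => |mixedD α.1 α.2 (moll U t ψ v) x|) q (vol U) ≤
      eLpNorm (((1 - t) ^ m) • moll U t ψ (g α)) q (vol U) := by
    refine eLpNorm_mono_ae ?_
    filter_upwards [ae_restrict_mem hU.measurableSet] with x hx
    rw [mixedD_moll hψ hU hv (hg α hα) hx, hαm, Real.norm_eq_abs, abs_abs]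
    rfl
  refine h1.trans ?_
  rw [eLpNorm_const_smul]
  refine (mul_le_mul_right (eLpNorm_moll_le hψ hU.measurableSet ht hq (hgm α hα)) _).trans ?_
  have h1t : 0 < 1 - t := by linarith [ht.2]
  have h1t' : 1 - t ≤ 1 := by linarith [ht.1]
  rw [← mul_assoc, Real.enorm_of_nonneg (by positivity), ← ofReal_mul (by positivity)]
  refine mul_le_of_le_one_left' ?_
  rw [ENNReal.ofReal_le_one, ← Real.rpow_natCast, ← Real.rpow_add h1t]
  refine Real.rpow_le_one h1t.le h1t' ?_
  have := two_div_toReal_le hq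
  have hm' : (2 : ℝ) ≤ m := by exact_mod_cast hm
  linarith

include hne hc

/-- Approximation by polynomials of degree less than `m`. -/
theorem exists_isPoly_approx {m} (hm : 3 ≤ m) {q} (hq : 2 ≤ q) (hqm : 4 ≤ m ∨ 4 ≤ q)
    {v} (hv : MemC2Closure U v) {g}
    (hg : ∀ α ∈ multiIdx m, IsWeakDeriv U α.1 α.2 v (g α))
    (hgm : ∀ α ∈ multiIdx m, MemLp (g α) q (vol U))
    {δ : ℝ} (hδ : 0 < δ) :
    ∃ P, IsPoly m P ∧ ∀ a b, a + b ≤ 2 → ∀ z ∈ U, |mixedD a b v z - mixedD a b P z| ≤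
      δ + 2 * (2 * d) ^ (m - (a + b)) * avgNorm q m g U := by
  have hb := isBounded_of_dist_le hd
  have hd0 : 0 ≤ d := let ⟨x, hx⟩ := hne; dist_nonneg.trans (hd x hx x hx)
  choose! ψ hψ using fun t (ht : t ∈ J) => exists_isMollifier hU hne hc hd ht
  have hev : ∀ᶠ t in 𝓝[>] (0 : ℝ), ∀ x ∈ polyIdx 3, ∀ z ∈ U,
      |mixedD x.1 x.2 (moll U t (ψ t) v) z - mixedD x.1 x.2 v z| ≤ δ :=
    (Finset.eventually_all _).2 fun x hx => eventually_mixedD_moll_sub_le hU hd hv hψ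
      (by have := mem_polyIdx.1 hx; omega) hδ
  have h1 : ∀ᶠ t in 𝓝[>] (0 : ℝ), t < 1 := nhdsWithin_le_nhds (gt_mem_nhds one_pos)
  obtain ⟨t, ⟨htd, ht1⟩, ht0⟩ := ((hev.and h1).and self_mem_nhdsWithin).exists
  have ht : t ∈ J := ⟨ht0, ht1⟩
  have hvi : IntegrableOn v U :=
    (hv.2.1.integrableOn_compact hb.isCompact_closure).mono_set subset_closure
  have hf := contDiff_moll (hψ t ht) hU.measurableSet hvi
  set f := moll U t (ψ t) v with hfd
  refine ⟨avgTaylor m f U, isPoly_avgTaylor m f U, fun a b hab z hz => ?_⟩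
  have e1 := htd (a, b) (mem_polyIdx.2 (by simp only; omega)) z hz
  have e2 := enorm_mixedD_sub_avgTaylor_le hU hne hb hc hd hf (m := m) (k := m - (a + b)) (a := a)
    (b := b) (by omega) (by omega) hq (by rcases hqm with h | h; exacts [.inl (by omega), .inr h]) hz
  have e3 := eLpNorm_absD_moll_le hU ht (hψ t ht) hvi (by omega) (le_trans (by norm_num) hq) hg
    fun α hα => (hgm α hα).1
  have e4 := e2.trans (mul_le_mul_right (mul_le_mul_right e3 _) _)
  have hGt : ∑ α ∈ multiIdx m, eLpNorm (g α) q (vol U) ≠ ⊤ := ENNReal.sum_ne_top.2 fun α hα => (hgm α hα).2.ne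
  have e5 : |mixedD a b f z - mixedD a b (avgTaylor m f U) z| ≤
      2 * (2 * d) ^ (m - (a + b)) * avgNorm q m g U := by
    have := toReal_mono (mul_ne_top ofReal_ne_top (mul_ne_top (ENNReal.rpow_ne_top_of_ne_zero
      (hU.measure_pos volume hne).ne' hb.measure_lt_top.ne) hGt)) e4
    rw [toReal_enorm, ENNReal.toReal_mul, ENNReal.toReal_ofReal (by positivity),
      mixedD_sub hf (isPoly_avgTaylor m f U).contDiff] at this
    exact this
  have e6 := abs_sub_le (mixedD a b v z) (mixedD a b f z) (mixedD a b (avgTaylor m f U) z)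
  rw [abs_sub_comm] at e1
  linarith

end

/-! ### Convergence of mollifications and the Sobolev inequality -/

section

variable {U : Set Plane} (hU : IsOpen U) (hne : U.Nonempty) (hc : Convex ℝ U) {d : ℝ}
  (hd : ∀ x ∈ U, ∀ y ∈ U, dist x y ≤ d) {ψ : ℝ → Fn}
  (hψ : ∀ t ∈ J, IsMollifier U d t (ψ t)) {q : ℝ≥0∞} (hq : 1 ≤ q) (hqt : q ≠ ⊤)

lemma moll_sub {t : ℝ} {φ} (hφ : IsMollifier U d t φ) (hU : MeasurableSet U)
    {v w} (hv : IntegrableOn v U) (hw : IntegrableOn w U) :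
    moll U t φ (v - w) = moll U t φ v - moll U t φ w := by
  ext x
  rw [Pi.sub_apply, moll_eq_integral, moll_eq_integral, moll_eq_integral,
    ← integral_sub (integrable_moll hφ hU hv x) (integrable_moll hφ hU hw x)]
  congr 1; ext y
  rw [indicator_sub']; simp only [Pi.sub_apply]; ring

lemma rpow_neg_le_four {t : ℝ} (ht0 : 0 < t) (ht : t < 1 / 2) {s : ℝ} (hs : s ≤ 2) :
    (1 - t) ^ (-s) ≤ 4 := by
  have h1 : (0 : ℝ) < 1 - t := by linarith
  have h2 : (1 - t) ^ (-s) ≤ (1 - t) ^ (-2 : ℝ) :=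
    Real.rpow_le_rpow_of_exponent_ge h1 (by linarith) (by linarith)
  refine h2.trans ?_
  have h3 : (1 - t) ^ (-2 : ℝ) ≤ (1 / 2) ^ (-2 : ℝ) :=
    Real.rpow_le_rpow_of_nonpos (by norm_num) (by linarith) (by norm_num)
  refine h3.trans (le_of_eq ?_)
  norm_num [Real.rpow_neg]

include hU hd hψ hq hqt in
lemma tendsto_eLpNorm_moll_sub {g} (hg : MemLp g q (vol U)) :
    Tendsto (fun t => eLpNorm (moll U t (ψ t) g - g) q (vol U)) (𝓝[>] 0) (𝓝 0) := by
  have hb := isBounded_of_dist_le hd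
  have : IsFiniteMeasure (vol U) := isFiniteMeasure_restrict.2 hb.measure_lt_top.ne
  suffices H : ∀ ε, ε ≠ 0 → ∀ᶠ t in 𝓝[>] (0 : ℝ),
      eLpNorm (moll U t (ψ t) g - g) q (vol U) ≤ 6 * ε by
    rw [ENNReal.tendsto_nhds_zero]
    intro ε hε
    have := H (ε / 6) (by simp [hε.ne'])
    rwa [ENNReal.mul_div_cancel (by norm_num) (by norm_num)] at this
  intro ε hε
  obtain ⟨h, -, hgh, hhc, hhm⟩ := hg.exists_hasCompactSupport_eLpNorm_sub_le hqt hε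
  obtain ⟨η, hηε, hη⟩ : ∃ η : ℝ, volume U ^ q.toReal⁻¹ * ofReal η ≤ ε ∧ 0 < η := by
    have h1 : Tendsto (fun η : ℝ => volume U ^ q.toReal⁻¹ * ofReal η) (𝓝[>] 0)
        (𝓝 (volume U ^ q.toReal⁻¹ * ofReal 0)) :=
      (ENNReal.Tendsto.const_mul (ENNReal.continuous_ofReal.tendsto 0)
        (.inr (ENNReal.rpow_ne_top_of_nonneg (by positivity) hb.measure_lt_top.ne))).mono_left
        nhdsWithin_le_nhds
    rw [ENNReal.ofReal_zero, mul_zero] at h1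
    exact ((ENNReal.tendsto_nhds_zero.1 h1 ε (pos_iff_ne_zero.2 hε)).and
      self_mem_nhdsWithin).exists
  obtain ⟨r, hr, hhr⟩ := Metric.uniformContinuousOn_iff.1
    (hb.isCompact_closure.uniformContinuousOn_of_continuous hhc.continuousOn) η hη
  have h1 : ∀ᶠ t in 𝓝[>] (0 : ℝ), t < 1 / 2 := nhdsWithin_le_nhds (gt_mem_nhds (by norm_num))
  have h2 : ∀ᶠ t in 𝓝[>] (0 : ℝ), t * d < r := by
    have : Tendsto (fun t : ℝ => t * d) (𝓝[>] 0) (𝓝 (0 * d)) :=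
      (tendsto_id.mul_const d).mono_left nhdsWithin_le_nhds
    rw [zero_mul] at this
    exact this.eventually (gt_mem_nhds hr)
  filter_upwards [h1, h2, self_mem_nhdsWithin] with t ht1 ht2 ht0
  have ht : t ∈ J := ⟨ht0, by linarith⟩
  have hgi : IntegrableOn g U := hg.integrable hq
  have hhi : IntegrableOn h U := hhm.integrable hq
  have m1 := contDiff_moll (hψ t ht) hU.measurableSet (hgi.sub hhi)
  have m2 := contDiff_moll (hψ t ht) hU.measurableSet hhi
  have e : moll U t (ψ t) g - g = moll U t (ψ t) (g - h) + (moll U t (ψ t) h - h) + (h - g) := by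
    rw [moll_sub (hψ t ht) hU.measurableSet hgi hhi]; abel
  rw [e]
  have am1 : AEStronglyMeasurable (moll U t (ψ t) (g - h)) (vol U) :=
    m1.continuous.aestronglyMeasurable
  have am2 : AEStronglyMeasurable (moll U t (ψ t) h - h) (vol U) :=
    (m2.continuous.sub hhc).aestronglyMeasurable
  refine (eLpNorm_add_le (am1.add am2) (hhm.1.sub hg.1) hq).trans ?_
  refine (add_le_add_left (eLpNorm_add_le am1 am2 hq) _).trans ?_
  have b1 : eLpNorm (moll U t (ψ t) (g - h)) q (vol U) ≤ 4 * ε := by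
    refine (eLpNorm_moll_le (hψ t ht) hU.measurableSet ht hq (hg.1.sub hhm.1)).trans ?_
    gcongr
    exact ENNReal.ofReal_le_of_le_toReal
      (by simpa using rpow_neg_le_four ht.1 ht1 (two_div_toReal_le hq))
  have b2 : eLpNorm (moll U t (ψ t) h - h) q (vol U) ≤ ε := by
    refine (eLpNorm_le_of_ae_bound (C := η) ?_).trans ?_
    · filter_upwards [ae_restrict_mem hU.measurableSet] with x hx
      exact abs_moll_sub_le (hψ t ht) hU.measurableSet hhi hx fun u hu hut =>
        (hhr u (subset_closure hu) x (subset_closure hx) (hut.trans_lt ht2)).le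
    · rwa [Measure.restrict_apply_univ]
  have b3 : eLpNorm (h - g) q (vol U) ≤ ε := by rwa [eLpNorm_sub_comm]
  calc _ ≤ 4 * ε + ε + ε := add_le_add (add_le_add b1 b2) b3
    _ = 6 * ε := by ring

include hU hd hψ hq hqt in
lemma tendsto_eLpNorm_mixedD_moll_sub {v g} (hv : IntegrableOn v U) {a b}
    (hw : IsWeakDeriv U a b v g) (hg : MemLp g q (vol U)) :
    Tendsto (fun t => eLpNorm (mixedD a b (moll U t (ψ t) v) - g) q (vol U))
      (𝓝[>] 0) (𝓝 0) := by
  have h1 := tendsto_eLpNorm_moll_sub hU hd hψ hq hqt hg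
  have h2 : Tendsto (fun t : ℝ => ‖(1 - t) ^ (a + b) - 1‖ₑ * eLpNorm g q (vol U))
      (𝓝[>] 0) (𝓝 0) := by
    have hc : Continuous fun t : ℝ => ‖(1 - t) ^ (a + b) - 1‖ₑ := by fun_prop
    have := ENNReal.Tendsto.mul_const (hc.tendsto 0) (.inr hg.2.ne)
    simp only [sub_zero, one_pow, sub_self, enorm_zero, zero_mul] at this
    exact this.mono_left nhdsWithin_le_nhds
  have h3 := h1.add h2
  rw [add_zero] at h3
  refine tendsto_of_tendsto_of_tendsto_of_le_of_le' tendsto_const_nhds h3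
    (Eventually.of_forall fun _ => zero_le) ?_
  filter_upwards [nhdsWithin_le_nhds (gt_mem_nhds (show 0 < 1 by norm_num)),
    self_mem_nhdsWithin] with t ht1 ht0
  have ht : t ∈ J := ⟨ht0, ht1⟩
  have hb := isBounded_of_dist_le hd
  have : IsFiniteMeasure (vol U) := isFiniteMeasure_restrict.2 hb.measure_lt_top.ne
  have m1 := (contDiff_moll (hψ t ht) hU.measurableSet (hg.integrable hq)).continuous
  have e : mixedD a b (moll U t (ψ t) v) - g =ᵐ[vol U]
      (1 - t) ^ (a + b) • (moll U t (ψ t) g - g) + ((1 - t) ^ (a + b) - 1) • g := by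
    filter_upwards [ae_restrict_mem hU.measurableSet] with x hx
    simp only [Pi.sub_apply, Pi.add_apply, Pi.smul_apply, smul_eq_mul]
    rw [mixedD_moll (hψ t ht) hU hv hw hx]; ring
  rw [eLpNorm_congr_ae e]
  refine (eLpNorm_add_le ((m1.aestronglyMeasurable.sub hg.1).const_smul _) (hg.1.const_smul _)
    hq).trans ?_
  rw [eLpNorm_const_smul, eLpNorm_const_smul]
  refine add_le_add (mul_le_of_le_one_left' ?_) le_rfl
  rw [Real.enorm_of_nonneg (pow_nonneg (by linarith) _), ENNReal.ofReal_le_one]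
  exact pow_le_one₀ (by linarith) (by linarith [ht.1])

include hU hd hne in
lemma enorm_mixedD_avgTaylor_le {f} (hf : ContDiff ℝ ∞ f) (m) (a b)
    {z} (hz : z ∈ U) {q} (hq1 : 1 ≤ q) :
    ‖mixedD a b (avgTaylor m f U) z‖ₑ ≤ ofReal ((1 + d) ^ (2 * m)) *
      volume U ^ (-(1 / q.toReal)) *
      ∑ x ∈ polyIdx m, eLpNorm (mixedD x.1 x.2 f) q (vol U) := by
  have hb := isBounded_of_dist_le hd
  have hd0 : 0 ≤ d := dist_nonneg.trans (hd z hz z hz)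
  have hV0 : volume U ≠ 0 := (hU.measure_pos volume hne).ne'
  have hVt : volume U ≠ ⊤ := hb.measure_lt_top.ne
  have hprob := isProbabilityMeasure_avgMeasure hU hne hb
  set A := 1 + d
  set S := ∑ x ∈ polyIdx m, eLpNorm (mixedD x.1 x.2 f) q (vol U)
  rw [mixedD_avgTaylor hU hne hb hf]
  refine (enorm_integral_le_lintegral_enorm _).trans ?_
  have hpt : ∀ y ∈ U, ‖mixedD a b (taylorPoly m f y) z‖ₑ ≤
      ∑ x ∈ polyIdx m, ofReal (A ^ (2 * m)) * ‖mixedD x.1 x.2 f y‖ₑ := by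
    intro y hy
    rw [mixedD_taylorPoly]
    refine (enorm_sum_le _ _).trans (sum_le_sum fun x hx => ?_)
    have hx' := mem_polyIdx.1 hx
    rw [Real.enorm_eq_ofReal_abs, Real.enorm_eq_ofReal_abs, ← ofReal_mul (by positivity)]
    refine ENNReal.ofReal_le_ofReal ?_
    have hcoord : ∀ i, ∀ n ≤ m, |(z i - y i) ^ n| ≤ A ^ m := fun i n hn => by
      rw [abs_pow]
      have h1 : |z i - y i| ≤ A := by
        have := abs_coord_le (z - y) i
        rw [← dist_eq_norm] at this
        have h2 := hd z hz y hy
        simp only [PiLp.sub_apply] at this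
        linarith
      calc _ ≤ A ^ n := by gcongr
        _ ≤ A ^ m := pow_le_pow_right₀ (by linarith) hn
    have hf1 : ∀ n k : ℕ, (n.descFactorial k : ℝ) / n.factorial ≤ 1 := fun n k => by
      rw [div_le_one (by positivity)]
      rcases le_or_gt k n with h | h
      · rw [← Nat.factorial_mul_descFactorial h]
        exact_mod_cast Nat.le_mul_of_pos_left _ (Nat.factorial_pos _)
      · rw [Nat.descFactorial_eq_zero_iff_lt.2 h]; exact_mod_cast Nat.zero_le _
    have hval : mixedD x.1 x.2 f y / (x.1.factorial * x.2.factorial) *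
        ((x.1.descFactorial a * (z 0 - y 0) ^ (x.1 - a)) *
        (x.2.descFactorial b * (z 1 - y 1) ^ (x.2 - b))) =
        ((x.1.descFactorial a : ℝ) / x.1.factorial * (z 0 - y 0) ^ (x.1 - a)) *
        ((x.2.descFactorial b : ℝ) / x.2.factorial * (z 1 - y 1) ^ (x.2 - b)) *
        mixedD x.1 x.2 f y := by
      field_simp
    rw [hval, abs_mul, abs_mul, abs_mul, abs_mul, two_mul, pow_add]
    gcongr
    all_goals
      rw [abs_of_nonneg (by positivity)]
      exact (mul_le_mul (hf1 _ _) (hcoord _ _ (by omega)) (abs_nonneg _) zero_le_one).trans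
        (one_mul _).le
  rw [avgMeasure, lintegral_smul_measure, smul_eq_mul]
  refine (mul_le_mul_right (setLIntegral_mono' hU.measurableSet hpt) _).trans ?_
  rw [lintegral_finsetSum _ fun x _ =>
    ((contDiff_mixedD hf x.1 x.2).continuous.measurable.enorm.const_mul _)]
  have hx : ∀ x : ℕ × ℕ, ∫⁻ y in U, ofReal (A ^ (2 * m)) * ‖mixedD x.1 x.2 f y‖ₑ ≤
      ofReal (A ^ (2 * m)) * (eLpNorm (mixedD x.1 x.2 f) q (vol U) *
        volume U ^ (1 - 1 / q.toReal)) := fun x => by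
    rw [lintegral_const_mul _ (contDiff_mixedD hf x.1 x.2).continuous.measurable.enorm]
    gcongr
    exact lintegral_enorm_le_eLpNorm hq1
      (contDiff_mixedD hf x.1 x.2).continuous.aestronglyMeasurable
  refine (mul_le_mul_right (sum_le_sum fun x _ => hx x) _).trans ?_
  rw [← mul_sum, ← sum_mul]
  rw [← inv_mul_rpow_one_sub hV0 hVt]
  exact le_of_eq (by ring)

include hU hd hne hc in
/-- The Sobolev inequality for derivatives of order at most two. -/
theorem exists_sobolev_bound {m} (hm : 3 ≤ m) (hq2 : 2 ≤ q) (hqm : 4 ≤ m ∨ 4 ≤ q) :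
    ∃ C, C ≠ ⊤ ∧ ∀ f, ContDiff ℝ ∞ f → ∀ a b, a + b ≤ 2 → ∀ z ∈ U,
      ‖mixedD a b f z‖ₑ ≤ C * ∑ x ∈ polyIdx (m + 1),
        eLpNorm (mixedD x.1 x.2 f) q (vol U) := by
  have hb := isBounded_of_dist_le hd
  have hd0 : 0 ≤ d := let ⟨x, hx⟩ := hne; dist_nonneg.trans (hd x hx x hx)
  have hV0 : volume U ≠ 0 := (hU.measure_pos volume hne).ne'
  have hVt : volume U ≠ ⊤ := hb.measure_lt_top.ne
  have hWt : volume U ^ (-(1 / q.toReal)) ≠ ⊤ := ENNReal.rpow_ne_top_of_ne_zero hV0 hVt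
  have hq1 : 1 ≤ q := le_trans (by norm_num) hq2
  set W := volume U ^ (-(1 / q.toReal))
  set A := 1 + d
  refine ⟨ofReal (2 * (2 * A) ^ m) * W + ofReal (A ^ (2 * m)) * W,
    ENNReal.add_ne_top.2 ⟨mul_ne_top ofReal_ne_top hWt,
      mul_ne_top ofReal_ne_top hWt⟩, fun f hf a b hab z hz => ?_⟩
  set S := ∑ x ∈ polyIdx (m + 1), eLpNorm (mixedD x.1 x.2 f) q (vol U)
  have hm1 : ∀ x : ℕ × ℕ, AEStronglyMeasurable (mixedD x.1 x.2 f) (vol U) := fun x =>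
    (contDiff_mixedD hf x.1 x.2).continuous.aestronglyMeasurable
  have e1 := enorm_mixedD_sub_avgTaylor_le hU hne hb hc hd hf (m := m) (k := m - (a + b)) (a := a)
    (b := b) (by omega) (by omega) hq2 (by rcases hqm with h | h; exacts [.inl (by omega), .inr h])
    hz
  have e2 : eLpNorm (absD m f) q (vol U) ≤ S := by
    have e : absD m f = ∑ α ∈ multiIdx m,
        fun x => |mixedD α.1 α.2 f x| := by ext x; simp [absD]
    rw [e]
    refine (eLpNorm_sum_le (fun α _ => (hm1 α).norm) hq1).trans ?_
    have : ∀ α : ℕ × ℕ, eLpNorm (fun x => |mixedD α.1 α.2 f x|) q (vol U) =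
        eLpNorm (mixedD α.1 α.2 f) q (vol U) := fun α => by
      simpa only [Real.norm_eq_abs] using eLpNorm_norm (mixedD α.1 α.2 f)
    refine (sum_le_sum fun α _ => (this α).le).trans ?_
    refine Finset.sum_le_sum_of_subset fun α hα => mem_polyIdx.2 ?_
    have := mem_antidiagonal.1 hα
    omega
  have e3 : ‖mixedD a b (avgTaylor m f U) z‖ₑ ≤ ofReal (A ^ (2 * m)) * W * S := by
    refine (enorm_mixedD_avgTaylor_le hU hne hd hf m a b hz hq1).trans (mul_le_mul_right ?_ _)
    exact Finset.sum_le_sum_of_subset fun x hx => mem_polyIdx.2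
      (by have := mem_polyIdx.1 hx; omega)
  have e4 : ofReal (2 * (2 * d) ^ (m - (a + b))) ≤ ofReal (2 * (2 * A) ^ m) := by
    gcongr
    calc _ ≤ (2 * A) ^ (m - (a + b)) := by gcongr; linarith
      _ ≤ _ := pow_le_pow_right₀ (by linarith) (by omega)
  have e5 : mixedD a b f z = mixedD a b (f - avgTaylor m f U) z + mixedD a b (avgTaylor m f U) z := by
    rw [mixedD_sub hf (isPoly_avgTaylor m f U).contDiff]; simp
  rw [e5, add_mul]
  refine (enorm_add_le _ _).trans (add_le_add (e1.trans ?_) e3)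
  rw [mul_assoc]
  gcongr

end

/-! ### Representatives that are twice continuously differentiable -/

lemma uniformCauchySeqOn_closure {U} {f : ℕ → Fn} (hf : ∀ n, Continuous (f n))
    (h : UniformCauchySeqOn f atTop U) : UniformCauchySeqOn f atTop (closure U) := by
  rw [Metric.uniformCauchySeqOn_iff] at h ⊢
  intro ε hε
  obtain ⟨N, hN⟩ := h (ε / 2) (by linarith)
  refine ⟨N, fun m hm n hn x hx => ?_⟩
  have : x ∈ {x | dist (f m x) (f n x) ≤ ε / 2} :=
    closure_minimal (fun y hy => (hN m hm n hn y hy).le)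
      (isClosed_le ((hf m).dist (hf n)) continuous_const) hx
  exact lt_of_le_of_lt this (by linarith)

lemma partialD_eqOn {U} (hU : IsOpen U) {f g} (h : EqOn f g U) (i) :
    EqOn (partialD i f) (partialD i g) U := fun x hx => by
  unfold partialD
  rw [(h.eventuallyEq_of_mem (hU.mem_nhds hx)).fderiv_eq]

lemma mixedD_eqOn {U} (hU : IsOpen U) {f g} (h : EqOn f g U) (a b) :
    EqOn (mixedD a b f) (mixedD a b g) U := by
  have key : ∀ (i : Fin 2) (n : ℕ) (f g : Fn), EqOn f g U →
      EqOn ((partialD i)^[n] f) ((partialD i)^[n] g) U := by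
    intro i n
    induction n with
    | zero => exact fun f g h => h
    | succ n ih => exact fun f g h => ih _ _ (partialD_eqOn hU h i)
  exact key 0 a _ _ (key 1 b _ _ h)

/-- The linear form with the two given coordinates. -/
def coordForm : ℝ × ℝ →L[ℝ] (Plane →L[ℝ] ℝ) :=
  (fst ℝ ℝ ℝ).smulRight (EuclideanSpace.proj (𝕜 := ℝ) 0 : Plane →L[ℝ] ℝ) +
  (snd ℝ ℝ ℝ).smulRight (EuclideanSpace.proj (𝕜 := ℝ) 1 : Plane →L[ℝ] ℝ)

lemma coordForm_apply (x) (v) : coordForm x v = x.1 * v 0 + x.2 * v 1 := by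
  simp [coordForm]

lemma fderiv_eq_coordForm (f) (x) :
    fderiv ℝ f x = coordForm (partialD 0 f x, partialD 1 f x) := by
  ext v
  rw [coordForm_apply, fderiv_eq_partialD]; ring

lemma contDiffOn_succ_of_coordForm {U} (hU : IsOpen U) {n : ℕ} {f A B}
    (hf : ∀ x ∈ U, HasFDerivAt f (coordForm (A x, B x)) x) (hA : ContDiffOn ℝ n A U)
    (hB : ContDiffOn ℝ n B U) : ContDiffOn ℝ (n + 1) f U := by
  rw [contDiffOn_succ_iff_fderiv_of_isOpen hU]
  refine ⟨fun x hx => (hf x hx).differentiableAt.differentiableWithinAt, fun h => by simp at h, ?_⟩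
  exact (coordForm.contDiff.comp_contDiffOn (hA.prodMk hB)).congr fun x hx => (hf x hx).fderiv

/-- A sequence whose derivatives of order at most two are uniformly Cauchy has a limit that is
twice continuously differentiable up to the boundary. -/
theorem exists_memC2Closure_of_uniformCauchySeqOn {U} (hU : IsOpen U)
    {f : ℕ → Fn} (hf : ∀ n, ContDiff ℝ ∞ (f n))
    (hC : ∀ a b, a + b ≤ 2 → UniformCauchySeqOn (fun n => mixedD a b (f n)) atTop U) :
    ∃ v, MemC2Closure U v ∧ ∀ z ∈ U, Tendsto (fun n => f n z) atTop (𝓝 (v z)) := by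
  have hcon : ∀ a b n, Continuous (mixedD a b (f n)) := fun a b n =>
    (contDiff_mixedD (hf n) a b).continuous
  have hC' := fun a b hab => uniformCauchySeqOn_closure (hcon a b) (hC a b hab)
  let F : ℕ → ℕ → Fn := fun a b z => limUnder atTop fun n => mixedD a b (f n) z
  have hF : ∀ a b, a + b ≤ 2 → ∀ z ∈ closure U,
      Tendsto (fun n => mixedD a b (f n) z) atTop (𝓝 (F a b z)) := fun a b hab z hz =>
    ((hC' a b hab).cauchySeq hz).tendsto_limUnder
  have hT : ∀ a b, a + b ≤ 2 →
      TendstoUniformlyOn (fun n => mixedD a b (f n)) (F a b) atTop (closure U) := fun a b hab =>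
    (hC' a b hab).tendstoUniformlyOn_of_tendsto (hF a b hab)
  have hFc : ∀ a b, a + b ≤ 2 → ContinuousOn (F a b) (closure U) := fun a b hab =>
    (hT a b hab).continuousOn (Frequently.of_forall fun n => (hcon a b n).continuousOn)
  have hD : ∀ a b, a + b ≤ 1 → ∀ x ∈ U,
      HasFDerivAt (F a b) (coordForm (F (a + 1) b x, F a (b + 1) x)) x := by
    intro a b hab x hx
    have h1 := ((hT (a + 1) b (by omega)).mono subset_closure).prodMk
      ((hT a (b + 1) (by omega)).mono subset_closure)
    have h2 := coordForm.uniformContinuous.comp_tendstoUniformlyOn h1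
    have h3 : TendstoUniformlyOn
        (fun n => fun x => coordForm (mixedD (a + 1) b (f n) x, mixedD a (b + 1) (f n) x))
        (fun x => coordForm (F (a + 1) b x, F a (b + 1) x)) atTop U := fun u hu =>
      (h2 u hu).diag_of_prod
    refine hasFDerivAt_of_tendstoUniformlyOn hU h3 (fun n y _ => ?_)
      (fun y hy => hF a b (by omega) y (subset_closure hy)) hx
    rw [← partialD_zero_mixedD, ← partialD_one_mixedD (hf n), ← fderiv_eq_coordForm]
    exact ((contDiff_mixedD (hf n) a b).differentiable (by simp) y).hasFDerivAt
  have hP0 : ∀ a b, a + b ≤ 1 → EqOn (partialD 0 (F a b)) (F (a + 1) b) U := fun a b hab x hx => by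
    unfold partialD
    rw [(hD a b hab x hx).fderiv, coordForm_apply]; simp
  have hP1 : ∀ a b, a + b ≤ 1 → EqOn (partialD 1 (F a b)) (F a (b + 1)) U := fun a b hab x hx => by
    unfold partialD
    rw [(hD a b hab x hx).fderiv, coordForm_apply]; simp
  have hcd1 : ∀ a b, a + b ≤ 1 → ContDiffOn ℝ 1 (F a b) U := fun a b hab => by
    have := contDiffOn_succ_of_coordForm hU (n := 0) (hD a b hab)
      (contDiffOn_zero.2 ((hFc _ _ (by omega)).mono subset_closure))
      (contDiffOn_zero.2 ((hFc _ _ (by omega)).mono subset_closure))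
    simpa using this
  have hcd : ContDiffOn ℝ 2 (F 0 0) U := by
    have := contDiffOn_succ_of_coordForm hU (n := 1) (hD 0 0 (by omega))
      (by simpa using hcd1 1 0 (by omega)) (by simpa using hcd1 0 1 (by omega))
    convert this using 1
    norm_num
  have hm1 : ∀ b, b ≤ 2 → EqOn ((partialD 1)^[b] (F 0 0)) (F 0 b) U := by
    intro b
    induction b with
    | zero => exact fun _ _ _ => rfl
    | succ b ih =>
      intro hb
      rw [Function.iterate_succ_apply']
      exact (partialD_eqOn hU (ih (by omega)) 1).trans (hP1 0 b (by omega))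
  have hm : ∀ a b, a + b ≤ 2 → EqOn (mixedD a b (F 0 0)) (F a b) U := by
    intro a
    induction a with
    | zero => exact fun b hb => hm1 b (by omega)
    | succ a ih =>
      intro b hb
      rw [← partialD_zero_mixedD]
      exact (partialD_eqOn hU (ih b (by omega)) 0).trans (hP0 a b (by omega))
  exact ⟨F 0 0, ⟨hcd, hFc 0 0 (by omega), fun a b hab => ⟨F a b, hFc a b hab, (hm a b hab).symm⟩⟩,
    fun z hz => hF 0 0 (by omega) z (subset_closure hz)⟩

section

variable {U : Set Plane} (hU : IsOpen U) (hne : U.Nonempty) (hc : Convex ℝ U) {d : ℝ}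
  (hd : ∀ x ∈ U, ∀ y ∈ U, dist x y ≤ d) {m : ℕ} (hm : 3 ≤ m) {q : ℝ≥0∞} (hq2 : 2 ≤ q)
  (hqt : q ≠ ⊤) (hqm : 4 ≤ m ∨ 4 ≤ q)

include hU hne hc hd hm hq2 hqt hqm in
theorem exists_c2Representative_of_convex {φ} (hφ : MemSobolev U m q φ) :
    ∃ v, IsC2Representative U φ v := by
  have hq1 : 1 ≤ q := le_trans (by norm_num) hq2
  have hb := isBounded_of_dist_le hd
  have : IsFiniteMeasure (vol U) := ⟨by
    rw [Measure.restrict_apply_univ]; exact hb.measure_lt_top⟩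
  choose! g hg hgm using fun a b (h : a + b ≤ m) => hφ a b h
  have h00 : IsWeakDeriv U 0 0 φ φ := ⟨(hg 0 0 (by omega)).1, (hg 0 0 (by omega)).1, by simp [mixedD]⟩
  have e00 := h00.ae_unique hU (hg 0 0 (by omega))
  have hφm : MemLp φ q (vol U) := (hgm 0 0 (by omega)).ae_eq e00.symm
  have hφi : IntegrableOn φ U := hφm.integrable hq1
  choose! ψ hψ using fun t (ht : t ∈ J) => exists_isMollifier hU hne hc hd ht
  obtain ⟨t, ht⟩ : ∃ t, (∀ n, t n ∈ J) ∧ Tendsto t atTop (𝓝[>] 0) := by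
    refine ⟨fun n => 1 / ((n + 1 : ℕ) + 1), fun n => ⟨by positivity, ?_⟩, ?_⟩
    · rw [div_lt_one (by positivity)]; push_cast; linarith [(Nat.cast_nonneg n : 0 ≤ n)]
    · refine tendsto_nhdsWithin_iff.2 ⟨(tendsto_add_atTop_iff_nat 1).2
        tendsto_one_div_add_atTop_nhds_zero_nat, Eventually.of_forall fun n => ?_⟩
      show (0 : ℝ) < _
      positivity
  obtain ⟨ht1, ht2⟩ := ht
  set f : ℕ → Fn := fun n => moll U (t n) (ψ (t n)) φ with hf
  have hfs : ∀ n, ContDiff ℝ ∞ (f n) := fun n => contDiff_moll (hψ _ (ht1 n)) hU.measurableSet hφi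
  have hlim : ∀ a b, a + b ≤ m → Tendsto (fun n => eLpNorm (mixedD a b (f n) - g a b) q
      (vol U)) atTop (𝓝 0) := fun a b hab =>
    (tendsto_eLpNorm_mixedD_moll_sub hU hd hψ hq1 hqt hφi (hg a b hab) (hgm a b hab)).comp ht2
  obtain ⟨C, hCt, hC⟩ := exists_sobolev_bound hU hne hc hd hm hq2 hqm
  set E : ℕ → ℝ≥0∞ := fun n => ∑ x ∈ polyIdx (m + 1),
    eLpNorm (mixedD x.1 x.2 (f n) - g x.1 x.2) q (vol U) with hE
  have hE0 : Tendsto E atTop (𝓝 0) := by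
    have := tendsto_finsetSum (polyIdx (m + 1)) fun x hx =>
      hlim x.1 x.2 (by have := mem_polyIdx.1 hx; omega)
    simpa using this
  have hdiff : ∀ a b, a + b ≤ 2 → ∀ n k, ∀ z ∈ U,
      ‖mixedD a b (f n) z - mixedD a b (f k) z‖ₑ ≤ C * (E n + E k) := by
    intro a b hab n k z hz
    have h1 := hC (f n - f k) ((hfs n).sub (hfs k)) a b hab z hz
    rw [mixedD_sub (hfs n) (hfs k)] at h1
    refine h1.trans (mul_le_mul_right ?_ _)
    rw [hE, ← sum_add_distrib]
    refine sum_le_sum fun x hx => ?_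
    have hx' := mem_polyIdx.1 hx
    rw [mixedD_sub (hfs n) (hfs k)]
    have e : mixedD x.1 x.2 (f n) - mixedD x.1 x.2 (f k) =
        (mixedD x.1 x.2 (f n) - g x.1 x.2) - (mixedD x.1 x.2 (f k) - g x.1 x.2) := by abel
    rw [e]
    have hs : ∀ n, AEStronglyMeasurable (mixedD x.1 x.2 (f n) - g x.1 x.2) (vol U) :=
      fun n => (contDiff_mixedD (hfs n) _ _).continuous.aestronglyMeasurable.sub
        (hgm x.1 x.2 (by omega)).1
    exact eLpNorm_sub_le (hs n) (hs k) hq1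
  obtain ⟨v, hv, hvl⟩ := exists_memC2Closure_of_uniformCauchySeqOn hU hfs (by
    intro a b hab
    rw [Metric.uniformCauchySeqOn_iff]
    intro ε hε
    have h1 : Tendsto (fun n => C * (E n.1 + E n.2)) (atTop ×ˢ atTop) (𝓝 0) := by
      have h2 : Tendsto (fun n => E n.1 + E n.2) (atTop ×ˢ atTop) (𝓝 (0 + 0)) :=
        (hE0.comp tendsto_fst).add (hE0.comp tendsto_snd)
      have := ENNReal.Tendsto.const_mul (a := C) h2 (.inr hCt)
      simpa using this
    rw [prod_atTop_atTop_eq] at h1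
    obtain ⟨N, hN⟩ := eventually_atTop.1
      (h1.eventually (gt_mem_nhds (ENNReal.ofReal_pos.2 hε)))
    refine ⟨max N.1 N.2, fun n hn k hk z hz => ?_⟩
    have h3 := hN (n, k) ⟨(le_max_left _ _).trans hn, (le_max_right _ _).trans hk⟩
    have h4 := (hdiff a b hab n k z hz).trans_lt h3
    rw [Real.enorm_eq_ofReal_abs, ENNReal.ofReal_lt_ofReal_iff hε] at h4
    rwa [Real.dist_eq])
  refine ⟨v, hv, ?_⟩
  have h1 : TendstoInMeasure (vol U) f atTop (g 0 0) :=
    tendstoInMeasure_of_tendsto_eLpNorm (p := q) (by positivity)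
      (fun n => (hfs n).continuous.aestronglyMeasurable) (hgm 0 0 (by omega)).1
      (by simpa [mixedD] using hlim 0 0 (by omega))
  obtain ⟨ns, hns, hae⟩ := h1.exists_seq_tendsto_ae
  filter_upwards [hae, e00, ae_restrict_mem hU.measurableSet] with x hx1 hx2 hx3
  rw [hx2]
  exact tendsto_nhds_unique ((hvl x hx3).comp hns.tendsto_atTop) hx1

end

lemma IsTest.mixedD {ψ} (h : IsTest Ω ψ) (a b) :
    IsTest Ω (mixedD a b ψ) := by
  have key : ∀ (i : Fin 2) (n : ℕ) (f : Fn), IsTest Ω f →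
      IsTest Ω ((BSQuad.partialD i)^[n] f) := by
    intro i n
    induction n with
    | zero => exact fun f h => h
    | succ n ih => exact fun f h => ih _ (h.partialD i)
  exact key 0 a _ (key 1 b _ h)

lemma IsTest.eq_zero {ψ} (h : IsTest Ω ψ) {x} (hx : x ∉ Ω) :
    ψ x = 0 := image_eq_zero_of_notMem_tsupport fun h' => hx (h.subset h')

lemma IsWeakDeriv.mono {Ω U} {a b} {u g} (h : IsWeakDeriv Ω a b u g)
    (hU : U ⊆ Ω) (hΩ : MeasurableSet Ω) : IsWeakDeriv U a b u g := by
  refine ⟨h.1.mono_set hU, h.2.1.mono_set hU, fun ψ h1 h2 h3 => ?_⟩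
  have hψ : IsTest U ψ := ⟨h1, h2, h3⟩
  have key : ∀ f χ : Fn, IsTest U χ → ∫ x in U, f x * χ x = ∫ x in Ω, f x * χ x :=
    fun f χ hχ => (setIntegral_eq_of_subset_of_forall_sdiff_eq_zero hΩ hU fun x hx => by
      rw [hχ.eq_zero hx.2, mul_zero]).symm
  rw [key u _ (hψ.mixedD a b), key g _ hψ]
  exact h.2.2 ψ h1 h2 (h3.trans hU)

lemma MemSobolev.mono {Ω U} {m} {q} {u}
    (h : MemSobolev Ω m q u) (hU : U ⊆ Ω) (hΩ : MeasurableSet Ω) : MemSobolev U m q u :=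
  fun a b hab => by
    obtain ⟨g, h1, h2⟩ := h a b hab
    exact ⟨g, h1.mono hU hΩ, h2.mono_measure (Measure.restrict_mono hU le_rfl)⟩

lemma MemSobolev.mono_exponent (hb : Bornology.IsBounded Ω) {m} {q q'}
    (hq : q' ≤ q) {u} (h : MemSobolev Ω m q u) : MemSobolev Ω m q' u :=
  fun a b hab => by
    obtain ⟨g, h1, h2⟩ := h a b hab
    have : IsFiniteMeasure (vol Ω) := ⟨by
      rw [Measure.restrict_apply_univ]; exact hb.measure_lt_top⟩
    exact ⟨g, h1, h2.mono_exponent hq⟩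

lemma QuadMesh.isBounded (M : QuadMesh Ω) : Bornology.IsBounded Ω := by
  refine Bornology.IsBounded.subset ?_ subset_closure
  rw [M.closure_eq]
  exact (Bornology.isBounded_biUnion_finset _).2 fun K _ => (isCompact_closedCell K).isBounded

section

variable (hΩ : IsOpen Ω) (M : QuadMesh Ω)

include hΩ in
/-- Local connectedness at the boundary makes the extensions to the elements agree. -/
theorem exists_tendsto_of_locallyConnectedAtBoundary (hl : LocallyConnectedAtBoundary Ω)
    {F} (hF : ContinuousOn F Ω) {g : (Quad) → Fn}
    (hg : ∀ K ∈ M.quads, ContinuousOn (g K) (closedCell K) ∧ EqOn (g K) F (cell K))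
    {x} (hx : x ∈ closure Ω) : ∃ y, Tendsto F (𝓝[Ω] x) (𝓝 y) := by
  by_cases hxΩ : x ∈ Ω
  · exact ⟨F x, hF x hxΩ⟩
  have hxf : x ∈ frontier Ω := ⟨hx, by rwa [hΩ.interior_eq]⟩
  have hagree : ∀ K ∈ M.quads, ∀ y ∈ Ω, y ∈ closedCell K → F y = g K y := by
    intro K hK y hy hyK
    have := nhdsWithin_cell_neBot (M.quad_convex K hK) hyK
    have h1 : Tendsto F (𝓝[cell K] y) (𝓝 (F y)) :=
      (hF y hy).mono_left (nhdsWithin_mono _ (M.cell_subset K hK))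
    have h2 : Tendsto (g K) (𝓝[cell K] y) (𝓝 (g K y)) :=
      ((hg K hK).1 y hyK).mono_left (nhdsWithin_mono _ interior_subset)
    refine tendsto_nhds_unique h1 (h2.congr' ?_)
    filter_upwards [self_mem_nhdsWithin] with z hz using (hg K hK).2 hz
  have hcov : ∀ y ∈ closure Ω, ∃ K ∈ M.quads, y ∈ closedCell K := fun y hy => by
    rw [M.closure_eq] at hy; simpa using hy
  obtain ⟨K₀, hK₀, hxK₀⟩ := hcov x hx
  set L := g K₀ x with hL
  refine ⟨L, Metric.tendsto_nhds.2 fun ε hε => ?_⟩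
  obtain ⟨c, hc, hcL⟩ : ∃ c ∈ Ioo 0 ε, ∀ K ∈ M.quads, |g K x - L| ≠ c := by
    obtain ⟨c, hc1, hc2⟩ := ((Ioo_infinite hε).sdiff
      ((M.quads.finite_toSet).image fun K => |g K x - L|)).nonempty
    exact ⟨c, hc1, fun K hK h => hc2 ⟨K, hK, h⟩⟩
  have hne : ∀ᶠ y in 𝓝 x, y ∈ Ω → |F y - L| ≠ c := by
    have : ∀ᶠ y in 𝓝 x, ∀ K ∈ M.quads, y ∈ closedCell K → |g K y - L| ≠ c := by
      rw [Filter.eventually_all_finset]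
      intro K hK
      by_cases hxK : x ∈ closedCell K
      · have h1 := (((hg K hK).1 x hxK).tendsto.sub_const L).abs
        exact eventually_nhdsWithin_iff.1 (h1.eventually_ne (hcL K hK))
      · filter_upwards [(isCompact_closedCell K).isClosed.isOpen_compl.mem_nhds hxK] with y hy hy'
        exact absurd hy' hy
    filter_upwards [this] with y hy hyΩ
    obtain ⟨K, hK, hyK⟩ := hcov y (subset_closure hyΩ)
    rw [hagree K hK y hyΩ hyK]
    exact hy K hK hyK
  obtain ⟨V, hV, hVU, hVp⟩ := hl x hxf _ hne
  obtain ⟨y₀, hy₀V, hy₀⟩ : ∃ y₀ ∈ V ∩ Ω, |F y₀ - L| < c := by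
    have := nhdsWithin_cell_neBot (M.quad_convex K₀ hK₀) hxK₀
    have h1 : Tendsto (g K₀) (𝓝[cell K₀] x) (𝓝 L) :=
      ((hg K₀ hK₀).1 x hxK₀).mono_left (nhdsWithin_mono _ interior_subset)
    obtain ⟨y, hy1, hy2, hy3⟩ := ((h1.eventually (Metric.ball_mem_nhds L hc.1)).and
      ((eventually_mem_set.2 (nhdsWithin_le_nhds hV)).and
        (eventually_mem_set.2 self_mem_nhdsWithin))).exists
    refine ⟨y, ⟨hy2, M.cell_subset K₀ hK₀ hy3⟩, ?_⟩
    rw [← (hg K₀ hK₀).2 hy3, ← Real.dist_eq]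
    exact hy1
  have hlt : ∀ y ∈ V ∩ Ω, |F y - L| < c := by
    intro y hy
    by_contra h
    push Not at h
    obtain ⟨z, hz, hzc⟩ := hVp.intermediate_value hy₀V hy
      (((hF.mono inter_subset_right).sub continuousOn_const).abs) ⟨hy₀.le, h⟩
    exact hVU hz.1 hz.2 hzc
  filter_upwards [nhdsWithin_le_nhds hV, self_mem_nhdsWithin] with y hy1 hy2
  rw [Real.dist_eq]
  exact (hlt y ⟨hy1, hy2⟩).trans hc.2

include hΩ M in
theorem exists_isC2Representative (hl : LocallyConnectedAtBoundary Ω) {m} (hm : 3 ≤ m)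
    {q} (hq2 : 2 ≤ q) (hqt : q ≠ ⊤) (hqm : 4 ≤ m ∨ 4 ≤ q) {φ}
    (hφ : MemSobolev Ω m q φ) : ∃ v, IsC2Representative Ω φ v := by
  have hloc : ∀ U, IsOpen U → U.Nonempty → Convex ℝ U → Bornology.IsBounded U → U ⊆ Ω →
      ∃ v, IsC2Representative U φ v := fun U h1 h2 h3 h4 h5 => by
    obtain ⟨d, hd⟩ := Metric.isBounded_iff.1 h4
    exact exists_c2Representative_of_convex h1 h2 h3 (fun x hx y hy => hd hx hy) hm hq2 hqt hqm
      (hφ.mono h5 hΩ.measurableSet)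
  choose! r hr hrΩ using fun x (hx : x ∈ Ω) => Metric.isOpen_iff.1 hΩ x hx
  choose! V hV using fun x (hx : x ∈ Ω) => hloc (ball x (r x)) Metric.isOpen_ball
    ⟨x, Metric.mem_ball_self (hr x hx)⟩ (convex_ball x _) Metric.isBounded_ball (hrΩ x hx)
  let w : Fn := fun x => V x x
  have hw : ∀ U, IsOpen U → U ⊆ Ω → ∀ u, IsC2Representative U φ u → EqOn w u U := by
    intro U hU hUΩ u hu x hx
    have hxr := hr x (hUΩ hx)
    have hB : IsOpen (ball x (r x) ∩ U) := Metric.isOpen_ball.inter hU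
    have h1 : V x =ᵐ[vol (ball x (r x) ∩ U)] φ :=
      ae_restrict_of_ae_restrict_of_subset inter_subset_left (hV x (hUΩ hx)).2
    have h2 : u =ᵐ[vol (ball x (r x) ∩ U)] φ :=
      ae_restrict_of_ae_restrict_of_subset inter_subset_right hu.2
    exact Measure.eqOn_open_of_ae_eq (h1.trans h2.symm) hB
      ((hV x (hUΩ hx)).1.1.continuousOn.mono inter_subset_left)
      (hu.1.1.continuousOn.mono inter_subset_right) ⟨Metric.mem_ball_self hxr, hx⟩
  have hball : ∀ x ∈ Ω, EqOn w (V x) (ball x (r x)) := fun x hx =>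
    hw _ Metric.isOpen_ball (hrΩ x hx) _ (hV x hx)
  have hw2 : ContDiffOn ℝ 2 w Ω := fun x hx => by
    have hm := Metric.ball_mem_nhds x (hr x hx)
    exact (((hV x hx).1.1.contDiffAt hm).congr_of_eventuallyEq
      ((hball x hx).eventuallyEq_of_mem hm)).contDiffWithinAt
  have hwc : ∀ a b, a + b ≤ 2 → ContinuousOn (mixedD a b w) Ω := fun a b hab x hx => by
    have hm := Metric.ball_mem_nhds x (hr x hx)
    obtain ⟨g, hg1, hg2⟩ := (hV x hx).1.2.2 a b hab
    refine (((hg1.mono subset_closure).continuousAt hm).congr ?_).continuousWithinAt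
    filter_upwards [hm] with y hy
    rw [hg2 hy, mixedD_eqOn Metric.isOpen_ball (hball x hx) a b hy]
  have hcell : ∀ K ∈ M.quads, ∃ u, IsC2Representative (cell K) φ u := fun K hK =>
    hloc _ (isOpen_cell K) (cell_nonempty (M.quad_convex K hK)) (convex_cell K)
      ((isCompact_closedCell K).isBounded.subset interior_subset) (M.cell_subset K hK)
  choose! u hu using hcell
  have hwu : ∀ K ∈ M.quads, EqOn w (u K) (cell K) := fun K hK =>
    hw _ (isOpen_cell K) (M.cell_subset K hK) _ (hu K hK)
  have hwφ : w =ᵐ[vol Ω] φ := by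
    have h1 : ∀ᵐ x : Plane, ∀ K ∈ M.quads, x ∈ cell K → u K x = φ x :=
      (ae_ball_iff M.quads.countable_toSet).2 fun K hK =>
        (ae_restrict_iff' (isOpen_cell K).measurableSet).1 (hu K hK).2
    filter_upwards [QuadMesh.ae_mem_cell (M := M) hΩ 1, ae_restrict_of_ae h1]
      with x ⟨K, hK, hxK, _⟩ hx
    rw [hwu K hK hxK, hx K hK hxK]
  have hlim : ∀ a b, a + b ≤ 2 → ∀ x ∈ closure Ω, ∃ y, Tendsto (mixedD a b w) (𝓝[Ω] x) (𝓝 y) := by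
    intro a b hab x hx
    have : ∀ K ∈ M.quads, ∃ g, ContinuousOn g (closedCell K) ∧
        EqOn g (mixedD a b w) (cell K) := fun K hK => by
      obtain ⟨g, hg1, hg2⟩ := (hu K hK).1.2.2 a b hab
      rw [closure_cell (M.quad_convex K hK)] at hg1
      exact ⟨g, hg1, hg2.trans (mixedD_eqOn (isOpen_cell K) (hwu K hK) a b).symm⟩
    choose! g hg using this
    exact exists_tendsto_of_locallyConnectedAtBoundary hΩ M hl (hwc a b hab) hg hx
  have hext : ∀ a b, a + b ≤ 2 → EqOn (extendFrom Ω (mixedD a b w)) (mixedD a b w) Ω :=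
    fun a b hab x hx => extendFrom_extends (hwc a b hab) x hx
  have h00 : EqOn (extendFrom Ω w) w Ω := hext 0 0 (by omega)
  refine ⟨extendFrom Ω w, ⟨hw2.congr h00, continuousOn_extendFrom le_rfl (hlim 0 0 (by omega)),
    fun a b hab => ⟨extendFrom Ω (mixedD a b w), continuousOn_extendFrom le_rfl (hlim a b hab),
      (hext a b hab).trans (mixedD_eqOn hΩ h00 a b).symm⟩⟩, ?_⟩
  filter_upwards [hwφ, ae_restrict_mem hΩ.measurableSet] with x hx1 hx2
  rw [h00 hx2, hx1]

end

/-! ### Shape regularity -/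

lemma abs_cross_eq (v w) :
    |cross v w| = sin (InnerProductGeometry.angle v w) * (‖v‖ * ‖w‖) := by
  rw [InnerProductGeometry.sin_angle_mul_norm_mul_norm, ← Real.sqrt_sq_eq_abs]
  congr 1
  rw [real_inner_self_eq_norm_sq, real_inner_self_eq_norm_sq, norm_sq_eq,
    norm_sq_eq]
  simp [cross, PiLp.inner_apply, Fin.sum_univ_two]; ring

lemma sin_le_sin_of_le_of_le_pi_sub {ρ θ} (h0 : 0 < ρ) (h1 : ρ ≤ θ) (h2 : θ ≤ Real.pi - ρ) :
    sin ρ ≤ sin θ := by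
  rcases le_total θ (Real.pi / 2) with h | h
  · exact Real.sin_le_sin_of_le_of_le_pi_div_two (by linarith) h h1
  · rw [← Real.sin_pi_sub θ]
    exact Real.sin_le_sin_of_le_of_le_pi_div_two (by linarith) (by linarith) (by linarith)

/-- In a triangle with angles at least `ρ`, the sides are comparable. -/
lemma triangle_regular {x y z} {ρ} (hρ : 0 < ρ) (h : ρ ≤ triangleMinAngle x y z)
    (hxy : x ≠ y) (hzx : z ≠ x) :
    sin ρ * dist x y ≤ dist y z ∧
    sin ρ * (dist x y * dist y z) ≤ |cross (x - y) (z - y)| := by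
  simp only [triangleMinAngle, le_min_iff] at h
  obtain ⟨h1, h2, h3⟩ := h
  have hsum := EuclideanGeometry.angle_add_angle_add_angle_eq_pi z hxy
  have c1 := EuclideanGeometry.angle_comm y z x
  have c2 := EuclideanGeometry.angle_comm z x y
  have c3 := EuclideanGeometry.angle_comm x y z
  have s1 := sin_le_sin_of_le_of_le_pi_sub hρ h1 (by linarith)
  have s3 := sin_le_sin_of_le_of_le_pi_sub hρ h3 (by linarith)
  have e1 := abs_cross_eq (x - y) (z - y)
  have e3 := abs_cross_eq (z - x) (y - x)
  have e : |cross (z - x) (y - x)| = |cross (x - y) (z - y)| := by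
    congr 1; simp [cross]; ring
  have b2 := abs_cross_le (y - z) (x - z)
  have e' : |cross (y - z) (x - z)| = |cross (x - y) (z - y)| := by
    congr 1; simp [cross]; ring
  rw [e] at e3
  rw [e', ← dist_eq_norm, ← dist_eq_norm, dist_comm x z] at b2
  rw [← dist_eq_norm, ← dist_eq_norm, dist_comm z y] at e1
  rw [← dist_eq_norm, ← dist_eq_norm, dist_comm y x] at e3
  have d1 := dist_pos.2 hzx
  change |_| = sin (EuclideanGeometry.angle x y z) * _ at e1
  change |_| = sin (EuclideanGeometry.angle z x y) * _ at e3
  constructor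
  · have : sin ρ * (dist z x * dist x y) ≤ dist y z * dist z x := by
      refine le_trans ?_ b2
      rw [e3]; gcongr
    refine le_of_mul_le_mul_right ?_ d1
    linarith
  · rw [e1]; gcongr

lemma fin_four_cases (i j : Fin 4) : i = j ∨ i = j + 1 ∨ i = j + 2 ∨ i = j + 3 := by
  decide +revert

/-- A bound from below for the corner determinants in terms of the minimum angle. -/
theorem le_corner_of_minAngle (hK : ConvexQuad K) {ρ : ℝ} (hρ : 0 < ρ)
    (h : ρ ≤ minAngle K) : 0 < sin ρ ∧ ∀ i, sin ρ ^ 7 * longestSide K ^ 2 ≤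
      cross (K (i + 1) - K i) (K (i + 3) - K i) := by
  have hT : ∀ i, ρ ≤ triangleMinAngle (K i) (K (i + 1)) (K (i + 2)) := fun i =>
    h.trans (ciInf_le (Set.finite_range _).bddBelow i)
  have hne : ∀ i, K (i + 2) ≠ K i := fun i e => by
    have := hK i
    rw [e, cross] at this
    simp only [PiLp.sub_apply] at this
    linarith
  have hσ : 0 < sin ρ := by
    have := hT 0
    simp only [triangleMinAngle, le_min_iff] at this
    have e := EuclideanGeometry.angle_add_angle_add_angle_eq_pi (K (0 + 2)) (hK.ne 0)
    have c1 := EuclideanGeometry.angle_comm (K (0 + 1)) (K (0 + 2)) (K 0)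
    have c2 := EuclideanGeometry.angle_comm (K (0 + 2)) (K 0) (K (0 + 1))
    have c3 := EuclideanGeometry.angle_comm (K 0) (K (0 + 1)) (K (0 + 2))
    exact Real.sin_pos_of_pos_of_lt_pi hρ (by linarith)
  have hσ1 := Real.sin_le_one ρ
  set σ := sin ρ
  have hr := fun i => triangle_regular hρ (hT i) (hK.ne i) (hne i)
  set S : Fin 4 → ℝ := fun i => dist (K i) (K (i + 1)) with hS
  have hS0 : ∀ i, 0 ≤ S i := fun i => dist_nonneg
  have hstep : ∀ i, σ * S i ≤ S (i + 1) := fun i => by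
    have := (hr i).1
    simp only [hS, add_assoc]; exact this
  have hstep2 : ∀ j, σ ^ 2 * S j ≤ S (j + 2) := fun j => by
    have a1 := mul_le_mul_of_nonneg_left (hstep j) hσ.le
    have a2 := hstep (j + 1)
    rw [add_assoc] at a2
    calc _ = σ * (σ * S j) := by ring
      _ ≤ _ := a1.trans a2
  have hall : ∀ i j, σ ^ 3 * S j ≤ S i := by
    intro i j
    have a0 := hS0 j
    have e1 : σ ^ 3 * S j ≤ σ ^ 2 * S j := by
      gcongr ?_ * _; exact pow_le_pow_of_le_one hσ.le hσ1 (by norm_num)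
    have e2 : σ ^ 2 * S j ≤ σ * S j := by
      gcongr ?_ * _; nlinarith
    have e3 : σ * S j ≤ S j := mul_le_of_le_one_left a0 hσ1
    rcases fin_four_cases i j with rfl | rfl | rfl | rfl
    · linarith
    · linarith [hstep j]
    · linarith [hstep2 j]
    · have a1 := mul_le_mul_of_nonneg_left (hstep2 j) hσ.le
      have a2 := hstep (j + 2)
      rw [add_assoc] at a2
      calc _ = σ * (σ ^ 2 * S j) := by ring
        _ ≤ _ := a1.trans a2
  have hL : ∀ i, σ ^ 3 * longestSide K ≤ S i := fun i => by
    rw [mul_comm, ← le_div_iff₀ (by positivity)]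
    refine ciSup_le fun j => ?_
    rw [le_div_iff₀ (by positivity), mul_comm]
    exact hall i j
  have hL0 : 0 ≤ longestSide K := (hS0 0).trans (dist_le_longestSide K 0)
  refine ⟨hσ, fun i => ?_⟩
  have h3 : i + 3 + 1 = i := by fin_cases i <;> rfl
  have h4 : i + 3 + 2 = i + 1 := by fin_cases i <;> rfl
  have := (hr (i + 3)).2
  have e : |cross (K (i + 3) - K i) (K (i + 1) - K i)| = cross (K (i + 1) - K i) (K (i + 3) - K i) := by
    rw [cross_swap, abs_neg, abs_of_pos (hK.corner_pos i)]
  rw [h3, h4, e] at this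
  refine le_trans ?_ this
  have a1 := hL (i + 3)
  simp only [hS, h3] at a1
  calc _ = σ * ((σ ^ 3 * longestSide K) * (σ ^ 3 * longestSide K)) := by ring
    _ ≤ _ := by
      gcongr
      exact hL i

lemma dist_le_two_mul_of_mem {x y}
    (hx : x ∈ closedCell K) (hy : y ∈ closedCell K) : dist x y ≤ 2 * longestSide K := by
  have hd : ∀ i j, dist (K i) (K j) ≤ 2 * longestSide K := fun i j => by
    have h0 : 0 ≤ longestSide K := dist_nonneg.trans (dist_le_longestSide K 0)
    have hd : j = i ∨ j = i + 1 ∨ j = i + 1 + 1 ∨ i = j + 1 := by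
      clear h0; revert i j; decide
    rcases hd with rfl | rfl | rfl | rfl
    · simp [h0]
    · linarith [dist_le_longestSide K i]
    · linarith [dist_triangle (K i) (K (i + 1)) (K (i + 1 + 1)), dist_le_longestSide K i,
        dist_le_longestSide K (i + 1)]
    · rw [dist_comm]; linarith [dist_le_longestSide K j]
  obtain ⟨a, ⟨i, rfl⟩, b, ⟨j, rfl⟩, h⟩ := convexHull_exists_dist_ge2 hx hy
  exact h.trans (hd i j)

/-! ### Stability of the interpolation -/

lemma Spline.exists_bound {d r k} {f} (hf : Spline d r k f) (hk : 0 < k) (l) :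
    ∃ C, ∀ s ∈ I, l ≤ r ∨ NotKnot k s → |iteratedDeriv l f s| ≤ C := by
  have hp : ∀ i < k, ∃ C, ∀ s ∈ knotIcc k i, l ≤ r ∨ NotKnot k s →
      |iteratedDeriv l f s| ≤ C := by
    intro i hi
    obtain ⟨P, -, hP⟩ := hf.2.1 i hi
    obtain ⟨C, hC⟩ := (isCompact_Icc (a := (i : ℝ) / k) (b := (i + 1 : ℝ) / k)).exists_bound_of_continuousOn
      (f := fun s => (derivative^[l] P).eval s) (by fun_prop)
    refine ⟨C, fun s hs h => ?_⟩
    rw [iteratedDeriv_eq_of_piece (piece_lt hi) hs (hf.contDiffAt h) le_rfl hP]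
    exact hC s hs
  choose! C hC using hp
  refine ⟨∑ i ∈ Finset.range k, |C i|, fun s hs h => ?_⟩
  obtain ⟨i, hi, hsi⟩ := exists_piece hk hs
  exact ((hC i hi s hsi h).trans (le_abs_self _)).trans
    (Finset.single_le_sum (f := fun i => |C i|) (fun _ _ => abs_nonneg _) (Finset.mem_range.2 hi))

lemma abs_sum_mul_le {ι : Type*} [Fintype ι] {c X C : ι → ℝ} {A : ℝ} (hc : ∀ j, |c j| ≤ A)
    (hX : ∀ j, |X j| ≤ C j) : |∑ j, c j * X j| ≤ (∑ j, C j) * A := by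
  rw [sum_mul]
  refine (Finset.abs_sum_le_sum_abs _ _).trans (sum_le_sum fun j _ => ?_)
  rw [abs_mul, mul_comm]
  exact mul_le_mul (hX j) (hc j) (abs_nonneg _) ((abs_nonneg _).trans (hX j))

/-- The data are bounded by `B`, with respect to the length scale `L`. -/
structure CellData.IsBounded (p : ℕ) (D : CellData) (L B : ℝ) : Prop where
  jet : ∀ i a b, a + b ≤ 2 → |D.1 i a b| * L ^ (a + b) ≤ B
  value : ∀ i, ∀ η ∈ edgeValueParams p, |D.2.1 i η| ≤ B
  normal : ∀ i, ∀ η ∈ edgeNormalParams p, |D.2.2.1 i η| * L ≤ B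
  face : ∀ ξ ∈ faceParams p, ∀ η ∈ faceParams p, |D.2.2.2 ξ η| ≤ B

/-- The sides of `K` have lengths between `κ L` and `L`. -/
def HasSides (K : Quad) (κ L : ℝ) : Prop :=
  ∀ i, κ * L ≤ dist (K i) (K (i + 1)) ∧ dist (K i) (K (i + 1)) ≤ L

variable {D : CellData} {L B κ : ℝ}

lemma CellData.IsBounded.rot (h : D.IsBounded p L B) (i) : (D.rot i).IsBounded p L B :=
  ⟨fun j => h.jet (j + i), fun j => h.value (j + i), fun j => h.normal (j + i), h.face⟩

lemma HasSides.rot (h : HasSides K κ L) (i) : HasSides (rot i K) κ L := fun j => by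
  have := h (j + i)
  rwa [add_right_comm] at this

lemma CellData.IsBounded.jet_zero (h : D.IsBounded p L B) (i) : |D.1 i 0 0| ≤ B := by
  simpa using h.jet i 0 0 (by omega)

lemma CellData.IsBounded.nonneg (h : D.IsBounded p L B) : 0 ≤ B :=
  (abs_nonneg _).trans (h.jet_zero 0)

lemma CellData.IsBounded.grad_mul_le (hL : 0 < L) (h : D.IsBounded p L B) (i) (z) :
    |D.grad i z| * L ≤ 2 * B * ‖z‖ := by
  have h1 := h.jet i 1 0 (by omega)
  have h2 := h.jet i 0 1 (by omega)
  simp only [add_zero, zero_add, pow_one] at h1 h2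
  calc |D.grad i z| * L ≤ (|D.1 i 1 0| * |z 0| + |D.1 i 0 1| * |z 1|) * L := by
        gcongr; rw [← abs_mul, ← abs_mul]; exact abs_add_le _ _
    _ = (|D.1 i 1 0| * L) * |z 0| + (|D.1 i 0 1| * L) * |z 1| := by ring
    _ ≤ B * ‖z‖ + B * ‖z‖ := by
      have := h.nonneg
      gcongr <;> exact abs_coord_le z _
    _ = _ := by ring

lemma CellData.IsBounded.hess_mul_le (hL : 0 < L) (h : D.IsBounded p L B) (i)
    (z z') : |D.hess i z z'| * L ^ 2 ≤ 4 * B * (‖z‖ * ‖z'‖) := by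
  have h1 := h.jet i 2 0 (by omega)
  have h2 := h.jet i 1 1 (by omega)
  have h3 := h.jet i 0 2 (by omega)
  simp only [add_zero, zero_add, Nat.reduceAdd] at h1 h2 h3
  have hc : ∀ j k, |z j| * |z' k| ≤ ‖z‖ * ‖z'‖ := fun j k => by
    gcongr <;> exact abs_coord_le _ _
  have hB := h.nonneg
  have e1 : |D.hess i z z'| ≤ |D.1 i 2 0| * (|z 0| * |z' 0|) +
      |D.1 i 1 1| * (|z 0| * |z' 1| + |z 1| * |z' 0|) + |D.1 i 0 2| * (|z 1| * |z' 1|) := by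
    refine (abs_add_le _ _).trans (add_le_add ((abs_add_le _ _).trans (add_le_add ?_ ?_)) ?_)
    · rw [abs_mul, abs_mul]
    · rw [abs_mul, ← abs_mul (z 0), ← abs_mul (z 1)]
      gcongr; exact abs_add_le _ _
    · rw [abs_mul, abs_mul]
  calc |D.hess i z z'| * L ^ 2 ≤ _ := mul_le_mul_of_nonneg_right e1 (by positivity)
    _ = (|D.1 i 2 0| * L ^ 2) * (|z 0| * |z' 0|) +
      (|D.1 i 1 1| * L ^ 2) * (|z 0| * |z' 1| + |z 1| * |z' 0|)
        + (|D.1 i 0 2| * L ^ 2) * (|z 1| * |z' 1|) := by ring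
    _ ≤ B * (‖z‖ * ‖z'‖) + B * (‖z‖ * ‖z'‖ + ‖z‖ * ‖z'‖) + B * (‖z‖ * ‖z'‖) := by
      gcongr ?_ * ?_ + ?_ * (?_ + ?_) + ?_ * ?_ <;> first | assumption | exact hc _ _
    _ = _ := by ring

lemma CellData.IsBounded.grad_le (hL : 0 < L) (h : D.IsBounded p L B) (i) {z}
    {c : ℝ} (hz : ‖z‖ ≤ c * L) : |D.grad i z| ≤ 2 * c * B := by
  refine le_of_mul_le_mul_right ((h.grad_mul_le hL i z).trans ?_) hL
  calc 2 * B * ‖z‖ ≤ 2 * B * (c * L) := by have := h.nonneg; gcongr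
    _ = _ := by ring

lemma CellData.IsBounded.hess_le (hL : 0 < L) (h : D.IsBounded p L B) (i) {z z'}
    (hz : ‖z‖ ≤ L) (hz' : ‖z'‖ ≤ L) : |D.hess i z z'| ≤ 4 * B := by
  refine le_of_mul_le_mul_right ((h.hess_mul_le hL i z z').trans ?_) (pow_pos hL 2)
  calc 4 * B * (‖z‖ * ‖z'‖) ≤ 4 * B * (L * L) := by have := h.nonneg; gcongr
    _ = _ := by ring

lemma norm_unitNormal_le (x y) : ‖unitNormal x y‖ ≤ 1 := by
  rw [unitNormal, norm_smul, norm_inv, Real.norm_of_nonneg dist_nonneg]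
  refine inv_mul_le_one_of_le₀ (le_of_eq ?_) dist_nonneg
  rw [dist_comm, dist_eq_norm, EuclideanSpace.norm_eq, EuclideanSpace.norm_eq]
  congr 1
  simp [Fin.sum_univ_two]; ring

lemma abs_dot_le (v w) : |dot v w| ≤ ‖v‖ * ‖w‖ := by
  have := abs_real_inner_le_norm v w
  simpa [dot, PiLp.inner_apply, Fin.sum_univ_two, mul_comm] using this

lemma exists_traceFn_bound (hp : 3 ≤ p) : ∃ M : ℝ, 0 ≤ M ∧ ∀ (K : Quad) (D : CellData)
    (L B κ : ℝ), 0 < L → HasSides K κ L → D.IsBounded p L B → ∀ τ ∈ I,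
      |traceFn p K D τ| ≤ M * B ∧ |deriv (traceFn p K D) τ| ≤ M * B ∧
      |normalFn p K D τ| * L ≤ M * B := by
  choose C0 hC0 using fun j => ((traceBasis_spec hp).1 j).exists_bound (subdiv_pos p) 0
  choose C1 hC1 using fun j => ((traceBasis_spec hp).1 j).exists_bound (subdiv_pos p) 1
  choose C2 hC2 using fun j => ((normalBasis_spec hp).1 j).exists_bound (subdiv_pos p) 0
  refine ⟨4 * (|∑ j, C0 j| + |∑ j, C1 j| + |∑ j, C2 j|), by positivity,
    fun K D L B κ hL hK hD τ hτ => ?_⟩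
  have hB := hD.nonneg
  have hk : ‖K 1 - K 0‖ ≤ L := by rw [← dist_eq_norm, dist_comm]; exact (hK 0).2
  have hT : ∀ j, |traceCoef p K D j| ≤ 4 * B := by
    rintro (⟨b, l⟩ | η)
    · fin_cases l
      · exact (hD.jet_zero _).trans (by linarith)
      · exact (hD.grad_le hL _ (c := 1) (by simpa using hk)).trans (by linarith)
      · exact hD.hess_le hL _ hk hk
    · exact (hD.value 0 η η.2).trans (by linarith)
  have hn := norm_unitNormal_le (K 0) (K 1)
  have hN : ∀ j, |normalCoef p K D j * L| ≤ 4 * B := by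
    intro j
    rw [abs_mul, abs_of_pos hL]
    rcases j with ⟨b, l⟩ | η
    · fin_cases l
      · refine (hD.grad_mul_le hL _ _).trans ?_
        calc 2 * B * ‖unitNormal (K 0) (K 1)‖ ≤ 2 * B * 1 := by gcongr
          _ ≤ _ := by linarith
      · refine le_of_mul_le_mul_right ?_ hL
        have := hD.hess_mul_le hL (sideCorner b) (K 1 - K 0) (unitNormal (K 0) (K 1))
        calc _ = |D.hess (sideCorner b) (K 1 - K 0) (unitNormal (K 0) (K 1))| * L ^ 2 := by
              simp [normalCoef]; ring
          _ ≤ _ := this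
          _ ≤ 4 * B * (L * 1) := by gcongr
          _ = _ := by ring
    · exact (hD.normal 0 η η.2).trans (by linarith)
  have hd : deriv (traceFn p K D) τ = ∑ j, traceCoef p K D j * iteratedDeriv 1 (traceBasis p j) τ := by
    simp only [iteratedDeriv_one]
    have hj : ∀ j ∈ Finset.univ, DifferentiableAt ℝ (fun τ => traceCoef p K D j * traceBasis p j τ) τ :=
      fun j _ => ((((traceBasis_spec hp).1 j).1.differentiable (by norm_cast; omega)) τ).const_mul _
    unfold traceFn
    rw [deriv_fun_sum hj]
    exact sum_congr rfl fun j _ => deriv_const_mul_field _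
  have b0 := abs_sum_mul_le hT fun j => hC0 j τ hτ (.inl (by omega))
  have b1 := abs_sum_mul_le hT fun j => hC1 j τ hτ (.inl (by omega))
  have b2 := abs_sum_mul_le hN fun j => hC2 j τ hτ (.inl (by omega))
  simp only [iteratedDeriv_zero] at b0 b2
  have e2 : |normalFn p K D τ| * L = |∑ j, normalCoef p K D j * L * normalBasis p j τ| := by
    rw [← abs_of_pos hL, ← abs_mul, normalFn, sum_mul, abs_of_pos hL]
    congr 1; exact sum_congr rfl fun j _ => by ring
  have n0 := mul_le_mul_of_nonneg_right (le_abs_self (∑ j, C0 j)) hB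
  have n1 := mul_le_mul_of_nonneg_right (le_abs_self (∑ j, C1 j)) hB
  have n2 := mul_le_mul_of_nonneg_right (le_abs_self (∑ j, C2 j)) hB
  have p0 := mul_nonneg (abs_nonneg (∑ j, C0 j)) hB
  have p1 := mul_nonneg (abs_nonneg (∑ j, C1 j)) hB
  have p2 := mul_nonneg (abs_nonneg (∑ j, C2 j)) hB
  rw [hd, e2]
  exact ⟨b0.trans (by linarith), b1.trans (by linarith), b2.trans (by linarith)⟩

lemma norm_twist_le (h : ∀ i, dist (K i) (K (i + 1)) ≤ L) : ‖twist K‖ ≤ 2 * L := by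
  have e : twist K = tanS K 1 - tanS K 0 := by simp [twist, tanS]; abel
  rw [e]
  have h1 := norm_tanS_le h (t := 1) (by simp)
  have h0 := norm_tanS_le h (t := 0) (by simp)
  linarith [norm_sub_le (tanS K 1) (tanS K 0)]

lemma exists_tensorCoef_bound (hp : 3 ≤ p) (hκ : 0 < κ) : ∃ M : ℝ, 0 ≤ M ∧
    ∀ (K : Quad) (D : CellData) (L B : ℝ), 0 < L → HasSides K κ L →
      D.IsBounded p L B → ∀ i j, |tensorCoef p K D i j| ≤ M * B := by
  obtain ⟨M, hM, h⟩ := exists_traceFn_bound hp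
  have hcross : ∀ (K : Quad) (D : CellData) (L B : ℝ), 0 < L → HasSides K κ L →
      D.IsBounded p L B → ∀ τ ∈ I, |crossFn p K D τ| ≤ (1 + 1 / κ) * M * B := by
    intro K D L B hL hK hD τ hτ
    obtain ⟨-, h1, h2⟩ := h K D L B κ hL hK hD τ hτ
    have hB := hD.nonneg
    have hT := norm_tanT_le (fun i => (hK i).2) hτ
    have hd : 0 < dist (K 0) (K 1) := (mul_pos hκ hL).trans_le (hK 0).1
    have e : ‖K 1 - K 0‖ = dist (K 0) (K 1) := by rw [dist_comm, dist_eq_norm]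
    have c1 : |cross (K 1 - K 0) (tanT K τ) / dist (K 0) (K 1)| ≤ L := by
      rw [abs_div, abs_of_pos hd, div_le_iff₀ hd, mul_comm]
      refine (abs_cross_le _ _).trans ?_
      rw [e]; gcongr
    have c2 : |dot (K 1 - K 0) (tanT K τ) / dist (K 0) (K 1) ^ 2| ≤ 1 / κ := by
      rw [abs_div, abs_of_pos (pow_pos hd 2), div_le_div_iff₀ (pow_pos hd 2) hκ, one_mul]
      calc |dot (K 1 - K 0) (tanT K τ)| * κ ≤ dist (K 0) (K 1) * L * κ := by
            gcongr; refine (abs_dot_le _ _).trans ?_; rw [e]; gcongr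
        _ = dist (K 0) (K 1) * (κ * L) := by ring
        _ ≤ dist (K 0) (K 1) * dist (K 0) (K 1) := by gcongr; exact (hK 0).1
        _ = _ := by ring
    rw [crossFn]
    refine (abs_add_le _ _).trans ?_
    rw [abs_mul, abs_mul]
    calc _ ≤ L * |normalFn p K D τ| + 1 / κ * (M * B) := by gcongr
      _ ≤ M * B + 1 / κ * (M * B) := by linarith
      _ = _ := by ring
  refine ⟨8 + (1 + 1 / κ) * M + M, by positivity, fun K D L B hL hK hD i j => ?_⟩
  have hB := hD.nonneg
  have hMB := mul_nonneg hM hB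
  have hMk : 0 ≤ (1 + 1 / κ) * M * B := by positivity
  have hE1 : 8 * B ≤ (8 + (1 + 1 / κ) * M + M) * B := by linarith
  have hE2 : M * B ≤ (8 + (1 + 1 / κ) * M + M) * B := by linarith
  have hE3 : (1 + 1 / κ) * M * B ≤ (8 + (1 + 1 / κ) * M + M) * B := by linarith
  generalize (8 + (1 + 1 / κ) * M + M) * B = E at *
  have hd := fun i => (hK i).2
  have hTn := fun b => norm_tanT_le hd (natCast_fin_two_mem b)
  have hSn := fun b => norm_tanS_le hd (natCast_fin_two_mem b)
  have ht := fun i τ hτ => (h (rot i K) (D.rot i) L B κ hL (hK.rot i) (hD.rot i) τ hτ).1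
  have hc := fun i τ hτ => hcross (rot i K) (D.rot i) L B hL (hK.rot i) (hD.rot i) τ hτ
  have ht0 := fun τ hτ => (h K D L B κ hL hK hD τ hτ).1
  have hc0 := fun τ hτ => hcross K D L B hL hK hD τ hτ
  have hf : ∀ η : faceParams p, (η : ℝ) ∈ I ∧ 1 - (η : ℝ) ∈ I := fun η => by
    have := faceParams_mem η.2
    exact ⟨⟨this.1.le, this.2.le⟩, ⟨by linarith [this.2], by linarith [this.1]⟩⟩
  rcases i with ⟨b, l⟩ | ξ <;> rcases j with ⟨b', l'⟩ | η
  · have k0 := hD.jet_zero (cornerIdx b b')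
    have k1 := hD.grad_le hL (cornerIdx b b') (c := 1) (by simpa using hTn b)
    have k2 := hD.grad_le hL (cornerIdx b b') (c := 1) (by simpa using hSn b')
    have k3 := hD.grad_le hL (cornerIdx b b') (norm_twist_le hd)
    have k4 := hD.hess_le hL (cornerIdx b b') (hSn b') (hTn b)
    fin_cases l <;> fin_cases l' <;> simp [tensorCoef]
    · linarith
    · linarith
    · linarith
    · exact (abs_add_le _ _).trans (by linarith)
  · fin_cases b <;> fin_cases l <;> simp [tensorCoef]
    · linarith [ht 3 _ (hf η).2]
    · linarith [hc 3 _ (hf η).2]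
    · linarith [ht 1 _ (hf η).1]
    · linarith [hc 1 _ (hf η).1]
  · fin_cases b' <;> fin_cases l' <;> simp [tensorCoef]
    · linarith [ht0 _ (hf ξ).1]
    · linarith [hc0 _ (hf ξ).1]
    · linarith [ht 2 _ (hf ξ).2]
    · linarith [hc 2 _ (hf ξ).2]
  · have := hD.face ξ ξ.2 η η.2
    simp only [tensorCoef]; linarith

section

variable {κ : ℝ}

lemma exists_interpD_bound (hp : 3 ≤ p) (hκ : 0 < κ) : ∃ N : ℝ, 0 ≤ N ∧
    ∀ (K : Quad) (D : CellData) (L B : ℝ), 0 < L → HasSides K κ L → D.IsBounded p L B →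
      ∀ l l', l ≤ 2 → l' ≤ 2 → ∀ s ∈ I, ∀ t ∈ I,
        NotKnot (subdiv p) s → NotKnot (subdiv p) t → |interpD p K D l l' s t| ≤ N * B := by
  obtain ⟨M, hM, h⟩ := exists_tensorCoef_bound hp hκ
  choose C hC using fun j (l : Fin 3) =>
    ((crossBasis_spec hp).1 j).exists_bound (subdiv_pos p) l
  set S := ∑ j, ∑ l, |C j l| with hS
  have hS0 : 0 ≤ S := Finset.sum_nonneg fun _ _ => Finset.sum_nonneg fun _ _ => abs_nonneg _
  have hb : ∀ l ≤ 2, ∀ s ∈ I, NotKnot (subdiv p) s → ∀ j,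
      |iteratedDeriv l (crossBasis p j) s| ≤ ∑ l, |C j l| := fun l hl s hs hk j =>
    ((hC j ⟨l, by omega⟩ s hs (.inr hk)).trans (le_abs_self _)).trans
      (Finset.single_le_sum (f := fun l => |C j l|) (fun _ _ => abs_nonneg _) (Finset.mem_univ _))
  refine ⟨S * (S * M), by positivity, fun K D L B hL hK hD l l' hl hl' s hs t ht hs' ht' => ?_⟩
  have hc := h K D L B hL hK hD
  rw [interpD, mul_assoc, mul_assoc]
  have e : ∀ i, ∑ j, tensorCoef p K D i j * iteratedDeriv l (crossBasis p i) s *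
      iteratedDeriv l' (crossBasis p j) t = (∑ j, tensorCoef p K D i j *
        iteratedDeriv l' (crossBasis p j) t) * iteratedDeriv l (crossBasis p i) s := fun i => by
    rw [sum_mul]; exact sum_congr rfl fun j _ => by ring
  simp only [e]
  exact abs_sum_mul_le (fun i => abs_sum_mul_le (hc i) (hb l' hl' t ht ht')) (hb l hl s hs hs')

lemma abs_second_order_le {a a' b b' x y z g r E G : ℝ} (ha : |a| ≤ r) (ha' : |a'| ≤ r)
    (hb : |b| ≤ r) (hb' : |b'| ≤ r) (hx : |x| ≤ E) (hy : |y| ≤ E) (hz : |z| ≤ E) (hg : |g| ≤ G) :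
    |a * a' * x + (a * b' + b * a') * (y - g) + b * b' * z| ≤ r ^ 2 * (4 * E + 2 * G) := by
  have hr : 0 ≤ r := (abs_nonneg _).trans ha
  have hm : ∀ {u v w W : ℝ}, |u| ≤ r → |v| ≤ r → |w| ≤ W → |u * v * w| ≤ r * r * W :=
    fun hu hv hw => by
      rw [abs_mul, abs_mul]
      exact mul_le_mul (mul_le_mul hu hv (abs_nonneg _) hr) hw (abs_nonneg _) (by positivity)
  have hyg : |y - g| ≤ E + G := (abs_sub _ _).trans (add_le_add hy hg)
  have e : a * a' * x + (a * b' + b * a') * (y - g) + b * b' * z =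
      a * a' * x + (a * b' * (y - g) + b * a' * (y - g)) + b * b' * z := by ring
  rw [e]
  refine (abs_add_le _ _).trans ((add_le_add ((abs_add_le _ _).trans (add_le_add (hm ha ha' hx)
    ((abs_add_le _ _).trans (add_le_add (hm ha hb' hyg) (hm hb ha' hyg))))) (hm hb hb' hz)).trans
    (le_of_eq ?_))
  ring

/-- Stability of the interpolation on shape regular elements. -/
theorem exists_isInterp_bound (hp : 3 ≤ p) (hκ : 0 < κ) : ∃ C : ℝ, 0 ≤ C ∧
    ∀ (K : Quad) (D : CellData) (L B : ℝ) (u : Fn), ConvexQuad K → 0 < L →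
      (∀ i, dist (K i) (K (i + 1)) ≤ L) →
      (∀ i, κ * L ^ 2 ≤ cross (K (i + 1) - K i) (K (i + 3) - K i)) → D.IsBounded p L B →
      IsInterp p K D u → ∀ x ∈ cell K, NotKnot (subdiv p) (paramInv K x).1 →
        NotKnot (subdiv p) (paramInv K x).2 → ∀ a b, a + b ≤ 2 →
          |mixedD a b u x| * L ^ (a + b) ≤ C * B := by
  obtain ⟨N, hN, h⟩ := exists_interpD_bound hp hκ
  refine ⟨N * (1 + 2 / κ + (4 + 8 / κ) / κ ^ 2), by positivity,
    fun K D L B u hK hL hd hj hD hu x hx hs' ht' a b hab => ?_⟩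
  have hsides : HasSides K κ L := fun i => ⟨by
    have h3 : i + 3 + 1 = i := by fin_cases i <;> rfl
    have e1 := (hj i).trans ((le_abs_self _).trans (abs_cross_le _ _))
    have e2 := hd (i + 3)
    rw [h3, dist_eq_norm] at e2
    rw [dist_comm, dist_eq_norm]
    refine le_of_mul_le_mul_right ?_ hL
    calc κ * L * L = κ * L ^ 2 := by ring
      _ ≤ _ := e1
      _ ≤ _ := by gcongr, hd i⟩
  have hxc := interior_subset hx
  have hm := paramInv_mem hK hxc
  have hst := boundary_notMem_cell hK hm.1 hm.2 (by rwa [param_paramInv hK hxc])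
  have hI := fun l l' hl hl' =>
    h K D L B hL hsides hD l l' hl hl' _ hm.1 _ hm.2 hs' ht'
  rw [← param_paramInv hK hxc]
  set s := (paramInv K x).1
  set t := (paramInv K x).2
  have hB := hD.nonneg
  have hNB := mul_nonneg hN hB
  have hjac : κ * L ^ 2 ≤ jac K s t := le_jac hj hm.1 hm.2
  have hj0 : 0 < jac K s t := (by positivity : 0 < κ * L ^ 2).trans_le hjac
  have hT := norm_tanT_le hd hm.1
  have hS := norm_tanS_le hd hm.2
  set r := 1 / (κ * L) with hr
  have hr0 : 0 < r := by positivity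
  have hq : ∀ w Z, |w| ≤ Z * L → |w / jac K s t| ≤ r * Z := fun w Z hw => by
    have hZ : 0 ≤ Z := nonneg_of_mul_nonneg_left ((abs_nonneg _).trans hw) hL
    rw [abs_div, abs_of_pos hj0, div_le_iff₀ hj0]
    calc |w| ≤ Z * L := hw
      _ = r * Z * (κ * L ^ 2) := by rw [hr]; field_simp
      _ ≤ _ := by gcongr
  have hα : ∀ z Z, ‖z‖ ≤ Z → |cross z (tanT K s) / jac K s t| ≤ r * Z := fun z Z hz =>
    hq _ _ ((abs_cross_le _ _).trans
      (mul_le_mul hz hT (norm_nonneg _) ((norm_nonneg _).trans hz)))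
  have hβ : ∀ z Z, ‖z‖ ≤ Z → |cross (tanS K t) z / jac K s t| ≤ r * Z := fun z Z hz =>
    hq _ _ ((abs_cross_le _ _).trans (by
      rw [mul_comm]; exact mul_le_mul hz hS (norm_nonneg _) ((norm_nonneg _).trans hz)))
  have hg : ∀ z Z, ‖z‖ ≤ Z → |gradFn p K D z (s, t)| ≤ 2 * (r * Z) * (N * B) := fun z Z hz => by
    have hZ : 0 ≤ Z := (norm_nonneg _).trans hz
    rw [gradFn, gradForm]
    refine (abs_add_le _ _).trans ?_
    rw [abs_mul, abs_mul]
    calc _ ≤ r * Z * (N * B) + r * Z * (N * B) := by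
          gcongr
          exacts [hα z Z hz, hI 1 0 (by omega) (by omega), hβ z Z hz, hI 0 1 (by omega) (by omega)]
      _ = _ := by ring
  have hg1 : ∀ i, |gradFn p K D (single i 1) (s, t)| * L ≤ 2 / κ * (N * B) :=
    fun i => by
      have := hg (single i 1) 1 (by simp)
      calc _ ≤ 2 * (r * 1) * (N * B) * L := by gcongr
        _ = _ := by rw [hr]; field_simp
  have hh : ∀ i j, |hessFn p K D (single i 1) (single j 1) (s, t)| *
      L ^ 2 ≤ (4 + 8 / κ) / κ ^ 2 * (N * B) := fun i j => by
    have a1 := fun i => hα (single i 1) 1 (by simp)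
    have b1 := fun i => hβ (single i 1) 1 (by simp)
    have g1 := hg (twist K) (2 * L) (norm_twist_le hd)
    have i20 := hI 2 0 (by omega) (by omega)
    have i11 := hI 1 1 (by omega) (by omega)
    have i02 := hI 0 2 (by omega) (by omega)
    rw [gradFn] at g1
    rw [hessFn, hessForm]
    calc _ ≤ (r * 1) ^ 2 * (4 * (N * B) + 2 * (2 * (r * (2 * L)) * (N * B))) * L ^ 2 :=
          mul_le_mul_of_nonneg_right
            (abs_second_order_le (a1 i) (a1 j) (b1 i) (b1 j) i20 i11 i02 g1) (by positivity)
      _ = _ := by rw [hr]; field_simp; ring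
  have hp1 : ∀ i, |partialD i u (param K s t)| * L ≤ 2 / κ * (N * B) := fun i => by
    rw [partialD, hu.fderiv_eq hp hK hst.1 hst.2]; exact hg1 i
  have hp2 : ∀ i j, |partialD i (partialD j u) (param K s t)| * L ^ 2 ≤
      (4 + 8 / κ) / κ ^ 2 * (N * B) := fun i j => by
    rw [partialD_partialD ((hu.contDiffAt_of_notKnot hp hK hst.1 hst.2 hs' ht').of_le two_le_infty),
      hu.fderiv_fderiv_eq hp hK hst.1 hst.2 hs' ht']
    exact hh i j
  set X := 2 / κ * (N * B)
  set Y := (4 + 8 / κ) / κ ^ 2 * (N * B)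
  have hX : 0 ≤ X := by positivity
  have hY : 0 ≤ Y := by positivity
  rw [show N * (1 + 2 / κ + (4 + 8 / κ) / κ ^ 2) * B = N * B + X + Y by ring]
  have h0 := hI 0 0 (by omega) (by omega)
  rw [← hu s hm.1 t hm.2] at h0
  have h1 := fun i => (hp1 i).trans (by linarith : X ≤ N * B + X + Y)
  have h2 := fun i j => (hp2 i j).trans (by linarith : Y ≤ N * B + X + Y)
  cases order_two hab
  · simpa [mixedD] using h0.trans (by linarith : N * B ≤ N * B + X + Y)
  exacts [by simpa [mixedD] using h1 0, by simpa [mixedD] using h1 1,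
    by simpa [mixedD] using h2 0 0, by simpa [mixedD] using h2 0 1, by simpa [mixedD] using h2 1 1]

end

/-! ### Polynomials belong to the local space -/

/-- The polynomials of degree at most `n` in each of two variables. -/
def biPoly (n : ℕ) : Submodule ℝ (ℝ × ℝ → ℝ) :=
  Submodule.span ℝ (range fun (x : Fin (n + 1) × Fin (n + 1)) (q : ℝ × ℝ) =>
    q.1 ^ (x.1 : ℕ) * q.2 ^ (x.2 : ℕ))

lemma mem_biPoly {n i j} (hi : i ≤ n) (hj : j ≤ n) :
    (fun q => q.1 ^ i * q.2 ^ j) ∈ biPoly n :=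
  Submodule.subset_span ⟨(⟨i, by omega⟩, ⟨j, by omega⟩), rfl⟩

lemma mul_mem_biPoly {m n k} (h : m + n ≤ k) {f g} (hf : f ∈ biPoly m)
    (hg : g ∈ biPoly n) : f * g ∈ biPoly k := by
  have h1 : f * g ∈ biPoly m * biPoly n := Submodule.mul_mem_mul hf hg
  rw [biPoly, biPoly, Submodule.span_mul_span] at h1
  refine Submodule.span_le.2 ?_ h1
  rintro _ ⟨_, ⟨x, rfl⟩, _, ⟨y, rfl⟩, rfl⟩
  have e : (fun q : ℝ × ℝ => q.1 ^ (x.1 : ℕ) * q.2 ^ (x.2 : ℕ)) *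
      (fun q => q.1 ^ (y.1 : ℕ) * q.2 ^ (y.2 : ℕ)) =
      fun q => q.1 ^ (x.1 + y.1 : ℕ) * q.2 ^ (x.2 + y.2 : ℕ) := by
    ext q; simp only [Pi.mul_apply]; ring
  exact (congrArg (· ∈ biPoly k) e).mpr (mem_biPoly (by omega) (by omega))

lemma pow_mem_biPoly {f} (hf : f ∈ biPoly 1) (n) : f ^ n ∈ biPoly n := by
  induction n with
  | zero => simpa [Pi.one_def] using mem_biPoly (n := 0) (i := 0) (j := 0) le_rfl le_rfl
  | succ n ih => rw [pow_succ]; exact mul_mem_biPoly le_rfl ih hf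

lemma param_mem_biPoly (K) (i) :
    (fun q => param K q.1 q.2 i) ∈ biPoly 1 := by
  have m := fun (a b : ℕ) (ha : a ≤ 1) (hb : b ≤ 1) (c : ℝ) =>
    (biPoly 1).smul_mem c (mem_biPoly ha hb)
  convert add_mem (add_mem (m 0 0 (by omega) (by omega) (K 0 i))
    (m 1 0 (by omega) (by omega) (K 1 i - K 0 i))) (add_mem (m 0 1 (by omega) (by omega)
      (K 3 i - K 0 i)) (m 1 1 (by omega) (by omega) (twist K i))) using 1
  ext q
  simp [param, twist]; ring

lemma IsPoly.exists_eval_lineMap {m} {q} (hq : IsPoly m q) (x y) (a b) :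
    ∃ r : Polynomial ℝ, r.natDegree ≤ m - 1 - (a + b) ∧
      ∀ t : ℝ, mixedD a b q (lineMap x y t) = r.eval t := by
  obtain ⟨c, rfl⟩ := hq
  let ℓ : Fin 2 → Polynomial ℝ := fun i => .C (x i) + .C (y i - x i) * .X
  have hℓ : ∀ i, (ℓ i).natDegree ≤ 1 := fun i => by
    rw [show ℓ i = .C (y i - x i) * .X + .C (x i) from add_comm _ _]
    exact Polynomial.natDegree_linear_le
  have hℓe : ∀ i t, (ℓ i).eval t = (lineMap x y t : Plane) i := fun i t => by
    simp [ℓ, lineMap_apply]; ring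
  refine ⟨∑ z ∈ polyIdx m, .C (c z * z.1.descFactorial a * z.2.descFactorial b) *
    (ℓ 0 ^ (z.1 - a) * ℓ 1 ^ (z.2 - b)),
    Polynomial.natDegree_sum_le_of_forall_le _ _ fun z hz => ?_, fun t => ?_⟩
  · have hz' := mem_polyIdx.1 hz
    rcases lt_or_ge z.1 a with h | h
    · simp [Nat.descFactorial_eq_zero_iff_lt.2 h]
    rcases lt_or_ge z.2 b with h' | h'
    · simp [Nat.descFactorial_eq_zero_iff_lt.2 h']
    refine (natDegree_C_mul_le _ _).trans (Polynomial.natDegree_mul_le.trans ?_)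
    have h0 := Polynomial.natDegree_pow_le_of_le (z.1 - a) (hℓ 0)
    have h1 := Polynomial.natDegree_pow_le_of_le (z.2 - b) (hℓ 1)
    omega
  · rw [mixedD_sum _ _ contDiff_mono, eval_finsetSum]
    refine sum_congr rfl fun z _ => ?_
    have := mixedD_mul (u := fun t => t ^ z.1) (v := fun t => t ^ z.2) (by fun_prop)
      (by fun_prop) a b
    rw [this]
    simp [hℓe]; ring

lemma IsPoly.exists_normal_eval {m} {q} (hq : IsPoly m q) (x y n) :
    ∃ r : Polynomial ℝ, r.natDegree ≤ m - 1 - 1 ∧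
      ∀ t : ℝ, fderiv ℝ q (lineMap x y t) n = r.eval t := by
  obtain ⟨r0, h0, e0⟩ := hq.exists_eval_lineMap x y 1 0
  obtain ⟨r1, h1, e1⟩ := hq.exists_eval_lineMap x y 0 1
  refine ⟨C (n 0) * r0 + C (n 1) * r1, ?_, fun t => ?_⟩
  · exact (Polynomial.natDegree_add_le _ _).trans (max_le
      ((natDegree_C_mul_le _ _).trans h0) ((natDegree_C_mul_le _ _).trans h1))
  · have k0 : partialD 0 q (lineMap x y t) = r0.eval t := e0 t
    have k1 : partialD 1 q (lineMap x y t) = r1.eval t := e1 t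
    rw [Polynomial.eval_add, Polynomial.eval_mul, Polynomial.eval_mul, Polynomial.eval_C,
      Polynomial.eval_C, ← k0, ← k1]
    exact fderiv_eq_partialD q _ n

lemma IsPoly.comp_param_mem {p m} (hmp : m ≤ p + 1) {q} (hq : IsPoly m q)
    (K) : (fun s => q (param K s.1 s.2)) ∈ biPoly p := by
  obtain ⟨c, rfl⟩ := hq
  have hs : (∑ x ∈ polyIdx m, c x • ((fun s => param K s.1 s.2 0) ^ x.1 *
      (fun s => param K s.1 s.2 1) ^ x.2)) ∈ biPoly p :=
    sum_mem fun x hx => (biPoly p).smul_mem _ (mul_mem_biPoly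
      (by have := mem_polyIdx.1 hx; omega) (pow_mem_biPoly (param_mem_biPoly K 0) _)
      (pow_mem_biPoly (param_mem_biPoly K 1) _))
  convert hs using 1
  ext s
  simp

lemma IsPoly.memLocalSpace {p m} (hp : 3 ≤ p) (hmp : m ≤ p + 1) {q}
    (hq : IsPoly m q) (K) : MemLocalSpace p K q where
  smooth := (contDiff_infty.1 hq.contDiff _).contDiffOn
  piecewise i _ j _ := by
    obtain ⟨e, he⟩ := (Submodule.mem_span_range_iff_exists_fun ℝ).1 (hq.comp_param_mem hmp K)
    refine ⟨fun a b => e (a, b), fun s _ t _ => (congrFun he (s, t)).symm.trans ?_⟩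
    rw [Finset.sum_apply, sum_prod_type]
    simp [mul_assoc]
  trace_smooth i := by
    have h : ContDiff ℝ ∞ fun t : ℝ => (lineMap (K i) (K (i + 1)) t : Plane) := by
      simp only [AffineMap.lineMap_apply_module']; fun_prop
    exact (contDiff_infty.1 (hq.contDiff.comp h) _).contDiffOn
  normal_piecewise i j _ := by
    obtain ⟨r, h, hr⟩ := hq.exists_normal_eval (K i) (K (i + 1)) (unitNormal (K i) (K (i + 1)))
    refine ⟨r, by omega, fun t _ _ => ?_⟩
    have hc : Continuous fun y => fderiv ℝ q y (unitNormal (K i) (K (i + 1))) :=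
      (hq.contDiff.continuous_fderiv (by simp)).clm_apply continuous_const
    rw [← hr]
    exact (hc.tendsto _).mono_left nhdsWithin_le_nhds

/-- The point values of the local degrees of freedom. -/
def pointData (K : Quad) (u : Fn) : CellData :=
  (fun i a b => mixedD a b u (K i), fun i η => u (lineMap (K i) (K (i + 1)) η),
    fun i η => fderiv ℝ u (lineMap (K i) (K (i + 1)) η) (unitNormal (K i) (K (i + 1))),
    fun ξ η => u (param K ξ η))

lemma hasLocalData_pointData {u} (hu : ContDiff ℝ ∞ u) (p) (K) :
    HasLocalData p K (pointData K u) u where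
  jet i a b _ := ((contDiff_mixedD hu a b).continuous.tendsto _).mono_left nhdsWithin_le_nhds
  value i η _ := (hu.continuous.tendsto _).mono_left nhdsWithin_le_nhds
  normal i η _ := (((hu.continuous_fderiv (by simp)).clm_apply continuous_const).tendsto _).mono_left
    nhdsWithin_le_nhds
  face ξ _ η _ := (hu.continuous.tendsto _).mono_left nhdsWithin_le_nhds

/-! ### The error on one element -/

lemma partialD_sub_eventuallyEq {f g} {x} (hf : ContDiffAt ℝ 2 f x)
    (hg : ContDiffAt ℝ 2 g x) (i) :
    partialD i (f - g) =ᶠ[𝓝 x] partialD i f - partialD i g := by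
  filter_upwards [hf.eventually (by simp), hg.eventually (by simp)] with y hy hy'
  simp only [partialD, Pi.sub_apply]
  rw [fderiv_sub (hy.differentiableAt two_ne_zero) (hy'.differentiableAt two_ne_zero), sub_apply]

lemma differentiableAt_partialD {f} {x} (hf : ContDiffAt ℝ 2 f x) (i) :
    DifferentiableAt ℝ (partialD i f) x :=
  ((hf.fderiv_right (m := 1) (by norm_num)).differentiableAt one_ne_zero).clm_apply
    (differentiableAt_const _)

lemma mixedD_sub_apply {f g} {x} (hf : ContDiffAt ℝ 2 f x)
    (hg : ContDiffAt ℝ 2 g x) {a b} (hab : a + b ≤ 2) :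
    mixedD a b (f - g) x = mixedD a b f x - mixedD a b g x := by
  have h1 := fun i => (partialD_sub_eventuallyEq hf hg i).eq_of_nhds
  have h2 : ∀ i j, partialD i (partialD j (f - g)) x =
      partialD i (partialD j f) x - partialD i (partialD j g) x := fun i j => by
    rw [partialD, (partialD_sub_eventuallyEq hf hg j).fderiv_eq,
      fderiv_sub (differentiableAt_partialD hf j) (differentiableAt_partialD hg j), sub_apply]
    rfl
  cases order_two hab
  exacts [rfl, h1 0, h1 1, h2 0 0, h2 0 1, h2 1 1]

lemma IsInterp.sub (hp : 3 ≤ p) {D D'} {u u'}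
    (h : IsInterp p K D u) (h' : IsInterp p K D' u') : IsInterp p K (D - D') (u - u') :=
  fun s hs t ht => by
    rw [Pi.sub_apply, h s hs t ht, h' s hs t ht]
    exact ((interpLin K hp 0 0 s t).map_sub D D').symm

/-- Local data are bounded by the function and its derivatives. -/
lemma HasLocalData.isBounded_sub (hK : ConvexQuad K) {D}
    {v P} (hP : ContDiff ℝ ∞ P) (hv : HasLocalData p K D v) {L B : ℝ} (hL : 0 < L)
    (h : ∀ a b, a + b ≤ 2 → ∀ z ∈ cell K,
      |mixedD a b v z - mixedD a b P z| * L ^ (a + b) ≤ B) :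
    (D - pointData K P).IsBounded p L (2 * B) := by
  have hd := hasLocalData_pointData hP p K
  have hB : 0 ≤ B := by
    obtain ⟨z, hz⟩ := cell_nonempty hK
    exact le_trans (by positivity) (h 0 0 (by omega) z hz)
  have key : ∀ {f g : Fn} {x : Plane} {c c' w E : ℝ}, x ∈ closedCell K →
      Tendsto f (𝓝[cell K] x) (𝓝 c) → Tendsto g (𝓝[cell K] x) (𝓝 c') →
      (∀ z ∈ cell K, |f z - g z| * w ≤ E) → |c - c'| * w ≤ E := by
    intro f g x c c' w E hx hf hg hfg
    have := nhdsWithin_cell_neBot hK hx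
    refine le_of_tendsto ((hf.sub hg).abs.mul_const w) ?_
    filter_upwards [self_mem_nhdsWithin] with z hz using hfg z hz
  have h0 : ∀ z ∈ cell K, |v z - P z| * 1 ≤ 2 * B := fun z hz => by
    have := h 0 0 (by omega) z hz
    simp only [mixedD, Function.iterate_zero, id, add_zero, pow_zero] at this
    linarith
  have hside : ∀ i, ∀ η ∈ I, lineMap (K i) (K (i + 1)) η ∈ closedCell K :=
    fun i η hη => by
      have := sideCoord_mem (i := i) (q := (η, 0)) hη (by simp)
      rw [← param_sideCoord_zero]
      exact param_mem_closedCell K this.1 this.2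
  refine ⟨fun i a b hab => ?_, fun i η hη => ?_, fun i η hη => ?_, fun ξ hξ η hη => ?_⟩
  · refine (key (subset_convexHull ℝ _ (mem_range_self i)) (hv.jet i a b hab)
      (hd.jet i a b hab) (h a b hab)).trans (by linarith)
  · have := key (hside i η (edgeValueParams_mem_Icc hη)) (hv.value i η hη) (hd.value i η hη) h0
    rwa [mul_one] at this
  · refine key (hside i η (Ioo_subset_Icc_self (edgeNormalParams_mem hη))) (hv.normal i η hη)
      (hd.normal i η hη) fun z hz => ?_
    set n := unitNormal (K i) (K (i + 1))
    have hn : ∀ j, |n j| ≤ 1 := fun j => (abs_coord_le n j).trans (norm_unitNormal_le _ _)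
    have h1 : |partialD 0 v z - partialD 0 P z| * L ≤ B := by simpa [mixedD] using h 1 0 (by omega) z hz
    have h2 : |partialD 1 v z - partialD 1 P z| * L ≤ B := by simpa [mixedD] using h 0 1 (by omega) z hz
    rw [fderiv_eq_partialD, fderiv_eq_partialD]
    have e : n 0 * partialD 0 v z + n 1 * partialD 1 v z - (n 0 * partialD 0 P z +
        n 1 * partialD 1 P z) = n 0 * (partialD 0 v z - partialD 0 P z) +
        n 1 * (partialD 1 v z - partialD 1 P z) := by ring
    rw [e]
    calc _ ≤ (1 * |partialD 0 v z - partialD 0 P z| + 1 * |partialD 1 v z - partialD 1 P z|) * L := by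
          gcongr
          refine (abs_add_le _ _).trans ?_
          rw [abs_mul, abs_mul]
          gcongr <;> exact hn _
      _ ≤ _ := by linarith
  · have := key (param_mem_closedCell K (Ioo_subset_Icc_self (faceParams_mem hξ))
      (Ioo_subset_Icc_self (faceParams_mem hη))) (hv.face ξ hξ η hη) (hd.face ξ hξ η hη) h0
    rwa [mul_one] at this

/-- The pointwise error of the interpolation on one element. -/
theorem exists_cell_error (hp : 3 ≤ p) {κ : ℝ} (hκ : 0 < κ) : ∃ C : ℝ, 0 ≤ C ∧
    ∀ (K : Quad) (D : CellData) (v w : Fn), ConvexQuad K →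
      (∀ i, κ * longestSide K ^ 2 ≤ cross (K (i + 1) - K i) (K (i + 3) - K i)) →
      MemC2Closure (cell K) v → HasLocalData p K D v → IsInterp p K D w →
      ∀ m, 3 ≤ m → m ≤ p + 1 → ∀ q, 2 ≤ q → 4 ≤ m ∨ 4 ≤ q → ∀ g,
        (∀ α ∈ multiIdx m, IsWeakDeriv (cell K) α.1 α.2 v (g α) ∧
          MemLp (g α) q (vol (cell K))) →
        ∀ x ∈ cell K, NotKnot (subdiv p) (paramInv K x).1 → NotKnot (subdiv p) (paramInv K x).2 →
          ∀ a b, a + b ≤ 2 → |mixedD a b (v - w) x| ≤ C * longestSide K ^ (m - (a + b)) *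
            avgNorm q m g (cell K) := by
  obtain ⟨C, hC, hstab⟩ := exists_isInterp_bound hp hκ
  refine ⟨(1 + C * 2) * (2 * 4 ^ (p + 1)), by positivity, ?_⟩
  intro K D v w hK hj hv hvd hw m hm hmp q hq hqm g hg x hx hs ht a b hab
  have hd := dist_le_longestSide K
  have hL : 0 < longestSide K := (dist_pos.2 (hK.ne 0)).trans_le (hd 0)
  set L := longestSide K
  set G := avgNorm q m g (cell K)
  have hG0 : 0 ≤ G := ENNReal.toReal_nonneg
  have hpow : L ^ (m - (a + b)) * L ^ (a + b) = L ^ m := by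
    rw [← pow_add]; congr 1; omega
  have hLp : 0 < L ^ (a + b) := by positivity
  refine le_of_mul_le_mul_right ?_ hLp
  have hgoal : (1 + C * 2) * (2 * 4 ^ (p + 1)) * L ^ (m - (a + b)) * G * L ^ (a + b) =
      (1 + C * 2) * (2 * 4 ^ (p + 1) * L ^ m * G) := by rw [← hpow]; ring
  rw [hgoal]
  refine le_of_forall_pos_le_add fun ε hε => ?_
  set η := ε / (1 + C * 2)
  have hη : 0 < η := by positivity
  set B := 2 * 4 ^ (p + 1) * L ^ m * G + η with hB
  obtain ⟨P, hP, hPv⟩ := exists_isPoly_approx (isOpen_cell K) (cell_nonempty hK) (convex_cell K)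
    (d := 2 * L) (fun x hx y hy =>
      dist_le_two_mul_of_mem (interior_subset hx) (interior_subset hy)) hm hq hqm hv
    (fun α hα => (hg α hα).1) (fun α hα => (hg α hα).2) (δ := η / (1 + L) ^ 2) (by positivity)
  have happ : ∀ a b, a + b ≤ 2 → ∀ z ∈ cell K,
      |mixedD a b v z - mixedD a b P z| * L ^ (a + b) ≤ B := by
    intro a b hab z hz
    have h1 : η / (1 + L) ^ 2 * L ^ (a + b) ≤ η := by
      rw [div_mul_eq_mul_div, div_le_iff₀ (by positivity)]
      gcongr
      calc L ^ (a + b) ≤ (1 + L) ^ (a + b) := by gcongr; linarith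
        _ ≤ _ := pow_le_pow_right₀ (by linarith) hab
    have h2 : 2 * (2 * (2 * L)) ^ (m - (a + b)) * G * L ^ (a + b) ≤
        2 * 4 ^ (p + 1) * L ^ m * G := by
      have e : L ^ m = L ^ (m - (a + b)) * L ^ (a + b) := by rw [← pow_add]; congr 1; omega
      have h4 : (4 : ℝ) ^ (m - (a + b)) ≤ 4 ^ (p + 1) := pow_le_pow_right₀ (by norm_num) (by omega)
      calc _ = 2 * 4 ^ (m - (a + b)) * (L ^ (m - (a + b)) * L ^ (a + b)) * G := by
            rw [show 2 * (2 * L) = 4 * L by ring, mul_pow]; ring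
        _ ≤ _ := by rw [← e]; gcongr
    have := mul_le_mul_of_nonneg_right (hPv a b hab z hz) (by positivity : 0 ≤ L ^ (a + b))
    rw [add_mul] at this
    linarith
  have hPi := (hP.memLocalSpace hp hmp K).isInterp hp hK (hasLocalData_pointData hP.contDiff p K)
  have hst := hstab K (D - pointData K P) L (2 * B) (w - P) hK hL hd hj
    (hvd.isBounded_sub hK hP.contDiff hL happ) (hw.sub hp hPi) x hx hs ht a b hab
  have hxc := interior_subset hx
  have hm' := paramInv_mem hK hxc
  have hm'' := boundary_notMem_cell hK hm'.1 hm'.2 (by rwa [param_paramInv hK hxc])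
  have hwx := (hw.contDiffAt_of_notKnot hp hK hm''.1 hm''.2 hs ht).of_le two_le_infty
  rw [param_paramInv hK hxc] at hwx
  have hvx := hv.1.contDiffAt ((isOpen_cell K).mem_nhds hx)
  rw [mixedD_sub_apply hwx ((contDiff_infty.1 hP.contDiff 2).contDiffAt) hab] at hst
  rw [mixedD_sub_apply hvx hwx hab]
  have e : mixedD a b v x - mixedD a b w x = (mixedD a b v x - mixedD a b P x) -
      (mixedD a b w x - mixedD a b P x) := by ring
  rw [e]
  have h3 := mul_le_mul_of_nonneg_right (abs_sub (mixedD a b v x - mixedD a b P x)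
    (mixedD a b w x - mixedD a b P x)) hLp.le
  have h4 := happ a b hab x hx
  have h5 : (1 + C * 2) * η = ε := mul_div_cancel₀ _ (by positivity)
  calc _ ≤ B + C * (2 * B) := by linarith
    _ = (1 + C * 2) * (2 * 4 ^ (p + 1) * L ^ m * G) + (1 + C * 2) * η := by rw [hB]; ring
    _ = _ := by rw [h5]

/-! ### The error of the global projector -/

lemma ae_cell_notKnot (hK : ConvexQuad K) (k) :
    ∀ᵐ x ∂vol (cell K), x ∈ cell K ∧ NotKnot k (paramInv K x).1 ∧
      NotKnot k (paramInv K x).2 := by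
  filter_upwards [ae_restrict_mem (isOpen_cell K).measurableSet,
    ae_restrict_of_ae (ae_notKnot hK k)] with x hx h using ⟨hx, h hx⟩

lemma exists_corner_const {ρ : ℝ} (hρ : 0 < ρ) : ∃ κ : ℝ, 0 < κ ∧ ∀ K,
    ConvexQuad K → ρ ≤ minAngle K →
      ∀ i, κ * longestSide K ^ 2 ≤ cross (K (i + 1) - K i) (K (i + 3) - K i) := by
  by_cases h : ∃ K, ConvexQuad K ∧ ρ ≤ minAngle K
  · obtain ⟨K, hK, h⟩ := h
    exact ⟨_, pow_pos (le_corner_of_minAngle hK hρ h).1 7,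
      fun K' hK' h' => (le_corner_of_minAngle hK' hρ h').2⟩
  · exact ⟨1, one_pos, fun K hK hK' => absurd ⟨K, hK, hK'⟩ h⟩

lemma MemSobolev.weakDeriv (hΩ : IsOpen Ω) {m} {q} {φ}
    (h : MemSobolev Ω m q φ) {a b} (hab : a + b ≤ m) :
    IsWeakDeriv Ω a b φ (weakDeriv Ω a b φ) ∧ MemLp (weakDeriv Ω a b φ) q (vol Ω) := by
  obtain ⟨g, hg, hg'⟩ := h a b hab
  have := (weakDeriv_ae hΩ hg).symm
  exact ⟨hg.congr hΩ (ae_eq_refl _) this, hg'.ae_eq this⟩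

namespace QuadMesh
variable {M : QuadMesh Ω}

lemma shapeConst_le (hK : K ∈ M.quads) : M.shapeConst ≤ minAngle K :=
  ciInf_le (Set.finite_range fun K : M.quads => minAngle K.1).bddBelow (⟨K, hK⟩ : M.quads)

lemma longestSide_le_meshSize (hK : K ∈ M.quads) :
    longestSide K ≤ M.meshSize :=
  le_ciSup (Set.finite_range fun K : M.quads => longestSide K.1).bddAbove (⟨K, hK⟩ : M.quads)

lemma meshSize_nonneg (M : QuadMesh Ω) : 0 ≤ M.meshSize :=
  Real.iSup_nonneg fun K => dist_nonneg.trans (dist_le_longestSide K.1 0)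

lemma restrict_eq_restrict_openCells (hΩ : IsOpen Ω) :
    (volume : Measure Plane).restrict Ω = vol (⋃ K ∈ M.quads, cell K) := by
  refine Measure.restrict_congr_set (Filter.EventuallyLE.antisymm ?_
    (LE.le.eventuallyLE (iUnion₂_subset M.cell_subset)))
  filter_upwards [(ae_restrict_iff' hΩ.measurableSet).1 (ae_mem_cell (M := M) hΩ 1)] with x hx hxΩ
  obtain ⟨K, hK, h, -⟩ := hx hxΩ
  exact mem_biUnion hK h

/-- The square of the `L²` norm is additive over the elements. -/
lemma eLpNorm_two_sq (hΩ : IsOpen Ω) (f : Fn) :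
    eLpNorm f 2 (vol Ω) ^ 2 =
      ∑ K ∈ M.quads, eLpNorm f 2 (vol (cell K)) ^ 2 := by
  have h : ∀ μ : Measure Plane, eLpNorm f 2 μ ^ 2 = ∫⁻ x, ‖f x‖ₑ ^ (2 : ℝ) ∂μ := fun μ => by
    have := eLpNorm_nnreal_pow_eq_lintegral (f := f) (μ := μ) (p := 2) two_ne_zero
    simpa using this
  simp only [h]
  rw [restrict_eq_restrict_openCells (M := M) hΩ, lintegral_biUnion_finset
    (fun K hK K' hK' hne => M.disjoint_quads K hK K' hK' hne)
    fun K _ => (isOpen_cell K).measurableSet]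

/-- The derivatives of `E` of order at most two are elementwise of optimal order. -/
abbrev IsCellBound (M : QuadMesh Ω) (C : ℝ) (m : ℕ) (q : ℝ≥0∞) (φ E : Fn) : Prop :=
  ∀ K ∈ M.quads, ∀ᵐ x ∂vol (cell K), ∀ a b, a + b ≤ 2 → ‖mixedD a b E x‖ ≤
    C * M.meshSize ^ (m - (a + b)) * avgNorm q m (fun α => weakDeriv Ω α.1 α.2 φ) (cell K)

theorem exists_projector_error (hp : 3 ≤ p) {ρ : ℝ} (hρ : 0 < ρ) : ∃ C : ℝ, 0 ≤ C ∧
    ∀ (Ω : Set Plane) (M : QuadMesh Ω), IsOpen Ω → ρ ≤ M.shapeConst →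
      ∀ β, M.IsDualBasis p β → ∀ m, 3 ≤ m → m ≤ p + 1 → ∀ q, 2 ≤ q → 4 ≤ m ∨ 4 ≤ q →
      ∀ φ v, MemSobolev Ω m q φ → IsC2Representative Ω φ v →
        IsCellBound M C m q φ (v - M.projector p β v) := by
  obtain ⟨κ, hκ, hcorner⟩ := exists_corner_const hρ
  obtain ⟨C, hC, h⟩ := exists_cell_error hp hκ
  refine ⟨C, hC, fun Ω M hΩ hM β hβ m hm hmp q hq hqm φ v hφ hv K hK => ?_⟩
  have cK := M.quad_convex K hK
  have hs := M.cell_subset K hK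
  filter_upwards [ae_cell_notKnot cK (subdiv p)] with x hx a b hab
  refine (h K _ v _ cK (hcorner K cK (hM.trans (shapeConst_le hK))) (hv.1.mono hs)
    (hasLocalData_of_hasDofValue (fun d hd => hasDofValue_of_memC2Closure hv.1 hd) hK)
    (isInterp_projector hp hβ v hK) m hm hmp q hq hqm (fun α => weakDeriv Ω α.1 α.2 φ)
    (fun α hα => ?_) x hx.1 hx.2.1 hx.2.2 a b hab).trans ?_
  · have := hφ.weakDeriv hΩ (mem_antidiagonal.1 hα).le
    exact ⟨(this.1.congr hΩ hv.2.symm (ae_eq_refl _)).mono hs hΩ.measurableSet,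
      this.2.mono_measure (Measure.restrict_mono hs le_rfl)⟩
  · have := longestSide_le_meshSize hK
    have := dist_nonneg.trans (dist_le_longestSide K 0)
    gcongr

end QuadMesh

lemma volume_cell_ne_zero (hK : ConvexQuad K) : volume (cell K) ≠ 0 :=
  ((isOpen_cell K).measure_pos _ (cell_nonempty hK)).ne'

lemma volume_cell_ne_top (K) : volume (cell K) ≠ ⊤ :=
  (((isCompact_closedCell K).measure_lt_top).trans_le' (measure_mono interior_subset)).ne

lemma IsC2Representative.sub_ae {φ v} (h : IsC2Representative Ω φ v)
    (w) : v - w =ᵐ[vol Ω] φ - w := h.2.sub (ae_eq_refl w)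

namespace QuadMesh
variable {M : QuadMesh Ω} {β : Dof → Fn} {φ v : Fn}

lemma isWeakDeriv_sub_projector (hp : 3 ≤ p) (hΩ : IsOpen Ω) (hβ : M.IsDualBasis p β)
    (hv : IsC2Representative Ω φ v) {a b} (hab : a + b ≤ 2) :
    IsWeakDeriv Ω a b (φ - M.projector p β v) (mixedD a b (v - M.projector p β v)) :=
  (isWeakDeriv_sub_interp hp hΩ hv.1.1 _ (fun _ hK => isInterp_projector hp hβ v hK) hab).congr hΩ
    (hv.sub_ae _) (ae_eq_refl _)

lemma eLpNorm_two_sq_le (hΩ : IsOpen Ω) {m} {A : ℝ} (hA : 0 ≤ A) {E : Fn}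
    {g} (hg : ∀ α ∈ multiIdx m, MemLp (g α) 2 (vol Ω))
    (hE : ∀ K ∈ M.quads, ∀ᵐ x ∂vol (cell K), ‖E x‖ ≤ A * avgNorm 2 m g (cell K)) :
    eLpNorm E 2 (vol Ω) ^ 2 ≤ ofReal A ^ 2 * ((m + 1 : ℕ) *
      ∑ α ∈ multiIdx m, eLpNorm (g α) 2 (vol Ω) ^ 2) := by
  have hK : ∀ K ∈ M.quads, eLpNorm E 2 (vol (cell K)) ^ 2 ≤ ofReal A ^ 2 *
      ((m + 1 : ℕ) * ∑ α ∈ multiIdx m, eLpNorm (g α) 2 (vol (cell K)) ^ 2) := by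
    intro K hK
    have h0 := volume_cell_ne_zero (M.quad_convex K hK)
    have ht := volume_cell_ne_top K
    have hS : ∑ α ∈ multiIdx m, eLpNorm (g α) 2 (vol (cell K)) ≠ ⊤ := ENNReal.sum_ne_top.2 fun α hα =>
      ((hg α hα).mono_measure (Measure.restrict_mono (M.cell_subset K hK) le_rfl)).2.ne
    have h1 := eLpNorm_le_of_ae_bound (p := 2) (hE K hK)
    rw [ofReal_mul hA, ENNReal.ofReal_toReal (mul_ne_top
      (ENNReal.rpow_ne_top_of_ne_zero h0 ht) hS), Measure.restrict_apply_univ, mul_left_comm,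
      ← mul_assoc (volume (cell K) ^ _), ← ENNReal.rpow_add _ _ h0 ht, one_div,
      add_neg_cancel, ENNReal.rpow_zero, one_mul] at h1
    have h2 := ENNReal.rpow_sum_le_const_mul_sum_rpow (multiIdx m)
      (fun α => eLpNorm (g α) 2 (vol (cell K))) (p := 2) one_le_two
    norm_num [ENNReal.rpow_two, Finset.Nat.card_antidiagonal] at h2
    calc _ ≤ _ := pow_le_pow_left₀ zero_le h1 2
      _ = _ := mul_pow _ _ _
      _ ≤ _ := by push_cast; gcongr
  rw [eLpNorm_two_sq (M := M) hΩ]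
  refine (sum_le_sum hK).trans_eq ?_
  rw [← mul_sum, ← mul_sum, sum_comm]
  simp only [eLpNorm_two_sq (M := M) hΩ]

end QuadMesh

namespace QuadMesh
variable {M : QuadMesh Ω} {β : Dof → Fn} {φ v : Fn}

lemma toReal_sq_le (hΩ : IsOpen Ω) {m} {A : ℝ} (hA : 0 ≤ A) {E : Fn}
    (hφ : MemSobolev Ω m 2 φ)
    (hE : ∀ K ∈ M.quads, ∀ᵐ x ∂vol (cell K), ‖E x‖ ≤ A *
      avgNorm 2 m (fun α => weakDeriv Ω α.1 α.2 φ) (cell K)) :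
    eLpNorm E 2 (vol Ω) < ⊤ ∧
      (eLpNorm E 2 (vol Ω)).toReal ^ 2 ≤ A ^ 2 * ((m + 1) * hSeminorm Ω m φ ^ 2) := by
  have hg : ∀ α ∈ multiIdx m, MemLp (weakDeriv Ω α.1 α.2 φ) 2 (vol Ω) := fun α hα =>
    (hφ.weakDeriv hΩ (mem_antidiagonal.1 hα).le).2
  have h := eLpNorm_two_sq_le (g := fun α => weakDeriv Ω α.1 α.2 φ) hΩ hA hg hE
  have hfin : ∀ α ∈ multiIdx m, eLpNorm (weakDeriv Ω α.1 α.2 φ) 2 (vol Ω) ^ 2 ≠ ⊤ := fun α hα =>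
    ENNReal.pow_ne_top (hg α hα).2.ne
  have hR := mul_ne_top (ENNReal.pow_ne_top ofReal_ne_top (n := 2) (a := ofReal A))
    (mul_ne_top (ENNReal.natCast_ne_top (m + 1)) (ENNReal.sum_ne_top.2 hfin))
  refine ⟨(ENNReal.pow_lt_top_iff.1 (h.trans_lt hR.lt_top)).resolve_right two_ne_zero, ?_⟩
  have h' := toReal_mono hR h
  rw [ENNReal.toReal_mul, ENNReal.toReal_mul, ENNReal.toReal_sum hfin] at h'
  simp only [ENNReal.toReal_pow, ENNReal.toReal_ofReal hA, ENNReal.toReal_natCast] at h'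
  rw [hSeminorm, Real.sq_sqrt (by positivity)]
  exact_mod_cast h'

theorem hSeminorm_sub_projector_le (hp : 3 ≤ p) (hΩ : IsOpen Ω) (hβ : M.IsDualBasis p β)
    (hv : IsC2Representative Ω φ v) {m} (hm : m ≤ p + 1) (hφ : MemSobolev Ω m 2 φ)
    {C : ℝ} (hC : 0 ≤ C)
    (hE : IsCellBound M C m 2 φ (v - M.projector p β v)) {l} (hl : l ≤ 2) :
    MemSobolev Ω l 2 (φ - M.projector p β v) ∧
      hSeminorm Ω l (φ - M.projector p β v) ≤
        3 * (p + 2) * C * M.meshSize ^ (m - l) * hSeminorm Ω m φ := by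
  have hh := M.meshSize_nonneg
  have key := fun a b (hab : a + b ≤ 2) => toReal_sq_le (M := M) (m := m)
    (A := C * M.meshSize ^ (m - (a + b))) (E := mixedD a b (v - M.projector p β v)) hΩ
    (by positivity) hφ fun K hK => (hE K hK).mono fun x hx => hx a b hab
  have hw := fun a b (hab : a + b ≤ 2) =>
    isWeakDeriv_sub_projector (a := a) (b := b) hp hΩ hβ hv hab
  refine ⟨fun a b hab => ⟨_, hw a b (hab.trans hl),
    (hw a b (hab.trans hl)).2.1.aestronglyMeasurable, (key a b (hab.trans hl)).1⟩, ?_⟩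
  have hS : 0 ≤ hSeminorm Ω m φ := Real.sqrt_nonneg _
  refine Real.sqrt_le_iff.2 ⟨by positivity, ?_⟩
  have hsum : ∀ α ∈ multiIdx l,
      (eLpNorm (weakDeriv Ω α.1 α.2 (φ - M.projector p β v)) 2 (vol Ω)).toReal ^ 2 ≤
        (C * M.meshSize ^ (m - l)) ^ 2 * ((m + 1) * hSeminorm Ω m φ ^ 2) := fun α hα => by
    have e := mem_antidiagonal.1 hα
    rw [eLpNorm_congr_ae (weakDeriv_ae hΩ (hw α.1 α.2 (e.trans_le hl)))]
    exact e ▸ (key α.1 α.2 (e.trans_le hl)).2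
  refine (Finset.sum_le_card_nsmul _ _ _ hsum).trans ?_
  rw [Finset.Nat.card_antidiagonal, nsmul_eq_mul]
  have h1 : ((l + 1 : ℕ) : ℝ) * (m + 1) ≤ 3 * (p + 2) := by
    have : (m : ℝ) ≤ p + 1 := by exact_mod_cast hm
    have : (l : ℝ) ≤ 2 := by exact_mod_cast hl
    push_cast
    exact mul_le_mul (by linarith) (by linarith) (by positivity) (by norm_num)
  have h2 : ((l + 1 : ℕ) : ℝ) * (m + 1) ≤ (3 * (p + 2)) ^ 2 :=
    h1.trans (le_self_pow₀ (by linarith [(p.cast_nonneg : 0 ≤ p)]) two_ne_zero)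
  calc _ = ((l + 1 : ℕ) : ℝ) * (m + 1) * (C * M.meshSize ^ (m - l) * hSeminorm Ω m φ) ^ 2 := by ring
    _ ≤ (3 * (p + 2)) ^ 2 * (C * M.meshSize ^ (m - l) * hSeminorm Ω m φ) ^ 2 := by gcongr
    _ = _ := by ring

theorem lInftyNorm_sub_projector_le (hp : 3 ≤ p) (hΩ : IsOpen Ω) (hβ : M.IsDualBasis p β)
    (hv : IsC2Representative Ω φ v) {m} (hm : m ≤ p + 1) (hφ : MemSobolev Ω m ⊤ φ)
    {C : ℝ} (hC : 0 ≤ C)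
    (hE : IsCellBound M C m ⊤ φ (v - M.projector p β v)) :
    MemLp (φ - M.projector p β v) ⊤ (vol Ω) ∧
      lInftyNorm Ω (φ - M.projector p β v) ≤
        3 * (p + 2) * C * M.meshSize ^ m * wInftySeminorm Ω m φ := by
  have hh := M.meshSize_nonneg
  have hS : 0 ≤ wInftySeminorm Ω m φ := ENNReal.toReal_nonneg
  have hsup : (multiIdx m).sup
      (fun α => eLpNorm (weakDeriv Ω α.1 α.2 φ) ⊤ (vol Ω)) ≠ ⊤ :=
    ((Finset.sup_lt_iff ENNReal.coe_lt_top).2 fun α hα =>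
      (hφ.weakDeriv hΩ (mem_antidiagonal.1 hα).le).2.2).ne
  have hbd : ∀ᵐ x ∂vol Ω, ‖(v - M.projector p β v) x‖ ≤
      3 * (p + 2) * C * M.meshSize ^ m * wInftySeminorm Ω m φ := by
    rw [restrict_eq_restrict_openCells (M := M) hΩ, ae_restrict_biUnion_finset_iff]
    refine fun K hK => (hE K hK).mono fun x hx => (hx 0 0 (by omega)).trans ?_
    have h1 : (∑ α ∈ multiIdx m, eLpNorm (weakDeriv Ω α.1 α.2 φ) ⊤ (vol (cell K))).toReal ≤
        (m + 1) * wInftySeminorm Ω m φ := by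
      have := Finset.sum_le_card_nsmul (multiIdx m)
        (fun α => eLpNorm (weakDeriv Ω α.1 α.2 φ) ⊤ (vol (cell K))) _ fun α hα =>
        (eLpNorm_mono_measure _ (Measure.restrict_mono (M.cell_subset K hK) le_rfl)).trans
          (Finset.le_sup (f := fun α : ℕ × ℕ =>
            eLpNorm (weakDeriv Ω α.1 α.2 φ) ⊤ (vol Ω)) hα)
      rw [Finset.Nat.card_antidiagonal, nsmul_eq_mul] at this
      have h := toReal_mono (mul_ne_top (ENNReal.natCast_ne_top _) hsup) this
      rw [ENNReal.toReal_mul, ENNReal.toReal_natCast] at h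
      exact_mod_cast h
    simp only [avgNorm, ENNReal.toReal_top, div_zero, neg_zero, ENNReal.rpow_zero, one_mul, add_zero,
      Nat.sub_zero]
    have h2 : (m : ℝ) + 1 ≤ 3 * (p + 2) := by
      have : (m : ℝ) ≤ p + 1 := by exact_mod_cast hm
      linarith [(p.cast_nonneg : 0 ≤ p)]
    calc _ ≤ C * M.meshSize ^ m * ((m + 1) * wInftySeminorm Ω m φ) := by gcongr
      _ = (m + 1) * (C * M.meshSize ^ m * wInftySeminorm Ω m φ) := by ring
      _ ≤ 3 * (p + 2) * (C * M.meshSize ^ m * wInftySeminorm Ω m φ) := by gcongr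
      _ = _ := by ring
  have hms : AEStronglyMeasurable (v - M.projector p β v) (vol Ω) :=
    (isWeakDeriv_sub_projector (a := 0) (b := 0) hp hΩ hβ hv (by omega)).2.1.aestronglyMeasurable
  have hae := hv.sub_ae (M.projector p β v)
  refine ⟨(memLp_top_of_bound hms _ hbd).ae_eq hae, ?_⟩
  rw [lInftyNorm, ← eLpNorm_congr_ae hae, eLpNorm_exponent_top]
  exact ENNReal.toReal_le_of_le_ofReal (by positivity) (eLpNormEssSup_le_of_ae_bound hbd)

end QuadMesh

end

end BSQuad

theorem mainTheorem2 (p : ℕ) (hp : 3 ≤ p) (ρ : ℝ) (hρ : 0 < ρ) :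
    ∃ C : ℝ, 0 < C ∧
      ∀ (Ω : Set BSQuad.Plane) (M : BSQuad.QuadMesh Ω), IsOpen Ω → IsConnected Ω →
        ρ ≤ M.shapeConst →
        (∃ β, M.IsDualBasis p β) ∧
        ∀ β, M.IsDualBasis p β →
          (∀ m : ℕ, 4 ≤ m → m ≤ p + 1 → ∀ φ : BSQuad.Plane → ℝ, BSQuad.MemSobolev Ω m 2 φ →
            (BSQuad.LocallyConnectedAtBoundary Ω → ∃ v, BSQuad.IsC2Representative Ω φ v) ∧
            ∀ v, BSQuad.IsC2Representative Ω φ v → ∀ ℓ : ℕ, ℓ ≤ 2 →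
              BSQuad.MemSobolev Ω ℓ 2 (φ - M.projector p β v) ∧
              BSQuad.hSeminorm Ω ℓ (φ - M.projector p β v)
                ≤ C * M.meshSize ^ (m - ℓ) * BSQuad.hSeminorm Ω m φ) ∧
          (∀ m : ℕ, 3 ≤ m → m ≤ p + 1 → ∀ φ : BSQuad.Plane → ℝ, BSQuad.MemSobolev Ω m ∞ φ →
            (BSQuad.LocallyConnectedAtBoundary Ω → ∃ v, BSQuad.IsC2Representative Ω φ v) ∧
            ∀ v, BSQuad.IsC2Representative Ω φ v →
              MemLp (φ - M.projector p β v) ∞ (volume.restrict Ω) ∧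
              BSQuad.lInftyNorm Ω (φ - M.projector p β v)
                ≤ C * M.meshSize ^ m * BSQuad.wInftySeminorm Ω m φ) := by
  obtain ⟨C, hC, h⟩ := BSQuad.QuadMesh.exists_projector_error hp hρ
  refine ⟨3 * (p + 2) * C + 1, by positivity, fun Ω M hΩ _ hM =>
    ⟨BSQuad.QuadMesh.exists_isDualBasis hp M, fun β hβ => ⟨fun m hm hmp φ hφ =>
      ⟨fun hl => BSQuad.exists_isC2Representative hΩ M hl (by omega) le_rfl (by simp) (.inl hm) hφ,
        fun v hv l hl => ?_⟩, fun m hm hmp φ hφ => ⟨fun hl => ?_, fun v hv => ?_⟩⟩⟩⟩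
  · have := BSQuad.QuadMesh.hSeminorm_sub_projector_le hp hΩ hβ hv hmp hφ hC
      (h Ω M hΩ hM β hβ m (by omega) hmp 2 le_rfl (.inl hm) φ v hφ hv) hl
    refine ⟨this.1, this.2.trans ?_⟩
    have := M.meshSize_nonneg
    have : 0 ≤ BSQuad.hSeminorm Ω m φ := Real.sqrt_nonneg _
    gcongr
    linarith
  · exact BSQuad.exists_isC2Representative hΩ M hl hm (q := 4) (by norm_num) (by simp)
      (.inr le_rfl) (hφ.mono_exponent M.isBounded le_top)
  · have := BSQuad.QuadMesh.lInftyNorm_sub_projector_le hp hΩ hβ hv hmp hφ hC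
      (h Ω M hΩ hM β hβ m hm hmp ⊤ le_top (.inr le_top) φ v hφ hv)
    refine ⟨this.1, this.2.trans ?_⟩
    have := M.meshSize_nonneg
    have : 0 ≤ BSQuad.wInftySeminorm Ω m φ := ENNReal.toReal_nonneg
    gcongr
    linarith
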